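/- **Model.** Fix $p$ and constants $v_0,v_1,v_2$; let $Q(t)=v_0+v_1t+v_2t^2$, and let $\psi$ be the cumulant function of a regular non-degenerate natural exponential family with open natural parameter space $\Theta\subset\mathbb R$ and quadratic variance function: $\psi''=Q(\psi')>0$ on $\Theta$. Areas are indexed by $j=1,2,\dots$, with known $n_j>0$, $x_j\in\mathbb R^p$. For $\eta=(\beta^t,\nu)^t$ put $m_j=\psi'(x_j^t\beta)$. The pairs $(\theta_j,y_j)$ are independent over $j$; given $\theta_j$, $y_j$ has density $\exp[n_j(\theta_jy_j-\psi(\theta_j))+c(y_j,n_j)]$, and $\theta_j$ has density $\exp[\nu(m_j\theta_j-\psi(\theta_j))]C(\nu,m_j)$ on $\Theta$. Let $\xi_j=\psi'(\theta_j)$ and $\hat\xi_j(y_j,\eta)=(n_jy_j+\nu m_j)/(n_j+\nu)$, which is $E[\xi_j\mid y_j]$. **GT-estimator.** Let $\phi_j=(1+\nu/n_j)/(\nu-v_2)$, $\mu_{rj}=E[(y_j-m_j)^r]$, $g_j=(y_j-m_j,\,(y_j-m_j)^2-\phi_jQ(m_j))^t$, $\Sigma_j=\mathrm{Cov}(g_j)=\begin{pmatrix}\mu_{2j}&\mu_{3j}\\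 \mu_{3j}&\mu_{4j}-\mu_{2j}^2\end{pmatrix}$, $$D_j^t=Q(m_j)\begin{pmatrix}x_j&Q'(m_j)\phi_jx_j\\0&-(1+v_2/n_j)(\nu-v_2)^{-2}\end{pmatrix},\quad s_m=\sum_{j\le m}D_j^t\Sigma_j^{-1}g_j,\quad U(\eta)=\sum_{j\le m}D_j^t\Sigma_j^{-1}D_j .$$ The moments have the closed forms $\mu_{2j}=Q(m_j)(\nu/n_j+1)/(\nu-v_2)$, $\mu_{3j}=Q(m_j)Q'(m_j)(\nu/n_j+1)(\nu/n_j+2)/\{(\nu-v_2)(\nu-2v_2)\}$ and, with $d_j=v_2/n_j$ and $e_r=E[(\xi_j-m_j)^r]$, $$\mu_{4j}=(d_j+1)(2d_j+1)(3d_j+1)e_4+\tfrac6{n_j}Q'(m_j)(d_j+1)(2d_j+1)e_3+\tfrac{d_j+1}{n_j^2}\{7Q'(m_j)^2+2n_j(4d_j+3)Q(m_j)\}e_2+\tfrac1{n_j^3}Q(m_j)\{n_j(2d_j+3)Q(m_j)+Q'(m_j)^2\},$$ $e_2=\frac{Q(m_j)}{\nu-v_2}$, $e_3=\frac{2Q(m_j)Q'(m_j)}{(\nu-v_2)(\nu-2v_2)}$,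 $e_4=\frac{3Q(m_j)[(\nu-2v_2)Q(m_j)+2Q'(m_j)^2]}{(\nu-v_2)(\nu-2v_2)(\nu-3v_2)}$. Let $K\subset\mathbb R^{p+1}$ be a compact parameter set whose interior contains the true $\eta$. $\hat\eta=\hat\eta_{GT}$ is a $K$-valued measurable function of $y_1,\dots,y_m$ that solves $s_m(\hat\eta)=0$ whenever this equation has a solution in $K$. Assume: the probability that $s_m=0$ has more than one solution in $K$ is $o(m^{-1})$; on $K$, $\nu>0$ and $\nu>3v_2$; the values $x_j^t\beta$ ($j\ge1$, $\eta\in K$) lie in a compact subset of $\Theta$; $x_j$ and $n_j$ are bounded and $n_j$, $n_j+v_2$ are bounded away from $0$; the smallest eigenvalue of $m^{-1}\sum_{j\le m}x_jx_j^t$ is bounded away from $0$ for large $m$. **Estimator of the conditional MSE.** Fix an area $i$ and let $\lambda_i=(n_i+\nu-v_2)^{-1}$, $g_{1i}=y_i-m_i$, $\hat\xi_i=\hat\xi_i(y_i,\eta)$. Let $T_{1i}(y_i,\eta)=\lambda_iQ(\hat\xi_i)$, which is $\mathrm{Var}(\xi_i\mid y_i)$, and $T_{2i}(y_i,\eta)=\mathrm{tr}[P_iU(\eta)^{-1}]$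 with $$P_i=(n_i+\nu)^{-2}\begin{pmatrix}\nu^2Q(m_i)^2x_ix_i^t&-n_i\nu(n_i+\nu)^{-1}Q(m_i)g_{1i}x_i\\-n_i\nu(n_i+\nu)^{-1}Q(m_i)g_{1i}x_i^t&n_i^2(n_i+\nu)^{-2}g_{1i}^2\end{pmatrix}.$$ Let $$r(y_i,\eta)=\begin{pmatrix}\nu(n_i+\nu)^{-1}\lambda_iQ'(\hat\xi_i)Q(m_i)x_i\\-\lambda_i^2Q(\hat\xi_i)-\lambda_in_i(n_i+\nu)^{-2}Q'(\hat\xi_i)g_{1i}\end{pmatrix},\qquad R(y_i,\eta)=\begin{pmatrix}T^{11}&T^{12}\\(T^{12})^t&T^{22}\end{pmatrix},$$ $T^{11}=(n_i+\nu)^{-2}\nu\lambda_iQ(m_i)[2v_2\nu Q(m_i)+Q'(\hat\xi_i)Q'(m_i)(n_i+\nu)]x_ix_i^t$, $T^{12}=Q(m_i)\lambda_i(n_i+\nu)^{-2}\{Q'(\hat\xi_i)(n_i-\nu(n_i+\nu)\lambda_i)-2v_2n_i\nu g_{1i}(n_i+\nu)^{-1}\}x_i$, $T^{22}=2\lambda_i^3Q(\hat\xi_i)+2\lambda_i^2n_i(n_i+\nu)^{-2}Q'(\hat\xi_i)g_{1i}+2\lambda_in_i(n_i+\nu)^{-4}g_{1i}[(n_i+\nu)Q'(\hat\xi_i)+n_iv_2g_{1i}]$;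 these are the gradient and the Hessian of $T_{1i}$ in $\eta$. Finally let $b(y_i,\eta)=U(\eta)^{-1}\{D_i^t\Sigma_i^{-1}g_i+a_1(\eta)+\frac12a_2(\eta)\}$, where $$a_1=E\Bigl[\frac{\partial s_m}{\partial\eta^t}U^{-1}s_m\Bigr],\qquad a_{2,l}=\mathrm{tr}\Bigl\{E\Bigl[\frac{\partial^2s_{m,l}}{\partial\eta\,\partial\eta^t}\Bigr]U^{-1}\Bigr\}.$$ With $W_j=D_j^t\Sigma_j^{-1}$, $\tilde x_j=(x_j^t,0)^t$, $N_j=\begin{pmatrix}0\\ \tilde x_j^t\end{pmatrix}$ they have the closed forms $$a_1=\sum_{j\le m}\Bigl\{\sum_k\frac{\partial W_j}{\partial\eta_k}D_jU^{-1}e_k-2Q(m_j)W_jN_jU^{-1}W_j\binom{\mu_{2j}}{\mu_{3j}}\Bigr\},$$ $$a_{2,l}=\mathrm{tr}\Bigl(U^{-1}\sum_{j\le m}\Bigl\{-2\sum_a\frac{\partial W_{j,la}}{\partial\eta}D_{j,a\cdot}+\sum_aW_{j,la}Z_{j,a}\Bigr\}\Bigr),$$ where $Z_{j,1}=-\partial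 D_{j,1\cdot}/\partial\eta$ and $Z_{j,2}=2Q(m_j)^2\tilde x_j\tilde x_j^t-\partial D_{j,2\cdot}/\partial\eta$. **Theorem.** The estimator $$\widehat{\mathrm{CMSE}}_i=T_{1i}(y_i,\hat\eta)+T_{2i}(y_i,\hat\eta)-r(y_i,\hat\eta)^tb(y_i,\hat\eta)-\tfrac12\mathrm{tr}[R(y_i,\hat\eta)U(\hat\eta)^{-1}]$$ is second-order unbiased for the conditional MSE of the empirical Bayes predictor given $y_i$: for each fixed $i$, as $m\to\infty$, both conditional expectations are (for large $m$) those of integrable variables and $$E[\widehat{\mathrm{CMSE}}_i\mid y_i]=E[\{\hat\xi_i(y_i,\hat\eta)-\xi_i\}^2\mid y_i]+o_p(m^{-1}).$$ Moreover the identities asserted above hold: $E[\xi_i\mid y_i]=\hat\xi_i$, $\mathrm{Var}(\xi_i\mid y_i)=T_{1i}$; $r$ and $R$ are the gradient and Hessian of $T_{1i}$; the closed forms of $\mu_{2j},\mu_{3j},\mu_{4j}$; $U=\mathrm{Cov}(s_m)$; and the closed forms of $a_1$ and $a_2$. -/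

import Mathlib

open MeasureTheory ProbabilityTheory Filter Topology Matrix

noncomputable section

namespace NEFQVF

/-- Index set of the parameter vector `η = (β, ν)`, with `β ∈ ℝ^p` and `ν ∈ ℝ`. -/
abbrev Idx (p : ℕ) : Type := Fin p ⊕ Unit

/-- The parameter space `ℝ^(p+1)`. -/
abbrev Par (p : ℕ) : Type := Idx p → ℝ

/-- The regression coefficients `β`. -/
def beta {p : ℕ} (η : Par p) : Fin p → ℝ := fun k => η (Sum.inl k)

/-- The hyperparameter `ν`. -/
def nu {p : ℕ} (η : Par p) : ℝ := η (Sum.inr ())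

/-- Partial derivative with respect to the `k`-th coordinate of `η`. -/
def pd {p : ℕ} (k : Idx p) (F : Par p → ℝ) (η : Par p) : ℝ := fderiv ℝ F η (Pi.single k 1)

/-- The linear form `h ↦ ∑ k, v k * h k`. -/
def form {p : ℕ} (v : Par p) : Par p →L[ℝ] ℝ :=
  ∑ k, v k • (ContinuousLinearMap.proj k : Par p →L[ℝ] ℝ)

/-- A sequence of areas whose direct estimates follow a natural exponential family with quadratic
variance function. In area `j`, given `θ`, the observation has density
`exp (n j * (θ * y - ψ θ))` with respect to `base j` (the measure `exp (c (y, n j)) dy`, where `dy`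
is the Lebesgue measure or the counting measure on the lattice of the values of `y`). -/
structure Model (p : ℕ) where
  v₀ : ℝ
  v₁ : ℝ
  v₂ : ℝ
  ψ : ℝ → ℝ
  /-- the natural parameter space -/
  Θ : Set ℝ
  n : ℕ → ℝ
  x : ℕ → Fin p → ℝ
  base : ℕ → Measure ℝ
  base_sigmaFinite : ∀ j, SigmaFinite (base j)
  n_pos : ∀ j, 0 < n j
  Θ_nonempty : Θ.Nonempty
  /-- the family is regular: its full natural parameter space is open -/
  Θ_open : IsOpen Θ
  Θ_full : ∀ j, Θ = {θ | Integrable (fun y => Real.exp (n j * θ * y)) (base j)}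
  /-- the densities integrate to one -/
  density : ∀ j, ∀ θ ∈ Θ, ∫ y, Real.exp (n j * (θ * y - ψ θ)) ∂(base j) = 1
  /-- the variance function is quadratic -/
  qvf : ∀ θ ∈ Θ, deriv (deriv ψ) θ = v₀ + v₁ * deriv ψ θ + v₂ * deriv ψ θ ^ 2
  /-- the family is not degenerate -/
  var_pos : ∀ θ ∈ Θ, 0 < deriv (deriv ψ) θ

namespace Model

variable {p : ℕ} (M : Model p)

/-- `Q(t) = v₀ + v₁ t + v₂ t²`. -/
def Q (t : ℝ) : ℝ := M.v₀ + M.v₁ * t + M.v₂ * t ^ 2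

/-- `Q'(t)`. -/
def Q' (t : ℝ) : ℝ := M.v₁ + 2 * M.v₂ * t

/-- The canonical parameter `x_jᵗ β`. -/
def lin (j : ℕ) (η : Par p) : ℝ := M.x j ⬝ᵥ beta η

/-- The prior mean `m_j = ψ'(x_jᵗ β)`. -/
def mean (j : ℕ) (η : Par p) : ℝ := deriv M.ψ (M.lin j η)

/-- The normalizing constant `C(ν, μ)` of the conjugate prior. -/
def C (ν μ : ℝ) : ℝ := (∫ θ in M.Θ, Real.exp (ν * (μ * θ - M.ψ θ)))⁻¹

/-- The joint law of `(θ_j, y_j)`: its density with respect to `dθ ⊗ base j` is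
`f(y | θ) π(θ | ν, m_j)`. -/
def jointLaw (j : ℕ) (η : Par p) : Measure (ℝ × ℝ) :=
  ((volume.restrict M.Θ).prod (M.base j)).withDensity fun q =>
    ENNReal.ofReal
      (Real.exp (M.n j * (q.1 * q.2 - M.ψ q.1)) *
        (Real.exp (nu η * (M.mean j η * q.1 - M.ψ q.1)) * M.C (nu η) (M.mean j η)))

/-- Under `P` the pairs `(θ_j, y_j)` are independent and follow the mixed model with true
parameter `η`. -/
structure Generates {Ω : Type*} [MeasurableSpace Ω] (P : Measure Ω) (η : Par p)
    (θ y : ℕ → Ω → ℝ) : Prop where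
  measurable_θ : ∀ j, Measurable (θ j)
  measurable_y : ∀ j, Measurable (y j)
  indep : iIndepFun (fun j ω => (θ j ω, y j ω)) P
  law : ∀ j, P.map (fun ω => (θ j ω, y j ω)) = M.jointLaw j η

/-! ### Estimating equations -/

/-- `φ_j = (1 + ν / n_j) / (ν - v₂)`. -/
def phi (j : ℕ) (η : Par p) : ℝ := (1 + nu η / M.n j) / (nu η - M.v₂)

/-- `g_j = (y - m_j, (y - m_j)² - φ_j Q(m_j))`. -/
def g (j : ℕ) (y : ℝ) (η : Par p) : Fin 2 → ℝ :=
  ![y - M.mean j η, (y - M.mean j η) ^ 2 - M.phi j η * M.Q (M.mean j η)]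

/-- `E[(ξ_j - m_j)²]`. -/
def xiMoment2 (j : ℕ) (η : Par p) : ℝ := M.Q (M.mean j η) / (nu η - M.v₂)

/-- `E[(ξ_j - m_j)³]`. -/
def xiMoment3 (j : ℕ) (η : Par p) : ℝ :=
  2 * M.Q (M.mean j η) * M.Q' (M.mean j η) / ((nu η - M.v₂) * (nu η - 2 * M.v₂))

/-- `E[(ξ_j - m_j)⁴]`. -/
def xiMoment4 (j : ℕ) (η : Par p) : ℝ :=
  3 * M.Q (M.mean j η) *
      ((nu η - 2 * M.v₂) * M.Q (M.mean j η) + 2 * M.Q' (M.mean j η) ^ 2) /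
    ((nu η - M.v₂) * (nu η - 2 * M.v₂) * (nu η - 3 * M.v₂))

/-- `μ_{2j} = E[(y_j - m_j)²]`. -/
def mu2 (j : ℕ) (η : Par p) : ℝ :=
  M.Q (M.mean j η) * (nu η / M.n j + 1) / (nu η - M.v₂)

/-- `μ_{3j} = E[(y_j - m_j)³]`. -/
def mu3 (j : ℕ) (η : Par p) : ℝ :=
  M.Q (M.mean j η) * M.Q' (M.mean j η) * (nu η / M.n j + 1) * (nu η / M.n j + 2) /
    ((nu η - M.v₂) * (nu η - 2 * M.v₂))

/-- `d_j = v₂ / n_j`. -/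
def d (j : ℕ) : ℝ := M.v₂ / M.n j

/-- `μ_{4j} = E[(y_j - m_j)⁴]`. -/
def mu4 (j : ℕ) (η : Par p) : ℝ :=
  (M.d j + 1) * (2 * M.d j + 1) * (3 * M.d j + 1) * M.xiMoment4 j η
    + 6 / M.n j * M.Q' (M.mean j η) * (M.d j + 1) * (2 * M.d j + 1) * M.xiMoment3 j η
    + (M.d j + 1) / M.n j ^ 2 *
        (7 * M.Q' (M.mean j η) ^ 2 + 2 * M.n j * (4 * M.d j + 3) * M.Q (M.mean j η)) *
        M.xiMoment2 j η
    + 1 / M.n j ^ 3 * M.Q (M.mean j η) *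
        (M.n j * (2 * M.d j + 3) * M.Q (M.mean j η) + M.Q' (M.mean j η) ^ 2)

/-- `Σ_j = Cov(g_j)`. -/
def Sig (j : ℕ) (η : Par p) : Matrix (Fin 2) (Fin 2) ℝ :=
  !![M.mu2 j η, M.mu3 j η; M.mu3 j η, M.mu4 j η - M.mu2 j η ^ 2]

/-- `D_j`, that is, minus the expectation of the Jacobian matrix of `g_j`. -/
def D (j : ℕ) (η : Par p) : Matrix (Fin 2) (Idx p) ℝ :=
  Matrix.of fun a =>
    M.Q (M.mean j η) • Sum.elim
      (fun k => ![M.x j k, M.Q' (M.mean j η) * M.phi j η * M.x j k] a)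
      (fun _ => ![0, -(1 + M.v₂ / M.n j) * ((nu η - M.v₂) ^ 2)⁻¹] a)

/-- `R_j = D_jᵗ Σ_j⁻¹`. -/
def W (j : ℕ) (η : Par p) : Matrix (Idx p) (Fin 2) ℝ := (M.D j η)ᵀ * (M.Sig j η)⁻¹

/-- The estimating function `s_m = ∑_{j < m} D_jᵗ Σ_j⁻¹ g_j`. -/
def score (m : ℕ) (y : Fin m → ℝ) (η : Par p) : Par p :=
  ∑ j : Fin m, M.W j η *ᵥ M.g j (y j) η

/-- `U(η) = ∑_{j < m} D_jᵗ Σ_j⁻¹ D_j`. -/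
def U (m : ℕ) (η : Par p) : Matrix (Idx p) (Idx p) ℝ :=
  ∑ j ∈ Finset.range m, M.W j η * M.D j η

/-- `(x_jᵗ, 0)ᵗ`. -/
def xvec (j : ℕ) : Par p := Sum.elim (M.x j) (fun _ => 0)

/-- The vector `a₁(η)`, in closed form. -/
def a1 (m : ℕ) (η : Par p) : Par p := fun l =>
  ∑ j ∈ Finset.range m,
    ((∑ k, ∑ a, pd k (fun η' => M.W j η' l a) η * (M.D j η * (M.U m η)⁻¹) a k)
      - 2 * M.Q (M.mean j η) *
        ((M.W j η * Matrix.of ![0, M.xvec j] * (M.U m η)⁻¹ * M.W j η) *ᵥ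
          ![M.mu2 j η, M.mu3 j η]) l)

/-- `Z_j`: the expectations of the second partial derivatives of the two entries of `g_j`. -/
def Z (j : ℕ) (η : Par p) (a : Fin 2) (k k' : Idx p) : ℝ :=
  ![0, 2 * M.Q (M.mean j η) ^ 2 * M.xvec j k * M.xvec j k'] a
    - pd k (fun η' => M.D j η' a k') η

/-- The vector `a₂(η)`, in closed form. -/
def a2 (m : ℕ) (η : Par p) : Par p := fun l =>
  ((M.U m η)⁻¹ * ∑ j ∈ Finset.range m, Matrix.of fun k k' =>
    ∑ a, (-2 * pd k (fun η' => M.W j η' l a) η * M.D j η a k' + M.W j η l a * M.Z j η a k k')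
  ).trace

/-- `b(y_i, η) = U(η)⁻¹ (D_iᵗ Σ_i⁻¹ g_i + a₁(η) + a₂(η) / 2)`. -/
def b (m i : ℕ) (y : ℝ) (η : Par p) : Par p :=
  (M.U m η)⁻¹ *ᵥ (M.W i η *ᵥ M.g i y η + M.a1 m η + (1 / 2 : ℝ) • M.a2 m η)

/-! ### The predictor and the estimator of its conditional mean squared error -/

/-- The Bayes estimator `(n_i y + ν m_i) / (n_i + ν)` of `ξ_i = ψ'(θ_i)`. -/
def xiHat (i : ℕ) (y : ℝ) (η : Par p) : ℝ :=
  (M.n i * y + nu η * M.mean i η) / (M.n i + nu η)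

/-- `T_{1i}`, the posterior variance of `ξ_i`. -/
def T1 (i : ℕ) (y : ℝ) (η : Par p) : ℝ :=
  M.Q (M.xiHat i y η) / (M.n i + nu η - M.v₂)

/-- The matrix `P_i(y_i, η)`. -/
def Pmat (i : ℕ) (y : ℝ) (η : Par p) : Matrix (Idx p) (Idx p) ℝ :=
  ((M.n i + nu η) ^ 2)⁻¹ • Matrix.fromBlocks
    (Matrix.of fun k l => nu η ^ 2 * M.Q (M.mean i η) ^ 2 * M.x i k * M.x i l)
    (Matrix.of fun k _ => -(M.n i * nu η * (M.n i + nu η)⁻¹ * M.Q (M.mean i η) *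
      (y - M.mean i η) * M.x i k))
    (Matrix.of fun _ k => -(M.n i * nu η * (M.n i + nu η)⁻¹ * M.Q (M.mean i η) *
      (y - M.mean i η) * M.x i k))
    (Matrix.of fun _ _ => M.n i ^ 2 * ((M.n i + nu η) ^ 2)⁻¹ * (y - M.mean i η) ^ 2)

/-- `T_{2i} = tr [P_i U⁻¹]`. -/
def T2 (m i : ℕ) (y : ℝ) (η : Par p) : ℝ := (M.Pmat i y η * (M.U m η)⁻¹).trace

/-- `λ_i = (n_i + ν - v₂)⁻¹`. -/
def lam (i : ℕ) (η : Par p) : ℝ := (M.n i + nu η - M.v₂)⁻¹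

/-- The vector `r(y_i, η)`. -/
def r (i : ℕ) (y : ℝ) (η : Par p) : Par p :=
  Sum.elim
    (fun k => nu η * (M.n i + nu η)⁻¹ * M.lam i η * M.Q' (M.xiHat i y η) *
      M.Q (M.mean i η) * M.x i k)
    (fun _ => -M.lam i η ^ 2 * M.Q (M.xiHat i y η)
      - M.lam i η * M.n i * ((M.n i + nu η) ^ 2)⁻¹ * M.Q' (M.xiHat i y η) * (y - M.mean i η))

/-- The block `T_{1i}^{11}`. -/
def T11 (i : ℕ) (y : ℝ) (η : Par p) : Matrix (Fin p) (Fin p) ℝ :=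
  Matrix.of fun k l =>
    ((M.n i + nu η) ^ 2)⁻¹ * nu η * (M.x i k * M.x i l) * M.lam i η * M.Q (M.mean i η) *
      (2 * M.v₂ * nu η * M.Q (M.mean i η)
        + M.Q' (M.xiHat i y η) * M.Q' (M.mean i η) * (M.n i + nu η))

/-- The block `T_{1i}^{12}`. -/
def T12 (i : ℕ) (y : ℝ) (η : Par p) : Fin p → ℝ := fun k =>
  M.Q (M.mean i η) * M.lam i η * ((M.n i + nu η) ^ 2)⁻¹ *
    (M.Q' (M.xiHat i y η) * (M.n i - nu η * (M.n i + nu η) * M.lam i η)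
      - 2 * M.v₂ * M.n i * nu η * (y - M.mean i η) * (M.n i + nu η)⁻¹) * M.x i k

/-- The entry `T_{1i}^{22}`. -/
def T22 (i : ℕ) (y : ℝ) (η : Par p) : ℝ :=
  2 * M.lam i η ^ 3 * M.Q (M.xiHat i y η)
    + 2 * M.lam i η ^ 2 * M.n i * ((M.n i + nu η) ^ 2)⁻¹ * M.Q' (M.xiHat i y η) *
        (y - M.mean i η)
    + 2 * M.lam i η * M.n i * ((M.n i + nu η) ^ 4)⁻¹ * (y - M.mean i η) *
        ((M.n i + nu η) * M.Q' (M.xiHat i y η) + M.n i * M.v₂ * (y - M.mean i η))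

/-- The matrix `R(y_i, η)`. -/
def R (i : ℕ) (y : ℝ) (η : Par p) : Matrix (Idx p) (Idx p) ℝ :=
  Matrix.fromBlocks (M.T11 i y η) (Matrix.of fun k _ => M.T12 i y η k)
    (Matrix.of fun _ k => M.T12 i y η k) (Matrix.of fun _ _ => M.T22 i y η)

/-- The estimator of the conditional mean squared error, as a function of `y_i` and of the value
`η` of the estimator of the parameters. -/
def cmseHat (m i : ℕ) (y : ℝ) (η : Par p) : ℝ :=
  M.T1 i y η + M.T2 m i y η - M.r i y η ⬝ᵥ M.b m i y η
    - 1 / 2 * (M.R i y η * (M.U m η)⁻¹).trace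

/-! ### The asymptotic setting -/

/-- Regularity of the sequence of areas over a parameter set `K`: `K` is compact and the marginal
fourth moments exist on it, the sizes `n_j` and the covariates are bounded, the means stay away from
the boundary of the mean space, the information on `ν` in each area and on `β` per area does not
vanish. -/
structure Regular (K : Set (Par p)) : Prop where
  compact : IsCompact K
  nu_pos : ∀ η ∈ K, 0 < nu η
  nu_gt : ∀ η ∈ K, 3 * M.v₂ < nu η
  lin_mem : ∃ T ⊆ M.Θ, IsCompact T ∧ ∀ j, ∀ η ∈ K, M.lin j η ∈ T
  x_bdd : ∃ c, ∀ j k, |M.x j k| ≤ c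
  n_bdd : ∃ c, ∀ j, M.n j ≤ c
  n_low : ∃ c > 0, ∀ j, c ≤ M.n j ∧ c ≤ M.n j + M.v₂
  design : ∃ c > 0, ∀ᶠ m : ℕ in atTop, ∀ v : Fin p → ℝ,
    c * m * (v ⬝ᵥ v) ≤ ∑ j ∈ Finset.range m, (M.x j ⬝ᵥ v) ^ 2

/-- `ηhat` is the GT-estimator on the parameter set `K`: a measurable function of the data with
values in `K` that solves the estimating equations whenever they have a solution in `K`. -/
structure IsGT (K : Set (Par p)) (ηhat : (m : ℕ) → (Fin m → ℝ) → Par p) : Prop where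
  measurable : ∀ m, Measurable (ηhat m)
  mem : ∀ m y, ηhat m y ∈ K
  solves : ∀ m y, (∃ η ∈ K, M.score m y η = 0) → M.score m y (ηhat m y) = 0

/-- The samples of the first `m` areas for which the estimating equations have more than one
solution in `K`. -/
def multipleRoots (K : Set (Par p)) (m : ℕ) : Set (Fin m → ℝ) :=
  {y | ∃ η₁ ∈ K, ∃ η₂ ∈ K, η₁ ≠ η₂ ∧ M.score m y η₁ = 0 ∧ M.score m y η₂ = 0}

end Model

/-- The direct estimates of the first `m` areas. -/
def sample {Ω : Type*} (y : ℕ → Ω → ℝ) (m : ℕ) (ω : Ω) : Fin m → ℝ := fun j => y j ω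

/-- The σ-algebra generated by `y_i`. -/
abbrev sigmaOf {Ω : Type*} (y : ℕ → Ω → ℝ) (i : ℕ) : MeasurableSpace Ω :=
  MeasurableSpace.comap (y i) inferInstance

end NEFQVF

end

open MeasureTheory ProbabilityTheory Filter Topology Matrix

noncomputable section

namespace NEFQVF

namespace Model

variable {p : ℕ} (M : Model p)

/-! ### The exponential family -/

/-! Put ξ = ψ'(θ_i), a = ξ̂_i(η̂) − ξ̂_i(η) and e = ξ − ξ̂_i(η). The error of the estimator splits
as [T1(η) − e²] + 2ae + `excess`, where `excess` = T1(η̂) − T1(η) − a² + `corr`(η̂) and `corr` is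
the part of order 1/m of `cmseHat`. The first bracket has conditional mean zero because T1 is the
posterior variance. So does 2ae: a depends on the data only, the other areas are independent of
(θ_i, y_i), and e is centred given y_i (`Generates.condExp_mul_residual`).

The rest is a second-order expansion of `excess`. Let v = `noise` be the sum of the absolute
averages of the centred terms that enter the score, its first two derivatives, and y². If v is
small, t ↦ t + U(η)⁻¹ s_m(t) contracts a ball of radius O(v) about η, which gives a root
(`exists_root`). Iterating the Taylor expansion of the score yields t − η = `lead` + `second` +
O(v³) (`exists_root_expansion`). Where the roots in K are not multiple, η̂ is this root. Hence, for
|y_i| ≤ B, `excess` equals `mainTerm` up to a multiple of v^q + v/m + 1{multiple roots}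
(`exists_excess_approx`). A moment inequality for sums of independent variables gives E v^q =
O(m^(-q/2)) for some q > 2, so all three errors are o(1/m) in mean. This requires moments of y of
order 2q > 4, which exist because ν > 3v₂ is strict.

Finally, given y_i, `lead` has mean U⁻¹ W_i g_i, since only the i-th summand survives. The product
`lead` `lead`ᵗ has mean U⁻¹ and `second` has mean U⁻¹(a₁ + a₂/2), both up to o(1/m). The definition
of `corr` is the negative of what these means produce in `mainTerm`, so everything cancels
(`Generates.negl_mainTerm`). Convergence in probability follows by letting B grow
(`tendstoInMeasure_of_negl`).

The moments come from two differential equations. Differentiating exp(−nψ)∫y^k exp(nθy) gives a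
recursion for the moments of y given θ. For the prior, h = ψ' − m satisfies h' = Q(m) + Q'(m)h +
v₂h², and the density satisfies w' = −νhw. Integrating the derivative of h^(k+1) w gives the moment
recursion, and `pearson_moment` supplies the integrability and the vanishing boundary terms.
Uniformity in the area holds because each closed form is an analytic function of (y, n_j, x_j, η),
and for bounded y these arguments stay in a compact set (`SmoothFam`, `Regular.exists_compact`). -/

lemma integrableExpSet_eq (j : ℕ) :
    M.Θ = (fun θ => M.n j * θ) ⁻¹' integrableExpSet id (M.base j) := by
  rw [M.Θ_full j]; rfl

/-- Openness of Θ is transported by the dilation with factor n_j. At interior points the moment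
generating function is analytic and all moments exist. -/
lemma mem_interior_integrableExpSet (j : ℕ) {θ : ℝ} (hθ : θ ∈ M.Θ) :
    M.n j * θ ∈ interior (integrableExpSet id (M.base j)) := by
  rw [mem_interior_iff_mem_nhds]
  have h := M.Θ_open.mem_nhds hθ
  have hn := (M.n_pos j).ne'
  have hc : ContinuousAt (fun t : ℝ => (M.n j)⁻¹ * t) (M.n j * θ) := by fun_prop
  have h2 : (M.n j)⁻¹ * (M.n j * θ) = θ := by field_simp
  have h3 := hc.preimage_mem_nhds (t := M.Θ) (by simpa [h2] using h)
  filter_upwards [h3] with t ht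
  have := ht
  rw [Set.mem_preimage, M.integrableExpSet_eq j, Set.mem_preimage] at this
  simpa [← mul_assoc, mul_inv_cancel₀ hn] using this

lemma convex_Θ : Convex ℝ M.Θ := by
  rw [M.integrableExpSet_eq 0]
  exact (convex_integrableExpSet (X := id) (μ := M.base 0)).linear_preimage
    (M.n 0 • (LinearMap.id : ℝ →ₗ[ℝ] ℝ))

lemma ordConnected_Θ : M.Θ.OrdConnected := M.convex_Θ.ordConnected

lemma integrable_pow_mul_exp (j : ℕ) {θ : ℝ} (hθ : θ ∈ M.Θ) (k : ℕ) :
    Integrable (fun y => y ^ k * Real.exp (M.n j * (θ * y - M.ψ θ))) (M.base j) := by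
  have h := integrable_pow_mul_exp_of_mem_interior_integrableExpSet
    (M.mem_interior_integrableExpSet j hθ) k
  have h2 := h.mul_const (Real.exp (-(M.n j * M.ψ θ)))
  refine h2.congr (ae_of_all _ fun y => ?_)
  simp only [id, mul_assoc, ← Real.exp_add]
  congr 2; ring

lemma integral_pow_mul_exp (j : ℕ) (θ : ℝ) (k : ℕ) :
    ∫ y, y ^ k * Real.exp (M.n j * θ * y) ∂(M.base j)
      = Real.exp (M.n j * M.ψ θ) * ∫ y, y ^ k * Real.exp (M.n j * (θ * y - M.ψ θ)) ∂(M.base j) := by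
  rw [← integral_const_mul]
  congr 1; ext y
  rw [mul_left_comm, ← Real.exp_add]
  congr 2; ring

lemma mgf_eq (j : ℕ) {θ : ℝ} (hθ : θ ∈ M.Θ) :
    mgf id (M.base j) (M.n j * θ) = Real.exp (M.n j * M.ψ θ) := by
  have h := M.integral_pow_mul_exp j θ 0
  simp only [pow_zero, one_mul, M.density j θ hθ, mul_one] at h
  exact h

/-- The normalization of the densities identifies nψ(θ) with the logarithm of an analytic moment
generating function. A single area suffices, and area 0 is used. -/
lemma contDiffOn_ψ : ContDiffOn ℝ ⊤ M.ψ M.Θ := by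
  have h1 : ∀ θ ∈ M.Θ, M.ψ θ = Real.log (mgf id (M.base 0) (M.n 0 * θ)) / M.n 0 := by
    intro θ hθ
    rw [M.mgf_eq 0 hθ, Real.log_exp, mul_div_cancel_left₀ _ (M.n_pos 0).ne']
  refine ContDiffOn.congr (f := fun θ => Real.log (mgf id (M.base 0) (M.n 0 * θ)) / M.n 0) ?_ h1
  intro θ hθ
  refine ContDiffAt.contDiffWithinAt ?_
  have h2 := (analyticAt_mgf (M.mem_interior_integrableExpSet 0 hθ)).contDiffAt (n := ⊤)
  have h3 : ContDiffAt ℝ ⊤ (fun θ => mgf id (M.base 0) (M.n 0 * θ)) θ :=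
    h2.comp (f := fun θ => M.n 0 * θ) θ (contDiffAt_const.mul contDiffAt_id)
  refine (h3.log ?_).div_const _
  rw [M.mgf_eq 0 hθ]; positivity

lemma contDiffOn_deriv_ψ : ContDiffOn ℝ ⊤ (deriv M.ψ) M.Θ :=
  M.contDiffOn_ψ.deriv_of_isOpen M.Θ_open (by simp)

lemma hasDerivAt_ψ {θ : ℝ} (hθ : θ ∈ M.Θ) : HasDerivAt M.ψ (deriv M.ψ θ) θ :=
  ((M.contDiffOn_ψ.differentiableOn (by simp)).differentiableAt
    (M.Θ_open.mem_nhds hθ)).hasDerivAt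

lemma hasDerivAt_ξ {θ : ℝ} (hθ : θ ∈ M.Θ) :
    HasDerivAt (deriv M.ψ) (M.Q (deriv M.ψ θ)) θ := by
  have := ((M.contDiffOn_deriv_ψ.differentiableOn (by simp)).differentiableAt
    (M.Θ_open.mem_nhds hθ)).hasDerivAt
  rwa [M.qvf θ hθ] at this

lemma Q_pos {θ : ℝ} (hθ : θ ∈ M.Θ) : 0 < M.Q (deriv M.ψ θ) := by
  have := M.var_pos θ hθ
  rwa [M.qvf θ hθ] at this

lemma hasDerivAt_Q (t : ℝ) : HasDerivAt M.Q (M.Q' t) t := by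
  have := (((hasDerivAt_id t).const_mul M.v₁).const_add M.v₀).add
    (((hasDerivAt_id t).pow 2).const_mul M.v₂)
  refine this.congr_deriv ?_
  simp [Q']; ring

lemma hasDerivAt_Q' (t : ℝ) : HasDerivAt M.Q' (2 * M.v₂) t := by
  have := ((hasDerivAt_id t).const_mul (2 * M.v₂)).const_add M.v₁
  exact this.congr_deriv (by simp)

/-- The raw moments of the direct estimate given the canonical parameter. -/
def rawMoment (j k : ℕ) (θ : ℝ) : ℝ :=
  ∫ y, y ^ k * Real.exp (M.n j * (θ * y - M.ψ θ)) ∂(M.base j)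

/-- Product rule for exp(−nψ) times ∫ y^k exp(nθy): the second factor differentiates under the
integral, the first contributes −nψ'. -/
lemma hasDerivAt_rawMoment (j k : ℕ) {θ : ℝ} (hθ : θ ∈ M.Θ) :
    HasDerivAt (M.rawMoment j k)
      (M.n j * (M.rawMoment j (k + 1) θ - deriv M.ψ θ * M.rawMoment j k θ)) θ := by
  have h1 := hasDerivAt_integral_pow_mul_exp_real (M.mem_interior_integrableExpSet j hθ) k
  have h2 := h1.comp θ ((hasDerivAt_id θ).const_mul (M.n j))
  have h3 := ((M.hasDerivAt_ψ hθ).const_mul (M.n j)).neg.exp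
  have h4 := h3.mul h2
  have e : M.rawMoment j k = (fun t => Real.exp (-(M.n j * M.ψ t))) *
      ((fun t => ∫ ω, id ω ^ k * Real.exp (t * id ω) ∂(M.base j)) ∘ fun y => M.n j * id y) := by
    ext t
    simp only [Pi.mul_apply, Function.comp, id]
    rw [M.integral_pow_mul_exp j t k, ← mul_assoc, ← Real.exp_add]
    simp [rawMoment]
  rw [e]
  refine h4.congr_deriv ?_
  rw [← e]
  simp only [Function.comp, id]
  rw [M.integral_pow_mul_exp j θ k, M.integral_pow_mul_exp j θ (k + 1)]
  have e1 : Real.exp (-(M.n j * M.ψ θ)) * Real.exp (M.n j * M.ψ θ) = 1 := by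
    rw [← Real.exp_add]; simp
  simp only [rawMoment, Pi.neg_apply]
  linear_combination (M.n j * (∫ y, y ^ (k+1) * Real.exp (M.n j * (θ * y - M.ψ θ)) ∂(M.base j))
    - deriv M.ψ θ * M.n j * (∫ y, y ^ k * Real.exp (M.n j * (θ * y - M.ψ θ)) ∂(M.base j))) * e1

/-- Solves the differential relation for the next moment. When the k-th moment is a function F of
the mean, the chain rule with ξ' = Q(ξ) expresses the next one through F and F', so all moments are
polynomials in the mean. -/
lemma rawMoment_succ (j k : ℕ) {F : ℝ → ℝ} {F' : ℝ}
    (hF : ∀ θ ∈ M.Θ, M.rawMoment j k θ = F (deriv M.ψ θ)) {θ : ℝ} (hθ : θ ∈ M.Θ)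
    (hd : HasDerivAt F F' (deriv M.ψ θ)) :
    M.rawMoment j (k + 1) θ
      = (M.n j)⁻¹ * (F' * M.Q (deriv M.ψ θ)) + deriv M.ψ θ * F (deriv M.ψ θ) := by
  have h1 := M.hasDerivAt_rawMoment j k hθ
  have h2 := hd.comp θ (M.hasDerivAt_ξ hθ)
  have h3 : M.rawMoment j k =ᶠ[𝓝 θ] F ∘ deriv M.ψ := by
    filter_upwards [M.Θ_open.mem_nhds hθ] with t ht using hF t ht
  have h4 := h1.unique (h2.congr_of_eventuallyEq h3)
  rw [hF θ hθ] at h4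
  have hn := (M.n_pos j).ne'
  rw [← h4]
  field_simp
  ring

/-- Central moments of orders 2, 3, 4, 5 and 6 of the direct estimate, given the mean `x`. -/
def cm2 (s x : ℝ) : ℝ := s * M.Q x
def cm3 (s x : ℝ) : ℝ := s ^ 2 * M.Q x * M.Q' x
def cm4 (s x : ℝ) : ℝ :=
  s ^ 3 * (M.Q x * M.Q' x ^ 2 + 2 * M.v₂ * M.Q x ^ 2) + 3 * s ^ 2 * M.Q x ^ 2
def cm5 (s x : ℝ) : ℝ :=
  s ^ 4 * (M.Q x * M.Q' x ^ 3 + 8 * M.v₂ * M.Q x ^ 2 * M.Q' x) + 10 * s ^ 3 * M.Q x ^ 2 * M.Q' x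
def cm6 (s x : ℝ) : ℝ :=
  s ^ 5 * (M.Q x * M.Q' x ^ 4 + 22 * M.v₂ * M.Q x ^ 2 * M.Q' x ^ 2 + 16 * M.v₂ ^ 2 * M.Q x ^ 3)
    + s ^ 4 * (25 * M.Q x ^ 2 * M.Q' x ^ 2 + 30 * M.v₂ * M.Q x ^ 3) + 15 * s ^ 3 * M.Q x ^ 3

lemma rawMoment_zero (j : ℕ) {θ : ℝ} (hθ : θ ∈ M.Θ) : M.rawMoment j 0 θ = 1 := by
  simp [rawMoment, M.density j θ hθ]

lemma rawMoment_one (j : ℕ) {θ : ℝ} (hθ : θ ∈ M.Θ) : M.rawMoment j 1 θ = deriv M.ψ θ := by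
  rw [M.rawMoment_succ j 0 (F := fun _ => 1) (fun t ht => M.rawMoment_zero j ht) hθ
    (hasDerivAt_const _ _)]
  simp

lemma rawMoment_two (j : ℕ) {θ : ℝ} (hθ : θ ∈ M.Θ) :
    M.rawMoment j 2 θ = deriv M.ψ θ ^ 2 + M.cm2 (M.n j)⁻¹ (deriv M.ψ θ) := by
  rw [M.rawMoment_succ j 1 (F := fun x => x) (fun t ht => M.rawMoment_one j ht) hθ
    (hasDerivAt_id _)]
  simp [cm2]; ring

lemma rawMoment_three (j : ℕ) {θ : ℝ} (hθ : θ ∈ M.Θ) :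
    M.rawMoment j 3 θ = deriv M.ψ θ ^ 3 + 3 * deriv M.ψ θ * M.cm2 (M.n j)⁻¹ (deriv M.ψ θ)
      + M.cm3 (M.n j)⁻¹ (deriv M.ψ θ) := by
  rw [M.rawMoment_succ j 2 (F := fun x => x ^ 2 + M.cm2 (M.n j)⁻¹ x)
    (fun t ht => M.rawMoment_two j ht) hθ
    ((hasDerivAt_pow 2 _).add ((M.hasDerivAt_Q _).const_mul _))]
  simp [cm2, cm3]; ring

lemma rawMoment_four (j : ℕ) {θ : ℝ} (hθ : θ ∈ M.Θ) :
    M.rawMoment j 4 θ = deriv M.ψ θ ^ 4 + 6 * deriv M.ψ θ ^ 2 * M.cm2 (M.n j)⁻¹ (deriv M.ψ θ)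
      + 4 * deriv M.ψ θ * M.cm3 (M.n j)⁻¹ (deriv M.ψ θ) + M.cm4 (M.n j)⁻¹ (deriv M.ψ θ) := by
  have hQ := M.hasDerivAt_Q (deriv M.ψ θ)
  have hQ' := M.hasDerivAt_Q' (deriv M.ψ θ)
  have h := ((hasDerivAt_pow 3 (deriv M.ψ θ)).add
    (((hasDerivAt_id (deriv M.ψ θ)).const_mul 3).mul (hQ.const_mul (M.n j)⁻¹))).add
    ((hQ.const_mul ((M.n j)⁻¹ ^ 2)).mul hQ')
  rw [M.rawMoment_succ j 3 (F := fun x => x ^ 3 + 3 * x * M.cm2 (M.n j)⁻¹ x + M.cm3 (M.n j)⁻¹ x)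
    (fun t ht => M.rawMoment_three j ht) hθ h]
  simp [cm2, cm3, cm4]; ring

lemma rawMoment_five (j : ℕ) {θ : ℝ} (hθ : θ ∈ M.Θ) :
    M.rawMoment j 5 θ = deriv M.ψ θ ^ 5 + 10 * deriv M.ψ θ ^ 3 * M.cm2 (M.n j)⁻¹ (deriv M.ψ θ)
      + 10 * deriv M.ψ θ ^ 2 * M.cm3 (M.n j)⁻¹ (deriv M.ψ θ)
      + 5 * deriv M.ψ θ * M.cm4 (M.n j)⁻¹ (deriv M.ψ θ) + M.cm5 (M.n j)⁻¹ (deriv M.ψ θ) := by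
  have hQ := M.hasDerivAt_Q (deriv M.ψ θ)
  have hQ' := M.hasDerivAt_Q' (deriv M.ψ θ)
  have hi := hasDerivAt_id (deriv M.ψ θ)
  have h := (((hasDerivAt_pow 4 (deriv M.ψ θ)).add
    (((hasDerivAt_pow 2 (deriv M.ψ θ)).const_mul 6).mul (hQ.const_mul (M.n j)⁻¹))).add
    ((hi.const_mul 4).mul ((hQ.const_mul ((M.n j)⁻¹ ^ 2)).mul hQ'))).add
    ((((hQ.mul (hQ'.pow 2)).add ((hQ.pow 2).const_mul (2 * M.v₂))).const_mul ((M.n j)⁻¹ ^ 3)).add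
      ((hQ.pow 2).const_mul (3 * (M.n j)⁻¹ ^ 2)))
  rw [M.rawMoment_succ j 4 (F := fun x => x ^ 4 + 6 * x ^ 2 * M.cm2 (M.n j)⁻¹ x
    + 4 * x * M.cm3 (M.n j)⁻¹ x + M.cm4 (M.n j)⁻¹ x)
    (fun t ht => M.rawMoment_four j ht) hθ h]
  simp [cm2, cm3, cm4, cm5]; ring

lemma rawMoment_six (j : ℕ) {θ : ℝ} (hθ : θ ∈ M.Θ) :
    M.rawMoment j 6 θ = deriv M.ψ θ ^ 6 + 15 * deriv M.ψ θ ^ 4 * M.cm2 (M.n j)⁻¹ (deriv M.ψ θ)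
      + 20 * deriv M.ψ θ ^ 3 * M.cm3 (M.n j)⁻¹ (deriv M.ψ θ)
      + 15 * deriv M.ψ θ ^ 2 * M.cm4 (M.n j)⁻¹ (deriv M.ψ θ)
      + 6 * deriv M.ψ θ * M.cm5 (M.n j)⁻¹ (deriv M.ψ θ) + M.cm6 (M.n j)⁻¹ (deriv M.ψ θ) := by
  have hQ := M.hasDerivAt_Q (deriv M.ψ θ)
  have hQ' := M.hasDerivAt_Q' (deriv M.ψ θ)
  have hi := hasDerivAt_id (deriv M.ψ θ)
  have h := ((((hasDerivAt_pow 5 (deriv M.ψ θ)).add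
    (((hasDerivAt_pow 3 (deriv M.ψ θ)).const_mul 10).mul (hQ.const_mul (M.n j)⁻¹))).add
    (((hasDerivAt_pow 2 (deriv M.ψ θ)).const_mul 10).mul
      ((hQ.const_mul ((M.n j)⁻¹ ^ 2)).mul hQ'))).add
    ((hi.const_mul 5).mul
      ((((hQ.mul (hQ'.pow 2)).add
        ((hQ.pow 2).const_mul (2 * M.v₂))).const_mul ((M.n j)⁻¹ ^ 3)).add
      ((hQ.pow 2).const_mul (3 * (M.n j)⁻¹ ^ 2))))).add
    ((((hQ.mul (hQ'.pow 3)).add (((hQ.pow 2).const_mul (8 * M.v₂)).mul hQ')).const_mul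
      ((M.n j)⁻¹ ^ 4)).add (((hQ.pow 2).const_mul (10 * (M.n j)⁻¹ ^ 3)).mul hQ'))
  rw [M.rawMoment_succ j 5 (F := fun x => x ^ 5 + 10 * x ^ 3 * M.cm2 (M.n j)⁻¹ x
    + 10 * x ^ 2 * M.cm3 (M.n j)⁻¹ x + 5 * x * M.cm4 (M.n j)⁻¹ x + M.cm5 (M.n j)⁻¹ x)
    (fun t ht => M.rawMoment_five j ht) hθ h]
  simp [cm2, cm3, cm4, cm5, cm6]; ring

end Model
end NEFQVF

/-! ### Conditional moments about a given centre, and the boundary of the natural parameter space -/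

namespace NEFQVF

namespace Model

variable {p : ℕ} (M : Model p)

lemma integrable_sub_pow_mul_exp (j : ℕ) {θ : ℝ} (hθ : θ ∈ M.Θ) (a : ℝ) (k : ℕ) :
    Integrable (fun y => (y - a) ^ k * Real.exp (M.n j * (θ * y - M.ψ θ))) (M.base j) := by
  simp only [sub_eq_add_neg _ a, add_pow, Finset.sum_mul]
  refine integrable_finsetSum _ fun i _ => ?_
  refine ((M.integrable_pow_mul_exp j hθ i).mul_const ((-a) ^ (k - i) * (k.choose i))).congr
    (ae_of_all _ fun y => ?_)
  simp only
  ring_nf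

lemma integral_sub_pow_mul_exp (j : ℕ) {θ : ℝ} (hθ : θ ∈ M.Θ) (a : ℝ) (k : ℕ) :
    ∫ y, (y - a) ^ k * Real.exp (M.n j * (θ * y - M.ψ θ)) ∂(M.base j)
      = ∑ i ∈ Finset.range (k + 1), M.rawMoment j i θ * ((-a) ^ (k - i) * (k.choose i)) := by
  simp only [rawMoment, ← integral_mul_const]
  rw [← integral_finsetSum _ fun i _ => (M.integrable_pow_mul_exp j hθ i).mul_const _]
  congr 1; ext y
  simp only [sub_eq_add_neg _ a, add_pow, Finset.sum_mul]
  refine Finset.sum_congr rfl fun i _ => ?_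
  ring

lemma condMoment_one (j : ℕ) {θ : ℝ} (hθ : θ ∈ M.Θ) (a : ℝ) :
    ∫ y, (y - a) * Real.exp (M.n j * (θ * y - M.ψ θ)) ∂(M.base j) = deriv M.ψ θ - a := by
  have := M.integral_sub_pow_mul_exp j hθ a 1
  simp only [pow_one] at this
  rw [this]
  simp [Finset.sum_range_succ, M.rawMoment_zero j hθ, M.rawMoment_one j hθ]; ring

lemma condMoment_two (j : ℕ) {θ : ℝ} (hθ : θ ∈ M.Θ) (a : ℝ) :
    ∫ y, (y - a) ^ 2 * Real.exp (M.n j * (θ * y - M.ψ θ)) ∂(M.base j)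
      = (deriv M.ψ θ - a) ^ 2 + M.cm2 (M.n j)⁻¹ (deriv M.ψ θ) := by
  rw [M.integral_sub_pow_mul_exp j hθ a 2]
  simp [Finset.sum_range_succ, M.rawMoment_zero j hθ, M.rawMoment_one j hθ, M.rawMoment_two j hθ]
  ring

lemma condMoment_three (j : ℕ) {θ : ℝ} (hθ : θ ∈ M.Θ) (a : ℝ) :
    ∫ y, (y - a) ^ 3 * Real.exp (M.n j * (θ * y - M.ψ θ)) ∂(M.base j)
      = (deriv M.ψ θ - a) ^ 3 + 3 * (deriv M.ψ θ - a) * M.cm2 (M.n j)⁻¹ (deriv M.ψ θ)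
        + M.cm3 (M.n j)⁻¹ (deriv M.ψ θ) := by
  rw [M.integral_sub_pow_mul_exp j hθ a 3]
  simp [Finset.sum_range_succ, M.rawMoment_zero j hθ, M.rawMoment_one j hθ, M.rawMoment_two j hθ,
    M.rawMoment_three j hθ, Nat.choose]
  ring

lemma condMoment_four (j : ℕ) {θ : ℝ} (hθ : θ ∈ M.Θ) (a : ℝ) :
    ∫ y, (y - a) ^ 4 * Real.exp (M.n j * (θ * y - M.ψ θ)) ∂(M.base j)
      = (deriv M.ψ θ - a) ^ 4 + 6 * (deriv M.ψ θ - a) ^ 2 * M.cm2 (M.n j)⁻¹ (deriv M.ψ θ)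
        + 4 * (deriv M.ψ θ - a) * M.cm3 (M.n j)⁻¹ (deriv M.ψ θ)
        + M.cm4 (M.n j)⁻¹ (deriv M.ψ θ) := by
  rw [M.integral_sub_pow_mul_exp j hθ a 4]
  simp [Finset.sum_range_succ, M.rawMoment_zero j hθ, M.rawMoment_one j hθ, M.rawMoment_two j hθ,
    M.rawMoment_three j hθ, M.rawMoment_four j hθ, Nat.choose]
  ring

/-- The sixth moment is the even moment from which the fractional moments of order at most six are
interpolated in `cond_rpow_le`. -/
lemma condMoment_six (j : ℕ) {θ : ℝ} (hθ : θ ∈ M.Θ) :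
    ∫ y, (y - deriv M.ψ θ) ^ 6 * Real.exp (M.n j * (θ * y - M.ψ θ)) ∂(M.base j)
      = M.cm6 (M.n j)⁻¹ (deriv M.ψ θ) := by
  rw [M.integral_sub_pow_mul_exp j hθ _ 6]
  simp [Finset.sum_range_succ, M.rawMoment_zero j hθ, M.rawMoment_one j hθ, M.rawMoment_two j hθ,
    M.rawMoment_three j hθ, M.rawMoment_four j hθ, M.rawMoment_five j hθ, M.rawMoment_six j hθ,
    Nat.choose]
  ring

/-- A finite endpoint of the natural parameter space is approached only with unbounded cumulant
function. -/
lemma mem_Θ_of_tendsto {b B : ℝ} {u : ℕ → ℝ} (hu : Tendsto u atTop (𝓝 b))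
    (hmem : ∀ k, u k ∈ M.Θ) (hB : ∀ k, M.ψ (u k) ≤ B) : b ∈ M.Θ := by
  have hn := M.n_pos 0
  rw [M.Θ_full 0]
  refine ⟨by fun_prop, ?_⟩
  rw [hasFiniteIntegral_iff_ofReal (ae_of_all _ fun y => (Real.exp_pos _).le)]
  have h1 : ∀ y, ENNReal.ofReal (Real.exp (M.n 0 * b * y))
      = liminf (fun k => ENNReal.ofReal (Real.exp (M.n 0 * u k * y))) atTop := by
    intro y
    refine (Tendsto.liminf_eq ?_).symm
    refine (ENNReal.continuous_ofReal.comp Real.continuous_exp).continuousAt.tendsto.comp ?_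
    exact (hu.const_mul _).mul_const _
  simp_rw [h1]
  -- Fatou's lemma: the integrals along `u` are exp(nψ(u k)) ≤ exp(nB), so the limit point has a
  -- finite integral and belongs to the full natural parameter space.
  refine (lintegral_liminf_le fun k => by fun_prop).trans_lt ?_
  refine lt_of_le_of_lt (b := ENNReal.ofReal (Real.exp (M.n 0 * B))) ?_ ENNReal.ofReal_lt_top
  refine liminf_le_of_frequently_le' (Frequently.of_forall fun k => ?_)
  have hi : Integrable (fun y => Real.exp (M.n 0 * u k * y)) (M.base 0) := by
    have := hmem k; rw [M.Θ_full 0] at this; exact this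
  rw [← ofReal_integral_eq_lintegral_ofReal hi (ae_of_all _ fun y => (Real.exp_pos _).le)]
  refine ENNReal.ofReal_le_ofReal ?_
  have := M.mgf_eq 0 (hmem k)
  simp only [mgf, id] at this
  rw [this]
  exact Real.exp_le_exp.2 (mul_le_mul_of_nonneg_left (hB k) hn.le)

lemma strictMonoOn_ξ : StrictMonoOn (deriv M.ψ) M.Θ := by
  refine strictMonoOn_of_deriv_pos M.convex_Θ M.contDiffOn_deriv_ψ.continuousOn fun θ hθ => ?_
  rw [M.Θ_open.interior_eq] at hθ
  exact M.var_pos θ hθ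

lemma ψ_sub_le {a c B : ℝ} (ha : a ∈ M.Θ) (hc : c ∈ M.Θ)
    (hB : ∀ t ∈ Set.uIcc a c, |deriv M.ψ t| ≤ B) : M.ψ c ≤ M.ψ a + B * |c - a| := by
  have hs : Set.uIcc a c ⊆ M.Θ := M.ordConnected_Θ.uIcc_subset ha hc
  have := (convex_uIcc a c).norm_image_sub_le_of_norm_hasDerivWithin_le
    (fun t ht => (M.hasDerivAt_ψ (hs ht)).hasDerivWithinAt) hB Set.left_mem_uIcc Set.right_mem_uIcc
  simp only [Real.norm_eq_abs] at this
  linarith [le_abs_self (M.ψ c - M.ψ a)]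

/-- Steepness. If the increasing function ψ' stayed bounded near b, the mean value inequality would
bound ψ on [a, b), and `mem_Θ_of_tendsto` would put b into Θ. -/
lemma tendsto_ξ_right {a b : ℝ} (ha : a ∈ M.Θ) (hab : a < b) (hsub : Set.Ico a b ⊆ M.Θ)
    (hb : b ∉ M.Θ) : Tendsto (deriv M.ψ) (𝓝[<] b) atTop := by
  rw [tendsto_atTop]
  intro B
  by_contra hcon
  have h1 : ∀ t ∈ Set.Ico a b, deriv M.ψ t ≤ B := by
    intro t ht
    by_contra h2
    push Not at h2
    refine hcon ?_
    filter_upwards [Ioo_mem_nhdsLT ht.2] with s hs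
    exact h2.le.trans (M.strictMonoOn_ξ (hsub ht) (hsub ⟨ht.1.trans hs.1.le, hs.2⟩) hs.1).le
  obtain ⟨u, hu, hul, hut⟩ := exists_seq_strictMono_tendsto' hab
  refine hb (M.mem_Θ_of_tendsto (B := M.ψ a + (|B| + |deriv M.ψ a|) * (b - a)) hut
    (fun k => hsub ⟨(hul k).1.le, (hul k).2⟩) fun k => ?_)
  have hk := hul k
  refine (M.ψ_sub_le (B := |B| + |deriv M.ψ a|) ha (hsub ⟨hk.1.le, hk.2⟩) ?_).trans ?_
  · intro t ht
    rw [Set.uIcc_of_le hk.1.le] at ht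
    have h3 : deriv M.ψ a ≤ deriv M.ψ t := by
      exact M.strictMonoOn_ξ.monotoneOn ha (hsub ⟨ht.1, ht.2.trans_lt hk.2⟩) ht.1
    have h4 := h1 t ⟨ht.1, ht.2.trans_lt hk.2⟩
    rw [abs_le]
    constructor
    · linarith [neg_abs_le (deriv M.ψ a), abs_nonneg B]
    · linarith [le_abs_self B, abs_nonneg (deriv M.ψ a)]
  · rw [abs_of_pos (a := u k - a) (by linarith [hk.1])]
    gcongr
    exact hk.2.le

lemma tendsto_ξ_left {a b : ℝ} (ha : a ∈ M.Θ) (hab : b < a) (hsub : Set.Ioc b a ⊆ M.Θ)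
    (hb : b ∉ M.Θ) : Tendsto (deriv M.ψ) (𝓝[>] b) atBot := by
  rw [tendsto_atBot]
  intro B
  by_contra hcon
  have h1 : ∀ t ∈ Set.Ioc b a, B ≤ deriv M.ψ t := by
    intro t ht
    by_contra h2
    push Not at h2
    refine hcon ?_
    filter_upwards [Ioo_mem_nhdsGT ht.1] with s hs
    exact (M.strictMonoOn_ξ (hsub ⟨hs.1, hs.2.le.trans ht.2⟩) (hsub ht) hs.2).le.trans h2.le
  obtain ⟨u, hu, hul, hut⟩ := exists_seq_strictAnti_tendsto' hab
  refine hb (M.mem_Θ_of_tendsto (B := M.ψ a + (|B| + |deriv M.ψ a|) * (a - b)) hut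
    (fun k => hsub ⟨(hul k).1, (hul k).2.le⟩) fun k => ?_)
  have hk := hul k
  refine (M.ψ_sub_le (B := |B| + |deriv M.ψ a|) ha (hsub ⟨hk.1, hk.2.le⟩) ?_).trans ?_
  · intro t ht
    rw [Set.uIcc_of_ge hk.2.le] at ht
    have h3 : deriv M.ψ t ≤ deriv M.ψ a := by
      exact M.strictMonoOn_ξ.monotoneOn (hsub ⟨hk.1.trans_le ht.1, ht.2⟩) ha ht.2
    have h4 := h1 t ⟨hk.1.trans_le ht.1, ht.2⟩
    rw [abs_le]
    constructor
    · linarith [neg_abs_le B, abs_nonneg (deriv M.ψ a)]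
    · linarith [le_abs_self (deriv M.ψ a), abs_nonneg B]
  · rw [abs_of_neg (a := u k - a) (by linarith [hk.2])]
    have := hk.1
    gcongr
    linarith

end Model
end NEFQVF

namespace NEFQVF

/-! ### Integration over an open interval -/

section Interval

variable {Θ : Set ℝ}

/-- An open order-connected set extends to the right of a either without bound or up to a supremum
which openness keeps outside. -/
lemma inter_Ioi_cases (hO : IsOpen Θ) (hc : Θ.OrdConnected) {a : ℝ} (ha : a ∈ Θ) :
    (Set.Ici a ⊆ Θ) ∨ ∃ b, a < b ∧ b ∉ Θ ∧ Set.Ico a b ⊆ Θ ∧ Θ ∩ Set.Ioi a = Set.Ioo a b := by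
  by_cases hb : BddAbove Θ
  · right
    have hlub := isLUB_csSup ⟨a, ha⟩ hb
    have hnot : sSup Θ ∉ Θ := by
      intro h
      obtain ⟨u, hu, hus⟩ := exists_Ico_subset_of_mem_nhds (hO.mem_nhds h) (exists_gt _)
      obtain ⟨c, hc1, hc2⟩ := exists_between hu
      exact absurd (hlub.1 (hus ⟨hc1.le, hc2⟩)) (not_le.2 hc1)
    have hlt : a < sSup Θ := lt_of_le_of_ne (hlub.1 ha) fun h => hnot (h ▸ ha)
    have hsub : Set.Ico a (sSup Θ) ⊆ Θ := by
      intro t ht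
      obtain ⟨c, hc1, hc2⟩ := exists_lt_of_lt_csSup ⟨a, ha⟩ ht.2
      exact hc.out ha hc1 ⟨ht.1, hc2.le⟩
    refine ⟨sSup Θ, hlt, hnot, hsub, Set.ext fun t => ⟨fun ht => ⟨ht.2, ?_⟩, fun ht => ⟨?_, ht.1⟩⟩⟩
    · exact lt_of_le_of_ne (hlub.1 ht.1) fun h => hnot (h ▸ ht.1)
    · exact hsub ⟨ht.1.le, ht.2⟩
  · left
    intro t ht
    obtain ⟨c, hc1, hc2⟩ := not_bddAbove_iff.1 hb t
    exact hc.out ha hc1 ⟨ht, hc2.le⟩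

lemma isOpen_preimage_neg (hO : IsOpen Θ) : IsOpen (Neg.neg ⁻¹' Θ) := hO.preimage continuous_neg

lemma ordConnected_preimage_neg (hc : Θ.OrdConnected) : (Neg.neg ⁻¹' Θ).OrdConnected :=
  ⟨fun _ hx _ hy _ hz => hc.out hy hx ⟨neg_le_neg hz.2, neg_le_neg hz.1⟩⟩

lemma setIntegral_preimage_neg (f : ℝ → ℝ) (S : Set ℝ) :
    ∫ t in Neg.neg ⁻¹' S, f (-t) = ∫ t in S, f t :=
  (Measure.measurePreserving_neg volume).setIntegral_preimage_emb
    (MeasurableEquiv.neg ℝ).measurableEmbedding f S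

lemma integrableOn_preimage_neg {f : ℝ → ℝ} {S : Set ℝ} :
    IntegrableOn (fun t => f (-t)) (Neg.neg ⁻¹' S) ↔ IntegrableOn f S :=
  (Measure.measurePreserving_neg volume).integrableOn_comp_preimage
    (MeasurableEquiv.neg ℝ).measurableEmbedding

/-- The boundary value at the far end vanishes: at infinity because F and F' are both integrable, at
a finite endpoint by the assumption on the limit. -/
lemma setIntegral_deriv_right (hO : IsOpen Θ) (hc : Θ.OrdConnected) {a : ℝ} (ha : a ∈ Θ)
    {F F' : ℝ → ℝ} (hd : ∀ t ∈ Θ, HasDerivAt F (F' t) t) (hF : IntegrableOn F Θ)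
    (hF' : IntegrableOn F' Θ)
    (hr : ∀ b ∉ Θ, a < b → Set.Ico a b ⊆ Θ → Tendsto F (𝓝[<] b) (𝓝 0)) :
    ∫ t in Θ ∩ Set.Ioi a, F' t = - F a := by
  rcases inter_Ioi_cases hO hc ha with h | ⟨b, hab, hb, hsub, he⟩
  · have h' : Set.Ioi a ⊆ Θ := Set.Ioi_subset_Ici_self.trans h
    rw [Set.inter_eq_right.2 h']
    rw [integral_Ioi_of_hasDerivAt_of_tendsto' (fun x hx => hd x (h hx)) (hF'.mono_set h')
      (tendsto_zero_of_hasDerivAt_of_integrableOn_Ioi (fun x hx => hd x (h' hx))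
        (hF'.mono_set h') (hF.mono_set h'))]
    simp
  · have hi : IntervalIntegrable F' volume a b := by
      rw [intervalIntegrable_iff_integrableOn_Ioo_of_le hab.le, ← he]
      exact hF'.mono_set Set.inter_subset_left
    rw [he, ← integral_Ioc_eq_integral_Ioo, ← intervalIntegral.integral_of_le hab.le,
      intervalIntegral.integral_eq_sub_of_hasDerivAt_of_tendsto hab
        (fun x hx => hd x (hsub ⟨hx.1.le, hx.2⟩)) hi
        ((hd a ha).continuousAt.tendsto.mono_left nhdsWithin_le_nhds) (hr b hb hab hsub)]
    simp

/-- The left half is the right half of the reflected set, and the two boundary values at a cancel.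
-/
lemma setIntegral_deriv_eq_zero (hO : IsOpen Θ) (hc : Θ.OrdConnected) {a : ℝ} (ha : a ∈ Θ)
    {F F' : ℝ → ℝ} (hd : ∀ t ∈ Θ, HasDerivAt F (F' t) t) (hF : IntegrableOn F Θ)
    (hF' : IntegrableOn F' Θ)
    (hr : ∀ b ∉ Θ, a < b → Set.Ico a b ⊆ Θ → Tendsto F (𝓝[<] b) (𝓝 0))
    (hl : ∀ b ∉ Θ, b < a → Set.Ioc b a ⊆ Θ → Tendsto F (𝓝[>] b) (𝓝 0)) :
    ∫ t in Θ, F' t = 0 := by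
  have h1 := setIntegral_deriv_right hO hc ha hd hF hF' hr
  have h2 := setIntegral_deriv_right (isOpen_preimage_neg hO) (ordConnected_preimage_neg hc)
    (a := -a) (by simpa using ha) (F := fun t => F (-t)) (F' := fun t => -F' (-t))
    (fun t ht => by simpa [Function.comp_def] using (hd (-t) ht).comp t (hasDerivAt_neg t))
    (integrableOn_preimage_neg.2 hF) (integrableOn_preimage_neg (f := F').2 hF').neg
    (fun b hb hab hsub => by
      refine (hl (-b) hb (by linarith) fun t ht => ?_).comp tendsto_neg_nhdsLT
      have := hsub (a := -t) ⟨by linarith [ht.2], by linarith [ht.1]⟩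
      simpa using this)
  have h3 : Neg.neg ⁻¹' Θ ∩ Set.Ioi (-a) = Neg.neg ⁻¹' (Θ ∩ Set.Iio a) := by
    ext t; simp
  rw [h3, integral_neg, setIntegral_preimage_neg] at h2
  have h4 : ∫ t in Θ \ Set.Ioi a, F' t = ∫ t in Θ ∩ Set.Iio a, F' t := by
    refine setIntegral_congr_set ?_
    rw [Set.sdiff_eq, Set.compl_Ioi]
    exact Filter.EventuallyEq.inter (ae_eq_refl _) Iio_ae_eq_Iic.symm
  rw [← integral_inter_add_sdiff measurableSet_Ioi hF', h1, h4]
  simp at h2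
  linarith

end Interval

/-! ### Moments of a Pearson-type density on an interval -/

section Pearson

variable {Θ : Set ℝ}

/-- A constant for the moment bounds of Pearson-type densities. -/
def pearsonConst (A q κ : ℝ) : ℝ :=
  (q - 1) * A * ((4 * (q - 1) * A / κ + 1) ^ (q - 2) + (4 * (q - 1) * A / κ + 1) ^ (q - 1))

/-- Beyond the threshold H half of the leading term absorbs the lower orders, because there 4(q −
1)A ≤ κx. Below H they are at most their values at H. The summand 1 in H ensures x ≥ 1 beyond it, so
that x^(q−2) ≤ x^(q−1). -/
lemma rpow_lower_order_le {A q κ x a b : ℝ} (hq : 2 ≤ q) (hκ : 0 < κ) (hx : 0 ≤ x)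
    (ha : a ≤ A) (hb : b ≤ A) (hA : 0 ≤ A) :
    (q - 1) * (a * x ^ (q - 2) + b * x ^ (q - 1)) ≤ κ / 2 * x ^ q + pearsonConst A q κ := by
  set H := 4 * (q - 1) * A / κ + 1 with hH
  have hH1 : 1 ≤ H := by
    have : 0 ≤ 4 * (q - 1) * A / κ := by
      have : 0 ≤ q - 1 := by linarith
      positivity
    linarith
  have hq1 : 0 ≤ q - 1 := by linarith
  have e1 : (q - 1) * (a * x ^ (q - 2) + b * x ^ (q - 1))
      ≤ (q - 1) * A * (x ^ (q - 2) + x ^ (q - 1)) := by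
    rw [mul_assoc]
    refine mul_le_mul_of_nonneg_left ?_ hq1
    have h1 : 0 ≤ x ^ (q - 2) := by positivity
    have h2 : 0 ≤ x ^ (q - 1) := by positivity
    nlinarith
  refine e1.trans ?_
  rcases le_total x H with hxH | hxH
  · have h1 : x ^ (q - 2) ≤ H ^ (q - 2) := Real.rpow_le_rpow hx hxH (by linarith)
    have h2 : x ^ (q - 1) ≤ H ^ (q - 1) := Real.rpow_le_rpow hx hxH (by linarith)
    have h3 : 0 ≤ κ / 2 * x ^ q := by positivity
    have : (q - 1) * A * (x ^ (q - 2) + x ^ (q - 1)) ≤ pearsonConst A q κ := by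
      unfold pearsonConst
      exact mul_le_mul_of_nonneg_left (add_le_add h1 h2) (by positivity)
    linarith
  · have hx1 : 1 ≤ x := hH1.trans hxH
    have hx0 : 0 < x := by linarith
    have h1 : x ^ (q - 2) ≤ x ^ (q - 1) := Real.rpow_le_rpow_of_exponent_le hx1 (by linarith)
    have h2 : x ^ q = x ^ (q - 1) * x := by
      rw [← Real.rpow_add_one hx0.ne']; congr 1; ring
    have h3 : 0 ≤ pearsonConst A q κ := by
      unfold pearsonConst
      rw [← hH]; positivity
    have h4 : 0 ≤ x ^ (q - 1) := by positivity
    have h5 : 4 * (q - 1) * A ≤ κ * x := by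
      have : 4 * (q - 1) * A / κ ≤ x := by linarith
      rw [div_le_iff₀ hκ] at this; linarith
    have h6 : 2 * ((q - 1) * A) ≤ κ / 2 * x := by linarith
    calc (q - 1) * A * (x ^ (q - 2) + x ^ (q - 1))
        ≤ (q - 1) * A * (2 * x ^ (q - 1)) :=
          mul_le_mul_of_nonneg_left (by linarith) (by positivity)
      _ = 2 * ((q - 1) * A) * x ^ (q - 1) := by ring
      _ ≤ κ / 2 * x * x ^ (q - 1) := mul_le_mul_of_nonneg_right h6 h4
      _ = κ / 2 * x ^ q := by rw [h2]; ring
      _ ≤ _ := by linarith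

/-- The derivative of h^(q−1) w is (q−1)(A h^(q−2) + B h^(q−1)) w − κ h^q w with κ = ν − (q−1)v > 0.
Integrate it from the zero a of h to c and absorb the lower orders into half of the last term. The
bound does not depend on c, and it also controls the endpoint value h(c)^(q−1) w(c). -/
lemma pearson_right_aux (hc : Θ.OrdConnected) {h w : ℝ → ℝ} {A B v ν q A₀ a c : ℝ}
    (hh : ∀ t ∈ Θ, HasDerivAt h (A + B * h t + v * h t ^ 2) t)
    (hw : ∀ t ∈ Θ, HasDerivAt w (-ν * h t * w t) t) (hw0 : ∀ t ∈ Θ, 0 < w t)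
    (ha : a ∈ Θ) (hha : h a = 0) (hpos : ∀ t ∈ Θ, a < t → 0 < h t) (hq : 2 ≤ q)
    (hκ : (q - 1) * v < ν) (hA : A ≤ A₀) (hB : B ≤ A₀) (hA₀ : 0 ≤ A₀)
    (hint : IntegrableOn w (Θ ∩ Set.Ioi a)) (hcm : c ∈ Θ) (hac : a < c) :
    h c ^ (q - 1) * w c + (ν - (q - 1) * v) / 2 * (∫ t in a..c, h t ^ q * w t)
      ≤ pearsonConst A₀ q (ν - (q - 1) * v) * ∫ t in Θ ∩ Set.Ioi a, w t := by
  have hsub : Set.Icc a c ⊆ Θ := hc.out ha hcm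
  have hh0 : ∀ t ∈ Set.Icc a c, 0 ≤ h t := fun t ht => by
    rcases ht.1.eq_or_lt with h1 | h1
    · rw [← h1, hha]
    · exact (hpos t (hsub ht) h1).le
  have hch : ContinuousOn h (Set.Icc a c) := fun t ht =>
    (hh t (hsub ht)).continuousAt.continuousWithinAt
  have hcw : ContinuousOn w (Set.Icc a c) := fun t ht =>
    (hw t (hsub ht)).continuousAt.continuousWithinAt
  have hrc : ∀ r : ℝ, 0 ≤ r → ContinuousOn (fun t => h t ^ r * w t) (Set.Icc a c) := fun r hr =>
    ContinuousOn.mul (f := fun t => h t ^ r) (hch.rpow_const (p := r) fun t _ => Or.inr hr) hcw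
  have hri : ∀ r : ℝ, 0 ≤ r → IntervalIntegrable (fun t => h t ^ r * w t) volume a c := fun r hr =>
    (by rw [Set.uIcc_of_le hac.le]; exact hrc r hr : ContinuousOn _ _).intervalIntegrable
  set κ := ν - (q - 1) * v with hκdef
  have hκ0 : 0 < κ := by linarith
  have hwi : IntervalIntegrable w volume a c := by
    simpa using hri 0 le_rfl
  have hd : ∀ t ∈ Set.uIcc a c, HasDerivAt (fun t => h t ^ (q - 1) * w t)
      ((q - 1) * (A * (h t ^ (q - 2) * w t) + B * (h t ^ (q - 1) * w t))
        - κ * (h t ^ q * w t)) t := by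
    intro t ht
    rw [Set.uIcc_of_le hac.le] at ht
    have h1 := ((hh t (hsub ht)).rpow_const (p := q - 1) (Or.inr (by linarith))).mul
      (hw t (hsub ht))
    refine h1.congr_deriv ?_
    have e0 := hh0 t ht
    have e1 : h t ^ (q - 1) = h t ^ (q - 2) * h t := by
      rw [← Real.rpow_add_one' e0 (by linarith)]; congr 1; ring
    have e2 : h t ^ q = h t ^ (q - 2) * h t * h t := by
      rw [← e1, ← Real.rpow_add_one' e0 (by linarith)]; congr 1; ring
    have e3 : q - 1 - 1 = q - 2 := by ring
    rw [e3, e1, e2]; ring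
  have hii : IntervalIntegrable (fun t => (q - 1) * (A * (h t ^ (q - 2) * w t)
      + B * (h t ^ (q - 1) * w t)) - κ * (h t ^ q * w t)) volume a c :=
    (((hri (q - 2) (by linarith)).const_mul A |>.add
      ((hri (q - 1) (by linarith)).const_mul B)).const_mul (q - 1)).sub
      ((hri q (by linarith)).const_mul κ)
  have hftc := intervalIntegral.integral_eq_sub_of_hasDerivAt hd hii
  simp only [hha] at hftc
  rw [Real.zero_rpow (by linarith), zero_mul, sub_zero] at hftc
  have hle : (∫ t in a..c, ((q - 1) * (A * (h t ^ (q - 2) * w t)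
      + B * (h t ^ (q - 1) * w t)) - κ * (h t ^ q * w t)))
      ≤ ∫ t in a..c, (pearsonConst A₀ q κ * w t - κ / 2 * (h t ^ q * w t)) := by
    refine intervalIntegral.integral_mono_on hac.le hii
      ((hwi.const_mul _).sub ((hri q (by linarith)).const_mul _)) fun t ht => ?_
    have h1 := rpow_lower_order_le (κ := κ) hq hκ0 (hh0 t ht) hA hB hA₀
    have h2 := mul_le_mul_of_nonneg_right h1 (hw0 t (hsub ht)).le
    nlinarith
  rw [intervalIntegral.integral_sub (hwi.const_mul _) ((hri q (by linarith)).const_mul _),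
    intervalIntegral.integral_const_mul, intervalIntegral.integral_const_mul, hftc] at hle
  have hw1 : ∫ t in a..c, w t ≤ ∫ t in Θ ∩ Set.Ioi a, w t := by
    rw [intervalIntegral.integral_of_le hac.le]
    refine setIntegral_mono_set hint ?_ (HasSubset.Subset.eventuallyLE fun t ht =>
      ⟨hsub ⟨ht.1.le, ht.2⟩, ht.1⟩)
    have hm : MeasurableSet (Θ ∩ Set.Ioi a) := hc.measurableSet.inter measurableSet_Ioi
    exact (ae_restrict_iff' hm).2 (ae_of_all _ fun t ht => (hw0 t ht.1).le)
  have hK : 0 ≤ pearsonConst A₀ q κ := by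
    have : 0 ≤ q - 1 := by linarith
    unfold pearsonConst; positivity
  nlinarith [mul_le_mul_of_nonneg_left hw1 hK]

/-- Monotone convergence in the previous bound. The right endpoints are taken rational to have a
countable directed union. -/
lemma pearson_right (hO : IsOpen Θ) (hc : Θ.OrdConnected) {h w : ℝ → ℝ} {A B v ν q A₀ a : ℝ}
    (hh : ∀ t ∈ Θ, HasDerivAt h (A + B * h t + v * h t ^ 2) t)
    (hw : ∀ t ∈ Θ, HasDerivAt w (-ν * h t * w t) t) (hw0 : ∀ t ∈ Θ, 0 < w t)
    (ha : a ∈ Θ) (hha : h a = 0) (hpos : ∀ t ∈ Θ, a < t → 0 < h t) (hq : 2 ≤ q)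
    (hκ : (q - 1) * v < ν) (hA : A ≤ A₀) (hB : B ≤ A₀) (hA₀ : 0 ≤ A₀)
    (hint : IntegrableOn w (Θ ∩ Set.Ioi a)) :
    ∫⁻ t in Θ ∩ Set.Ioi a, ENNReal.ofReal (|h t| ^ q * w t)
      ≤ ENNReal.ofReal (2 / (ν - (q - 1) * v) * pearsonConst A₀ q (ν - (q - 1) * v)
        * ∫ t in Θ ∩ Set.Ioi a, w t) := by
  have hU : Θ ∩ Set.Ioi a
      = ⋃ c : {c : ℚ // (c : ℝ) ∈ Θ ∧ a < c}, Set.Ioc a (c : ℝ) := by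
    ext t
    simp only [Set.mem_inter_iff, Set.mem_Ioi, Set.mem_iUnion, Set.mem_Ioc, Subtype.exists,
      exists_prop]
    constructor
    · rintro ⟨h1, h2⟩
      obtain ⟨u, hu, hus⟩ := exists_Ico_subset_of_mem_nhds (hO.mem_nhds h1) (exists_gt t)
      obtain ⟨c, hc1, hc2⟩ := exists_rat_btwn hu
      exact ⟨c, ⟨hus ⟨hc1.le, hc2⟩, h2.trans hc1⟩, h2, hc1.le⟩
    · rintro ⟨c, ⟨h1, h2⟩, h3, h4⟩
      exact ⟨hc.out ha h1 ⟨h3.le, h4⟩, h3⟩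
  conv_lhs => rw [hU]
  rw [setLIntegral_iUnion_of_directed]
  · refine iSup_le fun ⟨c, hcm, hac⟩ => ?_
    have h1 := pearson_right_aux hc hh hw hw0 ha hha hpos hq hκ hA hB hA₀ hint hcm hac
    have hsub : Set.Icc a c ⊆ Θ := hc.out ha hcm
    have hh0 : ∀ t ∈ Set.Icc a (c : ℝ), 0 ≤ h t := fun t ht => by
      rcases ht.1.eq_or_lt with h1 | h1
      · rw [← h1, hha]
      · exact (hpos t (hsub ht) h1).le
    have hci : ContinuousOn (fun t => h t ^ q * w t) (Set.Icc a c) := fun t ht =>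
      (((hh t (hsub ht)).continuousAt.rpow_const (Or.inr (by linarith))).mul
        (hw t (hsub ht)).continuousAt).continuousWithinAt
    rw [setLIntegral_congr_fun (g := fun t => ENNReal.ofReal (h t ^ q * w t)) measurableSet_Ioc
      (fun t ht => by
        simp only
        rw [abs_of_nonneg (hh0 t ⟨ht.1.le, ht.2⟩)]),
      ← ofReal_integral_eq_lintegral_ofReal
        ((hci.integrableOn_Icc).mono_set Set.Ioc_subset_Icc_self)
        ((ae_restrict_iff' measurableSet_Ioc).2 (ae_of_all _ fun t ht =>
          mul_nonneg (Real.rpow_nonneg (hh0 t ⟨ht.1.le, ht.2⟩) _) (hw0 t (hsub ⟨ht.1.le, ht.2⟩)).le)),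
      ← intervalIntegral.integral_of_le hac.le]
    refine ENNReal.ofReal_le_ofReal ?_
    have h2 : 0 ≤ h c ^ (q - 1) * w c :=
      mul_nonneg (Real.rpow_nonneg (hh0 c ⟨hac.le, le_rfl⟩) _) (hw0 c hcm).le
    set κ := ν - (q - 1) * v
    have hκ0 : 0 < κ := by simp only [κ]; linarith
    have e : 2 / κ * pearsonConst A₀ q κ * ∫ t in Θ ∩ Set.Ioi a, w t
        = 2 / κ * (pearsonConst A₀ q κ * ∫ t in Θ ∩ Set.Ioi a, w t) := by ring
    rw [e, div_mul_eq_mul_div, le_div_iff₀ hκ0]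
    linarith
  · refine directed_of_isDirected_le fun c d hcd => Set.Ioc_subset_Ioc_right ?_
    exact_mod_cast hcd

lemma pearsonConst_nonneg {A q κ : ℝ} (hq : 2 ≤ q) (hκ : 0 < κ) (hA : 0 ≤ A) :
    0 ≤ pearsonConst A q κ := by
  have : 0 ≤ q - 1 := by linarith
  unfold pearsonConst; positivity

/-- Moments and tails of a Pearson-type density. -/
lemma pearson_moment (hO : IsOpen Θ) (hc : Θ.OrdConnected) {h w : ℝ → ℝ} {A B v ν q A₀ a : ℝ}
    (hh : ∀ t ∈ Θ, HasDerivAt h (A + B * h t + v * h t ^ 2) t)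
    (hw : ∀ t ∈ Θ, HasDerivAt w (-ν * h t * w t) t) (hw0 : ∀ t ∈ Θ, 0 < w t)
    (ha : a ∈ Θ) (hha : h a = 0) (hmono : StrictMonoOn h Θ) (hq : 2 ≤ q)
    (hκ : (q - 1) * v < ν) (hA : A ≤ A₀) (hB : |B| ≤ A₀)
    (hint : IntegrableOn w Θ) :
    IntegrableOn (fun t => |h t| ^ q * w t) Θ ∧
    ∫ t in Θ, |h t| ^ q * w t ≤ 2 / (ν - (q - 1) * v) * pearsonConst A₀ q (ν - (q - 1) * v)
        * ∫ t in Θ, w t ∧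
    ∃ K, ∀ c ∈ Θ, |h c| ^ (q - 1) * w c ≤ K := by
  have hA₀ : 0 ≤ A₀ := (abs_nonneg B).trans hB
  have hm : MeasurableSet Θ := hO.measurableSet
  have hκ0 : 0 < ν - (q - 1) * v := by linarith
  have hK := pearsonConst_nonneg hq hκ0 hA₀
  have hpos : ∀ t ∈ Θ, a < t → 0 < h t := fun t ht hat => hha ▸ hmono ha ht hat
  have hneg : ∀ t ∈ Θ, t < a → h t < 0 := fun t ht hat => hha ▸ hmono ht ha hat
  have hB1 := (le_abs_self B).trans hB
  have hB2 := (neg_le_abs B).trans hB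
  have hwm : 0 ≤ᵐ[volume.restrict Θ] w :=
    (ae_restrict_iff' hm).2 (ae_of_all _ fun t ht => (hw0 t ht).le)
  have hint1 : IntegrableOn w (Θ ∩ Set.Ioi a) := hint.mono_set Set.inter_subset_left
  have hint2 : IntegrableOn w (Θ ∩ Set.Iio a) := hint.mono_set Set.inter_subset_left
  have hset : Neg.neg ⁻¹' Θ ∩ Set.Ioi (-a) = Neg.neg ⁻¹' (Θ ∩ Set.Iio a) := by
    ext t; simp
  -- The left tail is treated by reflection: t ↦ −h(−t) solves the same Riccati equation with B
  -- replaced by −B, which is why |B| has to be bounded.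
  have hh' : ∀ t ∈ Neg.neg ⁻¹' Θ, HasDerivAt (fun t => -h (-t))
      (A + (-B) * (-h (-t)) + v * (-h (-t)) ^ 2) t := fun t ht => by
    refine ((hh (-t) ht).comp t (hasDerivAt_neg t)).neg.congr_deriv ?_
    ring
  have hw' : ∀ t ∈ Neg.neg ⁻¹' Θ, HasDerivAt (fun t => w (-t))
      (-ν * (-h (-t)) * w (-t)) t := fun t ht => by
    refine ((hw (-t) ht).comp t (hasDerivAt_neg t)).congr_deriv ?_
    ring
  have hpos' : ∀ t ∈ Neg.neg ⁻¹' Θ, -a < t → 0 < -h (-t) := fun t ht hat => by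
    have := hneg (-t) ht (by linarith)
    linarith
  have hint3 : IntegrableOn (fun t => w (-t)) (Neg.neg ⁻¹' Θ ∩ Set.Ioi (-a)) := by
    rw [hset]; exact integrableOn_preimage_neg.2 hint2
  have r1 := pearson_right hO hc hh hw hw0 ha hha hpos hq hκ hA hB1 hA₀ hint1
  have r2 := pearson_right (isOpen_preimage_neg hO) (ordConnected_preimage_neg hc) hh' hw'
    (fun t ht => hw0 (-t) ht) (a := -a) (by simpa using ha) (by simp [hha]) hpos' hq hκ hA hB2 hA₀
    hint3
  rw [hset, setIntegral_preimage_neg w] at r2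
  simp only [abs_neg] at r2
  rw [(Measure.measurePreserving_neg volume).setLIntegral_comp_preimage_emb
    (MeasurableEquiv.neg ℝ).measurableEmbedding
    (fun t => ENNReal.ofReal (|h t| ^ q * w t)) (Θ ∩ Set.Iio a)] at r2
  have hsplit : ∀ f : ℝ → ENNReal, ∫⁻ t in Θ, f t
      = (∫⁻ t in Θ ∩ Set.Ioi a, f t) + ∫⁻ t in Θ ∩ Set.Iio a, f t := by
    intro f
    rw [← lintegral_inter_add_sdiff f Θ (measurableSet_Ioi (a := a))]
    congr 1
    refine setLIntegral_congr ?_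
    rw [Set.sdiff_eq, Set.compl_Ioi]
    exact Filter.EventuallyEq.inter (ae_eq_refl _) Iio_ae_eq_Iic.symm
  have hsum : (∫ t in Θ ∩ Set.Ioi a, w t) + ∫ t in Θ ∩ Set.Iio a, w t = ∫ t in Θ, w t := by
    rw [← integral_inter_add_sdiff (measurableSet_Ioi (a := a)) hint]
    congr 1
    refine setIntegral_congr_set ?_
    rw [Set.sdiff_eq, Set.compl_Ioi]
    exact Filter.EventuallyEq.inter (ae_eq_refl _) Iio_ae_eq_Iic
  have hC : 0 ≤ 2 / (ν - (q - 1) * v) * pearsonConst A₀ q (ν - (q - 1) * v) := by positivity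
  have hn1 : 0 ≤ ∫ t in Θ ∩ Set.Ioi a, w t :=
    setIntegral_nonneg (hm.inter measurableSet_Ioi) fun t ht => (hw0 t ht.1).le
  have hn2 : 0 ≤ ∫ t in Θ ∩ Set.Iio a, w t :=
    setIntegral_nonneg (hm.inter measurableSet_Iio) fun t ht => (hw0 t ht.1).le
  have htot : ∫⁻ t in Θ, ENNReal.ofReal (|h t| ^ q * w t)
      ≤ ENNReal.ofReal (2 / (ν - (q - 1) * v) * pearsonConst A₀ q (ν - (q - 1) * v)
        * ∫ t in Θ, w t) := by
    rw [hsplit, ← hsum, mul_add, ENNReal.ofReal_add (mul_nonneg hC hn1) (mul_nonneg hC hn2)]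
    exact add_le_add r1 r2
  have hnn : ∀ t ∈ Θ, 0 ≤ |h t| ^ q * w t := fun t ht => by
    have := (hw0 t ht).le
    positivity
  have hcont : ContinuousOn (fun t => |h t| ^ q * w t) Θ := fun t ht =>
    (((hh t ht).continuousAt.abs.rpow_const (Or.inr (by linarith))).mul
      (hw t ht).continuousAt).continuousWithinAt
  have hae : 0 ≤ᵐ[volume.restrict Θ] fun t => |h t| ^ q * w t :=
    (ae_restrict_iff' hm).2 (ae_of_all _ hnn)
  have hi : IntegrableOn (fun t => |h t| ^ q * w t) Θ :=
    ⟨hcont.aestronglyMeasurable hm, by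
      rw [hasFiniteIntegral_iff_ofReal hae]
      exact htot.trans_lt ENNReal.ofReal_lt_top⟩
  refine ⟨hi, ?_, ?_⟩
  · rw [← ofReal_integral_eq_lintegral_ofReal hi hae] at htot
    refine (ENNReal.ofReal_le_ofReal_iff (mul_nonneg hC ?_)).1 htot
    exact setIntegral_nonneg hm fun t ht => (hw0 t ht).le
  · set D := pearsonConst A₀ q (ν - (q - 1) * v) * ∫ t in Θ, w t with hD
    have hI : 0 ≤ ∫ t in Θ, w t := setIntegral_nonneg hm fun t ht => (hw0 t ht).le
    have hD0 : 0 ≤ D := mul_nonneg hK hI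
    refine ⟨D, fun c hcm => ?_⟩
    rcases lt_trichotomy a c with h1 | h1 | h1
    · have := pearson_right_aux hc hh hw hw0 ha hha hpos hq hκ hA hB1 hA₀ hint1 hcm h1
      have hi2 : 0 ≤ ∫ t in a..c, h t ^ q * w t := by
        rw [intervalIntegral.integral_of_le h1.le]
        refine setIntegral_nonneg measurableSet_Ioc fun t ht => ?_
        have htm := hc.out ha hcm ⟨ht.1.le, ht.2⟩
        exact mul_nonneg (Real.rpow_nonneg (hpos t htm ht.1).le _) (hw0 t htm).le
      rw [abs_of_pos (hpos c hcm h1)]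
      have h3 : pearsonConst A₀ q (ν - (q - 1) * v) * ∫ t in Θ ∩ Set.Ioi a, w t ≤ D :=
        mul_le_mul_of_nonneg_left (by linarith) hK
      nlinarith [mul_nonneg hκ0.le hi2]
    · rw [← h1, hha, abs_zero, Real.zero_rpow (by linarith)]
      simpa using hD0
    · have := pearson_right_aux (ordConnected_preimage_neg hc) hh' hw'
        (fun t ht => hw0 (-t) ht) (a := -a) (c := -c) (by simpa using ha) (by simp [hha]) hpos' hq
        hκ hA hB2 hA₀ hint3 (by simpa using hcm) (by linarith)
      have hi2 : 0 ≤ ∫ t in (-a)..(-c), (-h (-t)) ^ q * w (-t) := by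
        rw [intervalIntegral.integral_of_le (by linarith)]
        refine setIntegral_nonneg measurableSet_Ioc fun t ht => ?_
        have htm : -t ∈ Θ := hc.out hcm ha ⟨by linarith [ht.2], by linarith [ht.1]⟩
        exact mul_nonneg (Real.rpow_nonneg (hpos' t htm ht.1).le _) (hw0 (-t) htm).le
      simp only [neg_neg] at this
      rw [hset, setIntegral_preimage_neg w] at this
      rw [abs_of_neg (hneg c hcm h1)]
      have h3 : pearsonConst A₀ q (ν - (q - 1) * v) * ∫ t in Θ ∩ Set.Iio a, w t ≤ D :=
        mul_le_mul_of_nonneg_left (by linarith) hK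
      nlinarith [mul_nonneg hκ0.le hi2]

end Pearson

end NEFQVF

namespace NEFQVF

namespace Model

variable {p : ℕ} (M : Model p)

/-! ### The conjugate prior -/

/-- The unnormalized conjugate prior density with weight `ν` and mean `m`. -/
def conj (ν m θ : ℝ) : ℝ := Real.exp (ν * (m * θ - M.ψ θ))

lemma conj_pos (ν m θ : ℝ) : 0 < M.conj ν m θ := Real.exp_pos _

lemma hasDerivAt_conj (ν m : ℝ) {θ : ℝ} (hθ : θ ∈ M.Θ) :
    HasDerivAt (M.conj ν m) (-ν * (deriv M.ψ θ - m) * M.conj ν m θ) θ := by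
  have := ((((hasDerivAt_id θ).const_mul m).sub (M.hasDerivAt_ψ hθ)).const_mul ν).exp
  refine this.congr_deriv ?_
  simp [conj]; ring

lemma Q_expand (t m : ℝ) : M.Q t = M.Q m + M.Q' m * (t - m) + M.v₂ * (t - m) ^ 2 := by
  simp only [Q, Q']; ring

lemma hasDerivAt_ξ_sub (m : ℝ) {θ : ℝ} (hθ : θ ∈ M.Θ) :
    HasDerivAt (fun θ => deriv M.ψ θ - m)
      (M.Q m + M.Q' m * (deriv M.ψ θ - m) + M.v₂ * (deriv M.ψ θ - m) ^ 2) θ := by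
  rw [← M.Q_expand]
  exact (M.hasDerivAt_ξ hθ).sub_const m

/-- Convexity of ψ, from the mean value theorem and the monotonicity of ψ'. It serves to bound the
likelihood near an endpoint of Θ in `exp_bounded_near`. -/
lemma tangent_le {a c : ℝ} (ha : a ∈ M.Θ) (hc : c ∈ M.Θ) :
    M.ψ a + deriv M.ψ a * (c - a) ≤ M.ψ c := by
  rcases lt_trichotomy a c with h | h | h
  · obtain ⟨t, ht, he⟩ := exists_hasDerivAt_eq_slope M.ψ (deriv M.ψ) h
      (M.contDiffOn_ψ.continuousOn.mono (M.ordConnected_Θ.out ha hc))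
      (fun x hx => M.hasDerivAt_ψ (M.ordConnected_Θ.out ha hc ⟨hx.1.le, hx.2.le⟩))
    have h1 : deriv M.ψ a < deriv M.ψ t :=
      M.strictMonoOn_ξ ha (M.ordConnected_Θ.out ha hc ⟨ht.1.le, ht.2.le⟩) ht.1
    have h2 : 0 < c - a := by linarith
    rw [eq_div_iff h2.ne'] at he
    nlinarith
  · simp [h]
  · obtain ⟨t, ht, he⟩ := exists_hasDerivAt_eq_slope M.ψ (deriv M.ψ) h
      (M.contDiffOn_ψ.continuousOn.mono (M.ordConnected_Θ.out hc ha))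
      (fun x hx => M.hasDerivAt_ψ (M.ordConnected_Θ.out hc ha ⟨hx.1.le, hx.2.le⟩))
    have h1 : deriv M.ψ t < deriv M.ψ a :=
      M.strictMonoOn_ξ (M.ordConnected_Θ.out hc ha ⟨ht.1.le, ht.2.le⟩) ha ht.2
    have h2 : 0 < a - c := by linarith
    rw [eq_div_iff h2.ne'] at he
    nlinarith

variable {M}

lemma integrable_lin3 {α : Type*} {_ : MeasurableSpace α} {κ : Measure α} {f₀ f₁ f₂ : α → ℝ}
    (h₀ : Integrable f₀ κ) (h₁ : Integrable f₁ κ) (h₂ : Integrable f₂ κ) (A B D : ℝ) :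
    Integrable (fun t => A * f₀ t + B * f₁ t - D * f₂ t) κ :=
  ((h₀.const_mul A).add (h₁.const_mul B)).sub (h₂.const_mul D)

lemma integral_lin3 {α : Type*} {_ : MeasurableSpace α} {κ : Measure α} {f₀ f₁ f₂ : α → ℝ}
    (h₀ : Integrable f₀ κ) (h₁ : Integrable f₁ κ) (h₂ : Integrable f₂ κ) (A B D : ℝ) :
    ∫ t, (A * f₀ t + B * f₁ t - D * f₂ t) ∂κ
      = A * (∫ t, f₀ t ∂κ) + B * (∫ t, f₁ t ∂κ) - D * ∫ t, f₂ t ∂κ := by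
  have h : Integrable (fun t => A * f₀ t + B * f₁ t) κ := (h₀.const_mul A).add (h₁.const_mul B)
  rw [integral_sub h (h₂.const_mul D), integral_add (h₀.const_mul A) (h₁.const_mul B)]
  simp only [integral_const_mul]

/-! ### Moments of the conjugate prior by integration by parts -/

section prior

variable {ν μ a q : ℝ}

lemma conj_moment (ha : a ∈ M.Θ) (hμ : μ = deriv M.ψ a) (hq : 2 ≤ q)
    (hκ : (q - 1) * M.v₂ < ν) (hint : IntegrableOn (M.conj ν μ) M.Θ) {A₀ : ℝ}
    (hA : M.Q μ ≤ A₀) (hB : |M.Q' μ| ≤ A₀) :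
    IntegrableOn (fun t => |deriv M.ψ t - μ| ^ q * M.conj ν μ t) M.Θ ∧
    ∫ t in M.Θ, |deriv M.ψ t - μ| ^ q * M.conj ν μ t
      ≤ 2 / (ν - (q - 1) * M.v₂) * pearsonConst A₀ q (ν - (q - 1) * M.v₂)
        * ∫ t in M.Θ, M.conj ν μ t ∧
    ∃ K, ∀ c ∈ M.Θ, |deriv M.ψ c - μ| ^ (q - 1) * M.conj ν μ c ≤ K :=
  pearson_moment M.Θ_open M.ordConnected_Θ (h := fun t => deriv M.ψ t - μ)
    (fun t ht => M.hasDerivAt_ξ_sub μ ht)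
    (fun t ht => M.hasDerivAt_conj ν μ ht) (fun t _ => M.conj_pos ν μ t) ha (by simp [hμ])
    (fun s hs t ht hst => by simpa using M.strictMonoOn_ξ hs ht hst) hq hκ hA hB hint

lemma conj_integrable_rpow (ha : a ∈ M.Θ) (hμ : μ = deriv M.ψ a) (hq : 2 ≤ q)
    (hκ : (q - 1) * M.v₂ < ν) (hint : IntegrableOn (M.conj ν μ) M.Θ) :
    IntegrableOn (fun t => |deriv M.ψ t - μ| ^ q * M.conj ν μ t) M.Θ :=
  (conj_moment ha hμ hq hκ hint (le_max_left _ _) (le_max_right _ _)).1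

lemma pow_abs_le_one_add_rpow {x q : ℝ} {k : ℕ} (hk : (k : ℝ) ≤ q) :
    |x| ^ k ≤ 1 + |x| ^ q := by
  rcases le_total |x| 1 with h | h
  · have h1 : |x| ^ k ≤ 1 := pow_le_one₀ (abs_nonneg x) h
    have : 0 ≤ |x| ^ q := by positivity
    linarith
  · rw [← Real.rpow_natCast]
    have := Real.rpow_le_rpow_of_exponent_le h hk
    linarith

lemma conj_integrable_pow (ha : a ∈ M.Θ) (hμ : μ = deriv M.ψ a) (hq : 2 ≤ q)
    (hκ : (q - 1) * M.v₂ < ν) (hint : IntegrableOn (M.conj ν μ) M.Θ) {k : ℕ} (hk : (k : ℝ) ≤ q) :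
    IntegrableOn (fun t => (deriv M.ψ t - μ) ^ k * M.conj ν μ t) M.Θ := by
  have h1 := hint.add (conj_integrable_rpow ha hμ hq hκ hint)
  have hm := M.Θ_open.measurableSet
  refine h1.mono' ?_ ((ae_restrict_iff' hm).2 (ae_of_all _ fun t ht => ?_))
  · refine ContinuousOn.aestronglyMeasurable (fun t ht => ?_) hm
    exact (((M.hasDerivAt_ξ_sub μ ht).continuousAt.pow k).mul
      (M.hasDerivAt_conj ν μ ht).continuousAt).continuousWithinAt
  · have h2 := pow_abs_le_one_add_rpow (x := deriv M.ψ t - μ) hk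
    have h3 := M.conj_pos ν μ t
    simp only [norm_mul, norm_pow, Real.norm_eq_abs, abs_of_pos h3, Pi.add_apply]
    nlinarith

/-- The bound on |h|^(q−1) w gives |h|^k w ≤ K |h|^(−(q−1−k)), a negative power of a quantity that
tends to infinity. -/
lemma tendsto_pow_mul_of_bound {l : Filter ℝ} {h w : ℝ → ℝ} {K : ℝ} {k : ℕ}
    (hh : Tendsto (fun t => |h t|) l atTop) (hk : (k : ℝ) < q - 1)
    (hK : ∀ᶠ t in l, |h t| ^ (q - 1) * w t ≤ K) (hw : ∀ᶠ t in l, 0 ≤ w t) :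
    Tendsto (fun t => h t ^ k * w t) l (𝓝 0) := by
  have h1 : Tendsto (fun t => K * |h t| ^ (-(q - 1 - k))) l (𝓝 (K * 0)) :=
    ((tendsto_rpow_neg_atTop (by linarith)).comp hh).const_mul K
  rw [mul_zero] at h1
  refine squeeze_zero_norm' ?_ h1
  filter_upwards [hK, hw, hh.eventually_gt_atTop 0] with t h2 h3 h4
  rw [norm_mul, norm_pow, Real.norm_eq_abs, Real.norm_of_nonneg h3]
  have e : |h t| ^ k = |h t| ^ (q - 1) * |h t| ^ (-(q - 1 - k)) := by
    rw [← Real.rpow_add h4, ← Real.rpow_natCast]; congr 1; ring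
  rw [e]
  have : 0 ≤ |h t| ^ (-(q - 1 - k)) := by positivity
  nlinarith

/-- At a finite endpoint steepness makes the deviation from μ unbounded, while the tail bound of
`conj_moment` keeps its power of order q − 1 times the density bounded. -/
lemma conj_tendsto_right (ha : a ∈ M.Θ) (hμ : μ = deriv M.ψ a) (hq : 2 ≤ q)
    (hκ : (q - 1) * M.v₂ < ν) (hint : IntegrableOn (M.conj ν μ) M.Θ) {k : ℕ}
    (hk : (k : ℝ) < q - 1) {b : ℝ} (hb : b ∉ M.Θ) (hab : a < b) (hsub : Set.Ico a b ⊆ M.Θ) :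
    Tendsto (fun t => (deriv M.ψ t - μ) ^ k * M.conj ν μ t) (𝓝[<] b) (𝓝 0) := by
  obtain ⟨K, hK⟩ := (conj_moment ha hμ hq hκ hint (le_max_left _ _) (le_max_right _ _)).2.2
  refine tendsto_pow_mul_of_bound (K := K) (h := fun t => deriv M.ψ t - μ)
    (tendsto_abs_atTop_atTop.comp
      (tendsto_atTop_add_const_right _ (-μ) (M.tendsto_ξ_right ha hab hsub hb))) hk ?_
    (Eventually.of_forall fun t => (M.conj_pos ν μ t).le)
  filter_upwards [Ico_mem_nhdsLT hab] with t ht using hK t (hsub ht)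

lemma conj_tendsto_left (ha : a ∈ M.Θ) (hμ : μ = deriv M.ψ a) (hq : 2 ≤ q)
    (hκ : (q - 1) * M.v₂ < ν) (hint : IntegrableOn (M.conj ν μ) M.Θ) {k : ℕ}
    (hk : (k : ℝ) < q - 1) {b : ℝ} (hb : b ∉ M.Θ) (hab : b < a) (hsub : Set.Ioc b a ⊆ M.Θ) :
    Tendsto (fun t => (deriv M.ψ t - μ) ^ k * M.conj ν μ t) (𝓝[>] b) (𝓝 0) := by
  obtain ⟨K, hK⟩ := (conj_moment ha hμ hq hκ hint (le_max_left _ _) (le_max_right _ _)).2.2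
  refine tendsto_pow_mul_of_bound (K := K) (h := fun t => deriv M.ψ t - μ)
    (tendsto_abs_atBot_atTop.comp
      (tendsto_atBot_add_const_right _ (-μ) (M.tendsto_ξ_left ha hab hsub hb))) hk ?_
    (Eventually.of_forall fun t => (M.conj_pos ν μ t).le)
  filter_upwards [Ioc_mem_nhdsGT hab] with t ht using hK t (hsub ht)

/-- Recursion for the moments of a conjugate prior. -/
lemma conj_recursion (ha : a ∈ M.Θ) (hμ : μ = deriv M.ψ a) (hq : 2 ≤ q)
    (hκ : (q - 1) * M.v₂ < ν) (hint : IntegrableOn (M.conj ν μ) M.Θ) (k : ℕ)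
    (hk : (k : ℝ) + 1 < q - 1) :
    (ν - (k + 1) * M.v₂) * ∫ t in M.Θ, (deriv M.ψ t - μ) ^ (k + 2) * M.conj ν μ t
      = (k + 1) * (M.Q μ * (∫ t in M.Θ, (deriv M.ψ t - μ) ^ k * M.conj ν μ t)
        + M.Q' μ * ∫ t in M.Θ, (deriv M.ψ t - μ) ^ (k + 1) * M.conj ν μ t) := by
  have i0 := conj_integrable_pow ha hμ hq hκ hint (k := k) (by linarith)
  have i1 := conj_integrable_pow ha hμ hq hκ hint (k := k + 1) (by push_cast; linarith)
  have i2 := conj_integrable_pow ha hμ hq hκ hint (k := k + 2) (by push_cast; linarith)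
  -- The derivative of h^(k+1) w integrates to zero. The condition k + 1 < q − 1 serves both the
  -- vanishing of h^(k+1) w at finite endpoints and the integrability of h^(k+2) w.
  have key := setIntegral_deriv_eq_zero M.Θ_open M.ordConnected_Θ ha
    (F := fun t => (deriv M.ψ t - μ) ^ (k + 1) * M.conj ν μ t)
    (F' := fun t => (k + 1) * M.Q μ * ((deriv M.ψ t - μ) ^ k * M.conj ν μ t)
      + (k + 1) * M.Q' μ * ((deriv M.ψ t - μ) ^ (k + 1) * M.conj ν μ t)
      - (ν - (k + 1) * M.v₂) * ((deriv M.ψ t - μ) ^ (k + 2) * M.conj ν μ t))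
    (fun t ht => by
      refine (((M.hasDerivAt_ξ_sub μ ht).pow (k + 1)).mul (M.hasDerivAt_conj ν μ ht)).congr_deriv ?_
      simp only [Nat.add_sub_cancel, Pi.pow_apply]
      push_cast
      ring)
    i1 (integrable_lin3 i0 i1 i2 _ _ _)
    (fun b hb hab hsub => conj_tendsto_right ha hμ hq hκ hint (by push_cast; linarith) hb hab hsub)
    (fun b hb hab hsub => conj_tendsto_left ha hμ hq hκ hint (by push_cast; linarith) hb hab hsub)
  rw [integral_lin3 i0 i1 i2] at key
  linarith

/-- The derivative of the density itself, −νhw, integrates to zero. The exponent q = 2 suffices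
since only h⁰ w has to vanish at the endpoints. -/
lemma conj_mean (ha : a ∈ M.Θ) (hμ : μ = deriv M.ψ a) (hν : 0 < ν) (hκ : M.v₂ < ν)
    (hint : IntegrableOn (M.conj ν μ) M.Θ) :
    ∫ t in M.Θ, (deriv M.ψ t - μ) * M.conj ν μ t = 0 := by
  have hκ' : (2 - 1) * M.v₂ < ν := by linarith
  have i1 := conj_integrable_pow ha hμ le_rfl hκ' hint (k := 1) (by norm_num)
  simp only [pow_one] at i1
  have key := setIntegral_deriv_eq_zero M.Θ_open M.ordConnected_Θ ha
    (F := M.conj ν μ) (F' := fun t => -ν * ((deriv M.ψ t - μ) * M.conj ν μ t))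
    (fun t ht => by
      refine (M.hasDerivAt_conj ν μ ht).congr_deriv ?_
      ring)
    hint (i1.const_mul _)
    (fun b hb hab hsub => by
      simpa using conj_tendsto_right ha hμ le_rfl hκ' hint (k := 0) (by norm_num) hb hab hsub)
    (fun b hb hab hsub => by
      simpa using conj_tendsto_left ha hμ le_rfl hκ' hint (k := 0) (by norm_num) hb hab hsub)
  rw [integral_const_mul] at key
  rcases mul_eq_zero.1 key with h | h
  · linarith
  · exact h

end prior

/-! ### The posterior -/

section posterior

variable {ν μ a n y : ℝ}

/-- The posterior mean. -/
def postMean (n ν μ y : ℝ) : ℝ := (n * y + ν * μ) / (n + ν)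

/-- Conjugacy: the weights n and ν add, and the location becomes the weighted average of observation
and prior mean. -/
lemma exp_mul_conj (hn : 0 < n) (hν : 0 < ν) (t : ℝ) :
    Real.exp (n * (t * y - M.ψ t)) * M.conj ν μ t = M.conj (n + ν) (postMean n ν μ y) t := by
  have : n + ν ≠ 0 := by positivity
  rw [conj, conj, ← Real.exp_add, postMean]
  congr 1
  field_simp
  ring

/-- Since ψ lies above its tangent at a, the likelihood is at most the exponential of an affine
function of t. The point b may thus be an endpoint outside Θ. -/
lemma exp_bounded_near (ha : a ∈ M.Θ) (hn : 0 < n) (b y : ℝ) :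
    ∃ K, ∀ᶠ t in 𝓝 b, t ∈ M.Θ → Real.exp (n * (t * y - M.ψ t)) ≤ K := by
  have hc : ContinuousAt (fun t => Real.exp (n * (t * y - (M.ψ a + deriv M.ψ a * (t - a))))) b := by
    fun_prop
  have h := hc.tendsto.eventually (eventually_le_nhds (lt_add_one _))
  refine ⟨Real.exp (n * (b * y - (M.ψ a + deriv M.ψ a * (b - a)))) + 1, h.mono fun t ht htm => ?_⟩
  refine le_trans (Real.exp_le_exp.2 ?_) ht
  exact mul_le_mul_of_nonneg_left (by linarith [M.tangent_le ha htm]) hn.le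

/-- The posterior inherits the boundary behaviour of the prior, because the likelihood is bounded
near b. The results on the prior do not apply directly: they ask for a location of the form ψ'(a),
and y is arbitrary here. Orders 0 and 1 suffice for mean and variance. -/
lemma post_tendsto {l : Filter ℝ} {b : ℝ} (hl : l ≤ 𝓝 b) (hmem : ∀ᶠ t in l, t ∈ M.Θ)
    (ha : a ∈ M.Θ) (hn : 0 < n) (hν : 0 < ν) (k : ℕ) (hk : k ≤ 1)
    (h0 : Tendsto (fun t => (deriv M.ψ t - μ) ^ 0 * M.conj ν μ t) l (𝓝 0))
    (h1 : Tendsto (fun t => (deriv M.ψ t - μ) ^ 1 * M.conj ν μ t) l (𝓝 0)) :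
    Tendsto (fun t => (deriv M.ψ t - postMean n ν μ y) ^ k * M.conj (n + ν) (postMean n ν μ y) t)
      l (𝓝 0) := by
  obtain ⟨K, hK⟩ := exp_bounded_near ha hn b y
  have h2 : Tendsto (fun t => (deriv M.ψ t - postMean n ν μ y) ^ k * M.conj ν μ t) l (𝓝 0) := by
    interval_cases k
    · exact h0
    · have := h1.add (h0.const_mul (μ - postMean n ν μ y))
      simp only [mul_zero, add_zero] at this
      refine this.congr fun t => ?_
      ring
  have h3 : Tendsto (fun t => K * |(deriv M.ψ t - postMean n ν μ y) ^ k * M.conj ν μ t|)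
      l (𝓝 0) := by
    simpa using h2.abs.const_mul K
  refine squeeze_zero_norm' ?_ h3
  filter_upwards [hl hK, hmem] with t ht htm
  rw [← exp_mul_conj hn hν]
  have e : (deriv M.ψ t - postMean n ν μ y) ^ k * (Real.exp (n * (t * y - M.ψ t)) * M.conj ν μ t)
    = Real.exp (n * (t * y - M.ψ t)) * ((deriv M.ψ t - postMean n ν μ y) ^ k * M.conj ν μ t) := by
    ring
  rw [e, norm_mul, Real.norm_of_nonneg (Real.exp_pos _).le, Real.norm_eq_abs]
  exact mul_le_mul_of_nonneg_right (ht htm) (abs_nonneg _)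

/-- The same integrations by parts as for the prior, with weight n + ν. Integrability is a
hypothesis, to be supplied for almost every y by Fubini's theorem. -/
lemma post_moments (ha : a ∈ M.Θ) (hμ : μ = deriv M.ψ a) (hν : 0 < ν) (hκ : 2 * M.v₂ < ν)
    (hint : IntegrableOn (M.conj ν μ) M.Θ) (hn : 0 < n)
    (i0 : IntegrableOn (M.conj (n + ν) (postMean n ν μ y)) M.Θ)
    (i2 : IntegrableOn (fun t => (deriv M.ψ t - postMean n ν μ y) ^ 2
      * M.conj (n + ν) (postMean n ν μ y) t) M.Θ) :
    ∫ t in M.Θ, (deriv M.ψ t - postMean n ν μ y) * M.conj (n + ν) (postMean n ν μ y) t = 0 ∧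
    (n + ν - M.v₂) * ∫ t in M.Θ, (deriv M.ψ t - postMean n ν μ y) ^ 2
        * M.conj (n + ν) (postMean n ν μ y) t
      = M.Q (postMean n ν μ y) * ∫ t in M.Θ, M.conj (n + ν) (postMean n ν μ y) t := by
  set y' := postMean n ν μ y with hy'
  have hm := M.Θ_open.measurableSet
  have i1 : IntegrableOn (fun t => (deriv M.ψ t - y') * M.conj (n + ν) y' t) M.Θ := by
    refine (i0.add i2).mono' ?_ (ae_of_all _ fun t => ?_)
    · refine ContinuousOn.aestronglyMeasurable (fun t ht => ?_) hm
      exact ((M.hasDerivAt_ξ_sub y' ht).continuousAt.mul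
        (M.hasDerivAt_conj (n + ν) y' ht).continuousAt).continuousWithinAt
    · have h3 := M.conj_pos (n + ν) y' t
      simp only [norm_mul, Real.norm_eq_abs, abs_of_pos h3, Pi.add_apply]
      have : |deriv M.ψ t - y'| ≤ 1 + (deriv M.ψ t - y') ^ 2 := by
        rw [← sq_abs]; nlinarith [sq_nonneg (|deriv M.ψ t - y'| - 1), abs_nonneg (deriv M.ψ t - y')]
      nlinarith
  -- The exponent 3 is what 2v₂ < ν allows. Only k ≤ 1 < q − 1 is needed below.
  obtain ⟨q, hq2, hq⟩ : ∃ q : ℝ, 2 < q ∧ (q - 1) * M.v₂ < ν := by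
    rcases le_or_gt M.v₂ 0 with h | h
    · exact ⟨3, by norm_num, by linarith⟩
    · exact ⟨3, by norm_num, by linarith⟩
  have hright : ∀ k : ℕ, k ≤ 1 → ∀ b ∉ M.Θ, a < b → Set.Ico a b ⊆ M.Θ →
      Tendsto (fun t => (deriv M.ψ t - y') ^ k * M.conj (n + ν) y' t) (𝓝[<] b) (𝓝 0) := by
    intro k hk b hb hab hsub
    refine post_tendsto nhdsWithin_le_nhds ?_ ha hn hν k hk
      (conj_tendsto_right ha hμ hq2.le hq hint (by norm_num; linarith) hb hab hsub)
      (conj_tendsto_right ha hμ hq2.le hq hint (by norm_num; linarith) hb hab hsub)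
    filter_upwards [Ico_mem_nhdsLT hab] with t ht using hsub ht
  have hleft : ∀ k : ℕ, k ≤ 1 → ∀ b ∉ M.Θ, b < a → Set.Ioc b a ⊆ M.Θ →
      Tendsto (fun t => (deriv M.ψ t - y') ^ k * M.conj (n + ν) y' t) (𝓝[>] b) (𝓝 0) := by
    intro k hk b hb hab hsub
    refine post_tendsto nhdsWithin_le_nhds ?_ ha hn hν k hk
      (conj_tendsto_left ha hμ hq2.le hq hint (by norm_num; linarith) hb hab hsub)
      (conj_tendsto_left ha hμ hq2.le hq hint (by norm_num; linarith) hb hab hsub)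
    filter_upwards [Ioc_mem_nhdsGT hab] with t ht using hsub ht
  have key1 := setIntegral_deriv_eq_zero M.Θ_open M.ordConnected_Θ ha
    (F := M.conj (n + ν) y') (F' := fun t => -(n + ν) * ((deriv M.ψ t - y') * M.conj (n + ν) y' t))
    (fun t ht => by
      refine (M.hasDerivAt_conj (n + ν) y' ht).congr_deriv ?_
      ring)
    i0 (i1.const_mul _)
    (fun b hb hab hsub => by simpa using hright 0 zero_le_one b hb hab hsub)
    (fun b hb hab hsub => by simpa using hleft 0 zero_le_one b hb hab hsub)
  have e1 : ∫ t in M.Θ, (deriv M.ψ t - y') * M.conj (n + ν) y' t = 0 := by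
    rw [integral_const_mul] at key1
    rcases mul_eq_zero.1 key1 with h | h
    · linarith
    · exact h
  refine ⟨e1, ?_⟩
  have key2 := setIntegral_deriv_eq_zero M.Θ_open M.ordConnected_Θ ha
    (F := fun t => (deriv M.ψ t - y') * M.conj (n + ν) y' t)
    (F' := fun t => (M.Q y' * M.conj (n + ν) y' t
      + M.Q' y' * ((deriv M.ψ t - y') * M.conj (n + ν) y' t))
      - (n + ν - M.v₂) * ((deriv M.ψ t - y') ^ 2 * M.conj (n + ν) y' t))
    (fun t ht => by
      refine ((M.hasDerivAt_ξ_sub y' ht).mul (M.hasDerivAt_conj (n + ν) y' ht)).congr_deriv ?_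
      ring)
    i1 (integrable_lin3 i0 i1 i2 _ _ _)
    (fun b hb hab hsub => by simpa using hright 1 le_rfl b hb hab hsub)
    (fun b hb hab hsub => by simpa using hleft 1 le_rfl b hb hab hsub)
  rw [integral_lin3 i0 i1 i2, e1] at key2
  linarith

end posterior

end Model
end NEFQVF

namespace NEFQVF

namespace Model

variable {p : ℕ} {M : Model p}

/-! ### The joint law of the canonical parameter and the direct estimate -/

instance sigmaFinite_base (j : ℕ) : SigmaFinite (M.base j) := M.base_sigmaFinite j

variable {j : ℕ} {η : Par p}

/-- Only almost everywhere measurability is available, since nothing is assumed about ψ outside Θ.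
-/
lemma aemeasurable_jointDensity (j : ℕ) (η : Par p) :
    AEMeasurable (fun q : ℝ × ℝ => ENNReal.ofReal
      (Real.exp (M.n j * (q.1 * q.2 - M.ψ q.1)) *
        (Real.exp (nu η * (M.mean j η * q.1 - M.ψ q.1)) * M.C (nu η) (M.mean j η))))
      ((volume.restrict M.Θ).prod (M.base j)) := by
  have h1 : AEMeasurable M.ψ (volume.restrict M.Θ) :=
    M.contDiffOn_ψ.continuousOn.aemeasurable M.Θ_open.measurableSet
  have h2 : AEMeasurable (fun q : ℝ × ℝ => M.ψ q.1) ((volume.restrict M.Θ).prod (M.base j)) :=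
    h1.comp_fst
  have h3 : AEMeasurable (fun q : ℝ × ℝ => q.1) ((volume.restrict M.Θ).prod (M.base j)) :=
    measurable_fst.aemeasurable
  have h4 : AEMeasurable (fun q : ℝ × ℝ => q.2) ((volume.restrict M.Θ).prod (M.base j)) :=
    measurable_snd.aemeasurable
  refine AEMeasurable.ennreal_ofReal ?_
  exact (Real.measurable_exp.comp_aemeasurable (((h3.mul h4).sub h2).const_mul _)).mul
    ((Real.measurable_exp.comp_aemeasurable (((h3.const_mul _).sub h2).const_mul _)).mul_const _)

lemma C_nonneg (ν μ : ℝ) : 0 ≤ M.C ν μ :=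
  inv_nonneg.2 (integral_nonneg fun _ => (Real.exp_pos _).le)

/-- The normalized conjugate prior density in area `j`. -/
def prior (M : Model p) (j : ℕ) (η : Par p) (t : ℝ) : ℝ :=
  M.conj (nu η) (M.mean j η) t * M.C (nu η) (M.mean j η)

lemma prior_nonneg (t : ℝ) : 0 ≤ M.prior j η t :=
  mul_nonneg (M.conj_pos _ _ _).le (C_nonneg _ _)

lemma lintegral_jointLaw {f : ℝ × ℝ → ENNReal} (hf : Measurable f) :
    ∫⁻ q, f q ∂(M.jointLaw j η) = ∫⁻ t in M.Θ, ENNReal.ofReal (M.prior j η t) *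
      ∫⁻ y, f (t, y) * ENNReal.ofReal (Real.exp (M.n j * (t * y - M.ψ t))) ∂(M.base j) := by
  rw [jointLaw, lintegral_withDensity_eq_lintegral_mul₀ (aemeasurable_jointDensity j η)
    hf.aemeasurable, lintegral_prod _ ((aemeasurable_jointDensity j η).mul hf.aemeasurable)]
  refine lintegral_congr fun t => ?_
  rw [← lintegral_const_mul _ (by fun_prop)]
  refine lintegral_congr fun y => ?_
  rw [Pi.mul_apply, ENNReal.ofReal_mul (Real.exp_pos _).le]
  change ENNReal.ofReal _ * ENNReal.ofReal (M.prior j η t) * _ = _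
  ring

lemma integral_jointLaw {f : ℝ × ℝ → ℝ} (hf : Integrable f (M.jointLaw j η)) :
    ∫ q, f q ∂(M.jointLaw j η) = ∫ t in M.Θ, M.prior j η t *
      ∫ y, f (t, y) * Real.exp (M.n j * (t * y - M.ψ t)) ∂(M.base j) := by
  have hm := aemeasurable_jointDensity (M := M) j η
  have hlt : ∀ᵐ q ∂((volume.restrict M.Θ).prod (M.base j)), ENNReal.ofReal
      (Real.exp (M.n j * (q.1 * q.2 - M.ψ q.1)) *
        (Real.exp (nu η * (M.mean j η * q.1 - M.ψ q.1)) * M.C (nu η) (M.mean j η))) < ⊤ :=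
    ae_of_all _ fun q => ENNReal.ofReal_lt_top
  rw [jointLaw] at hf ⊢
  rw [integral_withDensity_eq_integral_toReal_smul₀ hm hlt]
  rw [integrable_withDensity_iff_integrable_smul₀' hm hlt] at hf
  rw [integral_prod _ hf]
  refine integral_congr_ae (ae_of_all _ fun t => ?_)
  simp only
  rw [← integral_const_mul]
  congr 1; ext y
  rw [ENNReal.toReal_ofReal (mul_nonneg (Real.exp_pos _).le
    (mul_nonneg (Real.exp_pos _).le (C_nonneg _ _))), smul_eq_mul]
  simp only [prior, conj]
  ring

lemma integral_jointLaw_swap {f : ℝ × ℝ → ℝ} (hf : Integrable f (M.jointLaw j η)) :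
    ∫ q, f q ∂(M.jointLaw j η) = ∫ y, (∫ t in M.Θ, f (t, y) *
      (M.prior j η t * Real.exp (M.n j * (t * y - M.ψ t)))) ∂(M.base j) := by
  have hm := aemeasurable_jointDensity (M := M) j η
  have hlt : ∀ᵐ q ∂((volume.restrict M.Θ).prod (M.base j)), ENNReal.ofReal
      (Real.exp (M.n j * (q.1 * q.2 - M.ψ q.1)) *
        (Real.exp (nu η * (M.mean j η * q.1 - M.ψ q.1)) * M.C (nu η) (M.mean j η))) < ⊤ :=
    ae_of_all _ fun q => ENNReal.ofReal_lt_top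
  rw [jointLaw] at hf ⊢
  rw [integral_withDensity_eq_integral_toReal_smul₀ hm hlt]
  rw [integrable_withDensity_iff_integrable_smul₀' hm hlt] at hf
  rw [integral_prod_symm _ hf]
  refine integral_congr_ae (ae_of_all _ fun t => ?_)
  simp only
  congr 1; ext y
  rw [ENNReal.toReal_ofReal (mul_nonneg (Real.exp_pos _).le
    (mul_nonneg (Real.exp_pos _).le (C_nonneg _ _))), smul_eq_mul]
  simp only [prior, conj]
  ring

lemma ae_integrable_of_jointLaw {f : ℝ × ℝ → ℝ} (hf : Integrable f (M.jointLaw j η)) :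
    ∀ᵐ y ∂(M.base j), IntegrableOn (fun t => f (t, y) *
      (M.prior j η t * Real.exp (M.n j * (t * y - M.ψ t)))) M.Θ := by
  have hm := aemeasurable_jointDensity (M := M) j η
  have hlt : ∀ᵐ q ∂((volume.restrict M.Θ).prod (M.base j)), ENNReal.ofReal
      (Real.exp (M.n j * (q.1 * q.2 - M.ψ q.1)) *
        (Real.exp (nu η * (M.mean j η * q.1 - M.ψ q.1)) * M.C (nu η) (M.mean j η))) < ⊤ :=
    ae_of_all _ fun q => ENNReal.ofReal_lt_top
  rw [jointLaw, integrable_withDensity_iff_integrable_smul₀' hm hlt] at hf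
  filter_upwards [hf.prod_left_ae] with y hy
  refine hy.congr (ae_of_all _ fun t => ?_)
  simp only
  rw [ENNReal.toReal_ofReal (mul_nonneg (Real.exp_pos _).le
    (mul_nonneg (Real.exp_pos _).le (C_nonneg _ _))), smul_eq_mul]
  simp only [prior, conj]
  ring

lemma lintegral_density {t : ℝ} (ht : t ∈ M.Θ) :
    ∫⁻ y, ENNReal.ofReal (Real.exp (M.n j * (t * y - M.ψ t))) ∂(M.base j) = 1 := by
  have hi := M.integrable_pow_mul_exp j ht 0
  simp only [pow_zero, one_mul] at hi
  rw [← ofReal_integral_eq_lintegral_ofReal hi (ae_of_all _ fun y => (Real.exp_pos _).le),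
    M.density j t ht, ENNReal.ofReal_one]

lemma lintegral_prior (hP : IsProbabilityMeasure (M.jointLaw j η)) :
    ∫⁻ t in M.Θ, ENNReal.ofReal (M.prior j η t) = 1 := by
  have h := lintegral_jointLaw (M := M) (j := j) (η := η) (f := fun _ => 1) measurable_const
  simp only [lintegral_one, measure_univ, one_mul] at h
  rw [h]
  refine setLIntegral_congr_fun M.Θ_open.measurableSet fun t ht => ?_
  rw [lintegral_density ht, mul_one]

/-- Integrability of the prior need not be assumed. Without it the Bochner integral takes its
default value 0, hence C = 0 and the joint law would vanish. -/
lemma conj_integrable (hP : IsProbabilityMeasure (M.jointLaw j η)) :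
    IntegrableOn (M.conj (nu η) (M.mean j η)) M.Θ := by
  by_contra h
  have hC : M.C (nu η) (M.mean j η) = 0 := by
    rw [C, inv_eq_zero]
    exact integral_undef h
  have := lintegral_prior hP
  simp [prior, hC] at this

lemma C_mul_integral (hP : IsProbabilityMeasure (M.jointLaw j η)) :
    M.C (nu η) (M.mean j η) * ∫ t in M.Θ, M.conj (nu η) (M.mean j η) t = 1 := by
  refine inv_mul_cancel₀ ?_
  intro h
  have hC : M.C (nu η) (M.mean j η) = 0 := by
    rw [C, inv_eq_zero]
    exact h
  have := lintegral_prior hP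
  simp [prior, hC] at this

end Model
end NEFQVF

namespace NEFQVF

namespace Model

variable {p : ℕ} {M : Model p} {j : ℕ} {η : Par p}

/-! ### Moment bounds under the joint law -/

lemma measurable_ξ : Measurable (deriv M.ψ) := measurable_deriv _

lemma abs_Q_le {A t m : ℝ} (h0 : |M.Q m| ≤ A) (h1 : |M.Q' m| ≤ A) :
    |M.Q t| ≤ (1 + 2 * A + 2 * |M.v₂|) * (1 + |t - m|) ^ 2 := by
  rw [M.Q_expand t m]
  have hA : 0 ≤ A := (abs_nonneg _).trans h0
  have h2 := abs_nonneg (t - m)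
  have h3 := abs_nonneg M.v₂
  have e := abs_add_three (M.Q m) (M.Q' m * (t - m)) (M.v₂ * (t - m) ^ 2)
  rw [abs_mul, abs_mul, abs_pow] at e
  refine e.trans ?_
  have : |M.Q' m| * |t - m| ≤ A * |t - m| := by gcongr
  nlinarith [mul_nonneg h3 h2, mul_nonneg hA h2, mul_nonneg h3 (sq_nonneg |t - m|),
    mul_nonneg hA (sq_nonneg |t - m|), sq_nonneg |t - m|]

lemma abs_Q'_le {A t m : ℝ} (h1 : |M.Q' m| ≤ A) :
    |M.Q' t| ≤ (1 + 2 * A + 2 * |M.v₂|) * (1 + |t - m|) := by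
  have e : M.Q' t = M.Q' m + 2 * M.v₂ * (t - m) := by simp only [Q']; ring
  have hA : 0 ≤ A := (abs_nonneg _).trans h1
  have h2 := abs_nonneg (t - m)
  have h3 := abs_nonneg M.v₂
  have e2 := abs_add_le (M.Q' m) (2 * M.v₂ * (t - m))
  rw [abs_mul, abs_mul, abs_two] at e2
  rw [e]
  nlinarith [mul_nonneg h3 h2, mul_nonneg hA h2]

/-- A constant for the sixth conditional moment. -/
def sixthConst (v S B : ℝ) : ℝ :=
  S ^ 5 * (B * B ^ 4 + 22 * |v| * B ^ 2 * B ^ 2 + 16 * |v| ^ 2 * B ^ 3)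
    + S ^ 4 * (25 * B ^ 2 * B ^ 2 + 30 * |v| * B ^ 3) + 15 * S ^ 3 * B ^ 3

/-- Giving Q weight 2 and Q' weight 1, every monomial of the sixth central moment has weight 6. -/
lemma abs_cm6_le {S B X s t : ℝ} (hs : 0 ≤ s) (hsS : s ≤ S) (_hX : 0 ≤ X)
    (hQ : |M.Q t| ≤ B * X ^ 2) (hQ' : |M.Q' t| ≤ B * X) :
    |M.cm6 s t| ≤ sixthConst M.v₂ S B * X ^ 6 := by
  have hS : 0 ≤ S := hs.trans hsS
  have h1 : |M.cm6 s t| ≤ s ^ 5 * (|M.Q t| * |M.Q' t| ^ 4 + 22 * |M.v₂| * |M.Q t| ^ 2 * |M.Q' t| ^ 2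
      + 16 * |M.v₂| ^ 2 * |M.Q t| ^ 3) + s ^ 4 * (25 * |M.Q t| ^ 2 * |M.Q' t| ^ 2
      + 30 * |M.v₂| * |M.Q t| ^ 3) + 15 * s ^ 3 * |M.Q t| ^ 3 := by
    unfold cm6
    refine (abs_add_three _ _ _).trans ?_
    simp only [abs_mul, abs_pow, abs_of_nonneg hs, Nat.abs_ofNat]
    gcongr
    · refine (abs_add_three _ _ _).trans ?_
      simp only [abs_mul, abs_pow, Nat.abs_ofNat]; rfl
    · refine (abs_add_le _ _).trans ?_
      simp only [abs_mul, abs_pow, Nat.abs_ofNat]; rfl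
  refine h1.trans ?_
  have h2 : s ^ 5 * (|M.Q t| * |M.Q' t| ^ 4 + 22 * |M.v₂| * |M.Q t| ^ 2 * |M.Q' t| ^ 2
      + 16 * |M.v₂| ^ 2 * |M.Q t| ^ 3) + s ^ 4 * (25 * |M.Q t| ^ 2 * |M.Q' t| ^ 2
      + 30 * |M.v₂| * |M.Q t| ^ 3) + 15 * s ^ 3 * |M.Q t| ^ 3
      ≤ S ^ 5 * ((B * X ^ 2) * (B * X) ^ 4 + 22 * |M.v₂| * (B * X ^ 2) ^ 2 * (B * X) ^ 2
      + 16 * |M.v₂| ^ 2 * (B * X ^ 2) ^ 3) + S ^ 4 * (25 * (B * X ^ 2) ^ 2 * (B * X) ^ 2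
      + 30 * |M.v₂| * (B * X ^ 2) ^ 3) + 15 * S ^ 3 * (B * X ^ 2) ^ 3 := by
    have := abs_nonneg (M.Q t)
    have := abs_nonneg (M.Q' t)
    gcongr
    exact (abs_nonneg (M.Q t)).trans hQ
  refine h2.trans (le_of_eq ?_)
  unfold sixthConst
  ring

/-- Splitting at |z| = X gives |z|^q ≤ X^q + X^(q−6) z⁶ for z = y − ψ'(t). With the natural scale X
= 1 + |ψ'(t) − m| the sixth conditional moment yields a bound of degree q in X, so the prior needs
moments of order q only, not six. -/
lemma cond_rpow_le {q K X : ℝ} (hq : 0 ≤ q) (hq6 : q ≤ 6) {t : ℝ} (ht : t ∈ M.Θ) (hX : 1 ≤ X)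
    (h6 : |M.cm6 (M.n j)⁻¹ (deriv M.ψ t)| ≤ K * X ^ 6) :
    ∫⁻ y, ENNReal.ofReal (|y - deriv M.ψ t| ^ q) *
        ENNReal.ofReal (Real.exp (M.n j * (t * y - M.ψ t))) ∂(M.base j)
      ≤ ENNReal.ofReal ((1 + K) * X ^ q) := by
  have hX0 : 0 < X := by linarith
  have i0 := M.integrable_pow_mul_exp j ht 0
  simp only [pow_zero, one_mul] at i0
  have i6 := M.integrable_sub_pow_mul_exp j ht (deriv M.ψ t) 6
  have hpt : ∀ y, |y - deriv M.ψ t| ^ q ≤ X ^ q + X ^ (q - 6) * (y - deriv M.ψ t) ^ 6 := by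
    intro y
    have hp : 0 ≤ X ^ (q - 6) * (y - deriv M.ψ t) ^ 6 :=
      mul_nonneg (by positivity) (Even.pow_nonneg (by decide) _)
    rcases le_total |y - deriv M.ψ t| X with h | h
    · have := Real.rpow_le_rpow (abs_nonneg _) h hq
      linarith
    · have hz : 0 < |y - deriv M.ψ t| := hX0.trans_le h
      have e : (y - deriv M.ψ t) ^ 6 = |y - deriv M.ψ t| ^ (6 : ℝ) := by
        rw [← Even.pow_abs (by decide)]
        exact_mod_cast (Real.rpow_natCast _ 6).symm
      have h1 : |y - deriv M.ψ t| ^ (q - 6) ≤ X ^ (q - 6) :=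
        Real.rpow_le_rpow_of_nonpos hX0 h (by linarith)
      have h2 : |y - deriv M.ψ t| ^ q
          = |y - deriv M.ψ t| ^ (q - 6) * |y - deriv M.ψ t| ^ (6 : ℝ) := by
        rw [← Real.rpow_add hz]; congr 1; ring
      have h3 : 0 ≤ X ^ q := by positivity
      rw [e, h2]
      have : 0 ≤ |y - deriv M.ψ t| ^ (6 : ℝ) := by positivity
      nlinarith
  have hint : Integrable (fun y => X ^ q * Real.exp (M.n j * (t * y - M.ψ t))
      + X ^ (q - 6) * ((y - deriv M.ψ t) ^ 6 * Real.exp (M.n j * (t * y - M.ψ t)))) (M.base j) :=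
    (i0.const_mul _).add (i6.const_mul _)
  calc _ ≤ ∫⁻ y, ENNReal.ofReal (X ^ q * Real.exp (M.n j * (t * y - M.ψ t))
      + X ^ (q - 6) * ((y - deriv M.ψ t) ^ 6 * Real.exp (M.n j * (t * y - M.ψ t)))) ∂(M.base j) := by
        refine lintegral_mono fun y => ?_
        rw [← ENNReal.ofReal_mul (by positivity)]
        refine ENNReal.ofReal_le_ofReal ?_
        have := mul_le_mul_of_nonneg_right (hpt y) (Real.exp_pos (M.n j * (t * y - M.ψ t))).le
        linarith
    _ = ENNReal.ofReal (X ^ q + X ^ (q - 6) * M.cm6 (M.n j)⁻¹ (deriv M.ψ t)) := by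
        rw [← ofReal_integral_eq_lintegral_ofReal hint (ae_of_all _ fun y => ?_),
          integral_add (i0.const_mul _) (i6.const_mul _), integral_const_mul, integral_const_mul,
          M.density j t ht, M.condMoment_six j ht, mul_one]
        have : 0 ≤ (y - deriv M.ψ t) ^ 6 := Even.pow_nonneg (by decide) _
        positivity
    _ ≤ _ := by
        refine ENNReal.ofReal_le_ofReal ?_
        have h1 := (le_abs_self _).trans h6
        have e : X ^ q = X ^ (q - 6) * X ^ 6 := by
          rw [← Real.rpow_natCast X 6, ← Real.rpow_add hX0]; congr 1; norm_num
        have h2 : 0 ≤ X ^ (q - 6) := by positivity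
        have h3 := mul_le_mul_of_nonneg_left h1 h2
        have h4 : X ^ (q - 6) * (K * X ^ 6) = K * X ^ q := by rw [e]; ring
        linarith

lemma one_add_rpow_le {x q : ℝ} (hx : 0 ≤ x) (hq : 0 ≤ q) :
    (1 + x) ^ q ≤ 2 ^ q * (1 + x ^ q) := by
  have h0 : 0 ≤ x ^ q := by positivity
  have h2 : (0 : ℝ) ≤ 2 ^ q := by positivity
  rcases le_total x 1 with h | h
  · have := Real.rpow_le_rpow (by linarith) (by linarith : 1 + x ≤ 2) hq
    nlinarith
  · have := Real.rpow_le_rpow (by linarith) (by linarith : 1 + x ≤ 2 * x) hq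
    rw [Real.mul_rpow (by norm_num) hx] at this
    nlinarith

lemma add_rpow_le_two {x y q : ℝ} (hx : 0 ≤ x) (hy : 0 ≤ y) (hq : 0 ≤ q) :
    (x + y) ^ q ≤ 2 ^ q * (x ^ q + y ^ q) := by
  have h0 : 0 ≤ x ^ q := by positivity
  have h1 : 0 ≤ y ^ q := by positivity
  have h2 : (0 : ℝ) ≤ 2 ^ q := by positivity
  rcases le_total x y with h | h
  · have := Real.rpow_le_rpow (by linarith) (by linarith : x + y ≤ 2 * y) hq
    rw [Real.mul_rpow (by norm_num) hy] at this
    nlinarith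
  · have := Real.rpow_le_rpow (by linarith) (by linarith : x + y ≤ 2 * x) hq
    rw [Real.mul_rpow (by norm_num) hx] at this
    nlinarith

lemma prior_rpow_le {q A : ℝ} (hP : IsProbabilityMeasure (M.jointLaw j η))
    (hlin : M.lin j η ∈ M.Θ) (hq : 2 ≤ q) (hκ : (q - 1) * M.v₂ < nu η)
    (hA : |M.Q (M.mean j η)| ≤ A) (hB : |M.Q' (M.mean j η)| ≤ A) :
    ∫⁻ t in M.Θ, ENNReal.ofReal (M.prior j η t) *
        ENNReal.ofReal (|deriv M.ψ t - M.mean j η| ^ q)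
      ≤ ENNReal.ofReal (2 / (nu η - (q - 1) * M.v₂) * pearsonConst A q (nu η - (q - 1) * M.v₂)) := by
  obtain ⟨hi, hle, -⟩ := conj_moment (μ := M.mean j η) hlin rfl hq hκ (conj_integrable hP)
    ((le_abs_self _).trans hA) hB
  have h1 : ∀ t, ENNReal.ofReal (M.prior j η t) *
        ENNReal.ofReal (|deriv M.ψ t - M.mean j η| ^ q)
      = ENNReal.ofReal (M.C (nu η) (M.mean j η) *
        (|deriv M.ψ t - M.mean j η| ^ q * M.conj (nu η) (M.mean j η) t)) := by
    intro t
    rw [← ENNReal.ofReal_mul (prior_nonneg t)]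
    congr 1; simp only [prior]; ring
  simp_rw [h1]
  rw [← ofReal_integral_eq_lintegral_ofReal (hi.const_mul _) (ae_of_all _ fun t =>
    mul_nonneg (C_nonneg _ _) (mul_nonneg (by positivity) (M.conj_pos _ _ _).le)),
    integral_const_mul]
  refine ENNReal.ofReal_le_ofReal ?_
  have h2 := mul_le_mul_of_nonneg_left hle (C_nonneg (M := M) (nu η) (M.mean j η))
  have h3 := C_mul_integral hP
  refine h2.trans (le_of_eq ?_)
  linear_combination (2 / (nu η - (q - 1) * M.v₂) * pearsonConst A q (nu η - (q - 1) * M.v₂)) * h3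

/-- Uniform moment bounds under the joint law. -/
lemma exists_rpow_bound (η : Par p) {q A S : ℝ} (hq : 2 ≤ q) (hq6 : q ≤ 6)
    (hκ : (q - 1) * M.v₂ < nu η) :
    ∃ C : ℝ, ∀ j, IsProbabilityMeasure (M.jointLaw j η) → M.lin j η ∈ M.Θ → (M.n j)⁻¹ ≤ S →
      |M.Q (M.mean j η)| ≤ A → |M.Q' (M.mean j η)| ≤ A →
      ∫⁻ z, ENNReal.ofReal (|deriv M.ψ z.1 - M.mean j η| ^ q) ∂(M.jointLaw j η)
        ≤ ENNReal.ofReal C ∧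
      ∫⁻ z, ENNReal.ofReal (|z.2 - M.mean j η| ^ q) ∂(M.jointLaw j η) ≤ ENNReal.ofReal C := by
  set C₁ := 2 / (nu η - (q - 1) * M.v₂) * pearsonConst A q (nu η - (q - 1) * M.v₂) with hC₁
  set B := 1 + 2 * A + 2 * |M.v₂| with hB
  set K := sixthConst M.v₂ S B with hK
  set C₂ := 2 ^ q * ((1 + |K|) * (2 ^ q * (1 + |C₁|)) + |C₁|) with hC₂
  have hC₂0 : 0 ≤ C₂ := by positivity
  refine ⟨|C₁| + C₂, fun j hP hlin hS hA hA' => ?_⟩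
  have hq0 : 0 ≤ q := by linarith
  have hpr := prior_rpow_le hP hlin hq hκ hA hA'
  rw [← hC₁] at hpr
  have hpr' := hpr.trans (ENNReal.ofReal_le_ofReal (le_abs_self C₁))
  have hm := M.Θ_open.measurableSet
  have hξ := measurable_ξ (M := M)
  have h1 : ∫⁻ z, ENNReal.ofReal (|deriv M.ψ z.1 - M.mean j η| ^ q) ∂(M.jointLaw j η)
      ≤ ENNReal.ofReal |C₁| := by
    rw [lintegral_jointLaw (by fun_prop)]
    refine le_trans (le_of_eq ?_) hpr'
    refine setLIntegral_congr_fun hm fun t ht => ?_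
    dsimp only
    rw [lintegral_const_mul' _ _ ENNReal.ofReal_ne_top, lintegral_density ht, mul_one]
  refine ⟨h1.trans (ENNReal.ofReal_le_ofReal (by linarith)), ?_⟩
  have h2 : ∫⁻ z, ENNReal.ofReal (|z.2 - deriv M.ψ z.1| ^ q) ∂(M.jointLaw j η)
      ≤ ENNReal.ofReal ((1 + |K|) * (2 ^ q * (1 + |C₁|))) := by
    rw [lintegral_jointLaw (by fun_prop)]
    calc _ ≤ ∫⁻ t in M.Θ, ENNReal.ofReal ((1 + |K|) * 2 ^ q) *
          (ENNReal.ofReal (M.prior j η t) + ENNReal.ofReal (M.prior j η t) *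
          ENNReal.ofReal (|deriv M.ψ t - M.mean j η| ^ q)) := by
          refine setLIntegral_mono' hm fun t ht => ?_
          have hX : 1 ≤ 1 + |deriv M.ψ t - M.mean j η| := by linarith [abs_nonneg (deriv M.ψ t - M.mean j η)]
          have h6 := abs_cm6_le (M := M) (inv_nonneg.2 (M.n_pos j).le) hS (zero_le_one.trans hX)
            (abs_Q_le (t := deriv M.ψ t) hA hA') (abs_Q'_le (t := deriv M.ψ t) hA')
          have h6' : |M.cm6 (M.n j)⁻¹ (deriv M.ψ t)| ≤ |K| * (1 + |deriv M.ψ t - M.mean j η|) ^ 6 :=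
            h6.trans (mul_le_mul_of_nonneg_right (le_abs_self _) (by positivity))
          have h7 := cond_rpow_le (j := j) hq0 hq6 ht hX h6'
          have h8 : (1 + |K|) * (1 + |deriv M.ψ t - M.mean j η|) ^ q
              ≤ (1 + |K|) * 2 ^ q * (1 + |deriv M.ψ t - M.mean j η| ^ q) := by
            rw [mul_assoc]
            exact mul_le_mul_of_nonneg_left (one_add_rpow_le (abs_nonneg _) hq0) (by positivity)
          have h9 := h7.trans (ENNReal.ofReal_le_ofReal h8)
          calc _ ≤ ENNReal.ofReal (M.prior j η t) * ENNReal.ofReal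
                ((1 + |K|) * 2 ^ q * (1 + |deriv M.ψ t - M.mean j η| ^ q)) := by gcongr
            _ = _ := by
              rw [ENNReal.ofReal_mul (by positivity), ENNReal.ofReal_add zero_le_one (by positivity),
                ENNReal.ofReal_one]
              ring
      _ ≤ ENNReal.ofReal ((1 + |K|) * 2 ^ q) * (1 + ENNReal.ofReal |C₁|) := by
          rw [lintegral_const_mul' _ _ ENNReal.ofReal_ne_top]
          gcongr
          have hpm : AEMeasurable (fun t => ENNReal.ofReal (M.prior j η t))
              (volume.restrict M.Θ) := by
            refine ENNReal.measurable_ofReal.comp_aemeasurable ?_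
            refine (ContinuousOn.aemeasurable (fun t ht => ?_) hm).mul_const _
            exact (M.hasDerivAt_conj _ _ ht).continuousAt.continuousWithinAt
          rw [lintegral_add_left' hpm, lintegral_prior hP]
          gcongr
      _ = _ := by
          rw [← ENNReal.ofReal_one, ← ENNReal.ofReal_add zero_le_one (abs_nonneg _),
            ← ENNReal.ofReal_mul (by positivity)]
          congr 1; ring
  calc _ ≤ ∫⁻ z, ENNReal.ofReal (2 ^ q) * (ENNReal.ofReal (|z.2 - deriv M.ψ z.1| ^ q)
        + ENNReal.ofReal (|deriv M.ψ z.1 - M.mean j η| ^ q)) ∂(M.jointLaw j η) := by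
        refine lintegral_mono fun z => ?_
        rw [← ENNReal.ofReal_add (by positivity) (by positivity), ← ENNReal.ofReal_mul (by positivity)]
        refine ENNReal.ofReal_le_ofReal (le_trans ?_
          (add_rpow_le_two (abs_nonneg _) (abs_nonneg _) hq0))
        refine Real.rpow_le_rpow (abs_nonneg _) ?_ hq0
        have := abs_add_le (z.2 - deriv M.ψ z.1) (deriv M.ψ z.1 - M.mean j η)
        simpa using this
    _ ≤ ENNReal.ofReal (2 ^ q) * (ENNReal.ofReal ((1 + |K|) * (2 ^ q * (1 + |C₁|)))
        + ENNReal.ofReal |C₁|) := by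
        rw [lintegral_const_mul _ (by fun_prop), lintegral_add_left (by fun_prop)]
        gcongr
    _ = ENNReal.ofReal C₂ := by
        rw [← ENNReal.ofReal_add (by positivity) (by positivity), ← ENNReal.ofReal_mul (by positivity)]
    _ ≤ _ := ENNReal.ofReal_le_ofReal (by linarith [abs_nonneg C₁])

end Model
end NEFQVF

namespace NEFQVF

namespace Model

variable {p : ℕ} {M : Model p} {j : ℕ} {η : Par p}

/-! ### Exact moments -/

/-- An exponent slightly larger than four for which all moments exist. -/
lemma exists_exponent {v ν : ℝ} (hν : 0 < ν) (h : 3 * v < ν) :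
    ∃ q : ℝ, 4 < q ∧ q ≤ 6 ∧ (q - 1) * v < ν := by
  rcases le_or_gt v 0 with hv | hv
  · exact ⟨6, by norm_num, le_rfl, by linarith⟩
  -- Half of the slack in 3v < ν is spent on raising the exponent above 4. The cap 6 is the order of
  -- the available conditional moment.
  · refine ⟨min 6 (4 + (ν - 3 * v) / (2 * v)), lt_min (by norm_num) ?_, min_le_left _ _, ?_⟩
    · have : 0 < (ν - 3 * v) / (2 * v) := by
        apply div_pos <;> linarith
      linarith
    · have h1 : (min 6 (4 + (ν - 3 * v) / (2 * v)) - 1) * v ≤ (3 + (ν - 3 * v) / (2 * v)) * v := by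
        refine mul_le_mul_of_nonneg_right ?_ hv.le
        linarith [min_le_right 6 (4 + (ν - 3 * v) / (2 * v))]
      have h2 : (3 + (ν - 3 * v) / (2 * v)) * v = 3 * v + (ν - 3 * v) / 2 := by
        field_simp
      linarith

section

variable (hP : IsProbabilityMeasure (M.jointLaw j η)) (hlin : M.lin j η ∈ M.Θ) (hν : 0 < nu η)
  (hv : 3 * M.v₂ < nu η)

include hν hv

lemma nu_sub_pos : 0 < nu η - M.v₂ ∧ 0 < nu η - 2 * M.v₂ ∧ 0 < nu η - 3 * M.v₂ := by
  refine ⟨?_, ?_, ?_⟩ <;> · rcases le_or_gt M.v₂ 0 with h | h <;> linarith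

include hP hlin

lemma prior_integrable_pow {k : ℕ} (hk : k ≤ 4) :
    IntegrableOn (fun t => (deriv M.ψ t - M.mean j η) ^ k * M.prior j η t) M.Θ := by
  obtain ⟨q, hq, -, hκ⟩ := exists_exponent hν hv
  have hk' : (k : ℝ) ≤ 4 := by exact_mod_cast hk
  have := conj_integrable_pow (μ := M.mean j η) hlin rfl (by linarith) hκ (conj_integrable hP) (k := k) (by linarith)
  refine (this.mul_const (M.C (nu η) (M.mean j η))).congr (ae_of_all _ fun t => ?_)
  simp only [prior]; ring

lemma prior_moments :
    ∫ t in M.Θ, M.prior j η t = 1 ∧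
    ∫ t in M.Θ, (deriv M.ψ t - M.mean j η) * M.prior j η t = 0 ∧
    ∫ t in M.Θ, (deriv M.ψ t - M.mean j η) ^ 2 * M.prior j η t = M.xiMoment2 j η ∧
    ∫ t in M.Θ, (deriv M.ψ t - M.mean j η) ^ 3 * M.prior j η t = M.xiMoment3 j η ∧
    ∫ t in M.Θ, (deriv M.ψ t - M.mean j η) ^ 4 * M.prior j η t = M.xiMoment4 j η := by
  obtain ⟨q, hq, -, hκ⟩ := exists_exponent hν hv
  have hi := conj_integrable hP
  have e : ∀ k : ℕ, ∫ t in M.Θ, (deriv M.ψ t - M.mean j η) ^ k * M.prior j η t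
      = M.C (nu η) (M.mean j η) * ∫ t in M.Θ,
        (deriv M.ψ t - M.mean j η) ^ k * M.conj (nu η) (M.mean j η) t := by
    intro k
    rw [← integral_const_mul]
    congr 1; ext t; simp only [prior]; ring
  have h0 := e 0
  have h1 := e 1
  have c0 := C_mul_integral hP
  have c1 := conj_mean (μ := M.mean j η) hlin rfl hν (by linarith [(nu_sub_pos hν hv).1]) hi
  have r0 := conj_recursion (μ := M.mean j η) hlin rfl (by linarith) hκ hi 0 (by norm_num; linarith)
  have r1 := conj_recursion (μ := M.mean j η) hlin rfl (by linarith) hκ hi 1 (by norm_num; linarith)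
  have r2 := conj_recursion (μ := M.mean j η) hlin rfl (by linarith) hκ hi 2 (by norm_num; linarith)
  obtain ⟨p1, p2, p3⟩ := nu_sub_pos hν hv
  simp only [pow_zero, one_mul, pow_one] at h0 h1
  norm_num at r0 r1 r2
  rw [c0] at h0
  rw [c1, mul_zero] at h1
  rw [c1] at r0 r1
  have h2 : ∫ t in M.Θ, (deriv M.ψ t - M.mean j η) ^ 2 * M.prior j η t = M.xiMoment2 j η := by
    rw [xiMoment2, eq_div_iff p1.ne', e 2]
    linear_combination M.C (nu η) (M.mean j η) * r0 + M.Q (M.mean j η) * c0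
  have h3 : ∫ t in M.Θ, (deriv M.ψ t - M.mean j η) ^ 3 * M.prior j η t = M.xiMoment3 j η := by
    have e3 : M.xiMoment3 j η * (nu η - 2 * M.v₂) = 2 * M.Q' (M.mean j η) * M.xiMoment2 j η := by
      rw [xiMoment3, xiMoment2]; field_simp
    rw [← mul_left_inj' p2.ne', e3, ← h2, e 3, e 2]
    linear_combination M.C (nu η) (M.mean j η) * r1
  refine ⟨h0, h1, h2, h3, ?_⟩
  have e4 : M.xiMoment4 j η * (nu η - 3 * M.v₂)
      = 3 * (M.Q (M.mean j η) * M.xiMoment2 j η + M.Q' (M.mean j η) * M.xiMoment3 j η) := by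
    rw [xiMoment4, xiMoment3, xiMoment2]; field_simp
  rw [← mul_left_inj' p3.ne', e4, ← h2, ← h3, e 4, e 3, e 2]
  linear_combination M.C (nu η) (M.mean j η) * r2

/-- The coefficient c₁ disappears because the first central moment of the prior is zero. This
evaluates the outer integral whenever the inner one is a quartic in ξ − m. -/
lemma prior_poly (c₀ c₁ c₂ c₃ c₄ : ℝ) :
    ∫ t in M.Θ, M.prior j η t * (c₀ + c₁ * (deriv M.ψ t - M.mean j η)
      + c₂ * (deriv M.ψ t - M.mean j η) ^ 2 + c₃ * (deriv M.ψ t - M.mean j η) ^ 3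
      + c₄ * (deriv M.ψ t - M.mean j η) ^ 4)
    = c₀ + c₂ * M.xiMoment2 j η + c₃ * M.xiMoment3 j η + c₄ * M.xiMoment4 j η := by
  obtain ⟨m0, m1, m2, m3, m4⟩ := prior_moments hP hlin hν hv
  have hi := fun (k : ℕ) (hk : k ≤ 4) => prior_integrable_pow hP hlin hν hv hk
  have e : ∀ t, M.prior j η t * (c₀ + c₁ * (deriv M.ψ t - M.mean j η)
      + c₂ * (deriv M.ψ t - M.mean j η) ^ 2 + c₃ * (deriv M.ψ t - M.mean j η) ^ 3
      + c₄ * (deriv M.ψ t - M.mean j η) ^ 4)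
      = ∑ k : Fin 5, ![c₀, c₁, c₂, c₃, c₄] k *
        ((deriv M.ψ t - M.mean j η) ^ (k : ℕ) * M.prior j η t) := by
    intro t
    simp [Fin.sum_univ_five]; ring
  simp_rw [e]
  rw [integral_finsetSum _ fun (k : Fin 5) _ =>
    (hi k (by omega)).const_mul (![c₀, c₁, c₂, c₃, c₄] k)]
  simp_rw [integral_const_mul]
  simp [Fin.sum_univ_five, m0, m1, m2, m3, m4]

lemma integrable_jointLaw_pow {k : ℕ} (hk : k ≤ 4) :
    Integrable (fun z : ℝ × ℝ => (z.2 - M.mean j η) ^ k) (M.jointLaw j η) ∧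
    Integrable (fun z : ℝ × ℝ => (deriv M.ψ z.1 - M.mean j η) ^ k) (M.jointLaw j η) := by
  obtain ⟨q, hq, hq6, hκ⟩ := exists_exponent hν hv
  have hk' : (k : ℝ) ≤ q := by
    have : (k : ℝ) ≤ 4 := by exact_mod_cast hk
    linarith
  obtain ⟨C, hC⟩ := exists_rpow_bound (M := M) η (q := q)
    (A := max |M.Q (M.mean j η)| |M.Q' (M.mean j η)|) (S := (M.n j)⁻¹) (by linarith) hq6 hκ
  obtain ⟨h1, h2⟩ := hC j hP hlin le_rfl (le_max_left _ _) (le_max_right _ _)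
  have hξ := measurable_ξ (M := M)
  have key : ∀ f : ℝ × ℝ → ℝ, Measurable f →
      ∫⁻ z, ENNReal.ofReal (|f z| ^ q) ∂(M.jointLaw j η) ≤ ENNReal.ofReal C →
      Integrable (fun z => f z ^ k) (M.jointLaw j η) := by
    intro f hf h
    have hi : Integrable (fun z => |f z| ^ q) (M.jointLaw j η) := by
      refine ⟨by fun_prop, ?_⟩
      rw [hasFiniteIntegral_iff_ofReal (ae_of_all _ fun z => by positivity)]
      exact h.trans_lt ENNReal.ofReal_lt_top
    refine ((integrable_const 1).add hi).mono' (by fun_prop) (ae_of_all _ fun z => ?_)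
    rw [norm_pow, Real.norm_eq_abs]
    exact pow_abs_le_one_add_rpow hk'
  exact ⟨key _ (by fun_prop) h2, key _ (by fun_prop) h1⟩

/-- Tower rule: with Q and Q' expanded at m, each conditional moment given θ is a polynomial in ξ −
m of degree at most four, and `prior_poly` integrates it. -/
lemma jointLaw_moments :
    ∫ z, z.2 ∂(M.jointLaw j η) = M.mean j η ∧
    ∫ z, (z.2 - M.mean j η) ^ 2 ∂(M.jointLaw j η) = M.mu2 j η ∧
    ∫ z, (z.2 - M.mean j η) ^ 3 ∂(M.jointLaw j η) = M.mu3 j η ∧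
    ∫ z, (z.2 - M.mean j η) ^ 4 ∂(M.jointLaw j η) = M.mu4 j η := by
  have hi := fun (k : ℕ) (hk : k ≤ 4) => (integrable_jointLaw_pow hP hlin hν hv hk).1
  have hn := (M.n_pos j).ne'
  obtain ⟨p1, p2, p3⟩ := nu_sub_pos hν hv
  have hm := M.Θ_open.measurableSet
  refine ⟨?_, ?_, ?_, ?_⟩
  · have h1 := hi 1 (by norm_num)
    simp only [pow_one] at h1
    have h2 := integral_jointLaw h1
    rw [setIntegral_congr_fun (g := fun t => M.prior j η t * (0 + 1 * (deriv M.ψ t - M.mean j η)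
      + 0 * (deriv M.ψ t - M.mean j η) ^ 2 + 0 * (deriv M.ψ t - M.mean j η) ^ 3
      + 0 * (deriv M.ψ t - M.mean j η) ^ 4)) hm (fun t ht => by
        simp only
        rw [M.condMoment_one j ht]; ring), prior_poly hP hlin hν hv] at h2
    have h3 : Integrable (fun z : ℝ × ℝ => z.2) (M.jointLaw j η) := by
      refine (h1.add (integrable_const (M.mean j η))).congr (ae_of_all _ fun z => ?_)
      simp
    rw [integral_sub h3 (integrable_const _)] at h2
    simp at h2
    linarith
  · rw [integral_jointLaw (hi 2 (by norm_num)),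
      setIntegral_congr_fun (g := fun t => M.prior j η t *
        ((M.n j)⁻¹ * M.Q (M.mean j η) + (M.n j)⁻¹ * M.Q' (M.mean j η) * (deriv M.ψ t - M.mean j η)
        + (1 + (M.n j)⁻¹ * M.v₂) * (deriv M.ψ t - M.mean j η) ^ 2
        + 0 * (deriv M.ψ t - M.mean j η) ^ 3
        + 0 * (deriv M.ψ t - M.mean j η) ^ 4)) hm (fun t ht => by
          simp only
          rw [M.condMoment_two j ht, cm2, M.Q_expand _ (M.mean j η)]; ring),
      prior_poly hP hlin hν hv, mu2, xiMoment2]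
    field_simp
    ring
  · rw [integral_jointLaw (hi 3 (by norm_num)),
      setIntegral_congr_fun (g := fun t => M.prior j η t *
        ((M.n j)⁻¹ ^ 2 * M.Q (M.mean j η) * M.Q' (M.mean j η)
        + (3 * (M.n j)⁻¹ * M.Q (M.mean j η) + (M.n j)⁻¹ ^ 2 * (M.Q' (M.mean j η) ^ 2
          + 2 * M.v₂ * M.Q (M.mean j η))) * (deriv M.ψ t - M.mean j η)
        + (3 * (M.n j)⁻¹ + 3 * (M.n j)⁻¹ ^ 2 * M.v₂) * M.Q' (M.mean j η)
          * (deriv M.ψ t - M.mean j η) ^ 2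
        + (1 + 3 * (M.n j)⁻¹ * M.v₂ + 2 * (M.n j)⁻¹ ^ 2 * M.v₂ ^ 2)
          * (deriv M.ψ t - M.mean j η) ^ 3
        + 0 * (deriv M.ψ t - M.mean j η) ^ 4)) hm (fun t ht => by
          simp only
          have e : M.Q' (deriv M.ψ t) = M.Q' (M.mean j η) + 2 * M.v₂ * (deriv M.ψ t - M.mean j η) := by
            simp only [Q']; ring
          rw [M.condMoment_three j ht, cm2, cm3, M.Q_expand _ (M.mean j η), e]; ring),
      prior_poly hP hlin hν hv, mu3, eq_div_iff (mul_pos p1 p2).ne']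
    have e2 : M.xiMoment2 j η * (nu η - M.v₂) = M.Q (M.mean j η) := by
      rw [xiMoment2, div_mul_cancel₀ _ p1.ne']
    have e3 : M.xiMoment3 j η * ((nu η - M.v₂) * (nu η - 2 * M.v₂))
        = 2 * M.Q (M.mean j η) * M.Q' (M.mean j η) := by
      rw [xiMoment3, div_mul_cancel₀ _ (mul_pos p1 p2).ne']
    linear_combination ((3 * (M.n j)⁻¹ + 3 * (M.n j)⁻¹ ^ 2 * M.v₂) * M.Q' (M.mean j η)
      * (nu η - 2 * M.v₂)) * e2
      + (1 + 3 * (M.n j)⁻¹ * M.v₂ + 2 * (M.n j)⁻¹ ^ 2 * M.v₂ ^ 2) * e3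
  · rw [integral_jointLaw (hi 4 (by norm_num)),
      setIntegral_congr_fun (g := fun t => M.prior j η t *
        (((M.n j)⁻¹ ^ 3 * (M.Q (M.mean j η) * M.Q' (M.mean j η) ^ 2
          + 2 * M.v₂ * M.Q (M.mean j η) ^ 2) + 3 * (M.n j)⁻¹ ^ 2 * M.Q (M.mean j η) ^ 2)
        + (4 * (M.n j)⁻¹ ^ 2 * M.Q (M.mean j η) * M.Q' (M.mean j η)
          + 6 * (M.n j)⁻¹ ^ 2 * M.Q (M.mean j η) * M.Q' (M.mean j η)
          + (M.n j)⁻¹ ^ 3 * (M.Q' (M.mean j η) ^ 3 + 8 * M.v₂ * M.Q (M.mean j η) * M.Q' (M.mean j η)))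
          * (deriv M.ψ t - M.mean j η)
        + ((M.d j + 1) / M.n j ^ 2 *
        (7 * M.Q' (M.mean j η) ^ 2 + 2 * M.n j * (4 * M.d j + 3) * M.Q (M.mean j η)))
          * (deriv M.ψ t - M.mean j η) ^ 2
        + (6 / M.n j * M.Q' (M.mean j η) * (M.d j + 1) * (2 * M.d j + 1))
          * (deriv M.ψ t - M.mean j η) ^ 3
        + ((M.d j + 1) * (2 * M.d j + 1) * (3 * M.d j + 1))
          * (deriv M.ψ t - M.mean j η) ^ 4)) hm (fun t ht => by
          simp only
          have e : M.Q' (deriv M.ψ t) = M.Q' (M.mean j η) + 2 * M.v₂ * (deriv M.ψ t - M.mean j η) := by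
            simp only [Q']; ring
          rw [M.condMoment_four j ht, cm2, cm3, cm4, M.Q_expand _ (M.mean j η), e, d]
          field_simp
          ring),
      prior_poly hP hlin hν hv, mu4, d]
    field_simp
    ring

/-- Posterior mean and variance, tested against functions of the direct estimate. -/
lemma jointLaw_posterior (f : ℝ → ℝ) :
    (Integrable (fun z : ℝ × ℝ => f z.2 * (deriv M.ψ z.1 - M.xiHat j z.2 η)) (M.jointLaw j η) →
      ∫ z, f z.2 * (deriv M.ψ z.1 - M.xiHat j z.2 η) ∂(M.jointLaw j η) = 0) ∧
    (Integrable (fun z : ℝ × ℝ => f z.2 *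
        ((deriv M.ψ z.1 - M.xiHat j z.2 η) ^ 2 - M.T1 j z.2 η)) (M.jointLaw j η) →
      ∫ z, f z.2 * ((deriv M.ψ z.1 - M.xiHat j z.2 η) ^ 2 - M.T1 j z.2 η)
        ∂(M.jointLaw j η) = 0) := by
  have hn := M.n_pos j
  have hξ := measurable_ξ (M := M)
  obtain ⟨p1, p2, p3⟩ := nu_sub_pos hν hv
  have hy2 := (integrable_jointLaw_pow hP hlin hν hv (k := 2) (by norm_num)).1
  have hx2 := (integrable_jointLaw_pow hP hlin hν hv (k := 2) (by norm_num)).2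
  have hsq : Integrable (fun z : ℝ × ℝ => (deriv M.ψ z.1 - M.xiHat j z.2 η) ^ 2)
      (M.jointLaw j η) := by
    refine ((hx2.const_mul 2).add (hy2.const_mul (2 * (M.n j / (M.n j + nu η)) ^ 2))).mono'
      (by unfold xiHat; fun_prop) (ae_of_all _ fun z => ?_)
    rw [Real.norm_of_nonneg (sq_nonneg _)]
    have e : deriv M.ψ z.1 - M.xiHat j z.2 η = (deriv M.ψ z.1 - M.mean j η)
        - M.n j / (M.n j + nu η) * (z.2 - M.mean j η) := by
      unfold xiHat; field_simp; ring
    simp only [Pi.add_apply]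
    rw [e]
    nlinarith [sq_nonneg ((deriv M.ψ z.1 - M.mean j η)
        + M.n j / (M.n j + nu η) * (z.2 - M.mean j η))]
  have hC : M.C (nu η) (M.mean j η) ≠ 0 := by
    intro h
    have := C_mul_integral hP
    rw [h, zero_mul] at this
    exact zero_ne_one this
  have hpost : ∀ t y, M.prior j η t * Real.exp (M.n j * (t * y - M.ψ t))
      = M.C (nu η) (M.mean j η) * M.conj (M.n j + nu η) (M.xiHat j y η) t := by
    intro t y
    have := exp_mul_conj (M := M) (y := y) (μ := M.mean j η) hn hν t
    rw [xiHat, prior]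
    rw [postMean] at this
    rw [← this]; ring
  -- For almost every y Fubini provides the integrability that `post_moments` asks for. The test
  -- function is constant in θ and factors out, so no conditional kernel is needed.
  have hae : ∀ᵐ y ∂(M.base j),
      ∫ t in M.Θ, (deriv M.ψ t - M.xiHat j y η) * M.conj (M.n j + nu η) (M.xiHat j y η) t = 0 ∧
      ∫ t in M.Θ, ((deriv M.ψ t - M.xiHat j y η) ^ 2 - M.T1 j y η)
        * M.conj (M.n j + nu η) (M.xiHat j y η) t = 0 := by
    filter_upwards [ae_integrable_of_jointLaw (integrable_const (1 : ℝ)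
      (μ := M.jointLaw j η)), ae_integrable_of_jointLaw hsq] with y h0 h2
    have i0 : IntegrableOn (M.conj (M.n j + nu η) (M.xiHat j y η)) M.Θ := by
      refine (h0.const_mul (M.C (nu η) (M.mean j η))⁻¹).congr (ae_of_all _ fun t => ?_)
      simp only [hpost]
      field_simp
    have i2 : IntegrableOn (fun t => (deriv M.ψ t - M.xiHat j y η) ^ 2
        * M.conj (M.n j + nu η) (M.xiHat j y η) t) M.Θ := by
      refine (h2.const_mul (M.C (nu η) (M.mean j η))⁻¹).congr (ae_of_all _ fun t => ?_)
      simp only [hpost]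
      field_simp
    have hp := post_moments (y := y) (n := M.n j) (μ := M.mean j η) hlin rfl hν (by linarith)
      (conj_integrable hP) hn i0 i2
    refine ⟨hp.1, ?_⟩
    simp only [sub_mul]
    rw [integral_sub i2 (i0.const_mul _), integral_const_mul]
    have h3 := hp.2
    change (M.n j + nu η - M.v₂) * (∫ t in M.Θ, (deriv M.ψ t - M.xiHat j y η) ^ 2
        * M.conj (M.n j + nu η) (M.xiHat j y η) t)
        = M.Q (M.xiHat j y η) * ∫ t in M.Θ, M.conj (M.n j + nu η) (M.xiHat j y η) t at h3
    have h4 : M.n j + nu η - M.v₂ ≠ 0 := by linarith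
    rw [T1, div_mul_eq_mul_div, ← h3]
    field_simp
    ring
  constructor
  · intro hf
    rw [integral_jointLaw_swap hf]
    refine integral_eq_zero_of_ae ?_
    filter_upwards [hae] with y hy
    simp only [hpost]
    have e : ∀ t, f y * (deriv M.ψ t - M.xiHat j y η) * (M.C (nu η) (M.mean j η)
        * M.conj (M.n j + nu η) (M.xiHat j y η) t) = (f y * M.C (nu η) (M.mean j η)) *
        ((deriv M.ψ t - M.xiHat j y η) * M.conj (M.n j + nu η) (M.xiHat j y η) t) := by
      intro t; ring
    simp_rw [e]
    rw [integral_const_mul, hy.1]; simp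
  · intro hf
    rw [integral_jointLaw_swap hf]
    refine integral_eq_zero_of_ae ?_
    filter_upwards [hae] with y hy
    simp only [hpost]
    have e : ∀ t, f y * ((deriv M.ψ t - M.xiHat j y η) ^ 2 - M.T1 j y η) *
        (M.C (nu η) (M.mean j η)
        * M.conj (M.n j + nu η) (M.xiHat j y η) t) = (f y * M.C (nu η) (M.mean j η)) *
        (((deriv M.ψ t - M.xiHat j y η) ^ 2 - M.T1 j y η) *
          M.conj (M.n j + nu η) (M.xiHat j y η) t) := by
      intro t; ring
    simp_rw [e]
    rw [integral_const_mul, hy.2]; simp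

end

end Model
end NEFQVF

namespace NEFQVF

variable {p : ℕ}

/-! ### Gradients in the parameter -/

lemma form_apply (v h : Par p) : form v h = ∑ k, v k * h k := by
  simp [form]

lemma form_single (v : Par p) (k : Idx p) : form v (Pi.single k 1) = v k := by
  simp [form_apply, Pi.single_apply]

/-- The unit vector of the hyperparameter `ν`. -/
def nuvec (p : ℕ) : Par p := Sum.elim (fun _ => 0) (fun _ => 1)

/-- Every gradient of this model is a combination of the covariate direction and the ν-direction.
Writing it so reduces identities between gradients to scalar algebra. -/
lemma form_elim (x : Fin p → ℝ) (a b : ℝ) :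
    form (Sum.elim (fun k => a * x k) (fun _ => b))
      = a • form (Sum.elim x (fun _ => 0)) + b • form (nuvec p) := by
  ext1 h
  simp [form_apply, nuvec, Finset.mul_sum, mul_assoc]

lemma hasFDerivAt_nu (η : Par p) : HasFDerivAt nu (form (nuvec p)) η := by
  have e : (nu : Par p → ℝ) = form (nuvec p) := by
    ext h; simp [form_apply, nuvec, nu]
  rw [e]; exact (form (nuvec p)).hasFDerivAt

namespace Model

variable (M : Model p)

lemma hasFDerivAt_lin (j : ℕ) (η : Par p) : HasFDerivAt (M.lin j) (form (M.xvec j)) η := by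
  have e : M.lin j = form (M.xvec j) := by
    ext h; simp [form_apply, xvec, lin, dotProduct, beta]
  rw [e]; exact (form (M.xvec j)).hasFDerivAt

lemma hasFDerivAt_mean (j : ℕ) {η : Par p} (h : M.lin j η ∈ M.Θ) :
    HasFDerivAt (M.mean j) (M.Q (M.mean j η) • form (M.xvec j)) η :=
  (M.hasDerivAt_ξ h).comp_hasFDerivAt η (M.hasFDerivAt_lin j η)

/-! ### Derivatives of the Bayes estimator and of its posterior variance -/

section predictor

variable {M} {i : ℕ} {t : ℝ} {η : Par p} (hlin : M.lin i η ∈ M.Θ) (hν : 0 < nu η)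

/-- The gradient of the Bayes estimator. -/
def xiGrad (M : Model p) (i : ℕ) (t : ℝ) (η : Par p) : Par p :=
  Sum.elim (fun k => nu η * (M.n i + nu η)⁻¹ * M.Q (M.mean i η) * M.x i k)
    (fun _ => -(M.n i * ((M.n i + nu η) ^ 2)⁻¹ * (t - M.mean i η)))

include hlin hν

omit hlin in
lemma hasFDerivAt_inv_add : HasFDerivAt (fun η : Par p => (M.n i + nu η)⁻¹)
    (-((M.n i + nu η) ^ 2)⁻¹ • form (nuvec p)) η := by
  have hn := M.n_pos i
  exact (hasDerivAt_inv (by positivity : M.n i + nu η ≠ 0)).comp_hasFDerivAt η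
    ((hasFDerivAt_nu η).const_add (M.n i))

lemma hasFDerivAt_xiHat :
    HasFDerivAt (M.xiHat i t) (form (M.xiGrad i t η)) η := by
  have hn := M.n_pos i
  have h0 : M.n i + nu η ≠ 0 := by positivity
  have h := (((hasFDerivAt_nu η).mul (M.hasFDerivAt_mean i hlin)).const_add (M.n i * t)).mul
    (hasFDerivAt_inv_add (M := M) (i := i) hν)
  have e : M.xiHat i t = fun η => (M.n i * t + nu η * M.mean i η) * (M.n i + nu η)⁻¹ := by
    ext; rw [xiHat, div_eq_mul_inv]
  rw [e]
  refine h.congr_fderiv ?_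
  rw [xiGrad, form_elim]
  ext1 v
  simp only [xvec, _root_.add_apply, _root_.smul_apply, smul_eq_mul,
    Pi.mul_apply]
  -- After evaluation at v only the two numbers N and X remain of the direction, and the claim is an
  -- identity of rational functions.
  generalize form (nuvec p) v = N
  generalize form (Sum.elim (M.x i) fun _ => 0) v = X
  field_simp
  ring

omit hlin hν in
lemma hasFDerivAt_lam (hv : M.v₂ < nu η) :
    HasFDerivAt (M.lam i) (-M.lam i η ^ 2 • form (nuvec p)) η := by
  have hn := M.n_pos i
  have h0 : M.n i + nu η - M.v₂ ≠ 0 := by linarith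
  have := (hasDerivAt_inv h0).comp_hasFDerivAt η
    (((hasFDerivAt_nu η).const_add (M.n i)).sub_const M.v₂)
  refine this.congr_fderiv ?_
  rw [lam, inv_pow]

lemma hasFDerivAt_Q_xiHat :
    HasFDerivAt (fun η => M.Q (M.xiHat i t η)) (M.Q' (M.xiHat i t η) • form (M.xiGrad i t η)) η :=
  (M.hasDerivAt_Q _).comp_hasFDerivAt η (hasFDerivAt_xiHat hlin hν)

lemma hasFDerivAt_Q'_xiHat :
    HasFDerivAt (fun η => M.Q' (M.xiHat i t η)) ((2 * M.v₂) • form (M.xiGrad i t η)) η :=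
  (M.hasDerivAt_Q' _).comp_hasFDerivAt η (hasFDerivAt_xiHat hlin hν)

lemma hasFDerivAt_T1 (hv : M.v₂ < nu η) :
    HasFDerivAt (M.T1 i t) (form (M.r i t η)) η := by
  have h := (hasFDerivAt_Q_xiHat (t := t) hlin hν).mul (hasFDerivAt_lam (M := M) (i := i) hv)
  have e : M.T1 i t = fun η => M.Q (M.xiHat i t η) * M.lam i η := by
    ext; rw [T1, lam, div_eq_mul_inv]
  rw [e]
  refine h.congr_fderiv ?_
  rw [r, form_elim, xiGrad, form_elim]
  ext1 v
  simp only [_root_.add_apply, _root_.smul_apply, smul_eq_mul]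
  ring

lemma hasFDerivAt_r (hv : M.v₂ < nu η) (k : Idx p) :
    HasFDerivAt (fun η => M.r i t η k) (form (M.R i t η k)) η := by
  have hn := M.n_pos i
  have h0 : M.n i + nu η ≠ 0 := by positivity
  have hm := M.hasFDerivAt_mean i hlin
  have hQm := (M.hasDerivAt_Q _).comp_hasFDerivAt η hm
  have hl := hasFDerivAt_lam (M := M) (i := i) hv
  have hQ := hasFDerivAt_Q_xiHat (t := t) hlin hν
  have hQ' := hasFDerivAt_Q'_xiHat (t := t) hlin hν
  have hi := hasFDerivAt_inv_add (M := M) (i := i) hν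
  rcases k with k | k
  · have h := (((((hasFDerivAt_nu η).mul hi).mul hl).mul hQ').mul hQm).mul_const (M.x i k)
    have eR : M.R i t η (Sum.inl k) = Sum.elim (fun l => ((M.n i + nu η) ^ 2)⁻¹ * nu η * M.x i k
        * M.lam i η * M.Q (M.mean i η) * (2 * M.v₂ * nu η * M.Q (M.mean i η)
        + M.Q' (M.xiHat i t η) * M.Q' (M.mean i η) * (M.n i + nu η)) * M.x i l)
        (fun _ => M.T12 i t η k) := by
      ext l
      rcases l with l | l
      · simp [R, T11]; ring
      · simp [R]
    rw [eR, form_elim]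
    refine h.congr_fderiv ?_
    rw [xiGrad, form_elim]
    ext1 v
    simp only [xvec, T12, _root_.add_apply, _root_.smul_apply, smul_eq_mul,
      Pi.mul_apply, Function.comp]
    generalize form (nuvec p) v = N
    generalize form (Sum.elim (M.x i) fun _ => 0) v = X
    generalize M.lam i η = l
    field_simp
    ring
  · have h := (((hl.pow 2).neg.mul hQ)).sub
      ((((hl.mul_const (M.n i)).mul (hi.pow 2)).mul hQ').mul (hm.const_sub t))
    have eR : M.R i t η (Sum.inr k) = Sum.elim (fun l => (M.Q (M.mean i η) * M.lam i η *
        ((M.n i + nu η) ^ 2)⁻¹ *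
        (M.Q' (M.xiHat i t η) * (M.n i - nu η * (M.n i + nu η) * M.lam i η)
        - 2 * M.v₂ * M.n i * nu η * (t - M.mean i η) * (M.n i + nu η)⁻¹)) * M.x i l)
        (fun _ => M.T22 i t η) := by
      ext l
      rcases l with l | l
      · simp [R, T12]
      · simp [R]
    rw [eR, form_elim]
    have e : (fun η => M.r i t η (Sum.inr k)) = fun η => -M.lam i η ^ 2 * M.Q (M.xiHat i t η)
      - M.lam i η * M.n i * ((M.n i + nu η)⁻¹ ^ 2) * M.Q' (M.xiHat i t η) * (t - M.mean i η) := by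
      ext; simp [r]
    rw [e]
    refine h.congr_fderiv ?_
    rw [xiGrad, form_elim]
    ext1 v
    simp only [xvec, T22, _root_.add_apply, _root_.smul_apply, smul_eq_mul,
      Pi.mul_apply, Pi.pow_apply, Pi.neg_apply, _root_.sub_apply,
      _root_.neg_apply, nsmul_eq_mul, Nat.cast_ofNat, Nat.reduceSub, pow_one]
    generalize form (nuvec p) v = N
    generalize form (Sum.elim (M.x i) fun _ => 0) v = X
    generalize M.lam i η = l
    field_simp
    ring

end predictor

/-- The matrix P is the outer square of the gradient of the Bayes estimator, which is why T2
captures the squared increment of the predictor caused by estimating η. -/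
lemma Pmat_eq (i : ℕ) (t : ℝ) {η : Par p} (k l : Idx p) :
    M.Pmat i t η k l = M.xiGrad i t η k * M.xiGrad i t η l := by
  rcases k with k | k <;> rcases l with l | l <;> simp [Pmat, xiGrad, ← inv_pow] <;> ring

end Model
end NEFQVF

namespace NEFQVF

variable {p : ℕ}

/-! ### Smooth families of functions of the parameter -/

/-- The arguments of the closed forms: a direct estimate, a size, a covariate, a parameter. -/
abbrev Arg (p : ℕ) : Type := ℝ × ℝ × (Fin p → ℝ) × Par p

lemma fderiv_eq_form (f : Par p → ℝ) (η : Par p) : fderiv ℝ f η = form (fun k => pd k f η) := by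
  ext1 h
  have : h = ∑ k, h k • (Pi.single k 1 : Par p) := by
    ext l; simp [Finset.sum_apply, Pi.single_apply]
  rw [form_apply]
  conv_lhs => rw [this]
  simp [pd, mul_comm]

lemma abs_form_le (v h : Par p) : |form v h| ≤ (∑ k, |v k|) * ‖h‖ := by
  rw [form_apply, Finset.sum_mul]
  refine (Finset.abs_sum_le_sum_abs _ _).trans (Finset.sum_le_sum fun k _ => ?_)
  rw [abs_mul]
  exact mul_le_mul_of_nonneg_left (norm_le_pi_norm h k) (abs_nonneg _)

lemma pd_eq_of_hasFDerivAt {f : Par p → ℝ} {v η : Par p} (h : HasFDerivAt f (form v) η)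
    (k : Idx p) : pd k f η = v k := by
  rw [pd, h.fderiv, form_single]

lemma pd_congr {f g : Par p → ℝ} {η : Par p} (h : f =ᶠ[𝓝 η] g) (k : Idx p) :
    pd k f η = pd k g η := by
  rw [pd, pd, h.fderiv_eq]

lemma pd_mul {f g : Par p → ℝ} {η : Par p} (hf : DifferentiableAt ℝ f η)
    (hg : DifferentiableAt ℝ g η) (k : Idx p) :
    pd k (fun t => f t * g t) η = pd k f η * g η + f η * pd k g η := by
  rw [pd, fderiv_fun_mul hf hg]
  simp [pd]; ring

lemma pd_add {f g : Par p → ℝ} {η : Par p} (hf : DifferentiableAt ℝ f η)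
    (hg : DifferentiableAt ℝ g η) (k : Idx p) :
    pd k (fun t => f t + g t) η = pd k f η + pd k g η := by
  rw [pd, fderiv_fun_add hf hg]; simp [pd]

lemma pd_sum {ι : Type*} (s : Finset ι) {f : ι → Par p → ℝ} {η : Par p}
    (hf : ∀ i ∈ s, DifferentiableAt ℝ (f i) η) (k : Idx p) :
    pd k (fun t => ∑ i ∈ s, f i t) η = ∑ i ∈ s, pd k (f i) η := by
  rw [pd, fderiv_fun_sum hf]; simp [pd]

namespace Model

variable (M : Model p)

/-- The domain of the closed forms. -/
def dom : Set (Arg p) :=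
  {e | 0 < e.2.1 ∧ 0 < e.2.1 + M.v₂ ∧ e.2.2.1 ⬝ᵥ beta e.2.2.2 ∈ M.Θ ∧ 0 < nu e.2.2.2 ∧
    3 * M.v₂ < nu e.2.2.2}

/-- The argument belonging to area `j`. -/
def arg (j : ℕ) (y : ℝ) (η : Par p) : Arg p := (y, M.n j, M.x j, η)

lemma contDiff_linArg : ContDiff ℝ ⊤ (fun e : Arg p => e.2.2.1 ⬝ᵥ beta e.2.2.2) := by
  unfold dotProduct beta
  fun_prop

lemma isOpen_dom : IsOpen M.dom := by
  have hl := (contDiff_linArg (p := p)).continuous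
  have hn : Continuous fun e : Arg p => nu e.2.2.2 := by unfold nu; fun_prop
  have h1 : Continuous fun e : Arg p => e.2.1 := by fun_prop
  have h2 : Continuous fun e : Arg p => e.2.1 + M.v₂ := by fun_prop
  refine IsOpen.inter (isOpen_lt continuous_const h1) ?_
  refine IsOpen.inter (isOpen_lt continuous_const h2) ?_
  refine IsOpen.inter (M.Θ_open.preimage hl) ?_
  exact IsOpen.inter (isOpen_lt continuous_const hn) (isOpen_lt continuous_const hn)

/-- A family of functions, indexed by the areas and the values of the direct estimate, which comes
from an analytic function of the size, the covariate, the direct estimate and the parameter. -/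
def SmoothFam (f : ℕ → ℝ → Par p → ℝ) : Prop :=
  ∃ F : Arg p → ℝ, ContDiffOn ℝ ⊤ F M.dom ∧
    ∀ j y η, M.arg j y η ∈ M.dom → f j y η = F (M.arg j y η)

variable {M}

namespace SmoothFam

variable {f g : ℕ → ℝ → Par p → ℝ}

lemma of_arg {F : Arg p → ℝ} (hF : ContDiffOn ℝ ⊤ F M.dom) :
    M.SmoothFam fun j y η => F (M.arg j y η) := ⟨F, hF, fun _ _ _ _ => rfl⟩

lemma const (c : ℝ) : M.SmoothFam fun _ _ _ => c := of_arg (F := fun _ => c) contDiffOn_const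

lemma add (hf : M.SmoothFam f) (hg : M.SmoothFam g) :
    M.SmoothFam fun j y η => f j y η + g j y η := by
  obtain ⟨F, hF, hF'⟩ := hf
  obtain ⟨G, hG, hG'⟩ := hg
  exact ⟨_, hF.add hG, fun j y η h => by
    simp only [hF' j y η h, hG' j y η h]⟩

lemma mul (hf : M.SmoothFam f) (hg : M.SmoothFam g) :
    M.SmoothFam fun j y η => f j y η * g j y η := by
  obtain ⟨F, hF, hF'⟩ := hf
  obtain ⟨G, hG, hG'⟩ := hg
  exact ⟨_, hF.mul hG, fun j y η h => by
    simp only [hF' j y η h, hG' j y η h]⟩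

lemma neg (hf : M.SmoothFam f) : M.SmoothFam fun j y η => -f j y η := by
  simpa using (const (-1)).mul hf

lemma sub (hf : M.SmoothFam f) (hg : M.SmoothFam g) :
    M.SmoothFam fun j y η => f j y η - g j y η := by
  simpa [sub_eq_add_neg] using hf.add hg.neg

lemma pow (hf : M.SmoothFam f) (k : ℕ) : M.SmoothFam fun j y η => f j y η ^ k := by
  obtain ⟨F, hF, hF'⟩ := hf
  exact ⟨_, hF.pow k, fun j y η h => by simp only [hF' j y η h]⟩

lemma sum {ι : Type*} (s : Finset ι) {f : ι → ℕ → ℝ → Par p → ℝ}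
    (hf : ∀ i ∈ s, M.SmoothFam (f i)) : M.SmoothFam fun j y η => ∑ i ∈ s, f i j y η := by
  classical
  induction s using Finset.induction_on with
  | empty => simpa using const 0
  | insert a s ha ih =>
    simp only [Finset.sum_insert ha]
    exact (hf a (Finset.mem_insert_self a s)).add
      (ih fun i hi => hf i (Finset.mem_insert_of_mem hi))

lemma congr (hf : M.SmoothFam f) (h : ∀ j y η, M.arg j y η ∈ M.dom → g j y η = f j y η) :
    M.SmoothFam g := by
  obtain ⟨F, hF, hF'⟩ := hf
  exact ⟨F, hF, fun j y η hm => (h j y η hm).trans (hF' j y η hm)⟩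

lemma eventually_mem {j : ℕ} {y : ℝ} {η : Par p} (h : M.arg j y η ∈ M.dom) :
    ∀ᶠ η' in 𝓝 η, M.arg j y η' ∈ M.dom := by
  have hc : Continuous fun η' : Par p => M.arg j y η' := by unfold arg; fun_prop
  exact hc.continuousAt.eventually (M.isOpen_dom.mem_nhds h)

lemma hasFDerivAt_arg (j : ℕ) (y : ℝ) (η : Par p) :
    HasFDerivAt (fun η' : Par p => M.arg j y η')
      (ContinuousLinearMap.inr ℝ ℝ (ℝ × (Fin p → ℝ) × Par p) ∘L
        (ContinuousLinearMap.inr ℝ ℝ ((Fin p → ℝ) × Par p) ∘L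
          ContinuousLinearMap.inr ℝ (Fin p → ℝ) (Par p))) η := by
  have h := (ContinuousLinearMap.inr ℝ ℝ (ℝ × (Fin p → ℝ) × Par p) ∘L
        (ContinuousLinearMap.inr ℝ ℝ ((Fin p → ℝ) × Par p) ∘L
          ContinuousLinearMap.inr ℝ (Fin p → ℝ) (Par p))).hasFDerivAt (x := η)
  refine (h.const_add (y, M.n j, M.x j, (0 : Par p))).congr_of_eventuallyEq ?_
  exact Eventually.of_forall fun t => by simp [arg]

lemma fderiv_comp_arg {F : Arg p → ℝ} (hF : ContDiffOn ℝ ⊤ F M.dom) {j : ℕ} {y : ℝ} {η : Par p}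
    (h : M.arg j y η ∈ M.dom) (v : Par p) :
    DifferentiableAt ℝ (fun η' => F (M.arg j y η')) η ∧
    fderiv ℝ (fun η' => F (M.arg j y η')) η v = fderiv ℝ F (M.arg j y η) (0, 0, 0, v) := by
  have h1 := ((hF.differentiableOn (by simp)).differentiableAt (M.isOpen_dom.mem_nhds h)).hasFDerivAt
  have h2 := h1.comp η (hasFDerivAt_arg j y η)
  refine ⟨h2.differentiableAt, ?_⟩
  have h3 := h2.fderiv
  simp only [Function.comp_def] at h3
  rw [h3]
  simp

lemma differentiableAt (hf : M.SmoothFam f) {j : ℕ} {y : ℝ} {η : Par p}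
    (h : M.arg j y η ∈ M.dom) : DifferentiableAt ℝ (f j y) η := by
  obtain ⟨F, hF, hF'⟩ := hf
  have he : f j y =ᶠ[𝓝 η] fun η' => F (M.arg j y η') :=
    (eventually_mem h).mono fun η' h' => hF' j y η' h'
  exact (fderiv_comp_arg hF h 0).1.congr_of_eventuallyEq he

/-- The underlying F is differentiated in the direction (0, 0, 0, e_k). The family agrees with F on
a whole neighbourhood, as the domain is open. -/
lemma pderiv (hf : M.SmoothFam f) (k : Idx p) : M.SmoothFam fun j y η => pd k (f j y) η := by
  obtain ⟨F, hF, hF'⟩ := hf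
  refine ⟨fun e => fderiv ℝ F e (0, 0, 0, Pi.single k 1), ?_, fun j y η h => ?_⟩
  · exact (hF.fderiv_of_isOpen M.isOpen_dom (m := ⊤) (by simp)).clm_apply contDiffOn_const
  · have he : f j y =ᶠ[𝓝 η] fun η' => F (M.arg j y η') :=
      (eventually_mem h).mono fun η' h' => hF' j y η' h'
    show NEFQVF.pd k (f j y) η = _
    rw [pd_congr he, pd, (fderiv_comp_arg hF h _).2]

lemma hasFDerivAt (hf : M.SmoothFam f) {j : ℕ} {y : ℝ} {η : Par p}
    (h : M.arg j y η ∈ M.dom) :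
    HasFDerivAt (f j y) (form fun k => pd k (f j y) η) η := by
  rw [← fderiv_eq_form]
  exact (hf.differentiableAt h).hasFDerivAt

/-- Mixed second partial derivatives commute. -/
lemma pd_comm (hf : M.SmoothFam f) {j : ℕ} {y : ℝ} {η : Par p} (h : M.arg j y η ∈ M.dom)
    (k l : Idx p) : pd k (fun t => pd l (f j y) t) η
      = pd l (fun t => pd k (f j y) t) η := by
  obtain ⟨F, hF, hF'⟩ := hf
  have hc : ContDiffAt ℝ 2 (f j y) η := by
    have h1 : ContDiffAt ℝ ⊤ F (M.arg j y η) := hF.contDiffAt (M.isOpen_dom.mem_nhds h)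
    have h2 : ContDiffAt ℝ ⊤ (fun η' => F (M.arg j y η')) η :=
      h1.comp η (by unfold arg; fun_prop)
    refine (h2.of_le le_top).congr_of_eventuallyEq ?_
    exact (eventually_mem h).mono fun η' h' => hF' j y η' h'
  have hs := hc.isSymmSndFDerivAt (by simp)
  have hd : DifferentiableAt ℝ (fderiv ℝ (f j y)) η :=
    (hc.fderiv_right (m := 1) (by norm_num)).differentiableAt (by simp)
  have key : ∀ a b : Idx p, pd a (fun t => pd b (f j y) t) η
      = fderiv ℝ (fderiv ℝ (f j y)) η (Pi.single a 1) (Pi.single b 1) := by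
    intro a b
    simp only [pd]
    rw [fderiv_clm_apply hd (differentiableAt_const _)]
    simp
  rw [key, key]
  exact hs _ _

end SmoothFam

/-! ### Uniform bounds -/

section Bounds

variable {K : Set (Par p)} {f : ℕ → ℝ → Par p → ℝ}

lemma Regular.arg_mem (hK : M.Regular K) {η : Par p} (hη : η ∈ K) (j : ℕ) (y : ℝ) :
    M.arg j y η ∈ M.dom := by
  obtain ⟨T, hT, -, hl⟩ := hK.lin_mem
  obtain ⟨c, hc, hn⟩ := hK.n_low
  exact ⟨M.n_pos j, hc.trans_le (hn j).2, hT (hl j η hη), hK.nu_pos η hη, hK.nu_gt η hη⟩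

/-- The assumptions confine the arguments of all areas to a compact box. The closed constraints on n
+ v₂ and on the linear predictor cut it down to a subset of the domain. Uniformity over the areas
stems from this. -/
lemma Regular.exists_compact (hK : M.Regular K) (B : ℝ) :
    ∃ S : Set (Arg p), IsCompact S ∧ S ⊆ M.dom ∧
      ∀ j y, |y| ≤ B → ∀ η ∈ K, M.arg j y η ∈ S := by
  obtain ⟨T, hT, hTc, hl⟩ := hK.lin_mem
  obtain ⟨c, hc, hn⟩ := hK.n_low
  obtain ⟨C, hC⟩ := hK.n_bdd
  obtain ⟨b, hb⟩ := hK.x_bdd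
  have hl' := (contDiff_linArg (p := p)).continuous
  have hcomp : IsCompact (Set.Icc (-B) B ×ˢ (Set.Icc c C ×ˢ
      ((Set.univ.pi fun _ : Fin p => Set.Icc (-b) b) ×ˢ K))) :=
    isCompact_Icc.prod (isCompact_Icc.prod
      ((isCompact_univ_pi fun _ => isCompact_Icc).prod hK.compact))
  have h2 : Continuous fun e : Arg p => e.2.1 + M.v₂ := by fun_prop
  have hclosed : IsClosed {e : Arg p | c ≤ e.2.1 + M.v₂ ∧ e.2.2.1 ⬝ᵥ beta e.2.2.2 ∈ T} :=
    (isClosed_le continuous_const h2).inter (hTc.isClosed.preimage hl')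
  refine ⟨_, hcomp.inter_right hclosed, ?_, ?_⟩
  · rintro ⟨y, n, x, η⟩ ⟨⟨-, ⟨h1, -⟩, -, h2⟩, h3, h4⟩
    exact ⟨hc.trans_le h1, hc.trans_le h3, hT h4, hK.nu_pos η h2, hK.nu_gt η h2⟩
  · intro j y hy η hη
    refine ⟨⟨abs_le.1 hy, ⟨(hn j).1, hC j⟩, fun k _ => abs_le.1 (hb j k), hη⟩, (hn j).2, hl j η hη⟩

lemma SmoothFam.exists_bound (hf : M.SmoothFam f) (hK : M.Regular K) (B : ℝ) :
    ∃ C, ∀ j y, |y| ≤ B → ∀ η ∈ K, |f j y η| ≤ C := by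
  obtain ⟨S, hS, hSd, hm⟩ := hK.exists_compact B
  obtain ⟨F, hF, hF'⟩ := hf
  obtain ⟨C, hC⟩ := hS.exists_bound_of_continuousOn (hF.continuousOn.mono hSd)
  refine ⟨C, fun j y hy η hη => ?_⟩
  rw [hF' j y η (hSd (hm j y hy η hη))]
  exact hC _ (hm j y hy η hη)


lemma SmoothFam.exists_lipschitz (hf : M.SmoothFam f) (hK : M.Regular K) (B : ℝ) {η : Par p} {ρ : ℝ}
    (hρ : Metric.closedBall η ρ ⊆ K) :
    ∃ C, 0 ≤ C ∧ ∀ j y, |y| ≤ B → ∀ η₁ ∈ Metric.closedBall η ρ, ∀ η₂ ∈ Metric.closedBall η ρ,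
      |f j y η₂ - f j y η₁| ≤ C * ‖η₂ - η₁‖ := by
  choose C hC using fun k => (hf.pderiv k).exists_bound hK B
  refine ⟨∑ k, |C k|, by positivity, fun j y hy η₁ h₁ η₂ h₂ => ?_⟩
  refine (convex_closedBall η ρ).norm_image_sub_le_of_norm_hasFDerivWithin_le
    (fun x hx => (hf.hasFDerivAt (hK.arg_mem (hρ hx) j y)).hasFDerivWithinAt) (fun x hx => ?_) h₁ h₂
  refine ContinuousLinearMap.opNorm_le_bound _ (by positivity) fun h => ?_
  refine (abs_form_le _ h).trans (mul_le_mul_of_nonneg_right ?_ (norm_nonneg h))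
  exact Finset.sum_le_sum fun k _ => (hC k j y hy x (hρ hx)).trans (le_abs_self _)

/-- If the gradient vanishes to order `r`, then the function vanishes to order `r + 1`. -/
lemma abs_sub_le_of_gradient {G : Par p → ℝ} {η : Par p} {ρ C : ℝ} {r : ℕ} {v : Par p → Par p}
    (hd : ∀ t ∈ Metric.closedBall η ρ, HasFDerivAt G (form (v t)) t)
    (hC : ∀ t ∈ Metric.closedBall η ρ, ∀ k, |v t k| ≤ C * ‖t - η‖ ^ r) (hC0 : 0 ≤ C)
    {t : Par p} (ht : t ∈ Metric.closedBall η ρ) :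
    |G t - G η| ≤ (Fintype.card (Idx p) : ℝ) * C * ‖t - η‖ ^ (r + 1) := by
  -- On the smaller ball of radius ‖t − η‖ the gradient bound is at most C‖t − η‖^r, and the mean
  -- value inequality adds one power.
  have hsub : Metric.closedBall η ‖t - η‖ ⊆ Metric.closedBall η ρ :=
    Metric.closedBall_subset_closedBall (by rw [← dist_eq_norm]; exact ht)
  have h := (convex_closedBall η ‖t - η‖).norm_image_sub_le_of_norm_hasFDerivWithin_le
    (C := (Fintype.card (Idx p) : ℝ) * C * ‖t - η‖ ^ r) (f := G) (f' := fun t => form (v t))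
    (x := η) (y := t)
    (fun x hx => (hd x (hsub hx)).hasFDerivWithinAt) (fun x hx => ?_)
    (Metric.mem_closedBall_self (norm_nonneg _)) (by simp [dist_eq_norm])
  · rw [pow_succ, ← mul_assoc]; exact h
  · refine ContinuousLinearMap.opNorm_le_bound _ (by positivity) fun h => ?_
    refine (abs_form_le _ h).trans (mul_le_mul_of_nonneg_right ?_ (norm_nonneg h))
    have hx' : ‖x - η‖ ≤ ‖t - η‖ := by rw [← dist_eq_norm]; exact hx
    calc ∑ k, |v x k| ≤ ∑ _k : Idx p, C * ‖t - η‖ ^ r := Finset.sum_le_sum fun k _ =>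
          (hC x (hsub hx) k).trans (by gcongr)
      _ = _ := by simp [mul_assoc]

/-- Second-order Taylor expansion with uniform remainder. -/
lemma SmoothFam.exists_taylor (hf : M.SmoothFam f) (hK : M.Regular K) (B : ℝ) {η : Par p} {ρ : ℝ}
    (hρ : Metric.closedBall η ρ ⊆ K) :
    ∃ C, 0 ≤ C ∧ ∀ j y, |y| ≤ B → ∀ t ∈ Metric.closedBall η ρ,
      |f j y t - f j y η - ∑ k, pd k (f j y) η * (t - η) k| ≤ C * ‖t - η‖ ^ 2 ∧
      |f j y t - f j y η - ∑ k, pd k (f j y) η * (t - η) k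
        - 1 / 2 * ∑ k, ∑ l, pd k (pd l (f j y)) η * (t - η) k * (t - η) l|
        ≤ C * ‖t - η‖ ^ 3 := by
  have hpd := fun k => hf.pderiv k
  have hpd2 := fun k l => (hf.pderiv l).pderiv k
  choose C₁ hC₁0 hC₁ using fun k => (hpd k).exists_lipschitz hK B hρ
  choose C₂ hC₂0 hC₂ using fun k l => (hpd2 k l).exists_lipschitz hK B hρ
  set N : ℝ := (Fintype.card (Idx p) : ℝ)
  set A := ∑ k, C₁ k
  set A' := ∑ k, ∑ l, C₂ k l
  have hA : 0 ≤ A := Finset.sum_nonneg fun k _ => hC₁0 k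
  have hA' : 0 ≤ A' := Finset.sum_nonneg fun k _ => Finset.sum_nonneg fun l _ => hC₂0 k l
  have hN : 0 ≤ N := by positivity
  refine ⟨N * A + N * (N * A'), by positivity, fun j y hy t ht => ?_⟩
  have hρ0 : 0 ≤ ρ := dist_nonneg.trans ht
  have hηm : η ∈ Metric.closedBall η ρ := Metric.mem_closedBall_self hρ0
  have hdm := fun x (hx : x ∈ Metric.closedBall η ρ) => hK.arg_mem (hρ hx) j y
  have hlin : ∀ (v : Par p) (x : Par p),
      HasFDerivAt (fun t : Par p => ∑ k, v k * (t - η) k) (form v) x := by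
    intro v x
    have : (fun t : Par p => ∑ k, v k * (t - η) k) = fun t => form v (t - η) := by
      ext t; rw [form_apply]
    rw [this]
    exact (form v).hasFDerivAt.comp x ((hasFDerivAt_id x).sub_const η)
  have hadd : ∀ v w : Par p, form v - form w = form (v - w) := by
    intro v w; ext1 h; simp [form_apply, sub_mul, Finset.sum_sub_distrib]
  constructor
  · have h1 := abs_sub_le_of_gradient (r := 1) (C := A)
      (G := fun t => f j y t - ∑ k, pd k (f j y) η * (t - η) k)
      (v := fun t k => pd k (f j y) t - pd k (f j y) η) (η := η) (ρ := ρ)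
      (fun x hx => by
        have := (hf.hasFDerivAt (hdm x hx)).sub (hlin (fun k => pd k (f j y) η) x)
        rw [hadd] at this
        exact this)
      (fun x hx k => by
        rw [pow_one]
        refine (hC₁ k j y hy η hηm x hx).trans ?_
        gcongr
        exact Finset.single_le_sum (f := C₁) (fun k _ => hC₁0 k) (Finset.mem_univ k)) hA ht
    simp only [sub_self, Pi.zero_apply, mul_zero, Finset.sum_const_zero, sub_zero] at h1
    have h2 : f j y t - f j y η - ∑ k, pd k (f j y) η * (t - η) k
      = f j y t - (∑ k, pd k (f j y) η * (t - η) k) - f j y η := by ring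
    rw [h2]
    refine h1.trans ?_
    have : 0 ≤ N * (N * A') * ‖t - η‖ ^ 2 := by positivity
    change N * A * ‖t - η‖ ^ 2 ≤ _
    linarith
  · have hgrad : ∀ x ∈ Metric.closedBall η ρ, ∀ l, |pd l (f j y) x - pd l (f j y) η
        - ∑ k, pd k (pd l (f j y)) η * (x - η) k| ≤ N * A' * ‖x - η‖ ^ 2 := by
      intro x hx l
      have h1 := abs_sub_le_of_gradient (r := 1) (C := A')
        (G := fun t => pd l (f j y) t
          - ∑ k, pd k (pd l (f j y)) η * (t - η) k)
        (v := fun t k => pd k (pd l (f j y)) t - pd k (pd l (f j y)) η)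
        (η := η) (ρ := ρ)
        (fun x hx => by
          have := ((hpd l).hasFDerivAt (hdm x hx)).sub
            (hlin (fun k => pd k (pd l (f j y)) η) x)
          rw [hadd] at this
          exact this)
        (fun x hx k => by
          rw [pow_one]
          refine (hC₂ k l j y hy η hηm x hx).trans ?_
          gcongr
          refine le_trans ?_ (Finset.single_le_sum (f := fun k => ∑ l, C₂ k l)
            (fun k _ => Finset.sum_nonneg fun l _ => hC₂0 k l) (Finset.mem_univ k))
          exact Finset.single_le_sum (f := C₂ k) (fun l _ => hC₂0 k l) (Finset.mem_univ l)) hA' hx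
      simp only [sub_self, Pi.zero_apply, mul_zero, Finset.sum_const_zero, sub_zero] at h1
      have h2 : pd l (f j y) x - pd l (f j y) η
          - ∑ k, pd k (pd l (f j y)) η * (x - η) k
        = pd l (f j y) x - (∑ k, pd k (pd l (f j y)) η * (x - η) k)
          - pd l (f j y) η := by ring
      rw [h2]; exact h1
    -- Symmetry of the second partial derivatives merges the two sums produced by the product rule,
    -- which cancels the factor 1/2.
    have hquad : ∀ x : Par p, HasFDerivAt (fun t : Par p => 1 / 2 * ∑ k, ∑ l,
        pd k (pd l (f j y)) η * (t - η) k * (t - η) l)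
        (form fun l => ∑ k, pd k (pd l (f j y)) η * (x - η) k) x := by
      intro x
      have hc : ∀ k : Idx p, HasFDerivAt (fun t : Par p => (t - η) k)
          (ContinuousLinearMap.proj k : Par p →L[ℝ] ℝ) x := fun k =>
        ((ContinuousLinearMap.proj k : Par p →L[ℝ] ℝ).hasFDerivAt.comp x
          ((hasFDerivAt_id x).sub_const η))
      have h1 := (HasFDerivAt.fun_sum fun k (_ : k ∈ Finset.univ) =>
        HasFDerivAt.fun_sum fun l (_ : l ∈ Finset.univ) =>
        ((hc k).const_mul (pd k (pd l (f j y)) η)).mul (hc l)).const_mul (1 / 2 : ℝ)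
      refine h1.congr_fderiv ?_
      ext1 h
      simp only [_root_.sum_apply, _root_.smul_apply, _root_.add_apply, smul_eq_mul,
        ContinuousLinearMap.proj_apply, form_apply, Finset.sum_add_distrib, Finset.sum_mul]
      have e : ∑ k, ∑ l, (x - η) l * (pd k (pd l (f j y)) η * h k)
          = ∑ k, ∑ l, pd k (pd l (f j y)) η * (x - η) k * h l := by
        rw [Finset.sum_comm]
        refine Finset.sum_congr rfl fun l _ => Finset.sum_congr rfl fun k _ => ?_
        have := hf.pd_comm (hdm η hηm) k l
        change pd k (pd l (f j y)) η = pd l (pd k (f j y)) η at this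
        rw [this]; ring
      rw [e, Finset.sum_comm (f := fun i l => pd l (pd i (f j y)) η * (x - η) l * h i)]
      ring
    have h1 := abs_sub_le_of_gradient (r := 2) (C := N * A')
      (G := fun t => (f j y t - ∑ k, pd k (f j y) η * (t - η) k)
        - 1 / 2 * ∑ k, ∑ l, pd k (pd l (f j y)) η * (t - η) k * (t - η) l)
      (v := fun t l => pd l (f j y) t - pd l (f j y) η
        - ∑ k, pd k (pd l (f j y)) η * (t - η) k) (η := η) (ρ := ρ)
      (fun x hx => by
        have := ((hf.hasFDerivAt (hdm x hx)).sub (hlin (fun k => pd k (f j y) η) x)).sub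
          (hquad x)
        rw [hadd, hadd] at this
        exact this)
      hgrad (by positivity) ht
    simp only [sub_self, Pi.zero_apply, mul_zero, Finset.sum_const_zero, sub_zero] at h1
    have h2 : f j y t - f j y η - ∑ k, pd k (f j y) η * (t - η) k
        - 1 / 2 * ∑ k, ∑ l, pd k (pd l (f j y)) η * (t - η) k * (t - η) l
      = f j y t - (∑ k, pd k (f j y) η * (t - η) k)
        - (1 / 2 * ∑ k, ∑ l, pd k (pd l (f j y)) η * (t - η) k * (t - η) l)
        - f j y η := by ring
    rw [h2]
    refine h1.trans ?_
    have : 0 ≤ N * A * ‖t - η‖ ^ 3 := by positivity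
    change N * (N * A') * ‖t - η‖ ^ 3 ≤ _
    linarith

end Bounds

end Model
end NEFQVF

namespace NEFQVF
namespace Model

variable {p : ℕ} {M : Model p}

/-! ### The closed forms are smooth families -/

/-- The determinant of `Σ_j` as a function of the size, of `ν` and of the values of `Q`, `Q'`. -/
def detForm (w n ν q t : ℝ) : ℝ :=
  2 * ν * (1 + n⁻¹ * (ν - w)) * (ν * n⁻¹ + 1) ^ 2 * (1 + w * n⁻¹)
    * ((ν - w) ^ 2 * (ν - 3 * w))⁻¹ * q ^ 2 * (q * (ν - w)⁻¹ + t ^ 2 * ((ν - 2 * w) ^ 2)⁻¹)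

lemma nu_sub_two_pos {ν v : ℝ} (hν : 0 < ν) (hv : 3 * v < ν) : 0 < ν - 2 * v := by
  rcases le_or_gt v 0 with h | h <;> linarith

lemma nu_sub_one_pos {ν v : ℝ} (hν : 0 < ν) (hv : 3 * v < ν) : 0 < ν - v := by
  rcases le_or_gt v 0 with h | h <;> linarith

lemma detForm_pos {w n ν q t : ℝ} (hn : 0 < n) (hnw : 0 < n + w) (hν : 0 < ν) (hv : 3 * w < ν)
    (hq : 0 < q) : 0 < detForm w n ν q t := by
  have h1 := nu_sub_one_pos hν hv
  have h2 := nu_sub_two_pos hν hv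
  have h3 : 0 < ν - 3 * w := by linarith
  have h4 : 0 < 1 + w * n⁻¹ := by
    have : 1 + w * n⁻¹ = (n + w) * n⁻¹ := by field_simp
    rw [this]; positivity
  unfold detForm
  positivity

/-- The factored form makes positivity evident, factor by factor. This is what makes Σ invertible on
the domain and its inverse smooth. -/
lemma det_Sig {j : ℕ} {y : ℝ} {η : Par p} (h : M.arg j y η ∈ M.dom) :
    (M.Sig j η).det = detForm M.v₂ (M.n j) (nu η) (M.Q (M.mean j η)) (M.Q' (M.mean j η)) := by
  obtain ⟨hn, -, -, hν, hv⟩ := h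
  change 0 < M.n j at hn
  change 0 < nu η at hν
  change 3 * M.v₂ < nu η at hv
  have h1 := (nu_sub_one_pos hν hv).ne'
  have h2 := (nu_sub_two_pos hν hv).ne'
  have h3 : nu η - 3 * M.v₂ ≠ 0 := by linarith
  rw [Sig, Matrix.det_fin_two_of]
  unfold mu2 mu3 mu4 xiMoment2 xiMoment3 xiMoment4 detForm d
  generalize M.Q (M.mean j η) = q
  generalize M.Q' (M.mean j η) = t
  generalize M.v₂ = w at *
  generalize nu η = ν at *
  generalize M.n j = n at *
  -- The differences ν − kw are kept as atoms while denominators are cleared, and restored for the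
  -- final polynomial identity.
  generalize hA₁ : ν - w = A₁ at *
  generalize hA₂ : ν - 2 * w = A₂ at *
  generalize hA₃ : ν - 3 * w = A₃ at *
  field_simp
  subst hA₁ hA₂ hA₃
  ring

lemma det_Sig_pos {j : ℕ} {y : ℝ} {η : Par p} (h : M.arg j y η ∈ M.dom) :
    0 < (M.Sig j η).det := by
  rw [det_Sig h]
  obtain ⟨hn, hnw, hl, hν, hv⟩ := h
  exact detForm_pos hn hnw hν hv (M.Q_pos hl)

namespace SmoothFam

lemma inv_of {F : Arg p → ℝ} (hF : ContDiffOn ℝ ⊤ F M.dom) (h0 : ∀ e ∈ M.dom, F e ≠ 0)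
    {f : ℕ → ℝ → Par p → ℝ} (hf : ∀ j y η, M.arg j y η ∈ M.dom → f j y η = F (M.arg j y η)) :
    M.SmoothFam fun j y η => (f j y η)⁻¹ :=
  ⟨_, hF.inv h0, fun j y η h => by simp only [hf j y η h, Pi.inv_apply]⟩

lemma obs : M.SmoothFam fun _ y _ => y :=
  of_arg (F := fun e => e.1) contDiff_fst.contDiffOn

lemma size : M.SmoothFam fun j _ _ => M.n j :=
  of_arg (F := fun e => e.2.1) contDiff_snd.fst.contDiffOn

lemma covariate (k : Fin p) : M.SmoothFam fun j _ _ => M.x j k :=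
  of_arg (F := fun e => e.2.2.1 k) (by fun_prop)

lemma coord (k : Idx p) : M.SmoothFam fun _ _ η => η k :=
  of_arg (F := fun e => e.2.2.2 k) (by fun_prop)

lemma nu : M.SmoothFam fun _ _ η => nu η := coord (Sum.inr ())

lemma contDiffOn_meanArg :
    ContDiffOn ℝ ⊤ (fun e : Arg p => deriv M.ψ (e.2.2.1 ⬝ᵥ beta e.2.2.2)) M.dom :=
  M.contDiffOn_deriv_ψ.comp contDiff_linArg.contDiffOn fun _ h => h.2.2.1

lemma mean : M.SmoothFam fun j _ η => M.mean j η := of_arg contDiffOn_meanArg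

lemma comp_Q {f : ℕ → ℝ → Par p → ℝ} (hf : M.SmoothFam f) :
    M.SmoothFam fun j y η => M.Q (f j y η) := by
  unfold Q
  exact ((const _).add ((const _).mul hf)).add ((const _).mul (hf.pow 2))

lemma comp_Q' {f : ℕ → ℝ → Par p → ℝ} (hf : M.SmoothFam f) :
    M.SmoothFam fun j y η => M.Q' (f j y η) := by
  unfold Q'
  exact (const _).add ((const _).mul hf)

lemma inv_size : M.SmoothFam fun j _ _ => (M.n j)⁻¹ :=
  inv_of (F := fun e => e.2.1) contDiff_snd.fst.contDiffOn (fun _ h => h.1.ne') fun _ _ _ _ => rfl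

lemma inv_nu_sub (c : ℝ) (hc : ∀ ν, 0 < ν → 3 * M.v₂ < ν → ν - c ≠ 0) :
    M.SmoothFam fun _ _ η => (NEFQVF.nu η - c)⁻¹ :=
  inv_of (F := fun e => e.2.2.2 (Sum.inr ()) - c) (by fun_prop)
    (fun e h => hc _ h.2.2.2.1 h.2.2.2.2) fun _ _ _ _ => rfl

lemma inv_nu_one : M.SmoothFam fun _ _ η => (NEFQVF.nu η - M.v₂)⁻¹ :=
  inv_nu_sub _ fun _ h h' => (nu_sub_one_pos h h').ne'

lemma inv_nu_two : M.SmoothFam fun _ _ η => (NEFQVF.nu η - 2 * M.v₂)⁻¹ :=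
  inv_nu_sub _ fun _ h h' => (nu_sub_two_pos h h').ne'

lemma inv_nu_three : M.SmoothFam fun _ _ η => (NEFQVF.nu η - 3 * M.v₂)⁻¹ :=
  inv_nu_sub _ fun _ _ h' => by linarith

lemma inv_size_add_nu : M.SmoothFam fun j _ η => (M.n j + NEFQVF.nu η)⁻¹ :=
  inv_of (F := fun e => e.2.1 + e.2.2.2 (Sum.inr ())) (by fun_prop)
    (fun e h => (add_pos h.1 h.2.2.2.1).ne') fun _ _ _ _ => rfl

lemma lam : M.SmoothFam fun j _ η => M.lam j η :=
  inv_of (F := fun e => e.2.1 + e.2.2.2 (Sum.inr ()) - M.v₂) (by fun_prop)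
    (fun e h => by
      have h1 := nu_sub_one_pos h.2.2.2.1 h.2.2.2.2
      have h2 := h.1
      unfold NEFQVF.nu at h1
      linarith) fun _ _ _ _ => rfl

lemma phi : M.SmoothFam fun j _ η => M.phi j η := by
  unfold Model.phi
  simp only [div_eq_mul_inv]
  exact ((const 1).add (nu.mul inv_size)).mul inv_nu_one

lemma mu2 : M.SmoothFam fun j _ η => M.mu2 j η := by
  unfold Model.mu2
  simp only [div_eq_mul_inv]
  exact ((comp_Q mean).mul ((nu.mul inv_size).add (const 1))).mul inv_nu_one

lemma mu3 : M.SmoothFam fun j _ η => M.mu3 j η := by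
  unfold Model.mu3
  simp only [div_eq_mul_inv, mul_inv]
  exact ((((comp_Q mean).mul (comp_Q' mean)).mul ((nu.mul inv_size).add (const 1))).mul
    ((nu.mul inv_size).add (const 2))).mul (inv_nu_one.mul inv_nu_two)

lemma mu4 : M.SmoothFam fun j _ η => M.mu4 j η := by
  unfold Model.mu4 Model.xiMoment2 Model.xiMoment3 Model.xiMoment4 Model.d
  simp only [div_eq_mul_inv, mul_inv, ← inv_pow]
  have q := comp_Q (mean (M := M))
  have q' := comp_Q' (mean (M := M))
  have dd := (const (M := M) M.v₂).mul inv_size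
  have d1 := dd.add (const 1)
  have d2 := ((const 2).mul dd).add (const 1)
  have d3 := ((const 3).mul dd).add (const 1)
  refine ((((d1.mul d2).mul d3).mul ?_).add ((((((const 6).mul inv_size).mul q').mul d1).mul d2).mul
    ?_)).add (((d1.mul (inv_size.pow 2)).mul (((const 7).mul (q'.pow 2)).add
    ((((const 2).mul size).mul (((const 4).mul dd).add (const 3))).mul q))).mul
    (q.mul inv_nu_one)) |>.add ((((const 1).mul (inv_size.pow 3)).mul q).mul
    (((size.mul (((const 2).mul dd).add (const 3))).mul q).add (q'.pow 2)))
  · exact (((const 3).mul q).mul (((nu.sub (const _)).mul q).add ((const 2).mul (q'.pow 2)))).mul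
      ((inv_nu_one.mul inv_nu_two).mul inv_nu_three)
  · exact (((const 2).mul q).mul q').mul (inv_nu_one.mul inv_nu_two)

lemma Sig (a c : Fin 2) : M.SmoothFam fun j _ η => M.Sig j η a c := by
  fin_cases a <;> fin_cases c
  · exact mu2
  · exact mu3
  · exact mu3
  · exact mu4.sub (mu2.pow 2)

lemma inv_det_Sig : M.SmoothFam fun j _ η => ((M.Sig j η).det)⁻¹ := by
  refine inv_of (F := fun e => detForm M.v₂ e.2.1 (e.2.2.2 (Sum.inr ()))
    (M.Q (deriv M.ψ (e.2.2.1 ⬝ᵥ beta e.2.2.2))) (M.Q' (deriv M.ψ (e.2.2.1 ⬝ᵥ beta e.2.2.2))))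
    ?_ (fun e h => ?_) fun j y η h => det_Sig h
  · have hm := contDiffOn_meanArg (M := M)
    have hn : ContDiffOn ℝ ⊤ (fun e : Arg p => (e.2.1)⁻¹) M.dom :=
      contDiff_snd.fst.contDiffOn.inv fun _ h => h.1.ne'
    have hν : ContDiffOn ℝ ⊤ (fun e : Arg p => e.2.2.2 (Sum.inr ())) M.dom := by fun_prop
    have h1 : ContDiffOn ℝ ⊤ (fun e : Arg p => (e.2.2.2 (Sum.inr ()) - M.v₂)⁻¹) M.dom :=
      (hν.sub contDiffOn_const).inv fun _ h => (nu_sub_one_pos h.2.2.2.1 h.2.2.2.2).ne'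
    have h2 : ContDiffOn ℝ ⊤ (fun e : Arg p => (e.2.2.2 (Sum.inr ()) - 2 * M.v₂)⁻¹) M.dom :=
      (hν.sub contDiffOn_const).inv fun _ h => (nu_sub_two_pos h.2.2.2.1 h.2.2.2.2).ne'
    have h3 : ContDiffOn ℝ ⊤ (fun e : Arg p => (e.2.2.2 (Sum.inr ()) - 3 * M.v₂)⁻¹) M.dom :=
      (hν.sub contDiffOn_const).inv fun _ h => (sub_pos.2 h.2.2.2.2).ne'
    unfold detForm Q Q'
    simp only [mul_inv, ← inv_pow]
    fun_prop
  · exact (detForm_pos h.1 h.2.1 h.2.2.2.1 h.2.2.2.2 (M.Q_pos h.2.2.1)).ne'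

lemma inv_Sig (a c : Fin 2) : M.SmoothFam fun j _ η => (M.Sig j η)⁻¹ a c := by
  simp only [Matrix.inv_def, Ring.inverse_eq_inv', Matrix.smul_apply, smul_eq_mul]
  refine inv_det_Sig.mul ?_
  simp only [Matrix.adjugate_fin_two]
  fin_cases a <;> fin_cases c
  · exact Sig 1 1
  · exact (Sig 0 1).neg
  · exact (Sig 1 0).neg
  · exact Sig 0 0

lemma D (a : Fin 2) (k : Idx p) : M.SmoothFam fun j _ η => M.D j η a k := by
  have q := comp_Q (mean (M := M))
  unfold Model.D
  simp only [Matrix.of_apply, Pi.smul_apply, smul_eq_mul]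
  refine q.mul ?_
  rcases k with k | k <;> fin_cases a
  · exact covariate k
  · exact ((comp_Q' mean).mul phi).mul (covariate k)
  · exact const 0
  · have := ((const 1).add ((const M.v₂).mul (inv_size (M := M)))).neg.mul (inv_nu_one.pow 2)
    refine this.congr fun j y η _ => ?_
    simp [div_eq_mul_inv]

lemma W (l : Idx p) (a : Fin 2) : M.SmoothFam fun j _ η => M.W j η l a := by
  unfold Model.W
  simp only [Matrix.mul_apply, Matrix.transpose_apply]
  exact sum _ fun c _ => (D c l).mul (inv_Sig c a)

lemma g (a : Fin 2) : M.SmoothFam fun j y η => M.g j y η a := by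
  unfold Model.g
  fin_cases a
  · exact obs.sub mean
  · exact ((obs.sub mean).pow 2).sub (phi.mul (comp_Q mean))

lemma xiHat : M.SmoothFam fun j y η => M.xiHat j y η := by
  unfold Model.xiHat
  simp only [div_eq_mul_inv]
  exact ((size.mul obs).add (nu.mul mean)).mul inv_size_add_nu

lemma T1 : M.SmoothFam fun j y η => M.T1 j y η := by
  unfold Model.T1
  simp only [div_eq_mul_inv]
  exact (comp_Q xiHat).mul lam

/-- As a partial derivative of a smooth family it is smooth without inspecting the closed form. The
same device serves `r` and `R`. -/
lemma xiGrad (k : Idx p) : M.SmoothFam fun j y η => M.xiGrad j y η k := by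
  refine (xiHat.pderiv k).congr fun j y η h => ?_
  exact (pd_eq_of_hasFDerivAt (M.hasFDerivAt_xiHat h.2.2.1 h.2.2.2.1) k).symm

lemma Pmat (k l : Idx p) : M.SmoothFam fun j y η => M.Pmat j y η k l :=
  ((xiGrad k).mul (xiGrad l)).congr fun _ _ _ _ => M.Pmat_eq ..

lemma nu_gt_of_mem {j : ℕ} {y : ℝ} {η : Par p} (h : M.arg j y η ∈ M.dom) : M.v₂ < NEFQVF.nu η :=
  sub_pos.1 (nu_sub_one_pos h.2.2.2.1 h.2.2.2.2)

lemma r (k : Idx p) : M.SmoothFam fun j y η => M.r j y η k := by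
  refine (T1.pderiv k).congr fun j y η h => ?_
  exact (pd_eq_of_hasFDerivAt (M.hasFDerivAt_T1 h.2.2.1 h.2.2.2.1 (nu_gt_of_mem h)) k).symm

lemma R (k l : Idx p) : M.SmoothFam fun j y η => M.R j y η k l := by
  refine ((r k).pderiv l).congr fun j y η h => ?_
  exact (pd_eq_of_hasFDerivAt (M.hasFDerivAt_r h.2.2.1 h.2.2.2.1 (nu_gt_of_mem h) k) l).symm

end SmoothFam

end Model
end NEFQVF

namespace NEFQVF
namespace Model

variable {p : ℕ} (M : Model p)

/-! ### Functions of the direct estimate which are affine in `g_j` -/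

/-- `c_j + ∑ a, α_{ja} g_{ja}`. -/
def aff (c : ℕ → Par p → ℝ) (α : Fin 2 → ℕ → Par p → ℝ) (j : ℕ) (y : ℝ) (η : Par p) : ℝ :=
  c j η + ∑ a, α a j η * M.g j y η a

/-- The constant part of the partial derivative of `aff c α`. -/
def pdConst (k : Idx p) (c : ℕ → Par p → ℝ) (α : Fin 2 → ℕ → Par p → ℝ) (j : ℕ) (η : Par p) : ℝ :=
  pd k (c j) η - ∑ a, α a j η * M.D j η a k

/-- The coefficients of `g_j` in the partial derivative of `aff c α`. -/
def pdCoef (k : Idx p) (α : Fin 2 → ℕ → Par p → ℝ) (a : Fin 2) (j : ℕ) (η : Par p) : ℝ :=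
  pd k (α a j) η - ![2 * α 1 j η * M.D j η 0 k, 0] a

/-- The coefficients of `g_j` in the contribution of area `j` to the score. -/
def scoreCoef (l : Idx p) (a : Fin 2) (j : ℕ) (η : Par p) : ℝ := M.W j η l a

/-- The contribution of area `j` to the score. -/
def areaScore (l : Idx p) : ℕ → ℝ → Par p → ℝ := M.aff (fun _ _ => 0) (M.scoreCoef l)

variable {M}

lemma D_zero (j : ℕ) (η : Par p) (k : Idx p) :
    M.D j η 0 k = M.Q (M.mean j η) * M.xvec j k := by
  rcases k with k | k <;> simp [D, xvec]

lemma score_apply (m : ℕ) (y : Fin m → ℝ) (η : Par p) (l : Idx p) :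
    M.score m y η l = ∑ j : Fin m, M.areaScore l j (y j) η := by
  simp [score, areaScore, aff, scoreCoef, Matrix.mulVec, dotProduct, Finset.sum_apply]

/-! ### First derivatives of the mean, of the variance and of `g` -/

section Derivatives

variable {j : ℕ} {y : ℝ} {η : Par p}

lemma pd_mean (h : M.arg j y η ∈ M.dom) (k : Idx p) :
    pd k (fun t => M.mean j t) η = M.D j η 0 k := by
  have h1 : HasFDerivAt (M.mean j) _ η := M.hasFDerivAt_mean j (η := η) h.2.2.1
  have h2 : pd k (M.mean j) η = M.D j η 0 k := by
    rw [pd, HasFDerivAt.fderiv h1, _root_.smul_apply, form_single, D_zero, smul_eq_mul]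
  exact h2

/-- The second row of `D` is the gradient of the marginal variance φQ, as the first row is the
gradient of the mean. -/
lemma pd_variance (h : M.arg j y η ∈ M.dom) (k : Idx p) :
    pd k (fun t => M.phi j t * M.Q (M.mean j t)) η = M.D j η 1 k := by
  have hm : HasFDerivAt (M.mean j) _ η := M.hasFDerivAt_mean j (η := η) h.2.2.1
  have hν := nu_sub_one_pos h.2.2.2.1 h.2.2.2.2
  change 0 < nu η - M.v₂ at hν
  have hn : M.n j ≠ 0 := h.1.ne'
  have hq : HasFDerivAt (fun t => M.Q (M.mean j t)) _ η :=
    (M.hasDerivAt_Q (M.mean j η)).comp_hasFDerivAt η hm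
  have h0 : HasFDerivAt (fun t : Par p => (nu t - M.v₂)⁻¹) _ η :=
    (hasDerivAt_inv hν.ne').comp_hasFDerivAt η ((hasFDerivAt_nu η).sub_const M.v₂)
  have h1 : HasFDerivAt (fun t : Par p => (1 + nu t * (M.n j)⁻¹) * (nu t - M.v₂)⁻¹) _ η :=
    (((hasFDerivAt_nu η).mul_const (M.n j)⁻¹).const_add 1).mul h0
  have h2 : HasFDerivAt (fun t => ((1 + nu t * (M.n j)⁻¹) * (nu t - M.v₂)⁻¹) * M.Q (M.mean j t)) _
    η := h1.mul hq
  have e : (fun t => M.phi j t * M.Q (M.mean j t)) = fun t =>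
      ((1 + nu t * (M.n j)⁻¹) * ((nu t - M.v₂)⁻¹)) * M.Q (M.mean j t) := by
    ext t; simp only [phi, div_eq_mul_inv]
  rw [pd, e, h2.fderiv]
  simp only [_root_.add_apply, _root_.smul_apply, form_single, smul_eq_mul]
  rcases k with k | k
  · simp [nuvec, D, xvec, phi]
    field_simp
  · simp [nuvec, D, xvec]
    field_simp
    left
    ring

/-- The derivative of the square produces 2(y − m), a multiple of the first entry of g. Hence
derivatives of g are affine in g again. -/
lemma pd_g (h : M.arg j y η ∈ M.dom) (k : Idx p) (a : Fin 2) :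
    pd k (fun t => M.g j y t a) η
      = -M.D j η a k - ![0, 2 * M.D j η 0 k * M.g j y η 0] a := by
  have hm := SmoothFam.mean.differentiableAt h
  have hv := (SmoothFam.phi.mul (SmoothFam.comp_Q SmoothFam.mean)).differentiableAt h
  fin_cases a
  · have : pd k (fun t => M.g j y t 0) η = -pd k (fun t => M.mean j t) η := by
      simp only [pd, g, Matrix.cons_val_zero]
      rw [fderiv_const_sub]; rfl
    simpa [pd_mean h] using this
  · have e : (fun t => M.g j y t 1)
        = fun t => (y - M.mean j t) * (y - M.mean j t) + (-1) * (M.phi j t * M.Q (M.mean j t)) := by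
      ext t; simp [g]; ring
    have hs : DifferentiableAt ℝ (fun t => y - M.mean j t) η := hm.const_sub y
    have hd : pd k (fun t => y - M.mean j t) η = -M.D j η 0 k := by
      rw [← pd_mean h, pd, fderiv_const_sub]; rfl
    have hc : pd k (fun t : Par p => (-1) * (M.phi j t * M.Q (M.mean j t))) η = -M.D j η 1 k := by
      rw [pd_mul (differentiableAt_const _) hv, pd_variance h]
      simp [pd]
    show pd k (fun t => M.g j y t 1) η = _
    rw [e, pd_add (hs.fun_mul hs) (hv.const_mul (-1)), pd_mul hs hs, hd, hc]
    simp [g]; ring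

end Derivatives

namespace SmoothFam

variable {c : ℕ → Par p → ℝ} {α : Fin 2 → ℕ → Par p → ℝ}
  (hc : M.SmoothFam fun j _ η => c j η) (hα : ∀ a, M.SmoothFam fun j _ η => α a j η)

include hα in
lemma aff_zero : M.SmoothFam (M.aff (fun _ _ => 0) α) := by
  unfold Model.aff
  exact (const 0).add (sum _ fun a _ => (hα a).mul (g a))

include hc hα

lemma pdConst (k : Idx p) : M.SmoothFam fun j _ η => M.pdConst k c α j η := by
  unfold Model.pdConst
  exact (hc.pderiv k).sub (sum _ fun a _ => (hα a).mul (D a k))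

omit hc in
lemma pdCoef (k : Idx p) (a : Fin 2) : M.SmoothFam fun j _ η => M.pdCoef k α a j η := by
  unfold Model.pdCoef
  refine ((hα a).pderiv k).sub ?_
  fin_cases a
  · exact ((const 2).mul (hα 1)).mul (D 0 k)
  · exact const 0

/-- Functions affine in g are stable under differentiation. Since g is centred at the true
parameter, this splits the Jacobian and the second derivatives of the score into expectation and
fluctuation. -/
lemma pd_aff {j : ℕ} {y : ℝ} {η : Par p} (h : M.arg j y η ∈ M.dom) (k : Idx p) :
    pd k (M.aff c α j y) η = M.aff (M.pdConst k c α) (M.pdCoef k α) j y η := by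
  unfold Model.aff
  have h1 : ∀ a, DifferentiableAt ℝ (fun t => α a j t) η := fun a => (hα a).differentiableAt h
  have h2 : ∀ a, DifferentiableAt ℝ (fun t => M.g j y t a) η := fun a => (g a).differentiableAt h
  rw [pd_add (hc.differentiableAt h) (DifferentiableAt.fun_sum fun a _ => (h1 a).fun_mul (h2 a)),
    pd_sum _ fun a _ => (h1 a).fun_mul (h2 a)]
  simp only [pd_mul (h1 _) (h2 _), pd_g h, Fin.sum_univ_two, Model.pdConst, Model.pdCoef]
  simp
  ring

end SmoothFam

lemma SmoothFam.scoreCoef (l : Idx p) (a : Fin 2) :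
    M.SmoothFam fun j _ η => M.scoreCoef l a j η := SmoothFam.W l a

lemma SmoothFam.areaScore (l : Idx p) : M.SmoothFam (M.areaScore l) :=
  SmoothFam.aff_zero (SmoothFam.scoreCoef l)

variable (M) in
/-- The expectations of the partial derivatives of the score in area `j`. -/
def jacConst (l k : Idx p) : ℕ → Par p → ℝ := M.pdConst k (fun _ _ => 0) (M.scoreCoef l)

variable (M) in
/-- The coefficients of `g_j` in the partial derivatives of the score. -/
def jacCoef (l k : Idx p) : Fin 2 → ℕ → Par p → ℝ := M.pdCoef k (M.scoreCoef l)

variable (M) in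
/-- The expectations of the second partial derivatives of the score in area `j`. -/
def hessConst (l k k' : Idx p) : ℕ → Par p → ℝ := M.pdConst k (M.jacConst l k') (M.jacCoef l k')

variable (M) in
/-- The coefficients of `g_j` in the second partial derivatives of the score. -/
def hessCoef (l k k' : Idx p) : Fin 2 → ℕ → Par p → ℝ := M.pdCoef k (M.jacCoef l k')

lemma SmoothFam.jacConst (l k : Idx p) : M.SmoothFam fun j _ η => M.jacConst l k j η :=
  SmoothFam.pdConst (SmoothFam.const 0) (SmoothFam.scoreCoef l) k

lemma SmoothFam.jacCoef (l k : Idx p) (a : Fin 2) : M.SmoothFam fun j _ η => M.jacCoef l k a j η :=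
  SmoothFam.pdCoef (SmoothFam.scoreCoef l) k a

lemma SmoothFam.hessConst (l k k' : Idx p) : M.SmoothFam fun j _ η => M.hessConst l k k' j η :=
  SmoothFam.pdConst (SmoothFam.jacConst l k') (SmoothFam.jacCoef l k') k

lemma SmoothFam.hessCoef (l k k' : Idx p) (a : Fin 2) :
    M.SmoothFam fun j _ η => M.hessCoef l k k' a j η :=
  SmoothFam.pdCoef (SmoothFam.jacCoef l k') k a

lemma pd_areaScore {j : ℕ} {y : ℝ} {η : Par p} (h : M.arg j y η ∈ M.dom) (l k : Idx p) :
    pd k (M.areaScore l j y) η = M.aff (M.jacConst l k) (M.jacCoef l k) j y η :=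
  SmoothFam.pd_aff (SmoothFam.const 0) (SmoothFam.scoreCoef l) h k

lemma pd_pd_areaScore {j : ℕ} {y : ℝ} {η : Par p} (h : M.arg j y η ∈ M.dom) (l k k' : Idx p) :
    pd k (pd k' (M.areaScore l j y)) η
      = M.aff (M.hessConst l k k') (M.hessCoef l k k') j y η := by
  rw [hessConst, hessCoef, ← SmoothFam.pd_aff (SmoothFam.jacConst l k') (SmoothFam.jacCoef l k') h k]
  exact pd_congr ((SmoothFam.eventually_mem h).mono fun t ht => pd_areaScore ht l k') k

/-- The derivative of W multiplies the centred g, so only −W D remains in the mean. Summed over the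
areas, the expected Jacobian of the score is −U. -/
lemma jacConst_eq (l k : Idx p) (j : ℕ) (η : Par p) :
    M.jacConst l k j η = -(M.W j η * M.D j η) l k := by
  simp [jacConst, pdConst, pd, scoreCoef, Matrix.mul_apply]

lemma hessConst_eq {j : ℕ} {y : ℝ} {η : Par p} (h : M.arg j y η ∈ M.dom) (l k k' : Idx p) :
    M.hessConst l k k' j η =
      ∑ a, (-pd k (fun t => M.W j t l a) η * M.D j η a k'
        - pd k' (fun t => M.W j t l a) η * M.D j η a k + M.W j η l a * M.Z j η a k k') := by
  have h1 : ∀ a, DifferentiableAt ℝ (fun t => M.W j t l a) η :=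
    fun a => (SmoothFam.W l a).differentiableAt h
  have h2 : ∀ a, DifferentiableAt ℝ (fun t => M.D j t a k') η :=
    fun a => (SmoothFam.D a k').differentiableAt h
  have e : M.jacConst l k' j = fun t => ∑ a, -1 * (M.W j t l a * M.D j t a k') := by
    ext t; rw [jacConst_eq, Matrix.mul_apply, ← Finset.sum_neg_distrib]; simp
  rw [hessConst, pdConst, e, pd_sum _ fun a _ => ((h1 a).fun_mul (h2 a)).const_mul (-1)]
  have e2 : ∀ a, pd k (fun t => -1 * (M.W j t l a * M.D j t a k')) η
      = -(pd k (fun t => M.W j t l a) η * M.D j η a k' + M.W j η l a * pd k (fun t => M.D j t a k') η) := by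
    intro a
    rw [pd_mul (differentiableAt_const _) ((h1 a).fun_mul (h2 a)), pd_mul (h1 a) (h2 a)]
    simp [pd]
  have e3 : ∀ a, M.scoreCoef l a j = fun t => M.W j t l a := fun _ => rfl
  have e4 : 2 * M.Q (M.mean j η) ^ 2 * M.xvec j k * M.xvec j k' = 2 * M.D j η 0 k * M.D j η 0 k' := by
    rw [D_zero, D_zero]; ring
  simp only [e2, jacCoef, pdCoef, Z, Fin.sum_univ_two, e3, e4]
  simp
  ring

lemma W_mul_Sig {j : ℕ} {y : ℝ} {η : Par p} (h : M.arg j y η ∈ M.dom) :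
    M.W j η * M.Sig j η = (M.D j η)ᵀ := by
  rw [W, Matrix.mul_assoc, Matrix.nonsing_inv_mul _ (det_Sig_pos h).ne'.isUnit, Matrix.mul_one]

lemma Sig_transpose (j : ℕ) (η : Par p) : (M.Sig j η)ᵀ = M.Sig j η := by
  ext a c; fin_cases a <;> fin_cases c <;> rfl

lemma U_transpose (m : ℕ) (η : Par p) : (M.U m η)ᵀ = M.U m η := by
  simp only [U, Matrix.transpose_sum, Matrix.transpose_mul, W, Matrix.transpose_transpose,
    Matrix.transpose_nonsing_inv, Sig_transpose, Matrix.mul_assoc]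

lemma U_inv_symm (m : ℕ) (η : Par p) (k l : Idx p) : (M.U m η)⁻¹ k l = (M.U m η)⁻¹ l k := by
  conv_lhs => rw [← U_transpose, ← Matrix.transpose_nonsing_inv]
  rfl

end Model
end NEFQVF

namespace NEFQVF

variable {Ω : Type*} {m₀ mΩ : MeasurableSpace Ω} {P : Measure Ω}

/-! ### Sequences whose conditional expectation is `o(1/m)` in mean -/

/-- The conditional expectation of `V m` given `m₀` is `o(1/m)` in `L¹`. -/
def Negl (P : Measure Ω) (m₀ : MeasurableSpace Ω) (V : ℕ → Ω → ℝ) : Prop :=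
  (∀ᶠ m in atTop, Integrable (V m) P) ∧
    Tendsto (fun m : ℕ => (m : ℝ) * ∫ ω, |(P[V m | m₀]) ω| ∂P) atTop (𝓝 0)

namespace Negl

variable {V V' : ℕ → Ω → ℝ}

lemma of_le (hV : ∀ᶠ m in atTop, Integrable (V m) P) {u : ℕ → ℝ} (hu : Tendsto u atTop (𝓝 0))
    (h : ∀ᶠ m : ℕ in atTop, (m : ℝ) * ∫ ω, |(P[V m | m₀]) ω| ∂P ≤ u m) : Negl P m₀ V :=
  ⟨hV, squeeze_zero' (Eventually.of_forall fun m => by positivity) h hu⟩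

lemma of_integral_abs (hV : ∀ᶠ m in atTop, Integrable (V m) P)
    (h : Tendsto (fun m : ℕ => (m : ℝ) * ∫ ω, |V m ω| ∂P) atTop (𝓝 0)) : Negl P m₀ V :=
  of_le hV h (Eventually.of_forall fun m =>
    mul_le_mul_of_nonneg_left (integral_abs_condExp_le _) (Nat.cast_nonneg m))

lemma of_condExp (hV : ∀ᶠ m in atTop, Integrable (V m) P)
    (h : ∀ᶠ m in atTop, P[V m | m₀] =ᵐ[P] 0) : Negl P m₀ V := by
  refine of_le hV (u := fun _ => 0) tendsto_const_nhds (h.mono fun m hm => ?_)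
  rw [integral_congr_ae (g := fun _ => 0) (hm.mono fun ω hω => by simp [hω])]
  simp

lemma add (h : Negl P m₀ V) (h' : Negl P m₀ V') : Negl P m₀ fun m ω => V m ω + V' m ω := by
  refine of_le (h.1.and h'.1 |>.mono fun m hm => hm.1.add hm.2)
    (by simpa using h.2.add h'.2) (h.1.and h'.1 |>.mono fun m hm => ?_)
  rw [← mul_add, ← integral_add integrable_condExp.abs integrable_condExp.abs]
  refine mul_le_mul_of_nonneg_left ?_ (Nat.cast_nonneg m)
  refine integral_mono_ae integrable_condExp.abs
    (integrable_condExp.abs.add integrable_condExp.abs) ?_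
  have e : P[fun ω => V m ω + V' m ω | m₀] =ᵐ[P] P[V m | m₀] + P[V' m | m₀] :=
    condExp_add hm.1 hm.2 m₀
  filter_upwards [e] with ω hω
  rw [hω]
  exact abs_add_le _ _

lemma congr (h : Negl P m₀ V) (e : ∀ᶠ m in atTop, V' m =ᵐ[P] V m) : Negl P m₀ V' := by
  refine of_le (h.1.and e |>.mono fun m hm => hm.1.congr hm.2.symm) h.2 (e.mono fun m hm => ?_)
  have := condExp_congr_ae (m := m₀) hm
  rw [integral_congr_ae (this.mono fun ω hω => by rw [hω])]

lemma zero : Negl P m₀ fun _ _ => 0 :=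
  of_condExp (Eventually.of_forall fun _ => integrable_zero _ _ _)
    (Eventually.of_forall fun _ => by
      have : (fun _ : Ω => (0 : ℝ)) = 0 := rfl
      rw [this, condExp_zero])

lemma sum {ι : Type*} (s : Finset ι) {V : ι → ℕ → Ω → ℝ} (h : ∀ i ∈ s, Negl P m₀ (V i)) :
    Negl P m₀ fun m ω => ∑ i ∈ s, V i m ω := by
  classical
  induction s using Finset.induction_on with
  | empty => simpa using zero
  | insert a s ha ih =>
    simp only [Finset.sum_insert ha]
    exact (h a (Finset.mem_insert_self a s)).add
      (ih fun i hi => h i (Finset.mem_insert_of_mem hi))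

lemma mul [IsFiniteMeasure P] (hm₀ : m₀ ≤ mΩ) (h : Negl P m₀ V) {c : ℕ → Ω → ℝ} {C : ℝ}
    (hc : ∀ m, StronglyMeasurable[m₀] (c m)) (hC : ∀ᶠ m in atTop, ∀ ω, |c m ω| ≤ C) :
    Negl P m₀ fun m ω => c m ω * V m ω := by
  refine of_le (h.1.and hC |>.mono fun m hm => ?_) (u := fun m => C * (m * ∫ ω, |(P[V m | m₀]) ω| ∂P))
    (by simpa using h.2.const_mul C) (h.1.and hC |>.mono fun m hm => ?_)
  · exact hm.1.bdd_mul (c := C) ((hc m).mono hm₀).aestronglyMeasurable (ae_of_all _ hm.2)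
  · have e : P[fun ω => c m ω * V m ω | m₀] =ᵐ[P] c m * P[V m | m₀] :=
      condExp_stronglyMeasurable_mul_of_bound hm₀ (hc m) hm.1 C (ae_of_all _ hm.2)
    calc (m : ℝ) * ∫ ω, |(P[fun ω => c m ω * V m ω | m₀]) ω| ∂P
        ≤ m * ∫ ω, C * |(P[V m | m₀]) ω| ∂P := by
          refine mul_le_mul_of_nonneg_left ?_ (Nat.cast_nonneg m)
          refine integral_mono_ae integrable_condExp.abs (integrable_condExp.abs.const_mul C) ?_
          filter_upwards [e] with ω hω
          rw [hω, Pi.mul_apply, abs_mul]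
          exact mul_le_mul_of_nonneg_right (hm.2 ω) (abs_nonneg _)
      _ = _ := by rw [integral_const_mul]; ring

lemma const_mul [IsFiniteMeasure P] (hm₀ : m₀ ≤ mΩ) (h : Negl P m₀ V) {c : ℕ → ℝ} {C : ℝ}
    (hC : ∀ᶠ m in atTop, |c m| ≤ C) : Negl P m₀ fun m ω => c m * V m ω :=
  h.mul hm₀ (c := fun m _ => c m) (fun _ => stronglyMeasurable_const) (hC.mono fun _ h _ => h)

end Negl

/-! ### Sums of functions of independent variables -/

section Sums

variable [IsProbabilityMeasure P] {y : ℕ → Ω → ℝ}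

lemma condExp_of_indepFun (hy : ∀ j, Measurable (y j)) {G : Ω → ℝ} (hG : Measurable G) {i : ℕ}
    (h : IndepFun G (y i) P) : P[G | sigmaOf y i] =ᵐ[P] fun _ => ∫ ω, G ω ∂P :=
  condExp_indep_eq hG.comap_le (hy i).comap_le (comap_measurable G).stronglyMeasurable h

variable (hy : ∀ j, Measurable (y j)) (hind : iIndepFun y P)
  {f f' : ℕ → ℝ → ℝ} (hf : ∀ j, Measurable (f j)) (hf' : ∀ j, Measurable (f' j))
  (h2 : ∀ j, MemLp (fun ω => f j (y j ω)) 2 P) (h2' : ∀ j, MemLp (fun ω => f' j (y j ω)) 2 P)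
  (h0 : ∀ j, ∫ ω, f j (y j ω) ∂P = 0) (h0' : ∀ j, ∫ ω, f' j (y j ω) ∂P = 0)

include h2 h2' in
omit [IsProbabilityMeasure P] in
lemma integrable_mul_of_memLp (j k : ℕ) : Integrable (fun ω => f j (y j ω) * f' k (y k ω)) P :=
  (h2 j).integrable_mul (h2' k)

include h2 in
omit [IsProbabilityMeasure P] in
lemma memLp_sum (s : Finset ℕ) : MemLp (fun ω => ∑ j ∈ s, f j (y j ω)) 2 P :=
  memLp_finsetSum s fun j _ => h2 j

include h2 h0 in
lemma integral_sum_eq_zero (s : Finset ℕ) : ∫ ω, ∑ j ∈ s, f j (y j ω) ∂P = 0 := by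
  rw [integral_finsetSum _ fun j _ => (h2 j).integrable (by norm_num)]
  simp [h0]

include hind hf hf' h2 h2' h0 in
omit [IsProbabilityMeasure P] in
-- Off-diagonal products vanish by independence, for which centring one of the two factors is
-- enough.
lemma integral_sum_mul_sum (s : Finset ℕ) :
    ∫ ω, (∑ j ∈ s, f j (y j ω)) * (∑ j ∈ s, f' j (y j ω)) ∂P
      = ∑ j ∈ s, ∫ ω, f j (y j ω) * f' j (y j ω) ∂P := by
  have hi := integrable_mul_of_memLp h2 h2'
  simp only [Finset.sum_mul_sum]
  rw [integral_finsetSum _ fun j _ => integrable_finsetSum _ fun k _ => hi j k]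
  refine Finset.sum_congr rfl fun j hj => ?_
  rw [integral_finsetSum _ fun k _ => hi j k]
  refine Finset.sum_eq_single_of_mem j hj fun k _ hkj => ?_
  have hI : IndepFun (fun ω => f j (y j ω)) (fun ω => f' k (y k ω)) P :=
    (hind.indepFun hkj.symm).comp (hf j) (hf' k)
  rw [hI.integral_fun_mul_eq_mul_integral (h2 j).1 (h2' k).1, h0, zero_mul]

include hy hind in
lemma indepFun_erase (s : Finset ℕ) (i : ℕ) {φ : (s.erase i → ℝ) → ℝ} (hφ : Measurable φ) :
    IndepFun (fun ω => φ fun j => y j ω) (y i) P := by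
  have h := hind.indepFun_finset (s.erase i) {i} (by simp) hy
  exact h.comp (φ := φ) (ψ := fun t : (({i} : Finset ℕ) → ℝ) => t ⟨i, by simp⟩) hφ
    (measurable_pi_apply (⟨i, by simp⟩ : ({i} : Finset ℕ)))

include hf in
lemma measurable_sum_tuple (s : Finset ℕ) :
    Measurable fun t : s → ℝ => ∑ j : s, f j (t j) :=
  Finset.measurable_sum _ fun j _ => (hf j).comp (measurable_pi_apply j)

include hy hf in
lemma measurable_sum_comp (s : Finset ℕ) : Measurable fun ω => ∑ j ∈ s, f j (y j ω) :=
  Finset.measurable_sum _ fun j _ => (hf j).comp (hy j)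

include hy hind hf h2 h0 in
/-- Given `y_i`, a sum of centred independent terms has mean its `i`-th term. -/
lemma condExp_sum (s : Finset ℕ) {i : ℕ} (hi : i ∈ s) :
    P[fun ω => (∑ j ∈ s, f j (y j ω)) - f i (y i ω) | sigmaOf y i] =ᵐ[P] 0 := by
  have e : (fun ω => (∑ j ∈ s, f j (y j ω)) - f i (y i ω))
      = fun ω => ∑ j ∈ s.erase i, f j (y j ω) := by
    ext ω; rw [← Finset.sum_erase_add s _ hi]; ring
  have hI := indepFun_erase hy hind s i (φ := fun t => ∑ j : s.erase i, f j (t j))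
    (measurable_sum_tuple hf _)
  have e2 : (fun ω => ∑ j : s.erase i, f j (y j ω)) = fun ω => ∑ j ∈ s.erase i, f j (y j ω) := by
    ext ω; exact Finset.sum_coe_sort (s.erase i) fun j => f j (y j ω)
  rw [e2] at hI
  rw [e]
  refine (condExp_of_indepFun hy (measurable_sum_comp hy hf _) hI).trans ?_
  rw [integral_sum_eq_zero h2 h0]
  rfl

include hy hind hf hf' h2 h2' h0 h0' in
/-- Given `y_i`, a product of sums of centred independent terms has mean the sum of the
covariances, up to a correction for the `i`-th term. -/
lemma condExp_sum_mul_sum (s : Finset ℕ) {i : ℕ} (hi : i ∈ s) :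
    P[fun ω => (∑ j ∈ s, f j (y j ω)) * (∑ j ∈ s, f' j (y j ω))
        - ∑ j ∈ s, ∫ ω, f j (y j ω) * f' j (y j ω) ∂P | sigmaOf y i]
      =ᵐ[P] fun ω => f i (y i ω) * f' i (y i ω) - ∫ ω, f i (y i ω) * f' i (y i ω) ∂P := by
  set A : Ω → ℝ := fun ω => ∑ j ∈ s.erase i, f j (y j ω) with hA
  set A' : Ω → ℝ := fun ω => ∑ j ∈ s.erase i, f' j (y j ω) with hA'
  have hA2 : MemLp A 2 P := memLp_sum h2 _
  have hA2' : MemLp A' 2 P := memLp_sum h2' _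
  have hle := (hy i).comap_le
  have hsm : ∀ {φ : ℝ → ℝ}, Measurable φ → StronglyMeasurable[sigmaOf y i] (fun ω => φ (y i ω)) :=
    fun hφ => (hφ.comp (comap_measurable (y i))).stronglyMeasurable
  have e1 : P[A | sigmaOf y i] =ᵐ[P] 0 := by
    have := condExp_sum hy hind hf h2 h0 s hi
    refine (condExp_congr_ae (ae_of_all _ fun ω => ?_)).trans this
    simp only [hA]; rw [← Finset.sum_erase_add s _ hi]; ring
  have e1' : P[A' | sigmaOf y i] =ᵐ[P] 0 := by
    have := condExp_sum hy hind hf' h2' h0' s hi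
    refine (condExp_congr_ae (ae_of_all _ fun ω => ?_)).trans this
    simp only [hA']; rw [← Finset.sum_erase_add s _ hi]; ring
  have p1 : P[(fun ω => f i (y i ω)) * A' | sigmaOf y i] =ᵐ[P] 0 := by
    refine (condExp_mul_of_stronglyMeasurable_left (hsm (hf i)) ((h2 i).integrable_mul hA2')
      (hA2'.integrable (by norm_num))).trans ?_
    filter_upwards [e1'] with ω hω
    simp [hω]
  have p2 : P[(fun ω => f' i (y i ω)) * A | sigmaOf y i] =ᵐ[P] 0 := by
    refine (condExp_mul_of_stronglyMeasurable_left (hsm (hf' i)) ((h2' i).integrable_mul hA2)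
      (hA2.integrable (by norm_num))).trans ?_
    filter_upwards [e1] with ω hω
    simp [hω]
  have p3 : P[A * A' | sigmaOf y i]
      =ᵐ[P] fun _ => ∑ j ∈ s.erase i, ∫ ω, f j (y j ω) * f' j (y j ω) ∂P := by
    have hI := indepFun_erase hy hind s i
      (φ := fun t => (∑ j : s.erase i, f j (t j)) * (∑ j : s.erase i, f' j (t j)))
      ((measurable_sum_tuple hf _).mul (measurable_sum_tuple hf' _))
    have e2 : (fun ω => (∑ j : s.erase i, f j (y j ω)) * (∑ j : s.erase i, f' j (y j ω)))
        = A * A' := by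
      ext ω
      rw [Finset.sum_coe_sort (s.erase i) fun j => f j (y j ω),
        Finset.sum_coe_sort (s.erase i) fun j => f' j (y j ω)]
      rfl
    rw [e2] at hI
    have hm : Measurable (A * A') :=
      (measurable_sum_comp hy hf _).mul (measurable_sum_comp hy hf' _)
    refine (condExp_of_indepFun hy hm hI).trans ?_
    have := integral_sum_mul_sum hind hf hf' h2 h2' h0 (s.erase i)
    filter_upwards with ω
    rw [← this]; rfl
  set c := ∑ j ∈ s, ∫ ω, f j (y j ω) * f' j (y j ω) ∂P with hc
  have i0 : Integrable (fun ω => f i (y i ω) * f' i (y i ω) - c) P :=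
    (integrable_mul_of_memLp h2 h2' i i).sub (integrable_const c)
  have i1 : Integrable ((fun ω => f i (y i ω)) * A') P := (h2 i).integrable_mul hA2'
  have i2 : Integrable ((fun ω => f' i (y i ω)) * A) P := (h2' i).integrable_mul hA2
  have i3 : Integrable (A * A') P := hA2.integrable_mul hA2'
  -- Separate the i-th terms from the remainders A and A'. The mixed products have conditional mean
  -- zero, A A' is independent of y_i, and f_i f'_i is a function of y_i.
  have e : (fun ω => (∑ j ∈ s, f j (y j ω)) * (∑ j ∈ s, f' j (y j ω)) - c)
      = (fun ω => f i (y i ω) * f' i (y i ω) - c) + ((fun ω => f i (y i ω)) * A'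
        + ((fun ω => f' i (y i ω)) * A + A * A')) := by
    ext ω
    simp only [Pi.add_apply, Pi.mul_apply, hA, hA']
    rw [← Finset.sum_erase_add s _ hi, ← Finset.sum_erase_add s (fun j => f' j (y j ω)) hi]
    ring
  rw [e]
  have q0 : P[fun ω => f i (y i ω) * f' i (y i ω) - c | sigmaOf y i]
      = fun ω => f i (y i ω) * f' i (y i ω) - c :=
    condExp_of_stronglyMeasurable hle
      (hsm (φ := fun t => f i t * f' i t - c) (((hf i).mul (hf' i)).sub_const c)) i0
  filter_upwards [condExp_add i0 (i1.add (i2.add i3)) (sigmaOf y i),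
    condExp_add i1 (i2.add i3) (sigmaOf y i), condExp_add i2 i3 (sigmaOf y i), p1, p2, p3]
    with ω w1 w2 w3 w4 w5 w6
  have h9 := Finset.sum_erase_add s (fun j => ∫ ω, f j (y j ω) * f' j (y j ω) ∂P) hi
  rw [w1, Pi.add_apply, w2, Pi.add_apply, w3, Pi.add_apply, w4, w5, w6, q0, hc]
  simp only [Pi.zero_apply] at h9 ⊢
  linarith

include hy hind hf h2 h0 in
lemma negl_sum (i : ℕ) : Negl P (sigmaOf y i) fun m ω =>
    (m : ℝ)⁻¹ * ((∑ j ∈ Finset.range m, f j (y j ω)) - f i (y i ω)) := by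
  have hI : ∀ m : ℕ, Integrable (fun ω => (∑ j ∈ Finset.range m, f j (y j ω)) - f i (y i ω)) P :=
    fun m => ((memLp_sum h2 _).sub (h2 i)).integrable (by norm_num)
  refine Negl.of_condExp (Eventually.of_forall fun m => (hI m).const_mul _) ?_
  filter_upwards [eventually_gt_atTop i] with m hm
  have h1 := condExp_sum hy hind hf h2 h0 (Finset.range m) (Finset.mem_range.2 hm)
  have h3 := condExp_smul (μ := P) ((m : ℝ)⁻¹)
    (fun ω => (∑ j ∈ Finset.range m, f j (y j ω)) - f i (y i ω)) (sigmaOf y i)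
  refine h3.trans ?_
  filter_upwards [h1] with ω hω
  simp [hω]

include hy hind hf hf' h2 h2' h0 h0' in
-- The conditional mean is a fixed integrable variable times m⁻², so multiplication by m still
-- leaves a factor 1/m.
lemma negl_sum_mul_sum (i : ℕ) : Negl P (sigmaOf y i) fun m ω =>
    ((m : ℝ)⁻¹) ^ 2 * ((∑ j ∈ Finset.range m, f j (y j ω)) * (∑ j ∈ Finset.range m, f' j (y j ω))
      - ∑ j ∈ Finset.range m, ∫ ω, f j (y j ω) * f' j (y j ω) ∂P) := by
  set c := fun m => ∑ j ∈ Finset.range m, ∫ ω, f j (y j ω) * f' j (y j ω) ∂P with hc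
  have hI : ∀ m : ℕ, Integrable (fun ω => (∑ j ∈ Finset.range m, f j (y j ω)) *
      (∑ j ∈ Finset.range m, f' j (y j ω)) - c m) P :=
    fun m => ((memLp_sum h2 _).integrable_mul (memLp_sum h2' _)).sub (integrable_const _)
  set B := ∫ ω, |f i (y i ω) * f' i (y i ω) - ∫ ω, f i (y i ω) * f' i (y i ω) ∂P| ∂P with hB
  refine Negl.of_le (Eventually.of_forall fun m => (hI m).const_mul _)
    (u := fun m : ℕ => (m : ℝ)⁻¹ * B) (by simpa using tendsto_inv_atTop_nhds_zero_nat.mul_const B) ?_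
  filter_upwards [eventually_gt_atTop i] with m hm
  have h1 := condExp_sum_mul_sum hy hind hf hf' h2 h2' h0 h0' (Finset.range m)
    (Finset.mem_range.2 hm)
  have h3 := condExp_smul (μ := P) (((m : ℝ)⁻¹) ^ 2)
    (fun ω => (∑ j ∈ Finset.range m, f j (y j ω)) * (∑ j ∈ Finset.range m, f' j (y j ω)) - c m)
    (sigmaOf y i)
  have h4 : (fun ω => |(P[fun ω => ((m : ℝ)⁻¹) ^ 2 * ((∑ j ∈ Finset.range m, f j (y j ω)) *
      (∑ j ∈ Finset.range m, f' j (y j ω)) - c m) | sigmaOf y i]) ω|)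
      =ᵐ[P] fun ω => ((m : ℝ)⁻¹) ^ 2 *
        |f i (y i ω) * f' i (y i ω) - ∫ ω, f i (y i ω) * f' i (y i ω) ∂P| := by
    filter_upwards [h1, h3] with ω w1 w3
    have w3' := w3
    simp only [Pi.smul_apply, smul_eq_mul] at w3'
    have e : ((((m : ℝ)⁻¹) ^ 2) • fun ω => (∑ j ∈ Finset.range m, f j (y j ω)) *
      (∑ j ∈ Finset.range m, f' j (y j ω)) - c m) = fun ω => ((m : ℝ)⁻¹) ^ 2 *
      ((∑ j ∈ Finset.range m, f j (y j ω)) * (∑ j ∈ Finset.range m, f' j (y j ω)) - c m) := rfl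
    rw [e] at w3'
    rw [w3', w1, abs_mul, abs_of_nonneg (by positivity : (0 : ℝ) ≤ ((m : ℝ)⁻¹) ^ 2)]
  rw [integral_congr_ae h4, integral_const_mul, ← hB]
  have hm0 : (0 : ℝ) < m := by exact_mod_cast (Nat.zero_le i).trans_lt hm
  refine le_of_eq ?_
  field_simp

end Sums

end NEFQVF

namespace NEFQVF

/-! ### A moment inequality for sums of independent centred variables -/

/-- For r ≤ 1 monotonicity of x^(1−r) gives b a^r ≤ b^r a. The constant 2 dominates the factor 1 + r
of the derivative. -/
lemma rpow_mul_sub_le {a b r : ℝ} (hb : 0 ≤ b) (hab : b ≤ a) (hr : 0 < r) (hr1 : r ≤ 1) :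
    a ^ r * a - b ^ r * b ≤ 2 * a ^ r * (a - b) := by
  have ha : 0 ≤ a := hb.trans hab
  have h1 : b * a ^ r ≤ b ^ r * a := by
    have eb : b = b ^ r * b ^ (1 - r) := by
      rw [← Real.rpow_add_of_nonneg hb hr.le (by linarith)]; simp
    have ea : a = a ^ r * a ^ (1 - r) := by
      rw [← Real.rpow_add_of_nonneg ha hr.le (by linarith)]; simp
    calc b * a ^ r = b ^ r * b ^ (1 - r) * a ^ r := by rw [← eb]
      _ ≤ b ^ r * a ^ (1 - r) * a ^ r := by
        gcongr
      _ = b ^ r * (a ^ r * a ^ (1 - r)) := by ring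
      _ = b ^ r * a := by rw [← ea]
  have h2 : b ^ r ≤ a ^ r := Real.rpow_le_rpow hb hab hr.le
  nlinarith [sub_nonneg.2 hab]

lemma abs_rpow_mul_sub_le {u s r : ℝ} (hr : 0 < r) (hr1 : r ≤ 1) :
    |(|u| ^ r * u - |s| ^ r * s)| ≤ 2 * (|s| + |u - s|) ^ r * |u - s| := by
  have hM : |u| ≤ |s| + |u - s| := by
    have := abs_add_le s (u - s); simpa using this
  have hM' : |s| ≤ |s| + |u - s| := by linarith [abs_nonneg (u - s)]
  have hu := Real.rpow_le_rpow (abs_nonneg u) hM hr.le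
  have hs := Real.rpow_le_rpow (abs_nonneg s) hM' hr.le
  have hu0 := Real.rpow_nonneg (abs_nonneg u) r
  have hs0 := Real.rpow_nonneg (abs_nonneg s) r
  set M := (|s| + |u - s|) ^ r
  have key : ∀ a b : ℝ, 0 ≤ a → 0 ≤ b → a ^ r ≤ M → b ^ r ≤ M →
      |a ^ r * a - b ^ r * b| ≤ 2 * M * |a - b| := by
    intro a b ha hb hA hB
    rcases le_total b a with h | h
    · have h1 := rpow_mul_sub_le hb h hr hr1
      have h2 := rpow_mul_sub_le (a := b) (b := b) hb le_rfl hr hr1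
      have h3 : b ^ r * b ≤ a ^ r * a :=
        mul_le_mul (Real.rpow_le_rpow hb h hr.le) h hb (Real.rpow_nonneg ha r)
      rw [abs_of_nonneg (by linarith), abs_of_nonneg (by linarith)]
      nlinarith
    · have h1 := rpow_mul_sub_le ha h hr hr1
      have h3 : a ^ r * a ≤ b ^ r * b :=
        mul_le_mul (Real.rpow_le_rpow ha h hr.le) h ha (Real.rpow_nonneg hb r)
      rw [abs_of_nonpos (by linarith), abs_of_nonpos (by linarith)]
      nlinarith
  rcases le_total 0 u with hu' | hu' <;> rcases le_total 0 s with hs' | hs'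
  · rw [abs_of_nonneg hu', abs_of_nonneg hs'] at *
    exact key u s hu' hs' hu hs
  · rw [abs_of_nonneg hu', abs_of_nonpos hs'] at *
    rw [abs_of_nonneg (by nlinarith), abs_of_nonneg (by linarith : 0 ≤ u - s)]
    nlinarith
  · rw [abs_of_nonpos hu', abs_of_nonneg hs'] at *
    rw [abs_of_nonpos (by nlinarith), abs_of_nonpos (by linarith : u - s ≤ 0)]
    nlinarith
  · rw [abs_of_nonpos hu', abs_of_nonpos hs'] at *
    have := key (-u) (-s) (by linarith) (by linarith) hu hs
    rw [show -u - -s = -(u - s) by ring, abs_neg] at this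
    rw [← abs_neg]
    refine le_trans (le_of_eq ?_) this
    congr 1; ring

/-- First-order Taylor expansion of |·|^q at s: the increment of the derivative is controlled by
`abs_rpow_mul_sub_le` with r = q − 2, and subadditivity of the power q − 2 ≤ 1 separates s from x.
The constant is 6 since 2q ≤ 6. -/
lemma abs_add_rpow_le {q : ℝ} (hq : 2 < q) (hq3 : q ≤ 3) (s x : ℝ) :
    |s + x| ^ q ≤ |s| ^ q + q * (|s| ^ (q - 2) * s * x)
      + 6 * (|s| ^ (q - 2) * x ^ 2 + |x| ^ q) := by
  have hx0 := Real.rpow_nonneg (abs_nonneg x) (q - 2)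
  have hs0 := Real.rpow_nonneg (abs_nonneg s) (q - 2)
  have hd : ∀ u ∈ Metric.closedBall s |x|, HasDerivWithinAt
      (fun u => |u| ^ q - q * (|s| ^ (q - 2) * s) * u)
      (q * |u| ^ (q - 2) * u - q * (|s| ^ (q - 2) * s)) (Metric.closedBall s |x|) u := by
    intro u _
    have := (hasDerivAt_abs_rpow u (by linarith : 1 < q)).sub
      ((hasDerivAt_id u).const_mul (q * (|s| ^ (q - 2) * s)))
    simp only [mul_one] at this
    exact this.hasDerivWithinAt
  have h := (convex_closedBall s |x|).norm_image_sub_le_of_norm_hasDerivWithin_le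
    (C := q * (2 * (|s| + |x|) ^ (q - 2) * |x|)) hd (fun u hu => ?_)
    (x := s) (y := s + x) (Metric.mem_closedBall_self (abs_nonneg x)) (by simp)
  · have h2 : (|s| + |x|) ^ (q - 2) ≤ |s| ^ (q - 2) + |x| ^ (q - 2) :=
      Real.rpow_add_le_add_rpow (abs_nonneg s) (abs_nonneg x) (by linarith) (by linarith)
    have h3 : |x| ^ q = |x| ^ (q - 2) * x ^ 2 := by
      rw [← sq_abs x, ← Real.rpow_natCast, ← Real.rpow_add_of_nonneg (abs_nonneg x) (by linarith)
        (by norm_num)]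
      norm_num
    have h4 := (le_abs_self _).trans h
    rw [Real.norm_eq_abs, add_sub_cancel_left] at h4
    have h5 : |x| * |x| = x ^ 2 := by rw [← sq, sq_abs]
    have h6 : q * (2 * (|s| + |x|) ^ (q - 2) * |x|) * |x|
        ≤ 6 * (|s| ^ (q - 2) * x ^ 2 + |x| ^ q) := by
      calc q * (2 * (|s| + |x|) ^ (q - 2) * |x|) * |x|
          = 2 * q * ((|s| + |x|) ^ (q - 2) * x ^ 2) := by rw [← h5]; ring
        _ ≤ 2 * 3 * ((|s| ^ (q - 2) + |x| ^ (q - 2)) * x ^ 2) := by gcongr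
        _ = _ := by rw [h3]; ring
    nlinarith
  · have h1 := abs_rpow_mul_sub_le (u := u) (s := s) (r := q - 2) (by linarith) (by linarith)
    have hu' : |u - s| ≤ |x| := by rw [← Real.dist_eq]; exact hu
    rw [Real.norm_eq_abs, show q * |u| ^ (q - 2) * u - q * (|s| ^ (q - 2) * s)
      = q * (|u| ^ (q - 2) * u - |s| ^ (q - 2) * s) by ring, abs_mul,
      abs_of_pos (by linarith : 0 < q)]
    refine mul_le_mul_of_nonneg_left (h1.trans ?_) (by linarith)
    gcongr

lemma sq_le_one_add_rpow {q : ℝ} (hq : 2 ≤ q) (x : ℝ) : x ^ 2 ≤ 1 + |x| ^ q := by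
  rw [← sq_abs]
  rcases le_total |x| 1 with h | h
  · have := pow_le_one₀ (n := 2) (abs_nonneg x) h
    linarith [Real.rpow_nonneg (abs_nonneg x) q]
  · have : |x| ^ (2 : ℝ) ≤ |x| ^ q := Real.rpow_le_rpow_of_exponent_le h hq
    rw [Real.rpow_two] at this
    linarith

lemma abs_rpow_le_one_add_rpow {r q : ℝ} (hr : 0 ≤ r) (hrq : r ≤ q) (x : ℝ) :
    |x| ^ r ≤ 1 + |x| ^ q := by
  rcases le_total |x| 1 with h | h
  · have := Real.rpow_le_one (abs_nonneg x) h hr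
    linarith [Real.rpow_nonneg (abs_nonneg x) q]
  · have := Real.rpow_le_rpow_of_exponent_le h hrq
    linarith

/-- With c = m and a second moment of order m this bounds the r-th absolute moment of a sum by a
multiple of m^(r/2). -/
lemma abs_rpow_le_of_pos {r c : ℝ} (hr : 0 < r) (hr2 : r ≤ 2) (hc : 0 < c) (s : ℝ) :
    |s| ^ r ≤ c ^ (r / 2) * (1 + c⁻¹ * s ^ 2) := by
  have h1 : |s| ^ r = (s ^ 2) ^ (r / 2) := by
    rw [← sq_abs, ← Real.rpow_natCast, ← Real.rpow_mul (abs_nonneg s)]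
    congr 1; push_cast; ring
  have h2 : s ^ 2 = c * (c⁻¹ * s ^ 2) := by field_simp
  have h3 : 0 ≤ c⁻¹ * s ^ 2 := by positivity
  rw [h1, h2, Real.mul_rpow hc.le h3, ← h2]
  refine mul_le_mul_of_nonneg_left ?_ (Real.rpow_nonneg hc.le _)
  calc (c⁻¹ * s ^ 2) ^ (r / 2) ≤ (1 + c⁻¹ * s ^ 2) ^ (r / 2) :=
        Real.rpow_le_rpow h3 (by linarith) (by linarith)
    _ ≤ (1 + c⁻¹ * s ^ 2) ^ (1 : ℝ) :=
        Real.rpow_le_rpow_of_exponent_le (by linarith) (by linarith)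
    _ = _ := Real.rpow_one _

lemma abs_sum_rpow_le {ι : Type*} [Fintype ι] {q : ℝ} (hq : 1 ≤ q) (a : ι → ℝ) :
    (∑ c, |a c|) ^ q ≤ (Fintype.card ι : ℝ) ^ (q - 1) * ∑ c, |a c| ^ q := by
  have := Real.rpow_sum_le_const_mul_sum_rpow (s := Finset.univ) (f := a) hq
  simpa using this

variable {Ω : Type*} [MeasurableSpace Ω] {P : Measure Ω} [IsProbabilityMeasure P]

/-- If the `q`-th absolute moments of independent centred variables are bounded by `b`, where
`2 < q ≤ 3`, then the `q`-th absolute moment of the sum of `m` of them is `O(m^(q/2))`. -/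
theorem integral_abs_sum_rpow_le {X : ℕ → Ω → ℝ} (hX : ∀ j, Measurable (X j))
    (hind : iIndepFun X P) {q b : ℝ} (hq : 2 < q) (hq3 : q ≤ 3)
    (hi : ∀ j, Integrable (fun ω => |X j ω| ^ q) P) (hb : ∀ j, ∫ ω, |X j ω| ^ q ∂P ≤ b)
    (h0 : ∀ j, ∫ ω, X j ω ∂P = 0) (m : ℕ) :
    Integrable (fun ω => |∑ j ∈ Finset.range m, X j ω| ^ q) P ∧
      ∫ ω, |∑ j ∈ Finset.range m, X j ω| ^ q ∂P
        ≤ 6 * ((2 + b) * (1 + b) + b) * (m : ℝ) ^ (q / 2) := by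
  have hb0 : 0 ≤ b := (integral_nonneg fun ω => Real.rpow_nonneg (abs_nonneg _) _).trans (hb 0)
  have hsq : ∀ j, Integrable (fun ω => X j ω ^ 2) P := fun j =>
    ((integrable_const (1 : ℝ)).add (hi j)).mono' ((hX j).pow_const 2).aestronglyMeasurable
      (ae_of_all _ fun ω => by
        rw [Real.norm_eq_abs, abs_of_nonneg (sq_nonneg _)]; exact sq_le_one_add_rpow hq.le _)
  have hsqb : ∀ j, ∫ ω, X j ω ^ 2 ∂P ≤ 1 + b := fun j => by
    calc ∫ ω, X j ω ^ 2 ∂P ≤ ∫ ω, (1 + |X j ω| ^ q) ∂P :=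
          integral_mono (hsq j) ((integrable_const _).add (hi j)) fun ω => sq_le_one_add_rpow hq.le _
      _ = 1 + ∫ ω, |X j ω| ^ q ∂P := by rw [integral_add (integrable_const _) (hi j)]; simp
      _ ≤ _ := by linarith [hb j]
  have h2 : ∀ j, MemLp (X j) 2 P := fun j =>
    (memLp_two_iff_integrable_sq (hX j).aestronglyMeasurable).2 (hsq j)
  set S : ℕ → Ω → ℝ := fun m ω => ∑ j ∈ Finset.range m, X j ω with hS
  have hSm : ∀ m, Measurable (S m) := fun m => Finset.measurable_sum _ fun j _ => hX j
  have hS2 : ∀ m, ∫ ω, S m ω ^ 2 ∂P ≤ m * (1 + b) := by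
    intro m
    have := integral_sum_mul_sum (f := fun _ t => t) (f' := fun _ t => t) hind
      (fun _ => measurable_id) (fun _ => measurable_id) h2 h2 h0 (Finset.range m)
    simp only [← sq] at this
    rw [this]
    refine (Finset.sum_le_sum fun j _ => hsqb j).trans (le_of_eq (by simp; ring))
  have hS2i : ∀ m, Integrable (fun ω => S m ω ^ 2) P := fun m =>
    (memLp_finsetSum (Finset.range m) fun j _ => h2 j).integrable_sq
  set K := 6 * ((2 + b) * (1 + b) + b) with hK
  have hK0 : 0 ≤ K := by positivity
  have hr : 0 < q - 2 := by linarith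
  -- The induction is run on K · m · m^((q−2)/2), because the step from m to m + 1 adds at most K (m
  -- + 1)^((q−2)/2).
  suffices h : Integrable (fun ω => |S m ω| ^ q) P ∧
      ∫ ω, |S m ω| ^ q ∂P ≤ K * (m * (m : ℝ) ^ ((q - 2) / 2)) by
    refine ⟨h.1, h.2.trans (le_of_eq ?_)⟩
    rcases Nat.eq_zero_or_pos m with rfl | hm
    · simp [Real.zero_rpow (by linarith : q / 2 ≠ 0)]
    · have hm' : (0 : ℝ) < m := by exact_mod_cast hm
      congr 1
      nth_rewrite 1 [← Real.rpow_one (m : ℝ)]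
      rw [← Real.rpow_add hm']
      congr 1; ring
  induction m with
  | zero =>
    have : ∀ ω, |S 0 ω| ^ q = 0 := fun ω => by
      simp [hS, Real.zero_rpow (by linarith : q ≠ 0)]
    simp [this]
  | succ m ih =>
    obtain ⟨ih1, ih2⟩ := ih
    have hI : IndepFun (S m) (X m) P := by
      have := hind.indepFun_finsetSum_of_notMem hX (s := Finset.range m) (i := m) (by simp)
      have e : S m = ∑ j ∈ Finset.range m, X j := by ext ω; simp [hS, Finset.sum_apply]
      rwa [e]
    have hSr : Integrable (fun ω => |S m ω| ^ (q - 2)) P :=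
      ((integrable_const (1 : ℝ)).add ih1).mono' ((hSm m).abs.pow_const _).aestronglyMeasurable
        (ae_of_all _ fun ω => by
          rw [Real.norm_eq_abs, abs_of_nonneg (Real.rpow_nonneg (abs_nonneg _) _)]
          exact abs_rpow_le_one_add_rpow hr.le (by linarith) _)
    have hSr1 : Integrable (fun ω => |S m ω| ^ (q - 2) * S m ω) P :=
      ((integrable_const (1 : ℝ)).add ih1).mono'
        (((hSm m).abs.pow_const _).mul (hSm m)).aestronglyMeasurable
        (ae_of_all _ fun ω => by
          rw [Real.norm_eq_abs, abs_mul, abs_of_nonneg (Real.rpow_nonneg (abs_nonneg _) _)]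
          refine le_trans (le_of_eq ?_) (abs_rpow_le_one_add_rpow (r := q - 1) (q := q)
            (by linarith) (by linarith) _)
          nth_rewrite 2 [← Real.rpow_one |S m ω|]
          rw [← Real.rpow_add_of_nonneg (abs_nonneg _) hr.le zero_le_one]
          congr 1; ring)
    have hm1 : Measurable fun s : ℝ => |s| ^ (q - 2) := by fun_prop
    have hI1 : IndepFun (fun ω => |S m ω| ^ (q - 2) * S m ω) (X m) P :=
      hI.comp (φ := fun s => |s| ^ (q - 2) * s) (ψ := id) (hm1.mul measurable_id) measurable_id
    have hI2 : IndepFun (fun ω => |S m ω| ^ (q - 2)) (fun ω => X m ω ^ 2) P :=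
      hI.comp (φ := fun s => |s| ^ (q - 2)) (ψ := fun x => x ^ 2) hm1 (measurable_id.pow_const 2)
    have i1 : Integrable (fun ω => |S m ω| ^ (q - 2) * S m ω * X m ω) P :=
      hI1.integrable_mul hSr1 ((h2 m).integrable (by norm_num))
    have i2 : Integrable (fun ω => |S m ω| ^ (q - 2) * X m ω ^ 2) P :=
      hI2.integrable_mul hSr (hsq m)
    have iA : Integrable (fun ω => |S m ω| ^ q + q * (|S m ω| ^ (q - 2) * S m ω * X m ω)) P :=
      ih1.add (i1.const_mul q)
    have iB : Integrable (fun ω => 6 * (|S m ω| ^ (q - 2) * X m ω ^ 2 + |X m ω| ^ q)) P :=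
      (i2.add (hi m)).const_mul 6
    have iR : Integrable (fun ω => |S m ω| ^ q + q * (|S m ω| ^ (q - 2) * S m ω * X m ω)
        + 6 * (|S m ω| ^ (q - 2) * X m ω ^ 2 + |X m ω| ^ q)) P := iA.add iB
    have hle : ∀ ω, |S (m + 1) ω| ^ q ≤ |S m ω| ^ q + q * (|S m ω| ^ (q - 2) * S m ω * X m ω)
        + 6 * (|S m ω| ^ (q - 2) * X m ω ^ 2 + |X m ω| ^ q) := fun ω => by
      have : S (m + 1) ω = S m ω + X m ω := Finset.sum_range_succ _ _
      rw [this]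
      exact abs_add_rpow_le hq hq3 _ _
    have hint : Integrable (fun ω => |S (m + 1) ω| ^ q) P :=
      iR.mono' ((hSm _).abs.pow_const _).aestronglyMeasurable (ae_of_all _ fun ω => by
        rw [Real.norm_eq_abs, abs_of_nonneg (Real.rpow_nonneg (abs_nonneg _) _)]; exact hle ω)
    refine ⟨hint, (integral_mono hint iR hle).trans ?_⟩
    -- The linear term has mean zero, as the new variable is centred and independent of the partial
    -- sum. The mean of |S|^(q−2) X² factorizes for the same reason.
    rw [integral_add iA iB, integral_add ih1 (i1.const_mul q), integral_const_mul,
      hI1.integral_fun_mul_eq_mul_integral hSr1.1 (hX m).aestronglyMeasurable, h0,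
      integral_const_mul, integral_add i2 (hi m),
      hI2.integral_fun_mul_eq_mul_integral hSr.1 (hsq m).1]
    have hEr : ∫ ω, |S m ω| ^ (q - 2) ∂P ≤ (m : ℝ) ^ ((q - 2) / 2) * (2 + b) := by
      rcases Nat.eq_zero_or_pos m with rfl | hm
      · simp [hS, Real.zero_rpow hr.ne', Real.zero_rpow (by linarith : (q - 2) / 2 ≠ 0)]
      · have hm' : (0 : ℝ) < m := by exact_mod_cast hm
        calc ∫ ω, |S m ω| ^ (q - 2) ∂P
            ≤ ∫ ω, (m : ℝ) ^ ((q - 2) / 2) * (1 + (m : ℝ)⁻¹ * S m ω ^ 2) ∂P := by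
              refine integral_mono hSr
                (((integrable_const 1).add ((hS2i m).const_mul _)).const_mul _) fun ω => ?_
              exact abs_rpow_le_of_pos hr (by linarith) hm' _
          _ = (m : ℝ) ^ ((q - 2) / 2) * (1 + (m : ℝ)⁻¹ * ∫ ω, S m ω ^ 2 ∂P) := by
              rw [integral_const_mul, integral_add (integrable_const _) ((hS2i m).const_mul _),
                integral_const_mul]
              simp
          _ ≤ (m : ℝ) ^ ((q - 2) / 2) * (1 + (m : ℝ)⁻¹ * (m * (1 + b))) := by
              gcongr
              exact hS2 m
          _ = _ := by field_simp; ring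
    have hmm : (m : ℝ) ^ ((q - 2) / 2) ≤ ((m + 1 : ℕ) : ℝ) ^ ((q - 2) / 2) :=
      Real.rpow_le_rpow (Nat.cast_nonneg m) (by push_cast; linarith) (by linarith)
    have h1m : 1 ≤ ((m + 1 : ℕ) : ℝ) ^ ((q - 2) / 2) :=
      Real.one_le_rpow (by push_cast; linarith [(Nat.cast_nonneg m : (0 : ℝ) ≤ m)]) (by linarith)
    set c := ((m + 1 : ℕ) : ℝ) ^ ((q - 2) / 2)
    have h3 : (∫ ω, |S m ω| ^ (q - 2) ∂P) * ∫ ω, X m ω ^ 2 ∂P ≤ c * (2 + b) * (1 + b) := by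
      refine mul_le_mul (hEr.trans ?_) (hsqb m) (integral_nonneg fun ω => sq_nonneg _) (by positivity)
      gcongr
    have h4 : K * (m * (m : ℝ) ^ ((q - 2) / 2)) ≤ K * (m * c) := by gcongr
    have h5 : b ≤ b * c := by nlinarith
    have h6 := hb m
    have h7 : 6 * (c * (2 + b) * (1 + b) + b * c) = K * c := by rw [hK]; ring
    push_cast
    calc _ ≤ K * (m * c) + 6 * (c * (2 + b) * (1 + b) + b * c) := by
          rw [mul_zero, mul_zero, add_zero]
          refine add_le_add (ih2.trans h4) ?_
          refine mul_le_mul_of_nonneg_left (add_le_add h3 (h6.trans h5)) (by norm_num)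
      _ = _ := by rw [h7]; ring

end NEFQVF

namespace NEFQVF
namespace Model

variable {p : ℕ} {M : Model p}

/-! ### The law of the data -/

variable (M) in
/-- `∑ a, α_{ja} g_{ja}`. -/
def ctr (α : Fin 2 → ℕ → Par p → ℝ) (j : ℕ) (t : ℝ) (η : Par p) : ℝ :=
  ∑ a, α a j η * M.g j t η a

lemma aff_eq (c : ℕ → Par p → ℝ) (α : Fin 2 → ℕ → Par p → ℝ) (j : ℕ) (t : ℝ) (η : Par p) :
    M.aff c α j t η = c j η + M.ctr α j t η := rfl

lemma areaScore_eq (l : Idx p) (j : ℕ) (t : ℝ) (η : Par p) :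
    M.areaScore l j t η = M.ctr (M.scoreCoef l) j t η := by
  rw [areaScore, aff_eq, zero_add]

lemma measurable_ctr (α : Fin 2 → ℕ → Par p → ℝ) (j : ℕ) (η : Par p) :
    Measurable fun t => M.ctr α j t η := by
  simp only [ctr, Fin.sum_univ_two, g, Matrix.cons_val_zero, Matrix.cons_val_one]
  fun_prop

lemma phi_mul_Q (j : ℕ) (η : Par p) : M.phi j η * M.Q (M.mean j η) = M.mu2 j η := by
  unfold phi mu2; ring

section law

variable {K : Set (Par p)} (hK : M.Regular K) {η : Par p} (hη : η ∈ K)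
  {Ω : Type*} [MeasurableSpace Ω] {P : Measure Ω} [IsProbabilityMeasure P]
  {θ y : ℕ → Ω → ℝ} (h : M.Generates P η θ y)

include h

omit [IsProbabilityMeasure P] in
lemma Generates.measurable_pair (j : ℕ) : Measurable fun ω => (θ j ω, y j ω) :=
  (h.measurable_θ j).prodMk (h.measurable_y j)

lemma Generates.isProbabilityMeasure (j : ℕ) : IsProbabilityMeasure (M.jointLaw j η) := by
  rw [← h.law j]
  exact Measure.isProbabilityMeasure_map (h.measurable_pair j).aemeasurable

omit [IsProbabilityMeasure P] in
lemma Generates.integral_comp (j : ℕ) {f : ℝ × ℝ → ℝ} (hf : Measurable f) :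
    ∫ ω, f (θ j ω, y j ω) ∂P = ∫ z, f z ∂(M.jointLaw j η) := by
  rw [← h.law j, integral_map (h.measurable_pair j).aemeasurable hf.aestronglyMeasurable]

omit [IsProbabilityMeasure P] in
lemma Generates.integrable_comp (j : ℕ) {f : ℝ × ℝ → ℝ} (hf : Measurable f) :
    Integrable (fun ω => f (θ j ω, y j ω)) P ↔ Integrable f (M.jointLaw j η) := by
  rw [← h.law j, integrable_map_measure hf.aestronglyMeasurable (h.measurable_pair j).aemeasurable]
  rfl

omit [IsProbabilityMeasure P] in
lemma Generates.indep_y : iIndepFun y P :=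
  h.indep.comp (fun _ z => z.2) fun _ => measurable_snd

include hK hη

lemma Generates.integrable_pow (j : ℕ) {k : ℕ} (hk : k ≤ 4) :
    Integrable (fun ω => (y j ω - M.mean j η) ^ k) P ∧
    Integrable (fun ω => (deriv M.ψ (θ j ω) - M.mean j η) ^ k) P := by
  have hj := integrable_jointLaw_pow (h.isProbabilityMeasure j) (hK.arg_mem hη j 0).2.2.1
    (hK.nu_pos η hη) (hK.nu_gt η hη) hk
  have hξ : Measurable fun z : ℝ × ℝ => (deriv M.ψ z.1 - M.mean j η) ^ k :=
    (((measurable_deriv M.ψ).comp measurable_fst).sub_const _).pow_const k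
  exact ⟨(h.integrable_comp j ((measurable_snd.sub_const _).pow_const k)).2 hj.1,
    (h.integrable_comp j hξ).2 hj.2⟩

lemma Generates.moments (j : ℕ) :
    ∫ ω, y j ω ∂P = M.mean j η ∧ ∫ ω, (y j ω - M.mean j η) ^ 2 ∂P = M.mu2 j η ∧
      ∫ ω, (y j ω - M.mean j η) ^ 3 ∂P = M.mu3 j η ∧
      ∫ ω, (y j ω - M.mean j η) ^ 4 ∂P = M.mu4 j η := by
  obtain ⟨h1, h2, h3, h4⟩ := jointLaw_moments (h.isProbabilityMeasure j)
    (hK.arg_mem hη j 0).2.2.1 (hK.nu_pos η hη) (hK.nu_gt η hη)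
  have e := fun k : ℕ => h.integral_comp j (f := fun z => (z.2 - M.mean j η) ^ k)
    ((measurable_snd.sub_const _).pow_const k)
  exact ⟨(h.integral_comp j (f := fun z => z.2) measurable_snd).trans h1, (e 2).trans h2,
    (e 3).trans h3, (e 4).trans h4⟩

lemma Generates.memLp_four (j : ℕ) : MemLp (y j) 4 P := by
  have h1 : MemLp (fun ω => y j ω - M.mean j η) 4 P := by
    refine (integrable_norm_rpow_iff ((h.measurable_y j).sub_const _).aestronglyMeasurable
      (by norm_num) (by norm_num)).1 ?_
    refine (h.integrable_pow hK hη j le_rfl).1.congr (ae_of_all _ fun ω => ?_)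
    have e4 : (4 : ENNReal).toReal = ((4 : ℕ) : ℝ) := by norm_num
    simp only [e4]
    rw [Real.rpow_natCast, Real.norm_eq_abs, Even.pow_abs (by decide)]
  have h2 := h1.add (memLp_const (M.mean j η))
  refine (memLp_congr_ae (ae_of_all _ fun ω => ?_)).1 h2
  simp

lemma Generates.memLp_ξ (j : ℕ) : MemLp (fun ω => deriv M.ψ (θ j ω)) 2 P := by
  have hm : Measurable fun ω => deriv M.ψ (θ j ω) :=
    (measurable_deriv M.ψ).comp (h.measurable_θ j)
  have h1 : MemLp (fun ω => deriv M.ψ (θ j ω) - M.mean j η) 2 P :=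
    (memLp_two_iff_integrable_sq (hm.sub_const _).aestronglyMeasurable).2
      (h.integrable_pow hK hη j (by norm_num)).2
  refine (memLp_congr_ae (ae_of_all _ fun ω => ?_)).1 (h1.add (memLp_const (M.mean j η)))
  simp

/-- Uniformly bounded absolute moments of an order larger than four. -/
lemma Generates.exists_rpow_moment :
    ∃ q : ℝ, 4 < q ∧ q ≤ 6 ∧ ∃ C : ℝ, 0 ≤ C ∧ ∀ j,
      Integrable (fun ω => |y j ω - M.mean j η| ^ q) P ∧
        ∫ ω, |y j ω - M.mean j η| ^ q ∂P ≤ C := by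
  obtain ⟨q, hq, hq6, hκ⟩ := exists_exponent (hK.nu_pos η hη) (hK.nu_gt η hη)
  obtain ⟨A, hA⟩ := (SmoothFam.comp_Q (M := M) SmoothFam.mean).exists_bound hK 0
  obtain ⟨A', hA'⟩ := (SmoothFam.comp_Q' (M := M) SmoothFam.mean).exists_bound hK 0
  obtain ⟨S, hS⟩ := (SmoothFam.inv_size (M := M)).exists_bound hK 0
  obtain ⟨C, hC⟩ := exists_rpow_bound (M := M) η (q := q) (A := max A A') (S := S) (by linarith)
    hq6 hκ
  refine ⟨q, hq, hq6, max C 0, le_max_right _ _, fun j => ?_⟩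
  have hb := (hC j (h.isProbabilityMeasure j) (hK.arg_mem hη j 0).2.2.1
    ((le_abs_self _).trans (hS j 0 (by simp) η hη))
    ((hA j 0 (by simp) η hη).trans (le_max_left _ _))
    ((hA' j 0 (by simp) η hη).trans (le_max_right _ _))).2
  have hm : Measurable fun z : ℝ × ℝ => |z.2 - M.mean j η| ^ q := by fun_prop
  have hl : ∫⁻ ω, ENNReal.ofReal (|y j ω - M.mean j η| ^ q) ∂P
      = ∫⁻ z, ENNReal.ofReal (|z.2 - M.mean j η| ^ q) ∂(M.jointLaw j η) := by
    rw [← h.law j, lintegral_map hm.ennreal_ofReal (h.measurable_pair j)]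
  have hn : ∀ ω, 0 ≤ |y j ω - M.mean j η| ^ q := fun ω => Real.rpow_nonneg (abs_nonneg _) q
  have hmeas : AEStronglyMeasurable (fun ω => |y j ω - M.mean j η| ^ q) P :=
    (hm.comp (h.measurable_pair j)).aestronglyMeasurable
  have hi : Integrable (fun ω => |y j ω - M.mean j η| ^ q) P := by
    refine ⟨hmeas, (hasFiniteIntegral_iff_ofReal (ae_of_all _ hn)).2 ?_⟩
    rw [hl]
    exact hb.trans_lt ENNReal.ofReal_lt_top
  refine ⟨hi, ?_⟩
  rw [integral_eq_lintegral_of_nonneg_ae (ae_of_all _ hn) hmeas, hl]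
  refine (ENNReal.toReal_mono ENNReal.ofReal_ne_top hb).trans ?_
  rw [ENNReal.toReal_ofReal']

lemma Generates.memLp_g (j : ℕ) (a : Fin 2) : MemLp (fun ω => M.g j (y j ω) η a) 2 P := by
  have hi := fun k (hk : k ≤ 4) => (h.integrable_pow hK hη j hk).1
  have hm : Measurable fun ω => y j ω - M.mean j η := (h.measurable_y j).sub_const _
  fin_cases a
  · exact (memLp_two_iff_integrable_sq hm.aestronglyMeasurable).2 (hi 2 (by norm_num))
  · have h1 : MemLp (fun ω => (y j ω - M.mean j η) ^ 2) 2 P := by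
      refine (memLp_two_iff_integrable_sq (hm.pow_const 2).aestronglyMeasurable).2
        ((hi 4 le_rfl).congr (ae_of_all _ fun ω => by ring))
    exact h1.sub (memLp_const (M.phi j η * M.Q (M.mean j η)))

lemma Generates.integral_g (j : ℕ) (a : Fin 2) : ∫ ω, M.g j (y j ω) η a ∂P = 0 := by
  obtain ⟨m1, m2, -, -⟩ := h.moments hK hη j
  have hi := fun k (hk : k ≤ 4) => (h.integrable_pow hK hη j hk).1
  fin_cases a
  · have hy : Integrable (y j) P := (h.memLp_four hK hη j).integrable (by norm_num)
    have : ∫ ω, (y j ω - M.mean j η) ∂P = 0 := by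
      rw [integral_sub hy (integrable_const _), m1]; simp
    exact this
  · have : ∫ ω, ((y j ω - M.mean j η) ^ 2 - M.phi j η * M.Q (M.mean j η)) ∂P = 0 := by
      rw [integral_sub (hi 2 (by norm_num)) (integrable_const _), m2, phi_mul_Q]; simp
    exact this

lemma Generates.integral_g_mul_g (j : ℕ) (a c : Fin 2) :
    ∫ ω, M.g j (y j ω) η a * M.g j (y j ω) η c ∂P = M.Sig j η a c := by
  obtain ⟨-, m2, m3, m4⟩ := h.moments hK hη j
  have m1 : ∫ ω, (y j ω - M.mean j η) ∂P = 0 := h.integral_g hK hη j 0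
  have hi := fun k (hk : k ≤ 4) => (h.integrable_pow hK hη j hk).1
  have i1 : Integrable (fun ω => y j ω - M.mean j η) P := by simpa using hi 1 (by norm_num)
  have h01 : ∫ ω, (y j ω - M.mean j η) * ((y j ω - M.mean j η) ^ 2 - M.mu2 j η) ∂P
      = M.mu3 j η := by
    have e : ∀ ω, (y j ω - M.mean j η) * ((y j ω - M.mean j η) ^ 2 - M.mu2 j η)
        = (y j ω - M.mean j η) ^ 3 - M.mu2 j η * (y j ω - M.mean j η) := fun ω => by ring
    simp only [e]
    rw [integral_sub (hi 3 (by norm_num)) (i1.const_mul _), integral_const_mul, m1, m3]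
    ring
  fin_cases a <;> fin_cases c
  · have : ∫ ω, (y j ω - M.mean j η) * (y j ω - M.mean j η) ∂P = M.mu2 j η := by
      simpa only [sq] using m2
    exact this
  · have e : ∀ ω, M.g j (y j ω) η 0 * M.g j (y j ω) η 1
        = (y j ω - M.mean j η) * ((y j ω - M.mean j η) ^ 2 - M.mu2 j η) := fun ω => by
      rw [← phi_mul_Q]; rfl
    exact (integral_congr_ae (ae_of_all _ e)).trans h01
  · have e : ∀ ω, M.g j (y j ω) η 1 * M.g j (y j ω) η 0
        = (y j ω - M.mean j η) * ((y j ω - M.mean j η) ^ 2 - M.mu2 j η) := fun ω => by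
      rw [← phi_mul_Q, mul_comm]; rfl
    exact (integral_congr_ae (ae_of_all _ e)).trans h01
  · have e : ∀ ω, M.g j (y j ω) η 1 * M.g j (y j ω) η 1
        = (y j ω - M.mean j η) ^ 4 - 2 * M.mu2 j η * (y j ω - M.mean j η) ^ 2
          + M.mu2 j η ^ 2 := fun ω => by
      rw [← phi_mul_Q]; simp [g]; ring
    have h11 : ∫ ω, ((y j ω - M.mean j η) ^ 4 - 2 * M.mu2 j η * (y j ω - M.mean j η) ^ 2
          + M.mu2 j η ^ 2) ∂P = M.mu4 j η - M.mu2 j η ^ 2 := by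
      have i5 : Integrable (fun ω => (y j ω - M.mean j η) ^ 4
          - 2 * M.mu2 j η * (y j ω - M.mean j η) ^ 2) P :=
        (hi 4 le_rfl).sub ((hi 2 (by norm_num)).const_mul _)
      rw [integral_add i5 (integrable_const _),
        integral_sub (hi 4 le_rfl) ((hi 2 (by norm_num)).const_mul _), integral_const_mul, m2, m4]
      simp; ring
    exact (integral_congr_ae (ae_of_all _ e)).trans h11

variable (α β : Fin 2 → ℕ → Par p → ℝ)

lemma Generates.memLp_ctr (j : ℕ) : MemLp (fun ω => M.ctr α j (y j ω) η) 2 P := by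
  unfold ctr
  exact memLp_finsetSum _ fun a _ => (h.memLp_g hK hη j a).const_mul _

lemma Generates.integral_ctr (j : ℕ) : ∫ ω, M.ctr α j (y j ω) η ∂P = 0 := by
  unfold ctr
  rw [integral_finsetSum _ fun a _ => ((h.memLp_g hK hη j a).integrable (by norm_num)).const_mul _]
  simp [integral_const_mul, h.integral_g hK hη]

lemma Generates.integral_ctr_mul_ctr (j : ℕ) :
    ∫ ω, M.ctr α j (y j ω) η * M.ctr β j (y j ω) η ∂P
      = ∑ a, ∑ c, α a j η * M.Sig j η a c * β c j η := by
  unfold ctr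
  have hi : ∀ a c, Integrable (fun ω => α a j η * M.g j (y j ω) η a * (β c j η * M.g j (y j ω) η c))
      P := fun a c => ((h.memLp_g hK hη j a).const_mul _).integrable_mul
        ((h.memLp_g hK hη j c).const_mul _)
  simp only [Finset.sum_mul_sum]
  rw [integral_finsetSum _ fun a _ => integrable_finsetSum _ fun c _ => hi a c]
  refine Finset.sum_congr rfl fun a _ => ?_
  rw [integral_finsetSum _ fun c _ => hi a c]
  refine Finset.sum_congr rfl fun c _ => ?_
  rw [← h.integral_g_mul_g hK hη j a c, mul_right_comm, ← integral_const_mul]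
  refine integral_congr_ae (ae_of_all _ fun ω => ?_)
  ring

omit h [IsProbabilityMeasure P] in
-- The identity Σ Wᵗ = D removes Σ: the covariance of a centred term with the score of the area is
-- its coefficient vector applied to D. The forms of `U` and `a1` rest on this.
lemma sum_coef_Sig_scoreCoef (j : ℕ) (k : Idx p) :
    ∑ a, ∑ c, α a j η * M.Sig j η a c * M.scoreCoef k c j η = ∑ a, α a j η * M.D j η a k := by
  have e : M.Sig j η * (M.W j η)ᵀ = M.D j η := by
    have := congrArg Matrix.transpose (W_mul_Sig (hK.arg_mem hη j 0))
    rwa [Matrix.transpose_mul, Sig_transpose, Matrix.transpose_transpose] at this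
  refine Finset.sum_congr rfl fun a _ => ?_
  rw [← e, Matrix.mul_apply, Finset.mul_sum]
  exact Finset.sum_congr rfl fun c _ => by rw [mul_assoc]; rfl

lemma Generates.integral_sum_ctr (m : ℕ) :
    ∫ ω, ∑ j ∈ Finset.range m, M.ctr α j (y j ω) η ∂P = 0 :=
  integral_sum_eq_zero (f := fun j t => M.ctr α j t η) (h.memLp_ctr hK hη α)
    (h.integral_ctr hK hη α) _

lemma Generates.integral_sum_ctr_mul (m : ℕ) :
    ∫ ω, (∑ j ∈ Finset.range m, M.ctr α j (y j ω) η) *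
        (∑ j ∈ Finset.range m, M.ctr β j (y j ω) η) ∂P
      = ∑ j ∈ Finset.range m, ∑ a, ∑ c, α a j η * M.Sig j η a c * β c j η := by
  rw [integral_sum_mul_sum (f := fun j t => M.ctr α j t η) (f' := fun j t => M.ctr β j t η)
    h.indep_y (fun j => measurable_ctr α j η) (fun j => measurable_ctr β j η) (h.memLp_ctr hK hη α)
    (h.memLp_ctr hK hη β) (h.integral_ctr hK hη α)]
  exact Finset.sum_congr rfl fun j _ => h.integral_ctr_mul_ctr hK hη α β j

lemma Generates.integrable_sum_ctr_mul (m : ℕ) :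
    Integrable (fun ω => (∑ j ∈ Finset.range m, M.ctr α j (y j ω) η) *
        (∑ j ∈ Finset.range m, M.ctr β j (y j ω) η)) P :=
  (memLp_sum (f := fun j t => M.ctr α j t η) (h.memLp_ctr hK hη α) _).integrable_mul
    (memLp_sum (f := fun j t => M.ctr β j t η) (h.memLp_ctr hK hη β) _)

end law

end Model
end NEFQVF

namespace NEFQVF
namespace Model

variable {p : ℕ} {M : Model p}

/-! ### The closed forms of `U`, `a₁` and `a₂` -/

lemma score_sample {Ω : Type*} (y : ℕ → Ω → ℝ) (m : ℕ) (ω : Ω) (η : Par p) (l : Idx p) :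
    M.score m (sample y m ω) η l
      = ∑ j ∈ Finset.range m, M.ctr (M.scoreCoef l) j (y j ω) η := by
  rw [score_apply, ← Fin.sum_univ_eq_sum_range (fun j => M.ctr (M.scoreCoef l) j (y j ω) η)]
  exact Finset.sum_congr rfl fun j _ => areaScore_eq ..

section

variable {K : Set (Par p)} (hK : M.Regular K) {η : Par p} (hη : η ∈ K)

include hK hη

lemma pd_score_sample {Ω : Type*} (y : ℕ → Ω → ℝ) (m : ℕ) (ω : Ω) (l k : Idx p) :
    pd k (fun t => M.score m (sample y m ω) t l) η
      = ∑ j ∈ Finset.range m, M.aff (M.jacConst l k) (M.jacCoef l k) j (y j ω) η := by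
  have e : (fun t => M.score m (sample y m ω) t l)
      = fun t => ∑ j ∈ Finset.range m, M.areaScore l j (y j ω) t := by
    ext t
    rw [score_apply, ← Fin.sum_univ_eq_sum_range (fun j => M.areaScore l j (y j ω) t)]
    rfl
  rw [e, pd_sum _ fun j _ => (SmoothFam.areaScore l).differentiableAt (hK.arg_mem hη j (y j ω))]
  exact Finset.sum_congr rfl fun j _ => pd_areaScore (hK.arg_mem hη j (y j ω)) l k

lemma pd_pd_score_sample {Ω : Type*} (y : ℕ → Ω → ℝ) (m : ℕ) (ω : Ω) (l k k' : Idx p) :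
    pd k (pd k' (fun t => M.score m (sample y m ω) t l)) η
      = ∑ j ∈ Finset.range m, M.aff (M.hessConst l k k') (M.hessCoef l k k') j (y j ω) η := by
  have e : (fun t => M.score m (sample y m ω) t l)
      = fun t => ∑ j ∈ Finset.range m, M.areaScore l j (y j ω) t := by
    ext t
    rw [score_apply, ← Fin.sum_univ_eq_sum_range (fun j => M.areaScore l j (y j ω) t)]
    rfl
  have hev : pd k' (fun t => M.score m (sample y m ω) t l)
      =ᶠ[𝓝 η] fun t => ∑ j ∈ Finset.range m, pd k' (M.areaScore l j (y j ω)) t := by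
    have : ∀ᶠ t in 𝓝 η, ∀ j ∈ Finset.range m, M.arg j (y j ω) t ∈ M.dom :=
      (Finset.eventually_all _).2 fun j _ =>
        SmoothFam.eventually_mem (hK.arg_mem hη j (y j ω))
    filter_upwards [this] with t ht
    rw [e, pd_sum _ fun j hj => (SmoothFam.areaScore l).differentiableAt (ht j hj)]
  rw [pd_congr hev, pd_sum _ fun j _ =>
    ((SmoothFam.areaScore l).pderiv k').differentiableAt (hK.arg_mem hη j (y j ω))]
  exact Finset.sum_congr rfl fun j _ => pd_pd_areaScore (hK.arg_mem hη j (y j ω)) l k k'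

lemma sum_scoreCoef_Sig (m : ℕ) (k l : Idx p) :
    ∑ j ∈ Finset.range m, ∑ a, ∑ c, M.scoreCoef k a j η * M.Sig j η a c * M.scoreCoef l c j η
      = M.U m η k l := by
  simp only [sum_coef_Sig_scoreCoef hK hη]
  simp [U, Matrix.sum_apply, Matrix.mul_apply, scoreCoef]

variable {Ω : Type*} [MeasurableSpace Ω] {P : Measure Ω} [IsProbabilityMeasure P]
  {θ y : ℕ → Ω → ℝ} (h : M.Generates P η θ y)

include h

/-- `U` is the covariance matrix of the score. -/
lemma Generates.integral_score_mul_score (m : ℕ) (k l : Idx p) :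
    ∫ ω, M.score m (sample y m ω) η k * M.score m (sample y m ω) η l ∂P = M.U m η k l := by
  simp only [score_sample]
  rw [h.integral_sum_ctr_mul hK hη, sum_scoreCoef_Sig hK hη]

lemma Generates.integral_sum_aff_mul_score (c : ℕ → Par p → ℝ) (α : Fin 2 → ℕ → Par p → ℝ)
    (m : ℕ) (k : Idx p) :
    Integrable (fun ω => (∑ j ∈ Finset.range m, M.aff c α j (y j ω) η) *
      M.score m (sample y m ω) η k) P ∧
    ∫ ω, (∑ j ∈ Finset.range m, M.aff c α j (y j ω) η) * M.score m (sample y m ω) η k ∂P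
      = ∑ j ∈ Finset.range m, ∑ a, α a j η * M.D j η a k := by
  have e : ∀ ω, (∑ j ∈ Finset.range m, M.aff c α j (y j ω) η) * M.score m (sample y m ω) η k
      = (∑ j ∈ Finset.range m, c j η) * (∑ j ∈ Finset.range m, M.ctr (M.scoreCoef k) j (y j ω) η)
        + (∑ j ∈ Finset.range m, M.ctr α j (y j ω) η) *
          (∑ j ∈ Finset.range m, M.ctr (M.scoreCoef k) j (y j ω) η) := by
    intro ω
    simp only [score_sample, aff_eq, Finset.sum_add_distrib]; ring
  have i1 : Integrable (fun ω => (∑ j ∈ Finset.range m, c j η) *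
      (∑ j ∈ Finset.range m, M.ctr (M.scoreCoef k) j (y j ω) η)) P :=
    ((memLp_sum (f := fun j t => M.ctr (M.scoreCoef k) j t η) (h.memLp_ctr hK hη _)
      (Finset.range m)).integrable (by norm_num)).const_mul _
  have i2 := h.integrable_sum_ctr_mul hK hη α (M.scoreCoef k) m
  simp only [e]
  refine ⟨i1.add i2, ?_⟩
  rw [integral_add i1 i2, integral_const_mul, h.integral_sum_ctr hK hη,
    h.integral_sum_ctr_mul hK hη, mul_zero, zero_add]
  simp only [sum_coef_Sig_scoreCoef hK hη]

lemma Generates.integral_sum_aff (c : ℕ → Par p → ℝ) (α : Fin 2 → ℕ → Par p → ℝ) (m : ℕ) :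
    ∫ ω, ∑ j ∈ Finset.range m, M.aff c α j (y j ω) η ∂P = ∑ j ∈ Finset.range m, c j η := by
  simp only [aff_eq, Finset.sum_add_distrib]
  rw [integral_add (integrable_const _) ((memLp_sum (f := fun j t => M.ctr α j t η)
      (h.memLp_ctr hK hη _) (Finset.range m)).integrable (by norm_num)), h.integral_sum_ctr hK hη]
  simp

omit h [IsProbabilityMeasure P] in
-- The vector W (μ₂, μ₃)ᵗ is the first column of W Σ = Dᵗ. Hence the second summand in the
-- definition of `a1` is the contribution of the term 2(y − m)∂m in the derivative of g, and both
-- summands combine into the Jacobian coefficients.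
lemma a1_eq_sum (m : ℕ) (l : Idx p) :
    M.a1 m η l = ∑ k, ∑ k', (M.U m η)⁻¹ k k' *
      ∑ j ∈ Finset.range m, ∑ a, M.jacCoef l k a j η * M.D j η a k' := by
  have hWμ : ∀ j, M.W j η *ᵥ ![M.mu2 j η, M.mu3 j η] = fun k => M.D j η 0 k := by
    intro j
    have e := W_mul_Sig (hK.arg_mem hη j 0)
    ext k
    have := congrFun (congrFun e k) 0
    rw [Matrix.mul_apply] at this
    simp only [Matrix.mulVec, dotProduct]
    rw [Matrix.transpose_apply] at this
    rw [← this]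
    refine Finset.sum_congr rfl fun a _ => ?_
    fin_cases a <;> rfl
  simp only [Finset.mul_sum]
  rw [Finset.sum_congr rfl fun k _ => Finset.sum_comm, Finset.sum_comm]
  simp only [a1]
  refine Finset.sum_congr rfl fun j _ => ?_
  have e2 : ((M.W j η * Matrix.of ![0, M.xvec j] * (M.U m η)⁻¹ * M.W j η) *ᵥ
          ![M.mu2 j η, M.mu3 j η]) l
      = ∑ k, ∑ k', M.W j η l 1 * M.xvec j k * (M.U m η)⁻¹ k k' * M.D j η 0 k' := by
    have e0 : ∀ k, (M.W j η * Matrix.of ![0, M.xvec j]) l k = M.W j η l 1 * M.xvec j k := by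
      intro k
      rw [Matrix.mul_apply, Fin.sum_univ_two]
      simp [-Fintype.sum_sum_type]
    rw [← Matrix.mulVec_mulVec, hWμ, ← Matrix.mulVec_mulVec]
    simp only [Matrix.mulVec, dotProduct, e0, Finset.mul_sum, mul_assoc]
  rw [e2]
  simp only [Matrix.mul_apply, Fin.sum_univ_two, jacCoef, pdCoef, Finset.mul_sum, Finset.sum_sub_distrib,
    ← Finset.sum_add_distrib, ← Finset.sum_sub_distrib]
  refine Finset.sum_congr rfl fun k _ => Finset.sum_congr rfl fun k' _ => ?_
  have e3 : ∀ a, M.scoreCoef l a j = fun t => M.W j t l a := fun _ => rfl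
  simp only [e3]
  rw [U_inv_symm m η k' k, D_zero j η k]
  simp
  ring

lemma Generates.a1_eq_integral (m : ℕ) (l : Idx p) :
    M.a1 m η l = ∫ ω, ∑ k, pd k (fun t => M.score m (sample y m ω) t l) η *
        ((M.U m η)⁻¹.mulVec (M.score m (sample y m ω) η)) k ∂P := by
  have key := fun k => h.integral_sum_aff_mul_score hK hη (M.jacConst l k) (M.jacCoef l k) m
  have e : ∀ ω, ∑ k, pd k (fun t => M.score m (sample y m ω) t l) η *
        ((M.U m η)⁻¹.mulVec (M.score m (sample y m ω) η)) k
      = ∑ k, ∑ k', (M.U m η)⁻¹ k k' * ((∑ j ∈ Finset.range m,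
        M.aff (M.jacConst l k) (M.jacCoef l k) j (y j ω) η) * M.score m (sample y m ω) η k') := by
    intro ω
    refine Finset.sum_congr rfl fun k _ => ?_
    rw [pd_score_sample hK hη, Matrix.mulVec, dotProduct, Finset.mul_sum]
    exact Finset.sum_congr rfl fun k' _ => by ring
  have hI : ∀ k k', Integrable (fun ω => (M.U m η)⁻¹ k k' * ((∑ j ∈ Finset.range m,
      M.aff (M.jacConst l k) (M.jacCoef l k) j (y j ω) η) * M.score m (sample y m ω) η k')) P :=
    fun k k' => (key k k').1.const_mul _
  simp only [e]
  rw [integral_finsetSum _ fun k _ => integrable_finsetSum _ fun k' _ => hI k k',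
    a1_eq_sum hK hη]
  refine Finset.sum_congr rfl fun k _ => ?_
  rw [integral_finsetSum _ fun k' _ => hI k k']
  exact Finset.sum_congr rfl fun k' _ => by rw [integral_const_mul, (key k k').2]

omit h [IsProbabilityMeasure P] in
-- The second derivative contains the cross terms ∂W · D in both orders of (k, k'). Contraction with
-- the symmetric matrix U⁻¹ does not distinguish the orders, which produces the factor −2 of the
-- closed form.
lemma a2_eq_sum (m : ℕ) (l : Idx p) :
    M.a2 m η l = ∑ k, ∑ k', (∑ j ∈ Finset.range m, M.hessConst l k k' j η) * (M.U m η)⁻¹ k k' := by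
  have hH : ∀ j k k', M.hessConst l k k' j η =
      (∑ a, (-2 * pd k (fun t => M.W j t l a) η * M.D j η a k' + M.W j η l a * M.Z j η a k k'))
      + ((∑ a, pd k (fun t => M.W j t l a) η * M.D j η a k')
        - ∑ a, pd k' (fun t => M.W j t l a) η * M.D j η a k) := by
    intro j k k'
    rw [hessConst_eq (hK.arg_mem hη j 0), ← Finset.sum_sub_distrib, ← Finset.sum_add_distrib]
    exact Finset.sum_congr rfl fun a _ => by ring
  set H : Idx p → Idx p → ℝ := fun k k' => ∑ j ∈ Finset.range m, ∑ a,
    (-2 * pd k (fun t => M.W j t l a) η * M.D j η a k' + M.W j η l a * M.Z j η a k k') with hHd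
  set G : Idx p → Idx p → ℝ := fun k k' => ∑ j ∈ Finset.range m,
    ∑ a, pd k (fun t => M.W j t l a) η * M.D j η a k' with hG
  have e1 : ∀ k k', ∑ j ∈ Finset.range m, M.hessConst l k k' j η = H k k' + (G k k' - G k' k) := by
    intro k k'
    simp only [hH, Finset.sum_add_distrib, Finset.sum_sub_distrib, hHd, hG]
  have e2 : ∑ k, ∑ k', G k k' * (M.U m η)⁻¹ k k' = ∑ k, ∑ k', G k' k * (M.U m η)⁻¹ k k' := by
    rw [Finset.sum_comm]
    exact Finset.sum_congr rfl fun k _ => Finset.sum_congr rfl fun k' _ => by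
      rw [U_inv_symm m η k' k]
  simp only [e1, add_mul, sub_mul, Finset.sum_add_distrib, Finset.sum_sub_distrib, e2, sub_self,
    add_zero]
  rw [a2, Matrix.trace_mul_comm]
  simp only [Matrix.trace, Matrix.diag_apply, Matrix.mul_apply, Matrix.sum_apply, Matrix.of_apply]
  refine Finset.sum_congr rfl fun k _ => Finset.sum_congr rfl fun k' _ => ?_
  rw [U_inv_symm m η k' k]

lemma Generates.a2_eq_integral (m : ℕ) (l : Idx p) :
    M.a2 m η l = ((Matrix.of fun k k' => ∫ ω,
      pd k (pd k' (fun t => M.score m (sample y m ω) t l)) η ∂P) * (M.U m η)⁻¹).trace := by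
  simp only [pd_pd_score_sample hK hη, h.integral_sum_aff hK hη]
  rw [a2_eq_sum hK hη]
  simp only [Matrix.trace, Matrix.diag_apply, Matrix.mul_apply, Matrix.of_apply]
  refine Finset.sum_congr rfl fun k _ => Finset.sum_congr rfl fun k' _ => ?_
  rw [U_inv_symm m η k' k]

end

end Model
end NEFQVF

namespace NEFQVF
namespace Model

variable {p : ℕ} {M : Model p}

/-! ### Conditioning on a direct estimate -/

lemma measurable_xiHat (i : ℕ) (η : Par p) : Measurable fun t => M.xiHat i t η := by
  unfold xiHat; fun_prop

lemma measurable_T1 (i : ℕ) (η : Par p) : Measurable fun t => M.T1 i t η := by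
  have := measurable_xiHat (M := M) i η
  unfold T1 Q; fun_prop

lemma condExp_eq_zero_of_forall {Ω : Type*} [MeasurableSpace Ω] {P : Measure Ω}
    [IsFiniteMeasure P] {y : ℕ → Ω → ℝ} {i : ℕ} (hy : Measurable (y i)) {V : Ω → ℝ}
    (hV : Integrable V P)
    (h : ∀ B : Set ℝ, MeasurableSet B → ∫ ω, B.indicator 1 (y i ω) * V ω ∂P = 0) :
    P[V | sigmaOf y i] =ᵐ[P] 0 := by
  refine (ae_eq_condExp_of_forall_setIntegral_eq hy.comap_le hV (g := 0)
    (fun s _ _ => integrableOn_zero) (fun s hs _ => ?_) aestronglyMeasurable_zero).symm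
  obtain ⟨B, hB, rfl⟩ := hs
  have e : ∀ ω, (y i ⁻¹' B).indicator V ω = B.indicator 1 (y i ω) * V ω := fun ω => by
    by_cases hω : y i ω ∈ B <;> simp [Set.indicator, hω]
  have e1 : ∫ ω in y i ⁻¹' B, V ω ∂P = 0 := by
    rw [← integral_indicator (hy hB), integral_congr_ae (ae_of_all _ e), h B hB]
  rw [e1]
  simp

section law

variable {K : Set (Par p)} (hK : M.Regular K) {η : Par p} (hη : η ∈ K)
  {Ω : Type*} [MeasurableSpace Ω] {P : Measure Ω} [IsProbabilityMeasure P]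
  {θ y : ℕ → Ω → ℝ} (h : M.Generates P η θ y)

include h hK hη

lemma Generates.memLp_xiHat (i : ℕ) : MemLp (fun ω => M.xiHat i (y i ω) η) 2 P := by
  have h2 : MemLp (y i) 2 P := (h.memLp_four hK hη i).mono_exponent (by norm_num)
  have := ((h2.const_mul (M.n i)).add (memLp_const (nu η * M.mean i η))).mul_const
    (M.n i + nu η)⁻¹
  refine (memLp_congr_ae (ae_of_all _ fun ω => ?_)).1 this
  simp [xiHat, div_eq_mul_inv]

lemma Generates.integrable_T1 (i : ℕ) : Integrable (fun ω => M.T1 i (y i ω) η) P := by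
  have h2 := h.memLp_xiHat hK hη i
  have h1 : Integrable (fun ω => M.xiHat i (y i ω) η) P := h2.integrable (by norm_num)
  have := (((integrable_const M.v₀).add (h1.const_mul M.v₁)).add
    (h2.integrable_sq.const_mul M.v₂)).mul_const (M.n i + nu η - M.v₂)⁻¹
  refine this.congr (ae_of_all _ fun ω => ?_)
  simp [T1, Q, div_eq_mul_inv]

lemma Generates.memLp_residual (i : ℕ) :
    MemLp (fun ω => deriv M.ψ (θ i ω) - M.xiHat i (y i ω) η) 2 P :=
  (h.memLp_ξ hK hη i).sub (h.memLp_xiHat hK hη i)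

/-- Orthogonality of the prediction error of the Bayes estimator to the functions of the data. -/
lemma Generates.condExp_mul_residual {m i : ℕ} {G : (Fin m → ℝ) → ℝ}
    (hG : Measurable G)
    (hV : Integrable
      (fun ω => G (sample y m ω) * (deriv M.ψ (θ i ω) - M.xiHat i (y i ω) η)) P) :
    P[fun ω => G (sample y m ω) * (deriv M.ψ (θ i ω) - M.xiHat i (y i ω) η) | sigmaOf y i]
      =ᵐ[P] 0 := by
  classical
  refine condExp_eq_zero_of_forall (h.measurable_y i) hV fun B hB => ?_
  set T : Finset ℕ := (Finset.range m).erase i with hT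
  set rest : Ω → (T → ℝ) := fun ω a => y a ω with hrest
  -- The sample is reassembled from y_i and the other observations. The latter are independent of
  -- (θ_i, y_i), so for fixed values of them G depends on y_i alone and `jointLaw_posterior`
  -- applies.
  set glue : ℝ → (T → ℝ) → Fin m → ℝ := fun t ρ j =>
    if hj : (j : ℕ) = i then t else ρ ⟨j, Finset.mem_erase.2 ⟨hj, Finset.mem_range.2 j.2⟩⟩ with hglue
  have hgs : ∀ ω, glue (y i ω) (rest ω) = sample y m ω := fun ω => by
    ext j
    simp only [hglue, hrest, sample]
    split_ifs with hj
    · rw [hj]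
    · rfl
  have hgm : Measurable fun z : ℝ × (T → ℝ) => glue z.1 z.2 := by
    refine measurable_pi_lambda _ fun j => ?_
    by_cases hj : (j : ℕ) = i
    · simp only [hglue, hj, dite_true]; exact measurable_fst
    · simp only [hglue, hj, dite_false]; exact (measurable_pi_apply _).comp measurable_snd
  have hrm : Measurable rest := measurable_pi_lambda _ fun a => h.measurable_y a
  have hξm : Measurable (deriv M.ψ) := measurable_deriv _
  have hI : IndepFun (fun ω => (θ i ω, y i ω)) rest P := by
    have h1 := h.indep.indepFun_finset {i} T (by simp [hT]) h.measurable_pair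
    exact h1.comp (φ := fun t : (({i} : Finset ℕ) → ℝ × ℝ) => t ⟨i, by simp⟩)
      (ψ := fun (t : T → ℝ × ℝ) a => (t a).2) (measurable_pi_apply _)
      (measurable_pi_lambda _ fun a => measurable_snd.comp (measurable_pi_apply a))
  set F : (ℝ × ℝ) × (T → ℝ) → ℝ := fun z => B.indicator 1 z.1.2 *
    (G (glue z.1.2 z.2) * (deriv M.ψ z.1.1 - M.xiHat i z.1.2 η)) with hF
  have hFm : Measurable F := by
    have h1 : Measurable fun z : (ℝ × ℝ) × (T → ℝ) => B.indicator (1 : ℝ → ℝ) z.1.2 :=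
      (measurable_one.indicator hB).comp measurable_fst.snd
    have h2 : Measurable fun z : (ℝ × ℝ) × (T → ℝ) => G (glue z.1.2 z.2) :=
      hG.comp (hgm.comp (measurable_fst.snd.prodMk measurable_snd))
    exact h1.mul (h2.mul ((hξm.comp measurable_fst.fst).sub
      ((measurable_xiHat i η).comp measurable_fst.snd)))
  have hmap := hI.map_prod_eq_prod_map_map (h.measurable_pair i).aemeasurable hrm.aemeasurable
  rw [h.law i] at hmap
  have hFi : Integrable F ((M.jointLaw i η).prod (P.map rest)) := by
    rw [← hmap, integrable_map_measure hFm.aestronglyMeasurable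
      ((h.measurable_pair i).prodMk hrm).aemeasurable]
    refine (hV.bdd_mul (c := 1) (f := fun ω => B.indicator 1 (y i ω))
      ((measurable_one.indicator hB).comp (h.measurable_y i)).aestronglyMeasurable
      (ae_of_all _ fun ω => ?_)).congr (ae_of_all _ fun ω => ?_)
    · by_cases hω : y i ω ∈ B <;> simp [hω]
    · simp only [hF, Function.comp, hgs]
  have hprob := h.isProbabilityMeasure i
  have hprob2 : IsProbabilityMeasure (P.map rest) :=
    Measure.isProbabilityMeasure_map hrm.aemeasurable
  have e1 : ∫ ω, B.indicator 1 (y i ω) *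
      (G (sample y m ω) * (deriv M.ψ (θ i ω) - M.xiHat i (y i ω) η)) ∂P
      = ∫ z, F z ∂((M.jointLaw i η).prod (P.map rest)) := by
    rw [← hmap, integral_map ((h.measurable_pair i).prodMk hrm).aemeasurable
      hFm.aestronglyMeasurable]
    refine integral_congr_ae (ae_of_all _ fun ω => ?_)
    simp only [hF, hgs]
  rw [e1, integral_prod_symm _ hFi]
  have hz : ∀ᵐ ρ ∂(P.map rest), ∫ z, F (z, ρ) ∂(M.jointLaw i η) = 0 := by
    filter_upwards [hFi.prod_left_ae] with ρ hρ
    have hp := (jointLaw_posterior hprob (hK.arg_mem hη i 0).2.2.1 (hK.nu_pos η hη)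
      (hK.nu_gt η hη) (fun t => B.indicator 1 t * G (glue t ρ))).1
    have e2 : ∀ z : ℝ × ℝ, F (z, ρ) = B.indicator 1 z.2 * G (glue z.2 ρ) *
        (deriv M.ψ z.1 - M.xiHat i z.2 η) := fun z => by simp only [hF]; ring
    simp only [e2] at hρ ⊢
    exact hp hρ
  rw [integral_congr_ae hz]
  simp

/-- `xiHat` is the posterior mean. -/
lemma Generates.condExp_ξ (i : ℕ) :
    P[fun ω => deriv M.ψ (θ i ω) | sigmaOf y i] =ᵐ[P] fun ω => M.xiHat i (y i ω) η := by
  have hr := (h.memLp_residual hK hη i).integrable (by norm_num)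
  have h1 := h.condExp_mul_residual hK hη (m := i) (G := fun _ => 1) measurable_const
    (by simpa using hr)
  simp only [one_mul] at h1
  have hξ : Integrable (fun ω => deriv M.ψ (θ i ω)) P :=
    (h.memLp_ξ hK hη i).integrable (by norm_num)
  have hx : Integrable (fun ω => M.xiHat i (y i ω) η) P :=
    (h.memLp_xiHat hK hη i).integrable (by norm_num)
  have h2 := condExp_sub hξ hx (sigmaOf y i)
  have h3 : P[fun ω => M.xiHat i (y i ω) η | sigmaOf y i] = fun ω => M.xiHat i (y i ω) η :=
    condExp_of_stronglyMeasurable (h.measurable_y i).comap_le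
      ((measurable_xiHat i η).comp (comap_measurable (y i))).stronglyMeasurable hx
  filter_upwards [h1, h2] with ω w1 w2
  have w1' : (P[(fun ω => deriv M.ψ (θ i ω)) - fun ω => M.xiHat i (y i ω) η | sigmaOf y i]) ω = 0 :=
    w1
  rw [w1', Pi.sub_apply, h3] at w2
  linarith

/-- The squared prediction error of the Bayes estimator has conditional mean `T1`. -/
lemma Generates.condExp_residual_sq (i : ℕ) :
    P[fun ω => (deriv M.ψ (θ i ω) - M.xiHat i (y i ω) η) ^ 2 - M.T1 i (y i ω) η | sigmaOf y i]
      =ᵐ[P] 0 := by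
  have hV : Integrable
      (fun ω => (deriv M.ψ (θ i ω) - M.xiHat i (y i ω) η) ^ 2 - M.T1 i (y i ω) η) P :=
    (h.memLp_residual hK hη i).integrable_sq.sub (h.integrable_T1 hK hη i)
  refine condExp_eq_zero_of_forall (h.measurable_y i) hV fun B hB => ?_
  have hm : Measurable fun z : ℝ × ℝ => B.indicator 1 z.2 *
      ((deriv M.ψ z.1 - M.xiHat i z.2 η) ^ 2 - M.T1 i z.2 η) :=
    ((measurable_one.indicator hB).comp measurable_snd).mul
      (((((measurable_deriv M.ψ).comp measurable_fst).sub
        ((measurable_xiHat i η).comp measurable_snd)).pow_const 2).sub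
        ((measurable_T1 i η).comp measurable_snd))
  have hi : Integrable (fun z : ℝ × ℝ => B.indicator 1 z.2 *
      ((deriv M.ψ z.1 - M.xiHat i z.2 η) ^ 2 - M.T1 i z.2 η)) (M.jointLaw i η) := by
    rw [← h.integrable_comp i hm]
    refine hV.bdd_mul (c := 1)
      ((measurable_one.indicator hB).comp (h.measurable_y i)).aestronglyMeasurable
      (ae_of_all _ fun ω => ?_)
    by_cases hω : y i ω ∈ B <;> simp [hω]
  have := (jointLaw_posterior (h.isProbabilityMeasure i) (hK.arg_mem hη i 0).2.2.1
    (hK.nu_pos η hη) (hK.nu_gt η hη) (B.indicator 1)).2 hi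
  rw [← h.integral_comp i hm] at this
  exact this

/-- `T1` is the posterior variance. -/
lemma Generates.condVar_ξ (i : ℕ) :
    condVar (sigmaOf y i) (fun ω => deriv M.ψ (θ i ω)) P =ᵐ[P] fun ω => M.T1 i (y i ω) η := by
  have h1 := h.condExp_residual_sq hK hη i
  have hs := (h.memLp_residual hK hη i).integrable_sq
  have ht := h.integrable_T1 hK hη i
  have h2 := condExp_sub hs ht (sigmaOf y i)
  have h3 : P[fun ω => M.T1 i (y i ω) η | sigmaOf y i] = fun ω => M.T1 i (y i ω) η :=
    condExp_of_stronglyMeasurable (h.measurable_y i).comap_le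
      ((measurable_T1 i η).comp (comap_measurable (y i))).stronglyMeasurable ht
  have h4 : condVar (sigmaOf y i) (fun ω => deriv M.ψ (θ i ω)) P
      =ᵐ[P] P[fun ω => (deriv M.ψ (θ i ω) - M.xiHat i (y i ω) η) ^ 2 | sigmaOf y i] := by
    unfold condVar
    refine condExp_congr_ae ?_
    filter_upwards [h.condExp_ξ hK hη i] with ω hω
    simp [hω]
  filter_upwards [h1, h2, h4] with ω w1 w2 w4
  have w1' : (P[(fun ω => (deriv M.ψ (θ i ω) - M.xiHat i (y i ω) η) ^ 2)
    - fun ω => M.T1 i (y i ω) η | sigmaOf y i]) ω = 0 := w1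
  rw [w1', Pi.sub_apply, h3] at w2
  rw [w4]
  linarith

end law

end Model
end NEFQVF

namespace NEFQVF
namespace Model

variable {p : ℕ} {M : Model p}

/-! ### Families which are quadratic in the direct estimate -/

variable (M) in
/-- The family is a polynomial of degree at most two in the direct estimate, written by means of
its values at `0`, `1` and `-1`. -/
def IsQuad (f : ℕ → ℝ → Par p → ℝ) : Prop :=
  ∀ j y t, M.arg j 0 t ∈ M.dom → f j y t = f j 0 t * (1 - y ^ 2) + f j 1 t * ((y ^ 2 + y) / 2)
    + f j (-1) t * ((y ^ 2 - y) / 2)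

lemma abs_quad_le {a₀ a₁ a₂ B : ℝ} (h₀ : |a₀| ≤ B) (h₁ : |a₁| ≤ B) (h₂ : |a₂| ≤ B) (y : ℝ) :
    |a₀ * (1 - y ^ 2) + a₁ * ((y ^ 2 + y) / 2) + a₂ * ((y ^ 2 - y) / 2)| ≤ 3 * B * (1 + y ^ 2) := by
  have hB : 0 ≤ B := (abs_nonneg _).trans h₀
  have w0 : |1 - y ^ 2| ≤ 1 + y ^ 2 := abs_le.2 ⟨by nlinarith [sq_nonneg y], by nlinarith [sq_nonneg y]⟩
  have w1 : |(y ^ 2 + y) / 2| ≤ 1 + y ^ 2 :=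
    abs_le.2 ⟨by nlinarith [sq_nonneg (y + 1)], by nlinarith [sq_nonneg (y - 1)]⟩
  have w2 : |(y ^ 2 - y) / 2| ≤ 1 + y ^ 2 :=
    abs_le.2 ⟨by nlinarith [sq_nonneg (y - 1)], by nlinarith [sq_nonneg (y + 1)]⟩
  refine (abs_add_three _ _ _).trans ?_
  rw [abs_mul, abs_mul, abs_mul]
  have := mul_le_mul h₀ w0 (abs_nonneg _) hB
  have := mul_le_mul h₁ w1 (abs_nonneg _) hB
  have := mul_le_mul h₂ w2 (abs_nonneg _) hB
  linarith

lemma isQuad_areaScore (l : Idx p) : M.IsQuad (M.areaScore l) := by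
  intro j y t _
  simp only [areaScore, aff, Fin.sum_univ_two, g, Matrix.cons_val_zero, Matrix.cons_val_one]
  ring

lemma isQuad_xiHat : M.IsQuad M.xiHat := by
  intro j y t _
  simp only [xiHat]
  ring

lemma isQuad_T1 : M.IsQuad M.T1 := by
  intro j y t _
  simp only [T1, xiHat, Q]
  ring

lemma isQuad_r (k : Idx p) : M.IsQuad fun j y t => M.r j y t k := by
  intro j y t _
  rcases k with k | k <;> simp only [r, xiHat, Q, Q', Sum.elim_inl, Sum.elim_inr] <;> ring

lemma isQuad_R (k l : Idx p) : M.IsQuad fun j y t => M.R j y t k l := by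
  intro j y t _
  rcases k with k | k <;> rcases l with l | l <;>
    simp only [R, T11, T12, T22, xiHat, Q, Q', Matrix.fromBlocks_apply₁₁, Matrix.fromBlocks_apply₁₂,
      Matrix.fromBlocks_apply₂₁, Matrix.fromBlocks_apply₂₂, Matrix.of_apply] <;> ring

lemma isQuad_Pmat (k l : Idx p) : M.IsQuad fun j y t => M.Pmat j y t k l := by
  intro j y t _
  simp only [M.Pmat_eq]
  rcases k with k | k <;> rcases l with l | l <;>
    simp only [xiGrad, Sum.elim_inl, Sum.elim_inr] <;> ring

/-! ### Bounds for quadratic families, uniform in the area and in the direct estimate -/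

section Bounds

variable {f : ℕ → ℝ → Par p → ℝ} (hf : M.SmoothFam f) (hq : M.IsQuad f)

include hf hq

/-- The interpolation identity holds for all parameters near t, with weights free of the parameter,
so it can be differentiated. -/
lemma IsQuad.pderiv (k : Idx p) : M.IsQuad fun j y t => pd k (f j y) t := by
  intro j y t ht
  have hd : ∀ y, DifferentiableAt ℝ (f j y) t := fun y => hf.differentiableAt (y := y) ht
  have e : f j y =ᶠ[𝓝 t] fun s => f j 0 s * (1 - y ^ 2) + f j 1 s * ((y ^ 2 + y) / 2)
    + f j (-1) s * ((y ^ 2 - y) / 2) :=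
    (SmoothFam.eventually_mem ht).mono fun s hs => hq j y s hs
  have hm : ∀ (y' c : ℝ), pd k (fun s => f j y' s * c) t = pd k (f j y') t * c := by
    intro y' c
    rw [pd_mul (hd y') (differentiableAt_const c)]
    simp [pd]
  show pd k (f j y) t = _
  rw [pd_congr e, pd_add (((hd 0).mul_const _).fun_add ((hd 1).mul_const _)) ((hd (-1)).mul_const _),
    pd_add ((hd 0).mul_const _) ((hd 1).mul_const _), hm, hm, hm]

variable {K : Set (Par p)} (hK : M.Regular K)

include hK

/-- Compactness bounds the family only for bounded y. Interpolation at 0, 1 and −1 extends the bound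
to all y, and the growth 1 + y² comes from the weights. -/
lemma IsQuad.exists_bound : ∃ C, 0 ≤ C ∧ ∀ j y, ∀ t ∈ K, |f j y t| ≤ C * (1 + y ^ 2) := by
  obtain ⟨C, hC⟩ := hf.exists_bound hK 1
  refine ⟨3 * |C|, by positivity, fun j y t ht => ?_⟩
  have h := fun y' (hy' : |y'| ≤ 1) => (hC j y' hy' t ht).trans (le_abs_self C)
  rw [hq j y t (hK.arg_mem ht j 0)]
  exact abs_quad_le (h 0 (by simp)) (h 1 (by simp)) (h (-1) (by simp)) y

variable {η : Par p} {ρ : ℝ} (hρ : Metric.closedBall η ρ ⊆ K)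

include hρ

lemma IsQuad.exists_lipschitz : ∃ C, 0 ≤ C ∧ ∀ j y, ∀ t₁ ∈ Metric.closedBall η ρ,
    ∀ t₂ ∈ Metric.closedBall η ρ, |f j y t₂ - f j y t₁| ≤ C * (1 + y ^ 2) * ‖t₂ - t₁‖ := by
  obtain ⟨C, hC0, hC⟩ := hf.exists_lipschitz hK 1 hρ
  refine ⟨3 * C, by positivity, fun j y t₁ h₁ t₂ h₂ => ?_⟩
  have h := fun y' (hy' : |y'| ≤ 1) => hC j y' hy' t₁ h₁ t₂ h₂
  have e : f j y t₂ - f j y t₁ = (f j 0 t₂ - f j 0 t₁) * (1 - y ^ 2)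
      + (f j 1 t₂ - f j 1 t₁) * ((y ^ 2 + y) / 2)
      + (f j (-1) t₂ - f j (-1) t₁) * ((y ^ 2 - y) / 2) := by
    rw [hq j y t₁ (hK.arg_mem (hρ h₁) j 0), hq j y t₂ (hK.arg_mem (hρ h₂) j 0)]
    ring
  rw [e]
  refine (abs_quad_le (h 0 (by simp)) (h 1 (by simp)) (h (-1) (by simp)) y).trans (le_of_eq ?_)
  ring

lemma IsQuad.exists_taylor : ∃ C, 0 ≤ C ∧ ∀ j y, ∀ t ∈ Metric.closedBall η ρ,
      |f j y t - f j y η - ∑ k, pd k (f j y) η * (t - η) k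
        - 1 / 2 * ∑ k, ∑ l, pd k (pd l (f j y)) η * (t - η) k * (t - η) l|
        ≤ C * (1 + y ^ 2) * ‖t - η‖ ^ 3 := by
  obtain ⟨C, hC0, hC⟩ := hf.exists_taylor hK 1 hρ
  refine ⟨3 * C, by positivity, fun j y t ht => ?_⟩
  have h := fun y' (hy' : |y'| ≤ 1) => (hC j y' hy' t ht).2
  have hη : η ∈ K := hρ (Metric.mem_closedBall_self (dist_nonneg.trans ht))
  have ha := hK.arg_mem hη j 0
  have e1 : ∀ k, pd k (f j y) η = _ := fun k => hq.pderiv hf k j y η ha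
  have e2 : ∀ k l, pd k (pd l (f j y)) η = _ :=
    fun k l => (hq.pderiv hf l).pderiv (hf.pderiv l) k j y η ha
  refine le_trans (le_of_eq ?_) ((abs_quad_le (h 0 (by simp)) (h 1 (by simp)) (h (-1) (by simp))
    y).trans (le_of_eq (by ring)))
  congr 1
  simp only [e1, e2, add_mul, Finset.sum_add_distrib, sub_mul, mul_add]
  rw [hq j y t (hK.arg_mem (hρ ht) j 0), hq j y η ha]
  have p1 : ∀ (u : Idx p → ℝ) (c : ℝ), ∑ k, u k * c * (t - η) k = (∑ k, u k * (t - η) k) * c := by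
    intro u c; rw [Finset.sum_mul]; exact Finset.sum_congr rfl fun k _ => by ring
  have p2 : ∀ (u : Idx p → Idx p → ℝ) (c : ℝ), ∑ k, ∑ l, u k l * c * (t - η) k * (t - η) l
      = (∑ k, ∑ l, u k l * (t - η) k * (t - η) l) * c := by
    intro u c; simp only [Finset.sum_mul]
    exact Finset.sum_congr rfl fun k _ => Finset.sum_congr rfl fun l _ => by ring
  rw [p1, p1, p1]
  rw [p2 (fun k l => pd k (fun t => pd l (f j 0) t) η), p2 (fun k l => pd k (fun t => pd l (f j 1) t) η),
    p2 (fun k l => pd k (fun t => pd l (f j (-1)) t) η)]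
  ring

end Bounds

/-! ### Coercivity of `U` -/

/-- The trace of a positive definite matrix dominates its largest eigenvalue, so its reciprocal is a
lower bound for the inverse. -/
lemma quadForm_inv_ge {S : Matrix (Fin 2) (Fin 2) ℝ} (hs : S 1 0 = S 0 1) (hd : 0 < S.det)
    (ha : 0 < S 0 0) (z : Fin 2 → ℝ) :
    (z 0 ^ 2 + z 1 ^ 2) ≤ (S 0 0 + S 1 1) * (z ⬝ᵥ (S⁻¹ *ᵥ z)) := by
  have hdet : S.det = S 0 0 * S 1 1 - S 0 1 * S 0 1 := by rw [Matrix.det_fin_two, hs]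
  have e : z ⬝ᵥ (S⁻¹ *ᵥ z)
      = (S 1 1 * z 0 ^ 2 - 2 * S 0 1 * (z 0 * z 1) + S 0 0 * z 1 ^ 2) / S.det := by
    rw [Matrix.inv_def, Ring.inverse_eq_inv', Matrix.adjugate_fin_two]
    simp [dotProduct, Matrix.mulVec, Fin.sum_univ_two, hs]
    field_simp
    ring
  rw [e, mul_div_assoc', le_div_iff₀ hd, hdet]
  nlinarith [sq_nonneg (S 1 1 * z 0 - S 0 1 * z 1), sq_nonneg (S 0 1 * z 0 - S 0 0 * z 1)]

lemma mu2_pos {K : Set (Par p)} (hK : M.Regular K) {t : Par p} (ht : t ∈ K) (j : ℕ) :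
    0 < M.mu2 j t := by
  have hd := hK.arg_mem ht j 0
  have h1 := M.Q_pos hd.2.2.1
  have h2 := nu_sub_one_pos (hK.nu_pos t ht) (hK.nu_gt t ht)
  have h3 := M.n_pos j
  have h4 := hK.nu_pos t ht
  unfold mu2 mean lin
  have h1' : 0 < M.Q (deriv M.ψ (M.x j ⬝ᵥ beta t)) := h1
  positivity

lemma inv_le_of_pos {f : ℕ → ℝ → Par p → ℝ} {K : Set (Par p)} {C : ℝ}
    (hC : ∀ j y, |y| ≤ 0 → ∀ t ∈ K, |(f j y t)⁻¹| ≤ C) (hpos : ∀ j, ∀ t ∈ K, 0 < f j 0 t)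
    (j : ℕ) {t : Par p} (ht : t ∈ K) : (|C| + 1)⁻¹ ≤ f j 0 t := by
  have h := (hC j 0 (by simp) t ht).trans (le_abs_self C)
  rw [abs_of_pos (inv_pos.2 (hpos j t ht))] at h
  rw [inv_le_comm₀ (by positivity) (hpos j t ht)]
  linarith

end Model
end NEFQVF

namespace NEFQVF
namespace Model

variable {p : ℕ} {M : Model p}

/-- The reciprocal of F is again smooth on the domain, hence bounded above uniformly over the areas.
-/
lemma exists_pos_le {K : Set (Par p)} (hK : M.Regular K) {F : Arg p → ℝ}
    (hF : ContDiffOn ℝ ⊤ F M.dom) (hpos : ∀ e ∈ M.dom, 0 < F e) :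
    ∃ c > 0, ∀ j, ∀ t ∈ K, c ≤ F (M.arg j 0 t) := by
  have hf : M.SmoothFam fun j y t => (F (M.arg j y t))⁻¹ :=
    SmoothFam.inv_of hF (fun e he => (hpos e he).ne') fun _ _ _ _ => rfl
  obtain ⟨C, hC⟩ := hf.exists_bound hK 0
  exact ⟨(|C| + 1)⁻¹, by positivity, fun j t ht =>
    inv_le_of_pos (f := fun j y t => F (M.arg j y t)) hC
      (fun j t ht => hpos _ (hK.arg_mem ht j 0)) j ht⟩

lemma D_zero_mulVec (j : ℕ) (t v : Par p) :
    (M.D j t *ᵥ v) 0 = M.Q (M.mean j t) * (M.x j ⬝ᵥ beta v) := by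
  simp [Matrix.mulVec, dotProduct, D, beta, Finset.mul_sum, mul_assoc]

lemma D_one_mulVec (j : ℕ) (t v : Par p) :
    (M.D j t *ᵥ v) 1 = M.Q' (M.mean j t) * M.phi j t * (M.D j t *ᵥ v) 0
      + M.D j t 1 (Sum.inr ()) * nu v := by
  rw [D_zero_mulVec]
  simp [Matrix.mulVec, dotProduct, D, beta, nu, Finset.mul_sum]
  exact Finset.sum_congr rfl fun k _ => by ring

lemma dotProduct_par (v : Par p) : v ⬝ᵥ v = beta v ⬝ᵥ beta v + nu v ^ 2 := by
  simp [dotProduct, beta, nu, sq]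

lemma U_quadForm (m : ℕ) (t v : Par p) : v ⬝ᵥ (M.U m t *ᵥ v)
    = ∑ j ∈ Finset.range m, (M.D j t *ᵥ v) ⬝ᵥ ((M.Sig j t)⁻¹ *ᵥ (M.D j t *ᵥ v)) := by
  rw [U, Matrix.sum_mulVec, dotProduct_sum]
  refine Finset.sum_congr rfl fun j _ => ?_
  rw [W, ← Matrix.mulVec_mulVec, ← Matrix.mulVec_mulVec, Matrix.dotProduct_mulVec,
    Matrix.vecMul_transpose]

/-- The information grows linearly, uniformly over the parameter set. -/
theorem Regular.exists_coercive {K : Set (Par p)} (hK : M.Regular K) :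
    ∃ c > 0, ∀ᶠ m : ℕ in atTop, ∀ t ∈ K, ∀ v, c * m * (v ⬝ᵥ v) ≤ v ⬝ᵥ (M.U m t *ᵥ v) := by
  obtain ⟨c₀, hc₀, hdes⟩ := hK.design
  obtain ⟨q₀, hq₀, hq⟩ := exists_pos_le hK (F := fun e => M.Q (deriv M.ψ (e.2.2.1 ⬝ᵥ beta e.2.2.2)))
    (by
      have := SmoothFam.contDiffOn_meanArg (M := M)
      unfold Q
      fun_prop) (fun e he => M.Q_pos he.2.2.1)
  obtain ⟨κ₀, hκ₀, hκ⟩ := exists_pos_le hK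
    (F := fun e => M.Q (deriv M.ψ (e.2.2.1 ⬝ᵥ beta e.2.2.2)) * (1 + M.v₂ * e.2.1⁻¹)
      * ((e.2.2.2 (Sum.inr ()) - M.v₂)⁻¹) ^ 2)
    (by
      have h1 := SmoothFam.contDiffOn_meanArg (M := M)
      have hn : ContDiffOn ℝ ⊤ (fun e : Arg p => (e.2.1)⁻¹) M.dom :=
        contDiff_snd.fst.contDiffOn.inv fun _ h => h.1.ne'
      have h2 : ContDiffOn ℝ ⊤ (fun e : Arg p => (e.2.2.2 (Sum.inr ()) - M.v₂)⁻¹) M.dom := by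
        have hν : ContDiffOn ℝ ⊤ (fun e : Arg p => e.2.2.2 (Sum.inr ())) M.dom := by fun_prop
        exact (hν.sub contDiffOn_const).inv
          fun _ h => (nu_sub_one_pos h.2.2.2.1 h.2.2.2.2).ne'
      unfold Q
      fun_prop) (fun e he => by
      have h1 := M.Q_pos he.2.2.1
      have h2 : 0 < e.2.2.2 (Sum.inr ()) - M.v₂ := nu_sub_one_pos he.2.2.2.1 he.2.2.2.2
      have h3 : 0 < 1 + M.v₂ * e.2.1⁻¹ := by
        have hn := he.1
        have hnw := he.2.1
        have : 1 + M.v₂ * e.2.1⁻¹ = (e.2.1 + M.v₂) * e.2.1⁻¹ := by field_simp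
        rw [this]; positivity
      positivity)
  obtain ⟨B, hB⟩ := ((SmoothFam.comp_Q' (M := M) SmoothFam.mean).mul SmoothFam.phi).exists_bound
    hK 0
  obtain ⟨C, hC⟩ := ((SmoothFam.Sig (M := M) 0 0).add (SmoothFam.Sig 1 1)).exists_bound hK 0
  -- The factor 3 + 2B² collects z₀² and the bound 2z₁² + 2B²z₀² for the ν-part. The factor |C| + 1
  -- dominates the trace of Σ.
  set C₁ := (3 + 2 * B ^ 2) * (|C| + 1) with hC₁
  have hC₁0 : 0 < C₁ := by positivity
  set c₁ := min (q₀ ^ 2) (κ₀ ^ 2) with hc₁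
  have hc₁0 : 0 < c₁ := by positivity
  -- The matrix D is triangular: the first entry of D v sees only x_jᵗβ, and subtracting a bounded
  -- multiple of it from the second leaves κν with |κ| ≥ κ₀. So one area controls (x_jᵗβ)² and ν²,
  -- and the design assumption sums the former.
  have key : ∀ j, ∀ t ∈ K, ∀ v, c₁ * ((M.x j ⬝ᵥ beta v) ^ 2 + nu v ^ 2)
      ≤ C₁ * ((M.D j t *ᵥ v) ⬝ᵥ ((M.Sig j t)⁻¹ *ᵥ (M.D j t *ᵥ v))) := by
    intro j t ht v
    have hd := hK.arg_mem ht j 0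
    set z := M.D j t *ᵥ v with hz
    have hz0 : z 0 = M.Q (M.mean j t) * (M.x j ⬝ᵥ beta v) := D_zero_mulVec j t v
    have hz1 : z 1 = M.Q' (M.mean j t) * M.phi j t * z 0 + M.D j t 1 (Sum.inr ()) * nu v :=
      D_one_mulVec j t v
    have hb := hB j 0 (by simp) t ht
    set b := M.Q' (M.mean j t) * M.phi j t
    set κ := M.D j t 1 (Sum.inr ()) with hκd
    have hκ' : κ₀ ≤ -κ := by
      refine (hκ j t ht).trans (le_of_eq ?_)
      have e : κ = M.Q (M.mean j t) * (-(1 + M.v₂ / M.n j) * ((nu t - M.v₂) ^ 2)⁻¹) := by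
        simp [hκd, D]
      rw [e]
      simp only [arg, mean, lin, div_eq_mul_inv, inv_pow, nu]
      ring
    have hq' : q₀ ≤ M.Q (M.mean j t) := hq j t ht
    have h1 := quadForm_inv_ge (S := M.Sig j t) rfl (det_Sig_pos hd) (mu2_pos hK ht j) z
    have htr : M.Sig j t 0 0 + M.Sig j t 1 1 ≤ |C| + 1 := by
      have := (le_abs_self _).trans ((hC j 0 (by simp) t ht).trans (le_abs_self C))
      linarith
    have hqf : 0 ≤ z ⬝ᵥ ((M.Sig j t)⁻¹ *ᵥ z) := by
      have hS : 0 < M.Sig j t 0 0 + M.Sig j t 1 1 := by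
        have h00 : 0 < M.Sig j t 0 0 := mu2_pos hK ht j
        have hdet := det_Sig_pos hd
        rw [Matrix.det_fin_two] at hdet
        have h10 : M.Sig j t 1 0 = M.Sig j t 0 1 := rfl
        rw [h10] at hdet
        have : 0 < M.Sig j t 1 1 := by
          by_contra hneg
          have := mul_nonneg h00.le (neg_nonneg.2 (not_lt.1 hneg))
          nlinarith [sq_nonneg (M.Sig j t 0 1)]
        linarith
      have h2 : 0 ≤ z 0 ^ 2 + z 1 ^ 2 := by positivity
      exact nonneg_of_mul_nonneg_right (h2.trans h1) hS
    have h2 : z 0 ^ 2 + z 1 ^ 2 ≤ (|C| + 1) * (z ⬝ᵥ ((M.Sig j t)⁻¹ *ᵥ z)) :=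
      h1.trans (mul_le_mul_of_nonneg_right htr hqf)
    have hb2 : b ^ 2 ≤ B ^ 2 := sq_le_sq' (by linarith [(abs_le.1 hb).1]) (abs_le.1 hb).2
    have h3 : κ ^ 2 * nu v ^ 2 ≤ 2 * z 1 ^ 2 + 2 * B ^ 2 * z 0 ^ 2 := by
      have e : κ * nu v = z 1 - b * z 0 := by rw [hz1]; ring
      have : κ ^ 2 * nu v ^ 2 = (z 1 - b * z 0) ^ 2 := by rw [← e]; ring
      rw [this]
      nlinarith [sq_nonneg (z 1 + b * z 0), mul_le_mul_of_nonneg_right hb2 (sq_nonneg (z 0))]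
    have h4 : c₁ * (M.x j ⬝ᵥ beta v) ^ 2 ≤ z 0 ^ 2 := by
      rw [hz0, mul_pow]
      refine mul_le_mul_of_nonneg_right ((min_le_left _ _).trans ?_) (sq_nonneg _)
      exact pow_le_pow_left₀ hq₀.le hq' 2
    have h5 : c₁ * nu v ^ 2 ≤ κ ^ 2 * nu v ^ 2 := by
      refine mul_le_mul_of_nonneg_right ((min_le_right _ _).trans ?_) (sq_nonneg _)
      rw [← neg_sq κ]
      exact pow_le_pow_left₀ hκ₀.le hκ' 2
    calc c₁ * ((M.x j ⬝ᵥ beta v) ^ 2 + nu v ^ 2)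
        ≤ (3 + 2 * B ^ 2) * (z 0 ^ 2 + z 1 ^ 2) := by
          nlinarith [sq_nonneg (z 0), sq_nonneg (z 1), mul_nonneg (sq_nonneg B) (sq_nonneg (z 1))]
      _ ≤ (3 + 2 * B ^ 2) * ((|C| + 1) * (z ⬝ᵥ ((M.Sig j t)⁻¹ *ᵥ z))) := by gcongr
      _ = _ := by rw [hC₁]; ring
  refine ⟨c₁ * min c₀ 1 / C₁, by positivity, hdes.mono fun m hm t ht v => ?_⟩
  have h1 : c₁ * (∑ j ∈ Finset.range m, (M.x j ⬝ᵥ beta v) ^ 2 + m * nu v ^ 2)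
      ≤ C₁ * (v ⬝ᵥ (M.U m t *ᵥ v)) := by
    rw [U_quadForm, Finset.mul_sum]
    refine le_trans (le_of_eq ?_) (Finset.sum_le_sum fun j _ => key j t ht v)
    rw [← Finset.mul_sum, Finset.sum_add_distrib]
    simp
  have h2 : min c₀ 1 * m * (v ⬝ᵥ v) ≤ ∑ j ∈ Finset.range m, (M.x j ⬝ᵥ beta v) ^ 2 + m * nu v ^ 2 := by
    have hbb : 0 ≤ beta v ⬝ᵥ beta v := by
      simp only [dotProduct]; exact Finset.sum_nonneg fun k _ => mul_self_nonneg _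
    have hm0 : (0 : ℝ) ≤ m := Nat.cast_nonneg m
    calc min c₀ 1 * m * (v ⬝ᵥ v)
        = min c₀ 1 * m * (beta v ⬝ᵥ beta v) + min c₀ 1 * (m * nu v ^ 2) := by
          rw [dotProduct_par]; ring
      _ ≤ c₀ * m * (beta v ⬝ᵥ beta v) + 1 * (m * nu v ^ 2) := by
          gcongr
          · exact min_le_left _ _
          · exact min_le_right _ _
      _ ≤ _ := by linarith [hm (beta v)]
  rw [div_mul_eq_mul_div, div_mul_eq_mul_div, div_le_iff₀ hC₁0]
  calc c₁ * min c₀ 1 * m * (v ⬝ᵥ v) = c₁ * (min c₀ 1 * m * (v ⬝ᵥ v)) := by ring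
    _ ≤ c₁ * (∑ j ∈ Finset.range m, (M.x j ⬝ᵥ beta v) ^ 2 + m * nu v ^ 2) := by gcongr
    _ ≤ _ := by linarith

variable (M) in
/-- The matrix `m U⁻¹`. -/
def ut (m : ℕ) (t : Par p) (k l : Idx p) : ℝ := m * (M.U m t)⁻¹ k l

lemma det_ne_zero_of_coercive {ι : Type*} [Fintype ι] [DecidableEq ι] {A : Matrix ι ι ℝ} {c : ℝ}
    (hc : 0 < c) (h : ∀ v, c * (v ⬝ᵥ v) ≤ v ⬝ᵥ (A *ᵥ v)) : A.det ≠ 0 := by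
  intro hd
  obtain ⟨v, hv, hv0⟩ := Matrix.exists_mulVec_eq_zero_iff.2 hd
  have h1 := h v
  rw [hv0, dotProduct_zero] at h1
  have h2 : 0 ≤ v ⬝ᵥ v := by
    simp only [dotProduct]; exact Finset.sum_nonneg fun k _ => mul_self_nonneg _
  have h3 : v ⬝ᵥ v = 0 := by nlinarith
  exact hv (dotProduct_self_eq_zero.1 h3)

/-- Coercivity at v = A⁻¹e_l reads c|v|² ≤ v_l ≤ |v|, hence c|v| ≤ 1 for each column v of the
inverse. -/
lemma abs_inv_le_of_coercive {ι : Type*} [Fintype ι] [DecidableEq ι] {A : Matrix ι ι ℝ} {c : ℝ}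
    (hc : 0 < c) (h : ∀ v, c * (v ⬝ᵥ v) ≤ v ⬝ᵥ (A *ᵥ v)) (k l : ι) : c * |A⁻¹ k l| ≤ 1 := by
  have hd := det_ne_zero_of_coercive hc h
  set v : ι → ℝ := A⁻¹ *ᵥ Pi.single l 1 with hv
  have hAv : A *ᵥ v = Pi.single l 1 := by
    rw [hv, Matrix.mulVec_mulVec, Matrix.mul_nonsing_inv _ hd.isUnit, Matrix.one_mulVec]
  have hvk : v k = A⁻¹ k l := by simp [hv]
  have h1 := h v
  rw [hAv, dotProduct_single_one] at h1
  have hle : ∀ a, v a ^ 2 ≤ v ⬝ᵥ v := fun a => by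
    rw [sq]
    exact Finset.single_le_sum (f := fun a => v a * v a) (fun a _ => mul_self_nonneg _)
      (Finset.mem_univ a)
  have h2 := hle l
  have h3 := hle k
  set S := v ⬝ᵥ v
  have hS : 0 ≤ S := (sq_nonneg _).trans h2
  have h4 : c ^ 2 * S ≤ 1 := by
    rcases hS.eq_or_lt with h0 | h0
    · rw [← h0]; simp
    · have : (c * S) ^ 2 ≤ S := by
        have : (c * S) ^ 2 ≤ v l ^ 2 := pow_le_pow_left₀ (by positivity) h1 2
        linarith
      nlinarith
  rw [← hvk]
  have h5 : (c * |v k|) ^ 2 ≤ 1 := by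
    rw [mul_pow, sq_abs]
    nlinarith [sq_nonneg c]
  nlinarith [mul_nonneg hc.le (abs_nonneg (v k))]

lemma Regular.exists_ut_bound {K : Set (Par p)} (hK : M.Regular K) :
    ∃ C, 0 ≤ C ∧ ∀ᶠ m : ℕ in atTop, ∀ t ∈ K, (M.U m t).det ≠ 0 ∧ ∀ k l, |M.ut m t k l| ≤ C := by
  obtain ⟨c, hc, h⟩ := hK.exists_coercive
  refine ⟨c⁻¹, by positivity, (h.and (eventually_gt_atTop 0)).mono fun m hm t ht => ?_⟩
  have hm0 : (0 : ℝ) < m := by exact_mod_cast hm.2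
  refine ⟨det_ne_zero_of_coercive (mul_pos hc hm0) (hm.1 t ht), fun k l => ?_⟩
  have := abs_inv_le_of_coercive (mul_pos hc hm0) (hm.1 t ht) k l
  rw [ut, abs_mul, abs_of_pos hm0]
  calc (m : ℝ) * |(M.U m t)⁻¹ k l| = c⁻¹ * (c * m * |(M.U m t)⁻¹ k l|) := by field_simp
    _ ≤ c⁻¹ * 1 := by gcongr
    _ = c⁻¹ := mul_one _

end Model
end NEFQVF

namespace NEFQVF

variable {p : ℕ}

/-! ### Asymptotically bounded and equicontinuous functions -/

/-- For large `m`, the functions are bounded over `K` and Lipschitz at `η` along the ball of radius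
`ρ`, with constants which grow at most like `|y|^d`. -/
def Nice (K : Set (Par p)) (η : Par p) (ρ : ℝ) (d : ℕ) (h : ℕ → ℝ → Par p → ℝ) : Prop :=
  ∃ C, 0 ≤ C ∧ ∀ᶠ m in atTop, ∀ y, (∀ t ∈ K, |h m y t| ≤ C * (1 + |y|) ^ d) ∧
    ∀ t ∈ Metric.closedBall η ρ, |h m y t - h m y η| ≤ C * (1 + |y|) ^ d * ‖t - η‖

namespace Nice

variable {K : Set (Par p)} {η : Par p} {ρ : ℝ} {d d' : ℕ} {h h' : ℕ → ℝ → Par p → ℝ}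

lemma const (c : ℝ) : Nice K η ρ 0 fun _ _ _ => c :=
  ⟨|c|, abs_nonneg c, Eventually.of_forall fun m y => ⟨fun t _ => by simp, fun t _ => by
    simp only [sub_self, abs_zero]; positivity⟩⟩

lemma congr (hh : Nice K η ρ d h) (hK : Metric.closedBall η ρ ⊆ K)
    (e : ∀ᶠ m in atTop, ∀ y, ∀ t ∈ K, h' m y t = h m y t) : Nice K η ρ d h' := by
  obtain ⟨C, hC, hm⟩ := hh
  refine ⟨C, hC, (hm.and e).mono fun m hm y => ⟨fun t ht => ?_, fun t ht => ?_⟩⟩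
  · rw [hm.2 y t ht]; exact (hm.1 y).1 t ht
  · rw [hm.2 y t (hK ht), hm.2 y η (hK (Metric.mem_closedBall_self (dist_nonneg.trans ht)))]
    exact (hm.1 y).2 t ht

lemma mono (hh : Nice K η ρ d h) (hd : d ≤ d') : Nice K η ρ d' h := by
  obtain ⟨C, hC, hm⟩ := hh
  refine ⟨C, hC, hm.mono fun m hm y => ?_⟩
  have h1 : (1 + |y|) ^ d ≤ (1 + |y|) ^ d' :=
    pow_le_pow_right₀ (by linarith [abs_nonneg y]) hd
  refine ⟨fun t ht => ((hm y).1 t ht).trans (by gcongr), fun t ht => ((hm y).2 t ht).trans ?_⟩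
  gcongr

lemma add (hh : Nice K η ρ d h) (hh' : Nice K η ρ d h') :
    Nice K η ρ d fun m y t => h m y t + h' m y t := by
  obtain ⟨C, hC, hm⟩ := hh
  obtain ⟨C', hC', hm'⟩ := hh'
  refine ⟨C + C', by positivity, (hm.and hm').mono fun m hm y => ⟨fun t ht => ?_, fun t ht => ?_⟩⟩
  · refine (abs_add_le _ _).trans ?_
    linarith [(hm.1 y).1 t ht, (hm.2 y).1 t ht]
  · rw [add_sub_add_comm]
    refine (abs_add_le _ _).trans ?_
    linarith [(hm.1 y).2 t ht, (hm.2 y).2 t ht]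

lemma mul (hh : Nice K η ρ d h) (hh' : Nice K η ρ d' h') (hK : Metric.closedBall η ρ ⊆ K) :
    Nice K η ρ (d + d') fun m y t => h m y t * h' m y t := by
  obtain ⟨C, hC, hm⟩ := hh
  obtain ⟨C', hC', hm'⟩ := hh'
  refine ⟨2 * (C * C'), by positivity, (hm.and hm').mono fun m hm y =>
    ⟨fun t ht => ?_, fun t ht => ?_⟩⟩
  · rw [abs_mul]
    have := mul_le_mul ((hm.1 y).1 t ht) ((hm.2 y).1 t ht) (abs_nonneg _) (by positivity)
    refine this.trans ?_
    have h0 : 0 ≤ C * C' * (1 + |y|) ^ (d + d') := by positivity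
    rw [pow_add] at h0 ⊢
    linarith
  · have hη : η ∈ K := hK (Metric.mem_closedBall_self (dist_nonneg.trans ht))
    have e : h m y t * h' m y t - h m y η * h' m y η
        = (h m y t - h m y η) * h' m y t + h m y η * (h' m y t - h' m y η) := by ring
    rw [e]
    refine (abs_add_le _ _).trans ?_
    rw [abs_mul, abs_mul]
    have h1 := mul_le_mul ((hm.1 y).2 t ht) ((hm.2 y).1 t (hK ht)) (abs_nonneg _) (by positivity)
    have h2 := mul_le_mul ((hm.1 y).1 η hη) ((hm.2 y).2 t ht) (abs_nonneg _) (by positivity)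
    refine (add_le_add h1 h2).trans (le_of_eq ?_)
    rw [pow_add]; ring

lemma const_mul (hh : Nice K η ρ d h) (hK : Metric.closedBall η ρ ⊆ K) (c : ℝ) :
    Nice K η ρ d fun m y t => c * h m y t := by
  simpa using (const c).mul hh hK

lemma sum {ι : Type*} (s : Finset ι) {h : ι → ℕ → ℝ → Par p → ℝ}
    (hh : ∀ i ∈ s, Nice K η ρ d (h i)) : Nice K η ρ d fun m y t => ∑ i ∈ s, h i m y t := by
  classical
  induction s using Finset.induction_on with
  | empty => simpa using (const (K := K) (η := η) (ρ := ρ) 0).mono (Nat.zero_le d)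
  | insert a s ha ih =>
    simp only [Finset.sum_insert ha]
    exact (hh a (Finset.mem_insert_self a s)).add
      (ih fun i hi => hh i (Finset.mem_insert_of_mem hi))

end Nice

namespace Model

variable {M : Model p} {K : Set (Par p)} (hK : M.Regular K) {η : Par p} {ρ : ℝ}
  (hρ : Metric.closedBall η ρ ⊆ K)

include hK hρ

lemma IsQuad.nice {f : ℕ → ℝ → Par p → ℝ} (hq : M.IsQuad f) (hf : M.SmoothFam f) (i : ℕ) :
    Nice K η ρ 2 fun _ y t => f i y t := by
  obtain ⟨C, hC, hb⟩ := hq.exists_bound hf hK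
  obtain ⟨C', hC', hb'⟩ := hq.exists_lipschitz hf hK hρ
  have hy : ∀ y : ℝ, 1 + y ^ 2 ≤ (1 + |y|) ^ 2 := fun y => by
    rw [← sq_abs y]; nlinarith [abs_nonneg y]
  refine ⟨max C C', hC.trans (le_max_left _ _), Eventually.of_forall fun m y =>
    ⟨fun t ht => (hb i y t ht).trans ?_, fun t ht => (hb' i y η
      (Metric.mem_closedBall_self (dist_nonneg.trans ht)) t ht).trans ?_⟩⟩
  · exact mul_le_mul (le_max_left _ _) (hy y) (by positivity) (hC.trans (le_max_left _ _))
  · refine mul_le_mul_of_nonneg_right ?_ (norm_nonneg _)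
    exact mul_le_mul (le_max_right _ _) (hy y) (by positivity) (hC.trans (le_max_left _ _))

lemma SmoothFam.nice_avg {f : ℕ → Par p → ℝ} (hf : M.SmoothFam fun j _ t => f j t) :
    Nice K η ρ 0 fun m _ t => (m : ℝ)⁻¹ * ∑ j ∈ Finset.range m, f j t := by
  obtain ⟨C, hb⟩ := hf.exists_bound hK 0
  obtain ⟨C', hC', hb'⟩ := hf.exists_lipschitz hK 0 hρ
  have avg : ∀ (m : ℕ) (a : ℕ → ℝ) (A : ℝ), 0 ≤ A → (∀ j, |a j| ≤ A) →
      |(m : ℝ)⁻¹ * ∑ j ∈ Finset.range m, a j| ≤ A := by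
    intro m a A hA h
    rw [abs_mul, abs_of_nonneg (by positivity : (0 : ℝ) ≤ (m : ℝ)⁻¹)]
    rcases Nat.eq_zero_or_pos m with rfl | hm
    · simpa using hA
    · have hm' : (0 : ℝ) < m := by exact_mod_cast hm
      rw [inv_mul_le_iff₀ hm']
      refine (Finset.abs_sum_le_sum_abs _ _).trans ((Finset.sum_le_sum fun j _ => h j).trans ?_)
      simp
  refine ⟨max |C| C', hC'.trans (le_max_right _ _), Eventually.of_forall fun m y =>
    ⟨fun t ht => ?_, fun t ht => ?_⟩⟩
  · rw [pow_zero, mul_one]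
    refine avg m _ _ (hC'.trans (le_max_right _ _)) fun j => ?_
    exact (hb j 0 (by simp) t ht).trans ((le_abs_self C).trans (le_max_left _ _))
  · rw [pow_zero, mul_one, ← mul_sub, ← Finset.sum_sub_distrib]
    refine avg m _ _ (by positivity) fun j => ?_
    refine (hb' j 0 (by simp) η (Metric.mem_closedBall_self (dist_nonneg.trans ht)) t ht).trans ?_
    exact mul_le_mul_of_nonneg_right (le_max_right _ _) (norm_nonneg _)

/-- Resolvent identity: the increment of m U⁻¹ is the product of two bounded factors m U⁻¹ with the
increment of the average m⁻¹U between them, and the latter is Lipschitz uniformly in m. -/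
lemma nice_ut (k l : Idx p) : Nice K η ρ 0 fun m _ t => M.ut m t k l := by
  obtain ⟨C, hC, hb⟩ := hK.exists_ut_bound
  have hU : ∀ a b, Nice K η ρ 0 fun m _ t =>
      (m : ℝ)⁻¹ * ∑ j ∈ Finset.range m, (M.W j t * M.D j t) a b := by
    intro a b
    refine SmoothFam.nice_avg hK hρ (f := fun j t => (M.W j t * M.D j t) a b) ?_
    simp only [Matrix.mul_apply]
    exact SmoothFam.sum _ fun c _ => (SmoothFam.W a c).mul (SmoothFam.D c b)
  choose L hL0 hL using hU
  have hL' : ∀ᶠ m in atTop, ∀ a b, ∀ y : ℝ, _ :=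
    eventually_all.2 fun a => eventually_all.2 fun b => hL a b
  have hs : 0 ≤ ∑ a, ∑ b, C * L a b * C := Finset.sum_nonneg fun a _ =>
    Finset.sum_nonneg fun b _ => by have := hL0 a b; positivity
  refine ⟨C + ∑ a, ∑ b, C * L a b * C, add_nonneg hC hs, ?_⟩
  filter_upwards [hb, hL', eventually_gt_atTop 0] with m hm hm' hm0 y
  have hm0' : (0 : ℝ) < m := by exact_mod_cast hm0
  refine ⟨fun t ht => ?_, fun t ht => ?_⟩
  · rw [pow_zero, mul_one]
    exact ((hm t ht).2 k l).trans (by linarith)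
  · have hη : η ∈ K := hρ (Metric.mem_closedBall_self (dist_nonneg.trans ht))
    have hdt := (hm t (hρ ht)).1.isUnit
    have hdη := (hm η hη).1.isUnit
    have e1 : (M.U m t)⁻¹ - (M.U m η)⁻¹
        = (M.U m t)⁻¹ * (M.U m η - M.U m t) * (M.U m η)⁻¹ := by
      rw [Matrix.mul_sub, Matrix.sub_mul, Matrix.nonsing_inv_mul _ hdt, Matrix.one_mul,
        Matrix.mul_assoc, Matrix.mul_nonsing_inv _ hdη, Matrix.mul_one]
    have e2 : M.ut m t k l - M.ut m η k l = ∑ a, ∑ b, M.ut m t k b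
        * ((m : ℝ)⁻¹ * ∑ j ∈ Finset.range m, (M.W j η * M.D j η) b a
          - (m : ℝ)⁻¹ * ∑ j ∈ Finset.range m, (M.W j t * M.D j t) b a) * M.ut m η a l := by
      have := congrFun (congrFun e1 k) l
      rw [Matrix.sub_apply, Matrix.mul_apply] at this
      simp only [ut]
      rw [← mul_sub, this, Finset.mul_sum]
      refine Finset.sum_congr rfl fun a _ => ?_
      rw [Matrix.mul_apply, Finset.sum_mul, Finset.mul_sum]
      refine Finset.sum_congr rfl fun b _ => ?_
      rw [Matrix.sub_apply, U, U, Matrix.sum_apply, Matrix.sum_apply]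
      field_simp
    rw [e2, pow_zero, mul_one, add_mul]
    refine (Finset.abs_sum_le_sum_abs _ _).trans ?_
    have h3 : ∑ a, |∑ b, M.ut m t k b
        * ((m : ℝ)⁻¹ * ∑ j ∈ Finset.range m, (M.W j η * M.D j η) b a
          - (m : ℝ)⁻¹ * ∑ j ∈ Finset.range m, (M.W j t * M.D j t) b a) * M.ut m η a l|
        ≤ (∑ a, ∑ b, C * L b a * C) * ‖t - η‖ := by
      rw [Finset.sum_mul]
      refine Finset.sum_le_sum fun a _ => (Finset.abs_sum_le_sum_abs _ _).trans ?_
      rw [Finset.sum_mul]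
      refine Finset.sum_le_sum fun b _ => ?_
      rw [abs_mul, abs_mul]
      have l1 := (hm' b a y).2 t ht
      rw [pow_zero, mul_one, abs_sub_comm] at l1
      calc _ ≤ C * (L b a * ‖t - η‖) * C := by
            gcongr
            · have := hL0 b a; positivity
            · exact (hm t (hρ ht)).2 k b
            · exact (hm η hη).2 a l
        _ = _ := by ring
    rw [Finset.sum_comm] at h3
    have : 0 ≤ C * ‖t - η‖ := by positivity
    linarith

/-- The vector is of order one: U⁻¹ is of order 1/m and the sum over the areas of order m. The
factor m is moved accordingly, onto m U⁻¹ and averages. -/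
lemma nice_a1 (l : Idx p) : Nice K η ρ 0 fun m _ t => M.a1 m t l := by
  have hsm : ∀ k k', M.SmoothFam fun j _ t => ∑ a, M.jacCoef l k a j t * M.D j t a k' :=
    fun k k' => SmoothFam.sum Finset.univ fun a _ =>
      (SmoothFam.jacCoef l k a).mul (SmoothFam.D a k')
  have h1 : ∀ k k', Nice K η ρ 0 fun m _ t => M.ut m t k k' * ((m : ℝ)⁻¹ *
      ∑ j ∈ Finset.range m, ∑ a, M.jacCoef l k a j t * M.D j t a k') := fun k k' =>
    (nice_ut hK hρ k k').mul (SmoothFam.nice_avg hK hρ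
      (f := fun j t => ∑ a, M.jacCoef l k a j t * M.D j t a k') (hsm k k')) hρ
  refine (Nice.sum Finset.univ fun k _ => Nice.sum Finset.univ fun k' _ => h1 k k').congr hρ ?_
  filter_upwards [eventually_gt_atTop 0] with m hm y t ht
  have hm0' : (m : ℝ) ≠ 0 := by exact_mod_cast hm.ne'
  rw [a1_eq_sum hK ht]
  refine Finset.sum_congr rfl fun k _ => Finset.sum_congr rfl fun k' _ => ?_
  rw [ut]; field_simp

lemma nice_a2 (l : Idx p) : Nice K η ρ 0 fun m _ t => M.a2 m t l := by
  have h1 : ∀ k k', Nice K η ρ 0 fun m _ t => M.ut m t k k' * ((m : ℝ)⁻¹ *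
      ∑ j ∈ Finset.range m, M.hessConst l k k' j t) := fun k k' =>
    (nice_ut hK hρ k k').mul (SmoothFam.nice_avg hK hρ
      (f := fun j t => M.hessConst l k k' j t) (SmoothFam.hessConst l k k')) hρ
  refine (Nice.sum Finset.univ fun k _ => Nice.sum Finset.univ fun k' _ => h1 k k').congr hρ ?_
  filter_upwards [eventually_gt_atTop 0] with m hm y t ht
  have hm0' : (m : ℝ) ≠ 0 := by exact_mod_cast hm.ne'
  rw [a2_eq_sum hK ht]
  refine Finset.sum_congr rfl fun k _ => Finset.sum_congr rfl fun k' _ => ?_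
  rw [ut]; field_simp

variable (M) in
omit hK hρ in
/-- The part of `cmseHat` of order `1 / m`. -/
def corr (m i : ℕ) (y : ℝ) (t : Par p) : ℝ :=
  M.T2 m i y t - M.r i y t ⬝ᵥ M.b m i y t - 1 / 2 * (M.R i y t * (M.U m t)⁻¹).trace

omit hK hρ in
lemma cmseHat_eq (m i : ℕ) (y : ℝ) (t : Par p) : M.cmseHat m i y t = M.T1 i y t + M.corr m i y t := by
  rw [cmseHat, corr]; ring

omit hK hρ in
lemma trace_mul_inv_U (A : Matrix (Idx p) (Idx p) ℝ) (m : ℕ) (t : Par p) :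
    (m : ℝ) * (A * (M.U m t)⁻¹).trace = ∑ k, ∑ l, A k l * M.ut m t l k := by
  simp only [Matrix.trace, Matrix.diag_apply, Matrix.mul_apply, Finset.mul_sum, ut]
  exact Finset.sum_congr rfl fun k _ => Finset.sum_congr rfl fun l _ => by ring

omit hK hρ in
lemma W_mulVec_g (i : ℕ) (y : ℝ) (t : Par p) (l : Idx p) :
    (M.W i t *ᵥ M.g i y t) l = M.areaScore l i y t := by
  simp [areaScore, aff, scoreCoef, Matrix.mulVec, dotProduct]

omit hK hρ in
lemma mul_b (m i : ℕ) (y : ℝ) (t : Par p) (l : Idx p) :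
    (m : ℝ) * M.b m i y t l = ∑ k, M.ut m t l k *
      (M.areaScore k i y t + M.a1 m t k + 1 / 2 * M.a2 m t k) := by
  simp only [b, Matrix.mulVec, dotProduct, Finset.mul_sum, ut, Pi.add_apply, Pi.smul_apply,
    smul_eq_mul]
  refine Finset.sum_congr rfl fun k _ => ?_
  rw [← W_mulVec_g]
  simp only [Matrix.mulVec, dotProduct]
  ring

omit hK hρ in
lemma mul_corr (m i : ℕ) (y : ℝ) (t : Par p) : (m : ℝ) * M.corr m i y t =
    (∑ k, ∑ l, M.Pmat i y t k l * M.ut m t l k)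
      + (-1) * (∑ l, M.r i y t l * ∑ k, M.ut m t l k *
        (M.areaScore k i y t + M.a1 m t k + 1 / 2 * M.a2 m t k))
      + (-1 / 2) * ∑ k, ∑ l, M.R i y t k l * M.ut m t l k := by
  have h1 : (m : ℝ) * (M.r i y t ⬝ᵥ M.b m i y t) = ∑ l, M.r i y t l * ∑ k, M.ut m t l k *
        (M.areaScore k i y t + M.a1 m t k + 1 / 2 * M.a2 m t k) := by
    rw [dotProduct, Finset.mul_sum]
    refine Finset.sum_congr rfl fun l _ => ?_
    rw [← mul_b]; ring
  rw [← h1, ← trace_mul_inv_U, ← trace_mul_inv_U, corr, T2]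
  ring

/-- The growth exponent 4 is that of the product of `r` with the score of area i, each quadratic in
y. The fourth moments of y_i then give integrability. -/
lemma nice_corr (i : ℕ) : Nice K η ρ 4 fun m y t => (m : ℝ) * M.corr m i y t := by
  simp only [mul_corr]
  have hu := fun k l => nice_ut hK hρ k l
  have hs := fun k => ((isQuad_areaScore (M := M) k).nice hK hρ (SmoothFam.areaScore k) i)
  have hv : ∀ k, Nice K η ρ 2 fun m y t =>
      M.areaScore k i y t + M.a1 m t k + 1 / 2 * M.a2 m t k := fun k =>
    ((hs k).add ((nice_a1 hK hρ k).mono (by norm_num))).add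
      (((nice_a2 hK hρ k).const_mul hρ (1 / 2)).mono (by norm_num))
  have h1 : Nice K η ρ 4 fun m y t => ∑ k, ∑ l, M.Pmat i y t k l * M.ut m t l k :=
    (Nice.sum _ fun k _ => Nice.sum _ fun l _ =>
      ((isQuad_Pmat k l).nice hK hρ (SmoothFam.Pmat k l) i).mul (hu l k) hρ).mono (by norm_num)
  have h2 : Nice K η ρ 4 fun m y t => ∑ k, ∑ l, M.R i y t k l * M.ut m t l k :=
    (Nice.sum _ fun k _ => Nice.sum _ fun l _ =>
      ((isQuad_R k l).nice hK hρ (SmoothFam.R k l) i).mul (hu l k) hρ).mono (by norm_num)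
  have h3 : Nice K η ρ 4 fun m y t => ∑ l, M.r i y t l * ∑ k, M.ut m t l k *
        (M.areaScore k i y t + M.a1 m t k + 1 / 2 * M.a2 m t k) :=
    Nice.sum _ fun l _ => ((isQuad_r l).nice hK hρ (SmoothFam.r l) i).mul (d' := 2)
      (Nice.sum _ fun k _ => by simpa using (hu l k).mul (hv k) hρ) hρ
  exact (h1.add (h3.const_mul hρ (-1))).add (h2.const_mul hρ (-1 / 2))

end Model
end NEFQVF

namespace NEFQVF
namespace Model

variable {p : ℕ} {M : Model p}

/-! ### Averages of centred variables -/

variable (M) in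
/-- The average over the first `m` areas of the centred parts with coefficients `α`. -/
def avg (α : Fin 2 → ℕ → Par p → ℝ) (m : ℕ) (Y : ℕ → ℝ) (η : Par p) : ℝ :=
  (m : ℝ)⁻¹ * ∑ j ∈ Finset.range m, M.ctr α j (Y j) η

variable (M) in
/-- The coefficients of `y²`, of the score and of its first two derivatives. -/
def noiseCoef :
    Option (Idx p ⊕ (Idx p × Idx p) ⊕ (Idx p × Idx p × Idx p)) → Fin 2 → ℕ → Par p → ℝ
  | none => fun a j η => ![2 * M.mean j η, 1] a
  | some (.inl l) => M.scoreCoef l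
  | some (.inr (.inl (l, k))) => M.jacCoef l k
  | some (.inr (.inr (l, k, k'))) => M.hessCoef l k k'

variable (M) in
/-- The size of the fluctuations of the averages which enter the expansion of the estimator. -/
def noise (m : ℕ) (Y : ℕ → ℝ) (η : Par p) : ℝ := ∑ c, |M.avg (M.noiseCoef c) m Y η|

lemma SmoothFam.noiseCoef (c : Option (Idx p ⊕ (Idx p × Idx p) ⊕ (Idx p × Idx p × Idx p)))
    (a : Fin 2) : M.SmoothFam fun j _ η => M.noiseCoef c a j η := by
  rcases c with _ | l | ⟨l, k⟩ | ⟨l, k, k'⟩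
  · fin_cases a
    · exact (SmoothFam.const 2).mul SmoothFam.mean
    · exact SmoothFam.const 1
  · exact SmoothFam.scoreCoef l a
  · exact SmoothFam.jacCoef l k a
  · exact SmoothFam.hessCoef l k k' a

lemma noise_nonneg (m : ℕ) (Y : ℕ → ℝ) (η : Par p) : 0 ≤ M.noise m Y η :=
  Finset.sum_nonneg fun _ _ => abs_nonneg _

lemma abs_avg_le_noise (c : Option (Idx p ⊕ (Idx p × Idx p) ⊕ (Idx p × Idx p × Idx p)))
    (m : ℕ) (Y : ℕ → ℝ) (η : Par p) : |M.avg (M.noiseCoef c) m Y η| ≤ M.noise m Y η :=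
  Finset.single_le_sum (f := fun c => |M.avg (M.noiseCoef c) m Y η|) (fun _ _ => abs_nonneg _)
    (Finset.mem_univ c)

/-- The Taylor remainders carry constants growing like 1 + y². Including the centred version of y²
in the fluctuations keeps the average of these constants bounded. -/
lemma sq_eq_ctr (j : ℕ) (t : ℝ) (η : Par p) :
    t ^ 2 = M.ctr (M.noiseCoef none) j t η + (M.mean j η ^ 2 + M.mu2 j η) := by
  simp only [ctr, Fin.sum_univ_two, noiseCoef, g, Matrix.cons_val_zero, Matrix.cons_val_one,
    phi_mul_Q]
  ring

/-- The average of `y²` is bounded in terms of the fluctuations. -/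
lemma exists_avg_sq_le {K : Set (Par p)} (hK : M.Regular K) {η : Par p} (hη : η ∈ K) :
    ∃ C, 0 ≤ C ∧ ∀ (m : ℕ) (Y : ℕ → ℝ),
      (m : ℝ)⁻¹ * ∑ j ∈ Finset.range m, (1 + Y j ^ 2) ≤ C + M.noise m Y η := by
  have hs : M.SmoothFam fun j _ t => M.mean j t ^ 2 + M.mu2 j t :=
    (SmoothFam.mean.pow 2).add SmoothFam.mu2
  obtain ⟨C, hC⟩ := hs.exists_bound hK 0
  refine ⟨1 + |C|, by positivity, fun m Y => ?_⟩
  have h1 : ∀ j ∈ Finset.range m, 1 + Y j ^ 2 ≤ (1 + |C|) + M.ctr (M.noiseCoef none) j (Y j) η := by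
    intro j _
    have h2 := (le_abs_self _).trans ((hC j 0 (by simp) η hη).trans (le_abs_self C))
    linarith [sq_eq_ctr (M := M) j (Y j) η]
  have h3 := Finset.sum_le_sum h1
  rw [Finset.sum_add_distrib (f := fun _ => 1 + |C|)] at h3
  have h4 := mul_le_mul_of_nonneg_left h3 (by positivity : (0 : ℝ) ≤ (m : ℝ)⁻¹)
  refine h4.trans ?_
  rw [mul_add]
  have h5 : M.avg (M.noiseCoef none) m Y η ≤ M.noise m Y η :=
    (le_abs_self _).trans (abs_avg_le_noise none m Y η)
  refine add_le_add ?_ h5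
  rw [Finset.sum_const, Finset.card_range, nsmul_eq_mul, ← mul_assoc]
  refine mul_le_of_le_one_left (by positivity) ?_
  exact inv_mul_le_one

section law

variable {K : Set (Par p)} (hK : M.Regular K) {η : Par p} (hη : η ∈ K)
  {Ω : Type*} [MeasurableSpace Ω] {P : Measure Ω} [IsProbabilityMeasure P]
  {θ y : ℕ → Ω → ℝ} (h : M.Generates P η θ y)

omit [IsProbabilityMeasure P] in
include h in
lemma Generates.measurable_avg (α : Fin 2 → ℕ → Par p → ℝ) (m : ℕ) :
    Measurable fun ω => M.avg α m (fun j => y j ω) η :=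
  (Finset.measurable_sum _ fun j _ => (measurable_ctr α j η).comp (h.measurable_y j)).const_mul _

omit [IsProbabilityMeasure P] in
include h in
lemma Generates.measurable_noise (m : ℕ) : Measurable fun ω => M.noise m (fun j => y j ω) η :=
  Finset.measurable_sum _ fun c _ => (h.measurable_avg _ m).abs

include hK hη h

/-- The centred terms are quadratic in y, so moments of y of order 2q bound their q-th moments. The
inequality for sums gives m^(q/2), and averaging multiplies by m^(−q). -/
lemma Generates.exists_avg_moment {q b : ℝ} (hq : 2 < q) (hq3 : q ≤ 3)
    (hb : ∀ j, Integrable (fun ω => |y j ω - M.mean j η| ^ (2 * q)) P ∧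
        ∫ ω, |y j ω - M.mean j η| ^ (2 * q) ∂P ≤ b)
    {α : Fin 2 → ℕ → Par p → ℝ} (hα : ∀ a, M.SmoothFam fun j _ η => α a j η) :
    ∃ C, 0 ≤ C ∧ ∀ m : ℕ, 0 < m →
      Integrable (fun ω => |M.avg α m (fun j => y j ω) η| ^ q) P ∧
      ∫ ω, |M.avg α m (fun j => y j ω) η| ^ q ∂P ≤ C * (m : ℝ) ^ (-(q / 2)) := by
  obtain ⟨A₀, hA₀⟩ := (hα 0).exists_bound hK 0
  obtain ⟨A₁, hA₁⟩ := (hα 1).exists_bound hK 0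
  obtain ⟨A₂, hA₂⟩ := (SmoothFam.mu2 (M := M)).exists_bound hK 0
  set A := |A₀| + |A₁| * (1 + |A₂|) with hA
  have hA0 : 0 ≤ A := by positivity
  set X : ℕ → Ω → ℝ := fun j ω => M.ctr α j (y j ω) η with hX
  have hXm : ∀ j, Measurable (X j) := fun j => (measurable_ctr α j η).comp (h.measurable_y j)
  have hpt : ∀ j ω, |X j ω| ^ q ≤ A ^ q * (2 ^ (q - 1) * (1 + |y j ω - M.mean j η| ^ (2 * q))) := by
    intro j ω
    set u := y j ω - M.mean j η with hu
    have e0 := (hA₀ j 0 (by simp) η hη).trans (le_abs_self _)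
    have e1 := (hA₁ j 0 (by simp) η hη).trans (le_abs_self _)
    have e2 := (hA₂ j 0 (by simp) η hη).trans (le_abs_self _)
    have h1 : |X j ω| ≤ A * (1 + |u| ^ (2 : ℝ)) := by
      have e : X j ω = α 0 j η * u + α 1 j η * (u ^ 2 - M.mu2 j η) := by
        simp only [hX, ctr, Fin.sum_univ_two, g, Matrix.cons_val_zero, Matrix.cons_val_one,
          phi_mul_Q, hu]
      have h3 : |u| ≤ 1 + |u| ^ 2 := by nlinarith [abs_nonneg u]
      have h4 : |u ^ 2 - M.mu2 j η| ≤ (1 + |A₂|) * (1 + |u| ^ 2) := by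
        refine (abs_sub _ _).trans ?_
        rw [abs_pow]
        nlinarith [sq_nonneg |u|, abs_nonneg A₂, mul_nonneg (abs_nonneg A₂) (sq_nonneg |u|)]
      rw [e, Real.rpow_two]
      refine (abs_add_le _ _).trans ?_
      rw [abs_mul, abs_mul]
      calc _ ≤ |A₀| * (1 + |u| ^ 2) + |A₁| * ((1 + |A₂|) * (1 + |u| ^ 2)) := by gcongr
        _ = _ := by rw [hA]; ring
    refine (Real.rpow_le_rpow (abs_nonneg _) h1 (by linarith)).trans ?_
    rw [Real.mul_rpow hA0 (by positivity)]
    refine mul_le_mul_of_nonneg_left ?_ (by positivity)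
    rw [Real.rpow_mul (abs_nonneg u)]
    have h5 := abs_sum_rpow_le (by linarith : 1 ≤ q) ![1, |u| ^ (2 : ℝ)]
    simp only [Fin.sum_univ_two, Matrix.cons_val_zero, Matrix.cons_val_one, abs_one,
      Real.one_rpow, Fintype.card_fin, abs_of_nonneg (Real.rpow_nonneg (abs_nonneg u) 2)] at h5
    exact_mod_cast h5
  have hi : ∀ j, Integrable (fun ω => |X j ω| ^ q) P := fun j =>
    ((((integrable_const (1 : ℝ)).add (hb j).1).const_mul (2 ^ (q - 1))).const_mul (A ^ q)).mono'
      ((hXm j).abs.pow_const q).aestronglyMeasurable (ae_of_all _ fun ω => by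
        rw [Real.norm_of_nonneg (by positivity)]; exact hpt j ω)
  have hbd : ∀ j, ∫ ω, |X j ω| ^ q ∂P ≤ A ^ q * (2 ^ (q - 1) * (1 + b)) := by
    intro j
    refine (integral_mono (hi j)
      ((((integrable_const (1 : ℝ)).add (hb j).1).const_mul (2 ^ (q - 1))).const_mul (A ^ q))
      (hpt j)).trans ?_
    rw [integral_const_mul, integral_const_mul]
    have e : ∫ ω, (1 + |y j ω - M.mean j η| ^ (2 * q)) ∂P
        = 1 + ∫ ω, |y j ω - M.mean j η| ^ (2 * q) ∂P := by
      rw [integral_add (integrable_const _) (hb j).1]; simp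
    simp only [Pi.add_apply]
    rw [e]
    gcongr
    exact (hb j).2
  have hind : iIndepFun X P :=
    h.indep_y.comp (fun j t => M.ctr α j t η) fun j => measurable_ctr α j η
  set b' := A ^ q * (2 ^ (q - 1) * (1 + b)) with hb'
  have hb0 : 0 ≤ b' := (integral_nonneg fun ω => Real.rpow_nonneg (abs_nonneg _) _).trans (hbd 0)
  refine ⟨6 * ((2 + b') * (1 + b') + b'), by positivity, fun m hm => ?_⟩
  obtain ⟨h1, h2⟩ := integral_abs_sum_rpow_le hXm hind hq hq3 hi hbd
    (fun j => h.integral_ctr hK hη α j) m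
  have hm0 : (0 : ℝ) < m := by exact_mod_cast hm
  have e : ∀ ω, |M.avg α m (fun j => y j ω) η| ^ q
      = (m : ℝ) ^ (-q) * |∑ j ∈ Finset.range m, X j ω| ^ q := by
    intro ω
    rw [avg, abs_mul, Real.mul_rpow (abs_nonneg _) (abs_nonneg _), abs_of_pos (by positivity),
      Real.inv_rpow hm0.le, Real.rpow_neg hm0.le]
  simp only [e]
  refine ⟨h1.const_mul _, ?_⟩
  rw [integral_const_mul]
  calc _ ≤ (m : ℝ) ^ (-q) * (6 * ((2 + b') * (1 + b') + b') * (m : ℝ) ^ (q / 2)) := by gcongr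
    _ = 6 * ((2 + b') * (1 + b') + b') * ((m : ℝ) ^ (-q) * (m : ℝ) ^ (q / 2)) := by ring
    _ = _ := by rw [← Real.rpow_add hm0]; congr 2; ring

/-- Some moment of order greater than two of the fluctuations is as small as under normality. -/
theorem Generates.exists_noise_moment :
    ∃ q : ℝ, 2 < q ∧ q ≤ 3 ∧ ∃ C, 0 ≤ C ∧ ∀ m : ℕ, 0 < m →
      Integrable (fun ω => M.noise m (fun j => y j ω) η ^ q) P ∧
      ∫ ω, M.noise m (fun j => y j ω) η ^ q ∂P ≤ C * (m : ℝ) ^ (-(q / 2)) := by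
  obtain ⟨q, hq, hq6, b, -, hb⟩ := h.exists_rpow_moment hK hη
  -- The exponent is halved because the averaged terms are quadratic in y.
  have hq2 : 2 < q / 2 := by linarith
  have hq3 : q / 2 ≤ 3 := by linarith
  have hb' : ∀ j, Integrable (fun ω => |y j ω - M.mean j η| ^ (2 * (q / 2))) P ∧
        ∫ ω, |y j ω - M.mean j η| ^ (2 * (q / 2)) ∂P ≤ b := by
    rw [mul_div_cancel₀ q two_ne_zero]; exact hb
  choose C hC0 hC using fun c =>
    h.exists_avg_moment hK hη hq2 hq3 hb' (SmoothFam.noiseCoef (M := M) c)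
  set N : ℝ := (Fintype.card (Option (Idx p ⊕ (Idx p × Idx p) ⊕ (Idx p × Idx p × Idx p))) : ℝ)
    ^ (q / 2 - 1)
  have hN : 0 ≤ N := by positivity
  refine ⟨q / 2, hq2, hq3, N * ∑ c, C c, mul_nonneg hN (Finset.sum_nonneg fun c _ => hC0 c),
    fun m hm => ?_⟩
  have hpt : ∀ ω, M.noise m (fun j => y j ω) η ^ (q / 2)
      ≤ N * ∑ c, |M.avg (M.noiseCoef c) m (fun j => y j ω) η| ^ (q / 2) := fun ω =>
    abs_sum_rpow_le (by linarith) _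
  have hI : Integrable (fun ω => N * ∑ c, |M.avg (M.noiseCoef c) m (fun j => y j ω) η| ^ (q / 2)) P :=
    (integrable_finsetSum _ fun c _ => (hC c m hm).1).const_mul N
  have hI' : Integrable (fun ω => M.noise m (fun j => y j ω) η ^ (q / 2)) P :=
    hI.mono' ((h.measurable_noise m).pow_const _).aestronglyMeasurable (ae_of_all _ fun ω => by
      rw [Real.norm_of_nonneg (Real.rpow_nonneg (noise_nonneg _ _ _) _)]; exact hpt ω)
  refine ⟨hI', (integral_mono hI' hI hpt).trans ?_⟩
  rw [integral_const_mul, integral_finsetSum _ fun c _ => (hC c m hm).1, mul_assoc, Finset.sum_mul]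
  gcongr with c
  exact (hC c m hm).2

/-- Sequences dominated by the fluctuations and by the probability of an exceptional event are
negligible. -/
lemma Generates.tendsto_noise :
    ∃ q : ℝ, 2 < q ∧ q ≤ 3 ∧
      (∀ m : ℕ, 0 < m → Integrable (fun ω => M.noise m (fun j => y j ω) η ^ q) P) ∧
      Tendsto (fun m : ℕ => (m : ℝ) * ∫ ω, M.noise m (fun j => y j ω) η ^ q ∂P) atTop (𝓝 0) ∧
      (∀ m : ℕ, 0 < m → Integrable (fun ω => M.noise m (fun j => y j ω) η) P) ∧
      Tendsto (fun m : ℕ => ∫ ω, M.noise m (fun j => y j ω) η ∂P) atTop (𝓝 0) := by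
  obtain ⟨q, hq, hq3, C, hC0, hC⟩ := h.exists_noise_moment hK hη
  have hV0 : ∀ m ω, 0 ≤ M.noise m (fun j => y j ω) η := fun m ω => noise_nonneg _ _ _
  -- Apply x ≤ 1 + x^q to x = m^(1/2) v. In mean the bracket stays bounded, so the first moment of
  -- the fluctuations is O(m^(−1/2)).
  have hpt : ∀ m : ℕ, 0 < m → ∀ ω, M.noise m (fun j => y j ω) η ≤ (m : ℝ) ^ (-(1 / 2) : ℝ) *
      (1 + (m : ℝ) ^ (q / 2) * M.noise m (fun j => y j ω) η ^ q) := by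
    intro m hm ω
    have hm0 : (0 : ℝ) < m := by exact_mod_cast hm
    have h1 := abs_rpow_le_one_add_rpow (r := 1) (q := q) (by norm_num) (by linarith)
      ((m : ℝ) ^ (1 / 2 : ℝ) * M.noise m (fun j => y j ω) η)
    rw [Real.rpow_one, abs_of_nonneg (mul_nonneg (by positivity) (hV0 m ω)),
      Real.mul_rpow (by positivity) (hV0 m ω), ← Real.rpow_mul hm0.le] at h1
    have h2 := mul_le_mul_of_nonneg_left h1 (by positivity : 0 ≤ (m : ℝ) ^ (-(1 / 2) : ℝ))
    rw [← mul_assoc, ← Real.rpow_add hm0, neg_add_cancel, Real.rpow_zero, one_mul] at h2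
    rwa [show 1 / 2 * q = q / 2 by ring] at h2
  have hIr : ∀ m : ℕ, 0 < m → Integrable (fun ω => (m : ℝ) ^ (-(1 / 2) : ℝ) *
      (1 + (m : ℝ) ^ (q / 2) * M.noise m (fun j => y j ω) η ^ q)) P := fun m hm =>
    ((integrable_const (1 : ℝ)).add ((hC m hm).1.const_mul _)).const_mul _
  have hI : ∀ m : ℕ, 0 < m → Integrable (fun ω => M.noise m (fun j => y j ω) η) P := fun m hm =>
    (hIr m hm).mono' (h.measurable_noise m).aestronglyMeasurable (ae_of_all _ fun ω => by
      rw [Real.norm_of_nonneg (hV0 m ω)]; exact hpt m hm ω)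
  have hneg : ∀ s : ℝ, 0 < s → Tendsto (fun m : ℕ => (m : ℝ) ^ (-s)) atTop (𝓝 0) := fun s hs =>
    (tendsto_rpow_neg_atTop hs).comp tendsto_natCast_atTop_atTop
  refine ⟨q, hq, hq3, fun m hm => (hC m hm).1, ?_, hI, ?_⟩
  · refine squeeze_zero' (Eventually.of_forall fun m => mul_nonneg (Nat.cast_nonneg m)
      (integral_nonneg fun ω => Real.rpow_nonneg (hV0 m ω) _))
      (g := fun m : ℕ => C * (m : ℝ) ^ (-(q / 2 - 1))) ?_
      (by simpa using (hneg (q / 2 - 1) (by linarith)).const_mul C)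
    filter_upwards [eventually_gt_atTop 0] with m hm
    have hm0 : (0 : ℝ) < m := by exact_mod_cast hm
    calc _ ≤ (m : ℝ) * (C * (m : ℝ) ^ (-(q / 2))) :=
          mul_le_mul_of_nonneg_left (hC m hm).2 hm0.le
      _ = C * ((m : ℝ) ^ (1 : ℝ) * (m : ℝ) ^ (-(q / 2))) := by rw [Real.rpow_one]; ring
      _ = _ := by rw [← Real.rpow_add hm0]; congr 2; ring
  · refine squeeze_zero' (Eventually.of_forall fun m => integral_nonneg (hV0 m))
      (g := fun m : ℕ => (1 + C) * (m : ℝ) ^ (-(1 / 2) : ℝ)) ?_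
      (by simpa using (hneg (1 / 2) (by norm_num)).const_mul (1 + C))
    filter_upwards [eventually_gt_atTop 0] with m hm
    have hm0 : (0 : ℝ) < m := by exact_mod_cast hm
    refine (integral_mono (hI m hm) (hIr m hm) (hpt m hm)).trans ?_
    rw [integral_const_mul, integral_add (integrable_const _) ((hC m hm).1.const_mul _),
      integral_const_mul]
    have h3 : (m : ℝ) ^ (q / 2) * ∫ ω, M.noise m (fun j => y j ω) η ^ q ∂P ≤ C := by
      calc _ ≤ (m : ℝ) ^ (q / 2) * (C * (m : ℝ) ^ (-(q / 2))) :=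
            mul_le_mul_of_nonneg_left (hC m hm).2 (by positivity)
        _ = C * ((m : ℝ) ^ (q / 2) * (m : ℝ) ^ (-(q / 2))) := by ring
        _ = C := by rw [← Real.rpow_add hm0, add_neg_cancel, Real.rpow_zero, mul_one]
    have h4 : ∫ _, (1 : ℝ) ∂P = 1 := by simp
    rw [h4, mul_comm]
    gcongr

end law

end Model
end NEFQVF

namespace NEFQVF

/-! ### Second-order solution of a quadratic fixed point equation -/

section expansion

variable {ι : Type*} [Fintype ι]

lemma abs_sum_mul_le {a b : ι → ℝ} {α β : ℝ} (ha : ∀ k, |a k| ≤ α) (hb : ∀ k, |b k| ≤ β) :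
    |∑ k, a k * b k| ≤ Fintype.card ι * (α * β) := by
  refine (Finset.abs_sum_le_sum_abs _ _).trans ?_
  have : ∀ k ∈ Finset.univ, |a k * b k| ≤ α * β := fun k _ => by
    rw [abs_mul]
    exact mul_le_mul (ha k) (hb k) (abs_nonneg _) ((abs_nonneg _).trans (ha k))
  refine (Finset.sum_le_sum this).trans ?_
  simp

lemma abs_sum_sum_mul_le {c : ι → ι → ℝ} {a b : ι → ℝ} {γ α β : ℝ} (hc : ∀ k l, |c k l| ≤ γ)
    (ha : ∀ k, |a k| ≤ α) (hb : ∀ k, |b k| ≤ β) :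
    |∑ k, ∑ l, c k l * a k * b l| ≤ Fintype.card ι * (Fintype.card ι * (γ * α * β)) := by
  refine (Finset.abs_sum_le_sum_abs _ _).trans ?_
  have : ∀ k ∈ Finset.univ, |∑ l, c k l * a k * b l| ≤ Fintype.card ι * (γ * α * β) :=
    fun k _ => abs_sum_mul_le (fun l => by
      rw [abs_mul]
      exact mul_le_mul (hc k l) (ha k) (abs_nonneg _) ((abs_nonneg _).trans (hc k l))) hb
  refine (Finset.sum_le_sum this).trans ?_
  simp

/-- Iterating a quadratic fixed point equation with small coefficients. -/
lemma exists_expansion_bound (ι : Type*) [Fintype ι] {C : ℝ} (hC : 0 ≤ C) :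
    ∃ C₁, 0 ≤ C₁ ∧ ∀ (z δ R : ι → ℝ) (A : ι → ι → ℝ) (E B : ι → ι → ι → ℝ) (v : ℝ), 0 ≤ v → v ≤ 1 →
      (∀ l, |z l| ≤ C * v) → (∀ l, |δ l| ≤ C * v) → (∀ l, |R l| ≤ C * v ^ 3) →
      (∀ l k, |A l k| ≤ C * v) → (∀ l k k', |E l k k'| ≤ C) → (∀ l k k', |B l k k'| ≤ C * v) →
      (∀ l, δ l = z l + ∑ k, A l k * δ k
        + 1 / 2 * (∑ k, ∑ k', E l k k' * δ k * δ k' + ∑ k, ∑ k', B l k k' * δ k * δ k') + R l) →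
      ∀ l, |δ l - z l| ≤ C₁ * v ^ 2 ∧ |δ l - (z l + (∑ k, A l k * z k
        + 1 / 2 * ∑ k, ∑ k', E l k k' * z k * z k'))| ≤ C₁ * v ^ 3 := by
  set N : ℝ := (Fintype.card ι : ℝ)
  have hN : 0 ≤ N := Nat.cast_nonneg _
  set C₂ := N * C ^ 2 + 1 / 2 * (N * (N * C ^ 3) + N * (N * C ^ 3)) + C with hC₂
  have hC₂0 : 0 ≤ C₂ := by positivity
  set C₃ := N * (C * C₂) + 1 / 2 * (N * (N * (C * C₂ * C)) + N * (N * (C * C * C₂)) + N * (N * C ^ 3))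
    + C with hC₃
  have hC₃0 : 0 ≤ C₃ := by positivity
  refine ⟨C₂ + C₃, by positivity, fun z δ R A E B v hv hv1 hz hδ hR hA hE hB heq => ?_⟩
  have hv32 : v ^ 3 ≤ v ^ 2 := pow_le_pow_of_le_one hv hv1 (by norm_num)
  have hBδ := fun l => abs_sum_sum_mul_le (hB l) hδ hδ
  -- First pass: every term on the right other than z is a product of at least two small factors.
  have h1 : ∀ l, |δ l - z l| ≤ C₂ * v ^ 2 := by
    intro l
    have e : δ l - z l = ∑ k, A l k * δ k
        + 1 / 2 * (∑ k, ∑ k', E l k k' * δ k * δ k' + ∑ k, ∑ k', B l k k' * δ k * δ k') + R l := by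
      linarith [heq l]
    have a1 := abs_le.1 (abs_sum_mul_le (hA l) hδ)
    have a2 := abs_le.1 (abs_sum_sum_mul_le (hE l) hδ hδ)
    have a3 := abs_le.1 (hBδ l)
    have a4 := abs_le.1 (hR l)
    have b3 : N * (N * (C * v * (C * v) * (C * v))) ≤ N * (N * C ^ 3) * v ^ 2 := by
      calc _ = N * (N * C ^ 3) * v ^ 3 := by ring
        _ ≤ _ := by gcongr
    have b4 : C * v ^ 3 ≤ C * v ^ 2 := by gcongr
    have e1 : C₂ * v ^ 2 = N * (C * v * (C * v)) + 1 / 2 * (N * (N * (C * (C * v) * (C * v)))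
        + N * (N * C ^ 3) * v ^ 2) + C * v ^ 2 := by rw [hC₂]; ring
    rw [e, abs_le, e1]
    constructor <;> linarith
  intro l
  refine ⟨(h1 l).trans (by nlinarith [sq_nonneg v]), ?_⟩
  -- Second pass: replacing δ by z in the linear and quadratic terms costs a factor v² by the first
  -- pass, next to another factor v. The B-term is of third order already.
  have e : δ l - (z l + (∑ k, A l k * z k + 1 / 2 * ∑ k, ∑ k', E l k k' * z k * z k'))
      = ∑ k, A l k * (δ k - z k) + 1 / 2 * (∑ k, ∑ k', E l k k' * (δ k - z k) * δ k'
        + ∑ k, ∑ k', E l k k' * z k * (δ k' - z k') + ∑ k, ∑ k', B l k k' * δ k * δ k') + R l := by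
    simp only [mul_sub, sub_mul, Finset.sum_sub_distrib]
    linarith [heq l]
  have a1 := abs_le.1 (abs_sum_mul_le (hA l) h1)
  have a2 := abs_le.1 (abs_sum_sum_mul_le (hE l) h1 hδ)
  have a3 := abs_le.1 (abs_sum_sum_mul_le (hE l) hz h1)
  have a4 := abs_le.1 (hBδ l)
  have a5 := abs_le.1 (hR l)
  have e1 : C₃ * v ^ 3 = N * (C * v * (C₂ * v ^ 2)) + 1 / 2 * (N * (N * (C * (C₂ * v ^ 2) * (C * v)))
      + N * (N * (C * (C * v) * (C₂ * v ^ 2))) + N * (N * (C * v * (C * v) * (C * v))))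
      + C * v ^ 3 := by rw [hC₃]; ring
  have h3 : |δ l - (z l + (∑ k, A l k * z k + 1 / 2 * ∑ k, ∑ k', E l k k' * z k * z k'))|
      ≤ C₃ * v ^ 3 := by
    rw [e, abs_le, e1]
    constructor <;> linarith
  refine h3.trans ?_
  have : 0 ≤ C₂ * v ^ 3 := by positivity
  linarith

end expansion

/-! ### The normalized score and the terms of its expansion -/

namespace Model

variable {p : ℕ} {M : Model p}

/-- The normalized aggregate `U⁻¹ ∑_{j < m} e_j`. -/
def agg (M : Model p) (m : ℕ) (η : Par p) (l : Idx p) : (Idx p → ℕ → ℝ) →ₗ[ℝ] ℝ :=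
  ∑ k, M.ut m η l k • (m : ℝ)⁻¹ • ∑ j ∈ Finset.range m,
    (LinearMap.proj j : (ℕ → ℝ) →ₗ[ℝ] ℝ) ∘ₗ (LinearMap.proj k : (Idx p → ℕ → ℝ) →ₗ[ℝ] (ℕ → ℝ))

lemma agg_apply (m : ℕ) (η : Par p) (l : Idx p) (e : Idx p → ℕ → ℝ) :
    M.agg m η l e = ∑ k, M.ut m η l k * ((m : ℝ)⁻¹ * ∑ j ∈ Finset.range m, e k j) := by
  simp only [agg, LinearMap.sum_apply, LinearMap.smul_apply, LinearMap.comp_apply,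
    LinearMap.proj_apply, smul_eq_mul]

lemma abs_agg_le {m : ℕ} {η : Par p} {l : Idx p} {e : Idx p → ℕ → ℝ} {c : ℕ → ℝ} {C : ℝ}
    (hC : ∀ k, |M.ut m η l k| ≤ C) (hc : ∀ k j, |e k j| ≤ c j) :
    |M.agg m η l e|
      ≤ Fintype.card (Idx p) * (C * ((m : ℝ)⁻¹ * ∑ j ∈ Finset.range m, c j)) := by
  rw [agg_apply]
  refine abs_sum_mul_le hC fun k => ?_
  rw [abs_mul, abs_of_nonneg (by positivity : (0 : ℝ) ≤ (m : ℝ)⁻¹)]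
  gcongr
  exact (Finset.abs_sum_le_sum_abs _ _).trans (Finset.sum_le_sum fun j _ => hc k j)

variable (M) in
/-- The leading term of the expansion of the estimator. -/
def lead (m : ℕ) (Y : ℕ → ℝ) (η : Par p) (l : Idx p) : ℝ :=
  M.agg m η l fun k j => M.ctr (M.scoreCoef k) j (Y j) η

variable (M) in
/-- The fluctuation of the normalized Jacobian matrix of the score. -/
def jacNoise (m : ℕ) (Y : ℕ → ℝ) (η : Par p) (l k : Idx p) : ℝ :=
  M.agg m η l fun a j => M.ctr (M.jacCoef a k) j (Y j) η

variable (M) in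
/-- The mean of the normalized second derivative of the score. -/
def hessMean (m : ℕ) (η : Par p) (l k k' : Idx p) : ℝ :=
  M.agg m η l fun a j => M.hessConst a k k' j η

variable (M) in
/-- The fluctuation of the normalized second derivative of the score. -/
def hessNoise (m : ℕ) (Y : ℕ → ℝ) (η : Par p) (l k k' : Idx p) : ℝ :=
  M.agg m η l fun a j => M.ctr (M.hessCoef a k k') j (Y j) η

variable (M) in
/-- The second-order term of the expansion of the estimator. -/
def second (m : ℕ) (Y : ℕ → ℝ) (η : Par p) (l : Idx p) : ℝ :=
  ∑ k, M.jacNoise m Y η l k * M.lead m Y η k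
    + 1 / 2 * ∑ k, ∑ k', M.hessMean m η l k k' * M.lead m Y η k * M.lead m Y η k'

variable (M) in
/-- The normalized score `U(η)⁻¹ s_m(t)`. -/
def newton (m : ℕ) (Y : ℕ → ℝ) (η t : Par p) (l : Idx p) : ℝ :=
  M.agg m η l fun k j => M.areaScore k j (Y j) t

lemma newton_self (m : ℕ) (Y : ℕ → ℝ) (η : Par p) (l : Idx p) :
    M.newton m Y η η l = M.lead m Y η l := by
  simp only [newton, lead, areaScore_eq]

lemma newton_eq_mulVec {m : ℕ} (hm : 0 < m) (Y : ℕ → ℝ) (η t : Par p) (l : Idx p) :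
    M.newton m Y η t l = ((M.U m η)⁻¹ *ᵥ M.score m (fun j : Fin m => Y j) t) l := by
  have hm0 : (m : ℝ) ≠ 0 := by exact_mod_cast hm.ne'
  rw [newton, agg_apply, Matrix.mulVec, dotProduct]
  refine Finset.sum_congr rfl fun k _ => ?_
  rw [score_apply, ut, Finset.sum_range]
  field_simp

lemma score_eq_zero_iff {m : ℕ} (hm : 0 < m) (Y : ℕ → ℝ) {η : Par p} (hU : (M.U m η).det ≠ 0)
    (t : Par p) : M.score m (fun j : Fin m => Y j) t = 0 ↔ ∀ l, M.newton m Y η t l = 0 := by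
  constructor
  · intro h l
    rw [newton_eq_mulVec hm, h, Matrix.mulVec_zero]; rfl
  · intro h
    have h1 : (M.U m η)⁻¹ *ᵥ M.score m (fun j : Fin m => Y j) t = 0 :=
      funext fun l => by rw [← newton_eq_mulVec hm]; exact h l
    have h2 := congrArg (M.U m η *ᵥ ·) h1
    simpa [Matrix.mulVec_mulVec, Matrix.mul_nonsing_inv _ hU.isUnit] using h2

/-- The expected Jacobian of the score is −U, so after normalization by U⁻¹ the linear part of the
estimating equation is minus the identity plus a fluctuation. -/
lemma agg_jacConst {m : ℕ} (hm : 0 < m) {η : Par p} (hU : (M.U m η).det ≠ 0) (l k : Idx p) :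
    (M.agg m η l fun a j => M.jacConst a k j η) = -(1 : Matrix (Idx p) (Idx p) ℝ) l k := by
  have hm0 : (m : ℝ) ≠ 0 := by exact_mod_cast hm.ne'
  rw [← Matrix.nonsing_inv_mul _ hU.isUnit, Matrix.mul_apply, agg_apply, ← Finset.sum_neg_distrib]
  refine Finset.sum_congr rfl fun a _ => ?_
  simp only [jacConst_eq, Finset.sum_neg_distrib]
  rw [ut, U, Matrix.sum_apply]
  field_simp

lemma abs_agg_ctr_le {m : ℕ} {Y : ℕ → ℝ} {η : Par p} {l : Idx p} {C : ℝ}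
    (hC : ∀ k, |M.ut m η l k| ≤ C)
    (c : Idx p → Option (Idx p ⊕ (Idx p × Idx p) ⊕ (Idx p × Idx p × Idx p))) :
    |M.agg m η l fun k j => M.ctr (M.noiseCoef (c k)) j (Y j) η|
      ≤ Fintype.card (Idx p) * C * M.noise m Y η := by
  rw [agg_apply, mul_assoc]
  exact abs_sum_mul_le hC fun k => abs_avg_le_noise (c k) m Y η

section bounds

variable {K : Set (Par p)} (hK : M.Regular K) {η : Par p} {ρ : ℝ}
  (hρ : Metric.closedBall η ρ ⊆ K)

include hK in
/-- The terms of the expansion are of the order of the fluctuations. -/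
lemma exists_abs_lead_le (hη : η ∈ K) : ∃ C, 0 ≤ C ∧ ∀ᶠ m in atTop, ∀ Y : ℕ → ℝ,
    (∀ l, |M.lead m Y η l| ≤ C * M.noise m Y η) ∧
    (∀ l k, |M.jacNoise m Y η l k| ≤ C * M.noise m Y η) ∧
    (∀ l k k', |M.hessMean m η l k k'| ≤ C) ∧
    ∀ l k k', |M.hessNoise m Y η l k k'| ≤ C * M.noise m Y η := by
  obtain ⟨C, hC, hb⟩ := hK.exists_ut_bound
  choose H hH using fun a k k' => (SmoothFam.hessConst (M := M) a k k').exists_bound hK 0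
  set S := ∑ a, ∑ k, ∑ k', |H a k k'|
  have hS : ∀ a k k', |H a k k'| ≤ S := fun a k k' =>
    (Finset.single_le_sum (f := fun k' => |H a k k'|) (fun _ _ => abs_nonneg _)
      (Finset.mem_univ k')).trans ((Finset.single_le_sum (f := fun k => ∑ k', |H a k k'|)
        (fun _ _ => Finset.sum_nonneg fun _ _ => abs_nonneg _) (Finset.mem_univ k)).trans
      (Finset.single_le_sum (f := fun a => ∑ k, ∑ k', |H a k k'|)
        (fun _ _ => Finset.sum_nonneg fun _ _ => Finset.sum_nonneg fun _ _ => abs_nonneg _)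
        (Finset.mem_univ a)))
  have hS0 : 0 ≤ S := Finset.sum_nonneg fun _ _ => Finset.sum_nonneg fun _ _ =>
    Finset.sum_nonneg fun _ _ => abs_nonneg _
  refine ⟨Fintype.card (Idx p) * C + Fintype.card (Idx p) * (C * S), by positivity, ?_⟩
  filter_upwards [hb] with m hm Y
  have hu := fun l k => (hm η hη).2 l k
  have hle : Fintype.card (Idx p) * C * M.noise m Y η
      ≤ (Fintype.card (Idx p) * C + Fintype.card (Idx p) * (C * S)) * M.noise m Y η :=
    mul_le_mul_of_nonneg_right (by
      have : 0 ≤ Fintype.card (Idx p) * (C * S) := by positivity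
      linarith) (noise_nonneg _ _ _)
  refine ⟨fun l => (abs_agg_ctr_le (hu l) fun a => some (.inl a)).trans hle,
    fun l k => (abs_agg_ctr_le (hu l) fun a => some (.inr (.inl (a, k)))).trans hle,
    fun l k k' => ?_,
    fun l k k' => (abs_agg_ctr_le (hu l) fun a => some (.inr (.inr (a, k, k')))).trans hle⟩
  refine (abs_agg_le (hu l) (c := fun _ => S) fun a j =>
    ((hH a k k' j 0 (by simp) η hη).trans (le_abs_self _)).trans (hS a k k')).trans ?_
  have h1 : (m : ℝ)⁻¹ * ∑ j ∈ Finset.range m, S ≤ S := by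
    rw [Finset.sum_const, Finset.card_range, nsmul_eq_mul, ← mul_assoc]
    exact mul_le_of_le_one_left hS0 inv_mul_le_one
  have h2 : 0 ≤ Fintype.card (Idx p) * C := by positivity
  calc _ ≤ Fintype.card (Idx p) * (C * S) := by gcongr
    _ ≤ _ := by linarith

include hK hρ in
/-- Increments of a smooth family are linear up to the distance from the base point. -/
lemma IsQuad.exists_increment {f : ℕ → ℝ → Par p → ℝ} (hq : M.IsQuad f) (hf : M.SmoothFam f) :
    ∃ C, 0 ≤ C ∧ ∀ j y, ∀ r ≤ ρ, ∀ t₁ ∈ Metric.closedBall η r, ∀ t₂ ∈ Metric.closedBall η r,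
      |f j y t₂ - f j y t₁ - ∑ k, pd k (f j y) η * (t₂ - t₁) k|
        ≤ C * (1 + y ^ 2) * r * ‖t₂ - t₁‖ := by
  choose L hL0 hL using fun k => (hq.pderiv hf k).exists_lipschitz (hf.pderiv k) hK hρ
  refine ⟨Fintype.card (Idx p) * ∑ k, L k,
    mul_nonneg (Nat.cast_nonneg _) (Finset.sum_nonneg fun k _ => hL0 k),
    fun j y r hr t₁ h₁ t₂ h₂ => ?_⟩
  have hr0 : 0 ≤ r := dist_nonneg.trans h₁
  have hρ0 : 0 ≤ ρ := hr0.trans hr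
  have hη : η ∈ Metric.closedBall η ρ := Metric.mem_closedBall_self hρ0
  set g : Par p → ℝ := fun t => f j y t - form (fun k => pd k (f j y) η) t with hg
  have hd : ∀ t ∈ Metric.closedBall η r, HasFDerivWithinAt g
      (form (fun k => pd k (f j y) t) - form (fun k => pd k (f j y) η)) (Metric.closedBall η r) t := by
    intro t ht
    have := (hf.hasFDerivAt (hK.arg_mem (hρ (Metric.closedBall_subset_closedBall hr ht)) j y))
    exact (this.sub (form (fun k => pd k (f j y) η)).hasFDerivAt).hasFDerivWithinAt
  have hb : ∀ t ∈ Metric.closedBall η r,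
      ‖form (fun k => pd k (f j y) t) - form (fun k => pd k (f j y) η)‖
        ≤ Fintype.card (Idx p) * (∑ k, L k) * (1 + y ^ 2) * r := by
    intro t ht
    have hS0 : 0 ≤ ∑ k, L k := Finset.sum_nonneg fun k _ => hL0 k
    refine ContinuousLinearMap.opNorm_le_bound _ (by positivity) fun v => ?_
    have e : (form (fun k => pd k (f j y) t) - form (fun k => pd k (f j y) η)) v
        = ∑ k, (pd k (f j y) t - pd k (f j y) η) * v k := by
      simp [form, sub_mul, Finset.sum_sub_distrib, -Fintype.sum_sum_type]
    rw [e, Real.norm_eq_abs]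
    refine (abs_sum_mul_le (α := (∑ k, L k) * (1 + y ^ 2) * r) (fun k => ?_)
      fun k => norm_le_pi_norm v k).trans (le_of_eq (by ring))
    refine (hL k j y η hη t (Metric.closedBall_subset_closedBall hr ht)).trans ?_
    have h1 : ‖t - η‖ ≤ r := by rw [← dist_eq_norm]; exact ht
    have h2 : L k ≤ ∑ k, L k := Finset.single_le_sum (f := L) (fun k _ => hL0 k) (Finset.mem_univ k)
    gcongr
  have := (convex_closedBall η r).norm_image_sub_le_of_norm_hasFDerivWithin_le hd hb h₁ h₂
  rw [Real.norm_eq_abs] at this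
  refine le_trans (le_of_eq ?_) (this.trans (le_of_eq (by ring)))
  congr 1
  have e : form (fun k => pd k (f j y) η) t₂ - form (fun k => pd k (f j y) η) t₁
      = ∑ k, pd k (f j y) η * (t₂ - t₁) k := by
    simp [form, mul_sub, Finset.sum_sub_distrib, -Fintype.sum_sum_type]
  rw [hg]
  simp only
  rw [← e]; ring

end bounds

end Model
end NEFQVF

namespace NEFQVF
namespace Model

variable {p : ℕ} {M : Model p}

/-! ### Existence and expansion of the root of the estimating equations -/

section root

variable {K : Set (Par p)} (hK : M.Regular K) {η : Par p} {ρ : ℝ} (hρ0 : 0 < ρ)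
  (hρ : Metric.closedBall η ρ ⊆ K)

include hK in
lemma agg_pd_areaScore (hη : η ∈ K) {m : ℕ} (hm : 0 < m) (hU : (M.U m η).det ≠ 0) (Y : ℕ → ℝ)
    (l : Idx p) (h : Par p) :
    (M.agg m η l fun k j => ∑ a, pd a (M.areaScore k j (Y j)) η * h a)
      = -h l + ∑ a, M.jacNoise m Y η l a * h a := by
  have e : (fun k j => ∑ a, pd a (M.areaScore k j (Y j)) η * h a)
      = ∑ a, h a • ((fun k j => M.jacConst k a j η) + fun k j => M.ctr (M.jacCoef k a) j (Y j) η) := by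
    funext k j
    rw [Finset.sum_apply, Finset.sum_apply]
    refine Finset.sum_congr rfl fun a _ => ?_
    rw [pd_areaScore (hK.arg_mem hη j (Y j)), aff_eq]
    simp only [Pi.smul_apply, Pi.add_apply, smul_eq_mul]
    ring
  rw [e, map_sum]
  simp only [map_smul, map_add, agg_jacConst hm hU, smul_eq_mul, mul_add, Finset.sum_add_distrib]
  congr 1
  · simp [Matrix.one_apply, -Fintype.sum_sum_type]
  · exact Finset.sum_congr rfl fun a _ => mul_comm _ _

include hK in
lemma agg_pd_pd_areaScore (hη : η ∈ K) (m : ℕ) (Y : ℕ → ℝ) (l : Idx p) (h : Par p) :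
    (M.agg m η l fun k j => ∑ a, ∑ b, pd a (pd b (M.areaScore k j (Y j))) η * h a * h b)
      = ∑ a, ∑ b, M.hessMean m η l a b * h a * h b
        + ∑ a, ∑ b, M.hessNoise m Y η l a b * h a * h b := by
  have e : (fun k j => ∑ a, ∑ b, pd a (pd b (M.areaScore k j (Y j))) η * h a * h b)
      = ∑ a, ∑ b, (h a * h b) • ((fun k j => M.hessConst k a b j η)
          + fun k j => M.ctr (M.hessCoef k a b) j (Y j) η) := by
    funext k j
    simp only [Finset.sum_apply]
    refine Finset.sum_congr rfl fun a _ => Finset.sum_congr rfl fun b _ => ?_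
    rw [pd_pd_areaScore (hK.arg_mem hη j (Y j)), aff_eq]
    simp only [Pi.smul_apply, Pi.add_apply, smul_eq_mul]
    ring
  rw [e, map_sum, ← Finset.sum_add_distrib]
  refine Finset.sum_congr rfl fun a _ => ?_
  rw [map_sum, ← Finset.sum_add_distrib]
  refine Finset.sum_congr rfl fun b _ => ?_
  rw [map_smul, map_add, smul_eq_mul, hessMean, hessNoise]
  ring

include hK hρ hρ0

/-- The derivative of t + U⁻¹s(t) at η is the fluctuation of the Jacobian alone, and on a ball of
radius r it varies by O(r), as the average of 1 + y² is bounded. This is the contraction estimate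
for `exists_root`. -/
lemma exists_newton_increment : ∃ C, 0 ≤ C ∧ ∀ᶠ m in atTop, ∀ Y : ℕ → ℝ, M.noise m Y η ≤ 1 →
    ∀ r ≤ ρ, ∀ t₁ ∈ Metric.closedBall η r, ∀ t₂ ∈ Metric.closedBall η r, ∀ l,
      |M.newton m Y η t₂ l - M.newton m Y η t₁ l + (t₂ - t₁) l|
        ≤ C * (r + M.noise m Y η) * ‖t₂ - t₁‖ := by
  have hη : η ∈ K := hρ (Metric.mem_closedBall_self hρ0.le)
  obtain ⟨Cu, hCu, hu⟩ := hK.exists_ut_bound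
  obtain ⟨Cl, hCl, hl⟩ := exists_abs_lead_le hK hη
  obtain ⟨Cs, hCs, hs⟩ := exists_avg_sq_le hK hη
  choose L hL0 hL using fun k => (isQuad_areaScore (M := M) k).exists_increment hK hρ
    (SmoothFam.areaScore k)
  set S := ∑ k, L k with hS
  have hS0 : 0 ≤ S := Finset.sum_nonneg fun k _ => hL0 k
  set N : ℝ := (Fintype.card (Idx p) : ℝ) with hN
  refine ⟨N * (Cu * (S * (Cs + 1))) + N * Cl, by positivity, ?_⟩
  filter_upwards [hu, hl, eventually_gt_atTop 0] with m hum hlm hm Y hY r hr t₁ h₁ t₂ h₂ l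
  have hr0 : 0 ≤ r := dist_nonneg.trans h₁
  have e : M.newton m Y η t₂ l - M.newton m Y η t₁ l + (t₂ - t₁) l
      = (M.agg m η l fun k j => M.areaScore k j (Y j) t₂ - M.areaScore k j (Y j) t₁
          - ∑ a, pd a (M.areaScore k j (Y j)) η * (t₂ - t₁) a)
        + ∑ a, M.jacNoise m Y η l a * (t₂ - t₁) a := by
    have e1 : (fun k j => M.areaScore k j (Y j) t₂ - M.areaScore k j (Y j) t₁
          - ∑ a, pd a (M.areaScore k j (Y j)) η * (t₂ - t₁) a)
        = (fun k j => M.areaScore k j (Y j) t₂) - (fun k j => M.areaScore k j (Y j) t₁)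
          - fun k j => ∑ a, pd a (M.areaScore k j (Y j)) η * (t₂ - t₁) a := rfl
    rw [e1, map_sub, map_sub, agg_pd_areaScore hK hη hm (hum η hη).1, newton, newton]
    ring
  rw [e]
  refine (abs_add_le _ _).trans ?_
  have b1 := abs_agg_le (l := l) (e := fun k j => M.areaScore k j (Y j) t₂
      - M.areaScore k j (Y j) t₁ - ∑ a, pd a (M.areaScore k j (Y j)) η * (t₂ - t₁) a)
    (c := fun j => S * r * ‖t₂ - t₁‖ * (1 + Y j ^ 2)) (fun k => (hum η hη).2 l k) fun k j => by
      refine (hL k j (Y j) r hr t₁ h₁ t₂ h₂).trans ?_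
      have : L k ≤ S := Finset.single_le_sum (f := L) (fun k _ => hL0 k) (Finset.mem_univ k)
      calc _ ≤ S * (1 + Y j ^ 2) * r * ‖t₂ - t₁‖ := by gcongr
        _ = _ := by ring
  have b2 : (m : ℝ)⁻¹ * ∑ j ∈ Finset.range m, S * r * ‖t₂ - t₁‖ * (1 + Y j ^ 2)
      ≤ S * r * ‖t₂ - t₁‖ * (Cs + 1) := by
    rw [← Finset.mul_sum, mul_left_comm]
    have := hs m Y
    gcongr
    linarith
  have b3 := abs_sum_mul_le (hlm Y |>.2.1 l) (fun k => norm_le_pi_norm (t₂ - t₁) k)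
  have hn := noise_nonneg (M := M) m Y η
  calc _ ≤ N * (Cu * (S * r * ‖t₂ - t₁‖ * (Cs + 1))) + N * (Cl * M.noise m Y η * ‖t₂ - t₁‖) := by
        refine add_le_add (b1.trans ?_) b3
        gcongr
    _ = (N * (Cu * (S * (Cs + 1))) * r + N * Cl * M.noise m Y η) * ‖t₂ - t₁‖ := by ring
    _ ≤ _ := by
        gcongr
        have c1 : 0 ≤ N * (Cu * (S * (Cs + 1))) := by positivity
        have c2 : 0 ≤ N * Cl := by positivity
        nlinarith [mul_nonneg c1 hn, mul_nonneg c2 hr0]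

/-- The areawise Taylor expansions of the score are aggregated by the linear map `agg`. The sum of
their remainders is controlled by the average of 1 + y². -/
lemma exists_newton_taylor : ∃ C, 0 ≤ C ∧ ∀ᶠ m in atTop, ∀ Y : ℕ → ℝ, M.noise m Y η ≤ 1 →
    ∀ t ∈ Metric.closedBall η ρ, ∀ l,
      |M.newton m Y η t l - (M.lead m Y η l - (t - η) l + ∑ k, M.jacNoise m Y η l k * (t - η) k
        + 1 / 2 * (∑ k, ∑ k', M.hessMean m η l k k' * (t - η) k * (t - η) k'
          + ∑ k, ∑ k', M.hessNoise m Y η l k k' * (t - η) k * (t - η) k'))|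
        ≤ C * ‖t - η‖ ^ 3 := by
  have hη : η ∈ K := hρ (Metric.mem_closedBall_self hρ0.le)
  obtain ⟨Cu, hCu, hu⟩ := hK.exists_ut_bound
  obtain ⟨Cs, hCs, hs⟩ := exists_avg_sq_le hK hη
  choose L hL0 hL using fun k => (isQuad_areaScore (M := M) k).exists_taylor
    (SmoothFam.areaScore k) hK hρ
  set S := ∑ k, L k with hS
  have hS0 : 0 ≤ S := Finset.sum_nonneg fun k _ => hL0 k
  set N : ℝ := (Fintype.card (Idx p) : ℝ) with hN
  refine ⟨N * (Cu * (S * (Cs + 1))), by positivity, ?_⟩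
  filter_upwards [hu, eventually_gt_atTop 0] with m hum hm Y hY t ht l
  have e : M.newton m Y η t l - (M.lead m Y η l - (t - η) l + ∑ k, M.jacNoise m Y η l k * (t - η) k
        + 1 / 2 * (∑ k, ∑ k', M.hessMean m η l k k' * (t - η) k * (t - η) k'
          + ∑ k, ∑ k', M.hessNoise m Y η l k k' * (t - η) k * (t - η) k'))
      = M.agg m η l fun k j => M.areaScore k j (Y j) t - M.areaScore k j (Y j) η
          - ∑ a, pd a (M.areaScore k j (Y j)) η * (t - η) a
          - 1 / 2 * ∑ a, ∑ b, pd a (pd b (M.areaScore k j (Y j))) η * (t - η) a * (t - η) b := by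
    have e1 : (fun k j => M.areaScore k j (Y j) t - M.areaScore k j (Y j) η
          - ∑ a, pd a (M.areaScore k j (Y j)) η * (t - η) a
          - 1 / 2 * ∑ a, ∑ b, pd a (pd b (M.areaScore k j (Y j))) η * (t - η) a * (t - η) b)
        = (fun k j => M.areaScore k j (Y j) t) - (fun k j => M.areaScore k j (Y j) η)
          - (fun k j => ∑ a, pd a (M.areaScore k j (Y j)) η * (t - η) a)
          - (1 / 2 : ℝ) • fun k j =>
            ∑ a, ∑ b, pd a (pd b (M.areaScore k j (Y j))) η * (t - η) a * (t - η) b := rfl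
    rw [e1, map_sub, map_sub, map_sub, map_smul, agg_pd_areaScore hK hη hm (hum η hη).1,
      agg_pd_pd_areaScore hK hη, smul_eq_mul, ← newton_self, newton, newton]
    ring
  rw [e]
  have b1 := abs_agg_le (l := l) (e := fun k j => M.areaScore k j (Y j) t
      - M.areaScore k j (Y j) η - ∑ a, pd a (M.areaScore k j (Y j)) η * (t - η) a
      - 1 / 2 * ∑ a, ∑ b, pd a (pd b (M.areaScore k j (Y j))) η * (t - η) a * (t - η) b)
    (c := fun j => S * ‖t - η‖ ^ 3 * (1 + Y j ^ 2)) (fun k => (hum η hη).2 l k) fun k j => by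
      refine (hL k j (Y j) t ht).trans ?_
      have : L k ≤ S := Finset.single_le_sum (f := L) (fun k _ => hL0 k) (Finset.mem_univ k)
      calc _ ≤ S * (1 + Y j ^ 2) * ‖t - η‖ ^ 3 := by gcongr
        _ = _ := by ring
  have b2 : (m : ℝ)⁻¹ * ∑ j ∈ Finset.range m, S * ‖t - η‖ ^ 3 * (1 + Y j ^ 2)
      ≤ S * ‖t - η‖ ^ 3 * (Cs + 1) := by
    rw [← Finset.mul_sum, mul_left_comm]
    have := hs m Y
    gcongr
    linarith
  calc _ ≤ N * (Cu * (S * ‖t - η‖ ^ 3 * (Cs + 1))) := by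
        refine b1.trans ?_
        gcongr
    _ = _ := by ring

/-- When the fluctuations are small, the estimating equations have a root close to `η`. -/
theorem exists_root : ∃ ε, 0 < ε ∧ ε ≤ 1 ∧ ∃ C, 0 ≤ C ∧ ∀ᶠ m in atTop, ∀ Y : ℕ → ℝ,
    M.noise m Y η ≤ ε → ∃ t ∈ Metric.closedBall η ρ,
      M.score m (fun j : Fin m => Y j) t = 0 ∧ ‖t - η‖ ≤ C * M.noise m Y η := by
  have hη : η ∈ K := hρ (Metric.mem_closedBall_self hρ0.le)
  obtain ⟨Cu, hCu, hu⟩ := hK.exists_ut_bound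
  obtain ⟨Cl, hCl, hl⟩ := exists_abs_lead_le hK hη
  obtain ⟨C, hC, hinc⟩ := exists_newton_increment hK hρ0 hρ
  -- With this radius factor Dv/2 + Cl·v ≤ Dv, so the ball is mapped into itself. The bounds in ε
  -- keep the ball inside radius ρ and make the Lipschitz constant at most 1/2.
  set D := 1 + 2 * Cl with hD
  have hD0 : 0 < D := by positivity
  set ε := min (min 1 (ρ / D)) (1 / (2 * (C * (D + 1) + 1))) with hε
  have hε0 : 0 < ε := by positivity
  refine ⟨ε, hε0, (min_le_left _ _).trans (min_le_left _ _), D, hD0.le, ?_⟩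
  filter_upwards [hu, hl, hinc, eventually_gt_atTop 0] with m hum hlm him hm Y hY
  set v := M.noise m Y η with hv
  have hv0 : 0 ≤ v := noise_nonneg _ _ _
  have hv1 : v ≤ 1 := hY.trans ((min_le_left _ _).trans (min_le_left _ _))
  have hvρ : D * v ≤ ρ := by
    have : v ≤ ρ / D := hY.trans ((min_le_left _ _).trans (min_le_right _ _))
    rwa [le_div_iff₀' hD0] at this
  have hvc : C * (D * v + v) ≤ 1 / 2 := by
    have h1 : v ≤ 1 / (2 * (C * (D + 1) + 1)) := hY.trans (min_le_right _ _)
    rw [le_div_iff₀ (by positivity)] at h1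
    nlinarith
  set s := Metric.closedBall η (D * v) with hs
  have hηs : η ∈ s := Metric.mem_closedBall_self (by positivity)
  -- Simplified Newton map with the matrix frozen at η. Its fixed points are the roots of the
  -- estimating equations.
  set Φ : Par p → Par p := fun t l => t l + M.newton m Y η t l with hΦ
  have hΦd : ∀ t₁ ∈ s, ∀ t₂ ∈ s, ‖Φ t₂ - Φ t₁‖ ≤ 1 / 2 * ‖t₂ - t₁‖ := by
    intro t₁ h₁ t₂ h₂
    refine (pi_norm_le_iff_of_nonneg (by positivity)).2 fun l => ?_
    have h3 := him Y hv1 (D * v) hvρ t₁ h₁ t₂ h₂ l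
    have e : (Φ t₂ - Φ t₁) l = M.newton m Y η t₂ l - M.newton m Y η t₁ l + (t₂ - t₁) l := by
      simp only [hΦ, Pi.sub_apply]; ring
    rw [e, Real.norm_eq_abs]
    exact h3.trans (mul_le_mul_of_nonneg_right hvc (norm_nonneg _))
  have hΦη : ‖Φ η - η‖ ≤ Cl * v := by
    refine (pi_norm_le_iff_of_nonneg (by positivity)).2 fun l => ?_
    have e : (Φ η - η) l = M.lead m Y η l := by simp [hΦ, newton_self]
    rw [e, Real.norm_eq_abs]
    exact (hlm Y).1 l
  have hmaps : Set.MapsTo Φ s s := by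
    intro t ht
    have h1 := hΦd η hηs t ht
    have ht' : ‖t - η‖ ≤ D * v := by rw [← dist_eq_norm]; exact ht
    change dist (Φ t) η ≤ D * v
    rw [dist_eq_norm]
    calc ‖Φ t - η‖ = ‖(Φ t - Φ η) + (Φ η - η)‖ := by rw [sub_add_sub_cancel]
      _ ≤ ‖Φ t - Φ η‖ + ‖Φ η - η‖ := norm_add_le _ _
      _ ≤ 1 / 2 * (D * v) + Cl * v := by
          refine add_le_add (h1.trans ?_) hΦη
          gcongr
      _ ≤ D * v := by rw [hD]; nlinarith
  have hcontr : ContractingWith (1 / 2 : NNReal) (hmaps.restrict Φ s s) := by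
    refine ⟨by norm_num, LipschitzWith.of_dist_le_mul fun a b => ?_⟩
    have := hΦd b.1 b.2 a.1 a.2
    rw [Subtype.dist_eq, Subtype.dist_eq, dist_eq_norm, dist_eq_norm]
    simpa using this
  obtain ⟨t, hts, hfix, -⟩ := hcontr.exists_fixedPoint' (s := s) Metric.isClosed_closedBall.isComplete
    hmaps hηs (edist_ne_top _ _)
  refine ⟨t, Metric.closedBall_subset_closedBall hvρ hts, ?_, ?_⟩
  · rw [score_eq_zero_iff hm Y (hum η hη).1]
    intro l
    have := congrFun hfix l
    simpa [hΦ] using this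
  · rw [← dist_eq_norm]; exact hts

/-- Second-order expansion of the root close to `η`. -/
theorem exists_root_expansion {C₀ : ℝ} (hC₀ : 0 ≤ C₀) : ∃ C, 0 ≤ C ∧ ∀ᶠ m in atTop,
    ∀ Y : ℕ → ℝ, M.noise m Y η ≤ 1 → ∀ t ∈ Metric.closedBall η ρ,
      M.score m (fun j : Fin m => Y j) t = 0 → ‖t - η‖ ≤ C₀ * M.noise m Y η → ∀ l,
      |(t - η) l - M.lead m Y η l| ≤ C * M.noise m Y η ^ 2 ∧
      |(t - η) l - (M.lead m Y η l + M.second m Y η l)| ≤ C * M.noise m Y η ^ 3 := by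
  have hη : η ∈ K := hρ (Metric.mem_closedBall_self hρ0.le)
  obtain ⟨Cu, hCu, hu⟩ := hK.exists_ut_bound
  obtain ⟨Cl, hCl, hl⟩ := exists_abs_lead_le hK hη
  obtain ⟨Ct, hCt, htay⟩ := exists_newton_taylor hK hρ0 hρ
  obtain ⟨C, hC, hexp⟩ := exists_expansion_bound (Idx p)
    (by positivity : 0 ≤ max (max C₀ Cl) (Ct * C₀ ^ 3))
  set A := max (max C₀ Cl) (Ct * C₀ ^ 3)
  have hA1 : C₀ ≤ A := (le_max_left _ _).trans (le_max_left _ _)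
  have hA2 : Cl ≤ A := (le_max_right _ _).trans (le_max_left _ _)
  have hA3 : Ct * C₀ ^ 3 ≤ A := le_max_right _ _
  refine ⟨C, hC, ?_⟩
  filter_upwards [hu, hl, htay, eventually_gt_atTop 0] with m hum hlm htm hm Y hY t ht hroot hδ
  have hv0 : 0 ≤ M.noise m Y η := noise_nonneg _ _ _
  obtain ⟨l1, l2, l3, l4⟩ := hlm Y
  have hle : Cl * M.noise m Y η ≤ A * M.noise m Y η := by gcongr
  -- The remainder is defined as what makes the fixed point equation hold exactly. It is of third
  -- order by `exists_newton_taylor`, since the normalized score vanishes at t.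
  refine hexp (M.lead m Y η) (t - η) (fun l => (t - η) l - (M.lead m Y η l
      + ∑ k, M.jacNoise m Y η l k * (t - η) k
      + 1 / 2 * (∑ k, ∑ k', M.hessMean m η l k k' * (t - η) k * (t - η) k'
          + ∑ k, ∑ k', M.hessNoise m Y η l k k' * (t - η) k * (t - η) k')))
    (M.jacNoise m Y η) (M.hessMean m η) (M.hessNoise m Y η) _ hv0 hY
    (fun l => (l1 l).trans hle) (fun l => ?_) (fun l => ?_) (fun l k => (l2 l k).trans hle)
    (fun l k k' => (l3 l k k').trans hA2) (fun l k k' => (l4 l k k').trans hle) (fun l => (add_sub_cancel _ _).symm)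
  · exact (norm_le_pi_norm (t - η) l).trans (hδ.trans (by gcongr))
  · have h1 := htm Y hY t ht l
    rw [(score_eq_zero_iff hm Y (hum η hη).1 t).1 hroot l] at h1
    have h2 : ‖t - η‖ ^ 3 ≤ (C₀ * M.noise m Y η) ^ 3 := by gcongr
    calc _ ≤ Ct * ‖t - η‖ ^ 3 := by
          refine le_trans (le_of_eq ?_) h1
          congr 1; ring
      _ ≤ Ct * (C₀ * M.noise m Y η) ^ 3 := by gcongr
      _ = Ct * C₀ ^ 3 * M.noise m Y η ^ 3 := by ring
      _ ≤ _ := by gcongr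

end root

end Model
end NEFQVF

namespace NEFQVF
namespace Model

variable {p : ℕ} {M : Model p}

/-! ### Expansion of the error of the estimator of the conditional mean squared error -/

variable (M) in
/-- The part of the error which depends on the estimator `t` of the parameter `η`. -/
def excess (m i : ℕ) (y : ℝ) (η t : Par p) : ℝ :=
  M.T1 i y t - M.T1 i y η - (M.xiHat i y t - M.xiHat i y η) ^ 2 + M.corr m i y t

variable (M) in
/-- The second-order approximation of `excess`. -/
def mainTerm (m i : ℕ) (Y : ℕ → ℝ) (η : Par p) : ℝ :=
  ∑ l, M.r i (Y i) η l * (M.lead m Y η l + M.second m Y η l)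
    + 1 / 2 * ∑ k, ∑ l, M.R i (Y i) η k l * M.lead m Y η k * M.lead m Y η l
    - ∑ k, ∑ l, M.Pmat i (Y i) η k l * M.lead m Y η k * M.lead m Y η l
    + M.corr m i (Y i) η

lemma exists_abs_le {ι : Type*} [Fintype ι] {P : ι → ℝ → Prop} (h : ∀ i, ∃ C, P i C)
    (hmono : ∀ i C C', C ≤ C' → P i C → P i C') : ∃ C, 0 ≤ C ∧ ∀ i, P i C := by
  choose C hC using h
  refine ⟨∑ i, |C i|, Finset.sum_nonneg fun i _ => abs_nonneg _, fun i => hmono i _ _ ?_ (hC i)⟩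
  exact (le_abs_self _).trans (Finset.single_le_sum (f := fun i => |C i|)
    (fun _ _ => abs_nonneg _) (Finset.mem_univ i))

lemma SmoothFam.exists_bound_at {K : Set (Par p)} (hK : M.Regular K) {η : Par p} (hη : η ∈ K)
    {ι : Type*} [Fintype ι] {f : ι → ℕ → ℝ → Par p → ℝ} (hf : ∀ a, M.SmoothFam (f a)) (B : ℝ) :
    ∃ C, 0 ≤ C ∧ ∀ a j y, |y| ≤ B → |f a j y η| ≤ C :=
  exists_abs_le (P := fun a C => ∀ j y, |y| ≤ B → |f a j y η| ≤ C)
    (fun a => let ⟨C, hC⟩ := (hf a).exists_bound hK B; ⟨C, fun j y hy => hC j y hy η hη⟩)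
    fun _ _ _ hCC' h j y hy => (h j y hy).trans hCC'

section bounds

variable {K : Set (Par p)} (hK : M.Regular K) {η : Par p} {ρ : ℝ}
  (hρ : Metric.closedBall η ρ ⊆ K)

include hK in
lemma pd_T1 (hη : η ∈ K) (i : ℕ) (y : ℝ) (k : Idx p) : pd k (M.T1 i y) η = M.r i y η k :=
  have h := hK.arg_mem hη i y
  pd_eq_of_hasFDerivAt (hasFDerivAt_T1 h.2.2.1 h.2.2.2.1 (SmoothFam.nu_gt_of_mem h)) k

include hK in
lemma pd_pd_T1 (hη : η ∈ K) (i : ℕ) (y : ℝ) (k l : Idx p) :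
    pd k (pd l (M.T1 i y)) η = M.R i y η l k := by
  have h := hK.arg_mem hη i y
  have e : pd l (M.T1 i y) =ᶠ[𝓝 η] fun t => M.r i y t l :=
    (SmoothFam.eventually_mem h).mono fun t ht => pd_eq_of_hasFDerivAt
      (hasFDerivAt_T1 ht.2.2.1 ht.2.2.2.1 (SmoothFam.nu_gt_of_mem ht)) l
  rw [pd_congr e]
  exact pd_eq_of_hasFDerivAt (hasFDerivAt_r h.2.2.1 h.2.2.2.1 (SmoothFam.nu_gt_of_mem h) l) k

include hK in
lemma pd_xiHat (hη : η ∈ K) (i : ℕ) (y : ℝ) (k : Idx p) :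
    pd k (M.xiHat i y) η = M.xiGrad i y η k :=
  have h := hK.arg_mem hη i y
  pd_eq_of_hasFDerivAt (hasFDerivAt_xiHat h.2.2.1 h.2.2.2.1) k

include hK hρ

lemma exists_T1_taylor (B : ℝ) : ∃ C, 0 ≤ C ∧ ∀ i y, |y| ≤ B → ∀ t ∈ Metric.closedBall η ρ,
    |M.T1 i y t - M.T1 i y η - ∑ l, M.r i y η l * (t - η) l
      - 1 / 2 * ∑ k, ∑ l, M.R i y η k l * (t - η) k * (t - η) l| ≤ C * ‖t - η‖ ^ 3 := by
  obtain ⟨C, hC, h⟩ := (SmoothFam.T1 (M := M)).exists_taylor hK B hρ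
  refine ⟨C, hC, fun i y hy t ht => ?_⟩
  have hη : η ∈ K := hρ (Metric.mem_closedBall_self (dist_nonneg.trans ht))
  have := (h i y hy t ht).2
  simp only [pd_T1 hK hη, pd_pd_T1 hK hη] at this
  rw [Finset.sum_comm] at this
  refine le_trans (le_of_eq ?_) this
  congr 3
  exact Finset.sum_congr rfl fun k _ => Finset.sum_congr rfl fun l _ => by ring

/-- Let u be the increment of the predictor and s its linear part. Then s² is the quadratic form of
P, and u² − s² = (u − s)(2s + (u − s)) is of order two times order one. -/
lemma exists_xiHat_sq_taylor (B : ℝ) :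
    ∃ C, 0 ≤ C ∧ ∀ i y, |y| ≤ B → ∀ t ∈ Metric.closedBall η ρ, ‖t - η‖ ≤ 1 →
    |(M.xiHat i y t - M.xiHat i y η) ^ 2
      - ∑ k, ∑ l, M.Pmat i y η k l * (t - η) k * (t - η) l| ≤ C * ‖t - η‖ ^ 3 := by
  obtain ⟨C, hC, h⟩ := (SmoothFam.xiHat (M := M)).exists_taylor hK B hρ
  rcases lt_or_ge ρ 0 with hρ0 | hρ0
  · exact ⟨0, le_rfl, fun i y _ t ht => absurd (dist_nonneg.trans ht) (not_le.2 hρ0)⟩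
  have hη : η ∈ K := hρ (Metric.mem_closedBall_self hρ0)
  obtain ⟨G, hG, hg⟩ := SmoothFam.exists_bound_at hK hη (fun k => SmoothFam.xiGrad (M := M) k) B
  set N : ℝ := (Fintype.card (Idx p) : ℝ)
  refine ⟨C * (2 * (N * G) + C), by positivity, fun i y hy t ht h1 => ?_⟩
  have h2 := (h i y hy t ht).1
  simp only [pd_xiHat hK hη] at h2
  set s := ∑ k, M.xiGrad i y η k * (t - η) k with hs
  have hs1 : |s| ≤ N * G * ‖t - η‖ := by
    rw [mul_assoc]
    exact abs_sum_mul_le (fun k => hg k i y hy) fun k => norm_le_pi_norm (t - η) k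
  have e : ∑ k, ∑ l, M.Pmat i y η k l * (t - η) k * (t - η) l = s ^ 2 := by
    rw [hs, sq, Finset.sum_mul_sum]
    exact Finset.sum_congr rfl fun k _ => Finset.sum_congr rfl fun l _ => by rw [M.Pmat_eq]; ring
  rw [e]
  set u := M.xiHat i y t - M.xiHat i y η
  have e2 : u ^ 2 - s ^ 2 = (u - s) * (2 * s + (u - s)) := by ring
  rw [e2, abs_mul]
  have h3 : |2 * s + (u - s)| ≤ (2 * (N * G) + C) * ‖t - η‖ := by
    refine (abs_add_le _ _).trans ?_
    rw [abs_mul, abs_two]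
    have : C * ‖t - η‖ ^ 2 ≤ C * ‖t - η‖ := by
      gcongr
      nlinarith [norm_nonneg (t - η)]
    linarith
  calc _ ≤ C * ‖t - η‖ ^ 2 * ((2 * (N * G) + C) * ‖t - η‖) := by gcongr
    _ = _ := by ring

/-- Near the true parameter, `mainTerm` approximates `excess` up to terms of third order. -/
lemma exists_excess_sub_mainTerm_le (hρ0 : 0 < ρ) (i : ℕ) (B : ℝ) {C₀ : ℝ} (hC₀ : 0 ≤ C₀) :
    ∃ C, 0 ≤ C ∧ ∀ᶠ m : ℕ in atTop, ∀ Y : ℕ → ℝ, |Y i| ≤ B → M.noise m Y η ≤ 1 →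
      ∀ t ∈ Metric.closedBall η ρ, M.score m (fun j : Fin m => Y j) t = 0 →
        ‖t - η‖ ≤ C₀ * M.noise m Y η → ‖t - η‖ ≤ 1 →
        |M.excess m i (Y i) η t - M.mainTerm m i Y η|
          ≤ C * (M.noise m Y η ^ 3 + M.noise m Y η / m) := by
  have hη : η ∈ K := hρ (Metric.mem_closedBall_self hρ0.le)
  obtain ⟨Cl, hCl, hl⟩ := exists_abs_lead_le hK hη
  obtain ⟨Ce, hCe, he⟩ := exists_root_expansion hK hρ0 hρ hC₀
  obtain ⟨C1, hC1, h1⟩ := exists_T1_taylor hK hρ B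
  obtain ⟨C2, hC2, h2⟩ := exists_xiHat_sq_taylor hK hρ B
  obtain ⟨C3, hC3, h3⟩ := nice_corr hK hρ i
  obtain ⟨Cr, hCr, hr⟩ := SmoothFam.exists_bound_at hK hη (fun k => SmoothFam.r (M := M) k) B
  obtain ⟨CR, hCR, hR⟩ := SmoothFam.exists_bound_at hK hη
    (fun k : Idx p × Idx p => SmoothFam.R (M := M) k.1 k.2) B
  obtain ⟨CP, hCP, hP⟩ := SmoothFam.exists_bound_at hK hη
    (fun k : Idx p × Idx p => SmoothFam.Pmat (M := M) k.1 k.2) B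
  set N : ℝ := (Fintype.card (Idx p) : ℝ) with hN
  set A := N * (Cr * Ce) + (N * (N * (CR * Ce * C₀)) + N * (N * (CR * Cl * Ce)))
    + (N * (N * (CP * Ce * C₀)) + N * (N * (CP * Cl * Ce))) + C1 * C₀ ^ 3 + C2 * C₀ ^ 3 with hA
  set A' := C3 * (1 + |B|) ^ 4 * C₀ with hA'
  have hA0 : 0 ≤ A := by positivity
  have hA'0 : 0 ≤ A' := by positivity
  refine ⟨A + A', by positivity, ?_⟩
  filter_upwards [hl, he, h3, eventually_gt_atTop 0] with m hlm hem h3m hm Y hYB hv t ht hroot htC ht1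
  set v := M.noise m Y η with hvdef
  have hv0 : 0 ≤ v := noise_nonneg _ _ _
  have hm0 : (0 : ℝ) < m := by exact_mod_cast hm
  set δ := t - η with hδ
  have hex := hem Y hv t ht hroot htC
  have hδb : ∀ k, |δ k| ≤ C₀ * v := fun k => (norm_le_pi_norm δ k).trans htC
  have hzb := (hlm Y).1
  have hd : ∀ k, |δ k - M.lead m Y η k| ≤ Ce * v ^ 2 := fun k => (hex k).1
  have n3 : ‖δ‖ ^ 3 ≤ C₀ ^ 3 * v ^ 3 := by rw [← mul_pow]; gcongr
  have t1 := (h1 i (Y i) hYB t ht).trans (mul_le_mul_of_nonneg_left n3 hC1)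
  have t2 := (h2 i (Y i) hYB t ht ht1).trans (mul_le_mul_of_nonneg_left n3 hC2)
  have t3 : |M.corr m i (Y i) t - M.corr m i (Y i) η| ≤ A' * (v / m) := by
    have := (h3m (Y i)).2 t ht
    rw [← mul_sub, abs_mul, abs_of_pos hm0] at this
    rw [← mul_div_assoc, le_div_iff₀' hm0]
    refine this.trans ?_
    have hB : |Y i| ≤ |B| := hYB.trans (le_abs_self B)
    calc _ ≤ C3 * (1 + |B|) ^ 4 * (C₀ * v) := by gcongr
      _ = _ := by rw [hA']; ring
  have t4 := abs_sum_mul_le (fun k => hr k i (Y i) hYB) (fun k => (hex k).2)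
  have t5 := abs_sum_sum_mul_le (fun k l => hR (k, l) i (Y i) hYB) hd hδb
  have t6 := abs_sum_sum_mul_le (fun k l => hR (k, l) i (Y i) hYB) hzb hd
  have t7 := abs_sum_sum_mul_le (fun k l => hP (k, l) i (Y i) hYB) hd hδb
  have t8 := abs_sum_sum_mul_le (fun k l => hP (k, l) i (Y i) hYB) hzb hd
  -- Besides the Taylor remainders and the increment of `corr`, the displacement δ is exchanged for
  -- `lead` in one slot of each quadratic form at a time.
  have e : M.excess m i (Y i) η t - M.mainTerm m i Y η
      = (M.T1 i (Y i) t - M.T1 i (Y i) η - ∑ l, M.r i (Y i) η l * δ l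
          - 1 / 2 * ∑ k, ∑ l, M.R i (Y i) η k l * δ k * δ l)
        - ((M.xiHat i (Y i) t - M.xiHat i (Y i) η) ^ 2
          - ∑ k, ∑ l, M.Pmat i (Y i) η k l * δ k * δ l)
        + (M.corr m i (Y i) t - M.corr m i (Y i) η)
        + ∑ l, M.r i (Y i) η l * (δ l - (M.lead m Y η l + M.second m Y η l))
        + 1 / 2 * (∑ k, ∑ l, M.R i (Y i) η k l * (δ k - M.lead m Y η k) * δ l
          + ∑ k, ∑ l, M.R i (Y i) η k l * M.lead m Y η k * (δ l - M.lead m Y η l))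
        - (∑ k, ∑ l, M.Pmat i (Y i) η k l * (δ k - M.lead m Y η k) * δ l
          + ∑ k, ∑ l, M.Pmat i (Y i) η k l * M.lead m Y η k * (δ l - M.lead m Y η l)) := by
    simp only [excess, mainTerm, mul_sub, sub_mul, Finset.sum_sub_distrib]
    ring
  rw [abs_le] at t1 t2 t3 t4 t5 t6 t7 t8
  have hvm : 0 ≤ v / m := by positivity
  have hp1 : 0 ≤ A * (v / m) := by positivity
  have hp2 : 0 ≤ A' * v ^ 3 := by positivity
  have hp3 : 0 ≤ N * (N * (CR * Ce * C₀)) * v ^ 3 := by positivity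
  have hp4 : 0 ≤ N * (N * (CR * Cl * Ce)) * v ^ 3 := by positivity
  have eA : (A + A') * (v ^ 3 + v / m) = N * (Cr * (Ce * v ^ 3))
      + (N * (N * (CR * (Ce * v ^ 2) * (C₀ * v))) + N * (N * (CR * (Cl * v) * (Ce * v ^ 2))))
      + (N * (N * (CP * (Ce * v ^ 2) * (C₀ * v))) + N * (N * (CP * (Cl * v) * (Ce * v ^ 2))))
      + C1 * (C₀ ^ 3 * v ^ 3) + C2 * (C₀ ^ 3 * v ^ 3) + A' * (v / m) + A * (v / m) + A' * v ^ 3 := by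
    rw [hA]; ring
  have e5 : N * (N * (CR * (Ce * v ^ 2) * (C₀ * v))) = N * (N * (CR * Ce * C₀)) * v ^ 3 := by ring
  have e6 : N * (N * (CR * (Cl * v) * (Ce * v ^ 2))) = N * (N * (CR * Cl * Ce)) * v ^ 3 := by ring
  rw [e, abs_le, eA]
  constructor <;> linarith [t1.1, t1.2, t2.1, t2.2, t3.1, t3.2, t4.1, t4.2, t5.1, t5.2, t6.1, t6.2,
    t7.1, t7.2, t8.1, t8.2]

/-- Everywhere, `excess` and `mainTerm` are bounded in terms of the fluctuations. -/
lemma exists_abs_excess_sub_mainTerm_le (hρ0 : 0 < ρ) (i : ℕ) (B : ℝ) :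
    ∃ C, 0 ≤ C ∧ ∀ᶠ m : ℕ in atTop, ∀ Y : ℕ → ℝ, |Y i| ≤ B → ∀ t ∈ K,
        |M.excess m i (Y i) η t - M.mainTerm m i Y η| ≤ C * (1 + M.noise m Y η ^ 2) := by
  have hη : η ∈ K := hρ (Metric.mem_closedBall_self hρ0.le)
  obtain ⟨Cl, hCl, hl⟩ := exists_abs_lead_le hK hη
  obtain ⟨C1, h1⟩ := (SmoothFam.T1 (M := M)).exists_bound hK B
  obtain ⟨C2, h2⟩ := (SmoothFam.xiHat (M := M)).exists_bound hK B
  obtain ⟨C3, hC3, h3⟩ := nice_corr hK hρ i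
  obtain ⟨Cr, hCr, hr⟩ := SmoothFam.exists_bound_at hK hη (fun k => SmoothFam.r (M := M) k) B
  obtain ⟨CR, hCR, hR⟩ := SmoothFam.exists_bound_at hK hη
    (fun k : Idx p × Idx p => SmoothFam.R (M := M) k.1 k.2) B
  obtain ⟨CP, hCP, hP⟩ := SmoothFam.exists_bound_at hK hη
    (fun k : Idx p × Idx p => SmoothFam.Pmat (M := M) k.1 k.2) B
  set N : ℝ := (Fintype.card (Idx p) : ℝ) with hN
  set Cs := N * Cl ^ 2 + N * (N * Cl ^ 3) with hCs
  have hCs0 : 0 ≤ Cs := by positivity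
  set D := C3 * (1 + |B|) ^ 4 with hD
  have hD0 : 0 ≤ D := by positivity
  set A := N * (Cr * (Cl + Cs)) + N * (N * (CR * Cl ^ 2)) + N * (N * (CP * Cl ^ 2)) with hA
  have hA0 : 0 ≤ A := by positivity
  refine ⟨2 * |C1| + 4 * C2 ^ 2 + 2 * D + A, by positivity, ?_⟩
  filter_upwards [hl, h3, eventually_gt_atTop 0] with m hlm h3m hm Y hYB t ht
  set v := M.noise m Y η with hvdef
  have hv0 : 0 ≤ v := noise_nonneg _ _ _
  have hm1 : (1 : ℝ) ≤ m := by exact_mod_cast hm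
  obtain ⟨l1, l2, l3, -⟩ := hlm Y
  have hcorr : ∀ s ∈ K, |M.corr m i (Y i) s| ≤ D := by
    intro s hs
    have h4 := (h3m (Y i)).1 s hs
    rw [abs_mul, abs_of_pos (by linarith : (0 : ℝ) < m)] at h4
    have hB : |Y i| ≤ |B| := hYB.trans (le_abs_self B)
    have h5 : C3 * (1 + |Y i|) ^ 4 ≤ D := by rw [hD]; gcongr
    nlinarith [abs_nonneg (M.corr m i (Y i) s)]
  have hsec : ∀ l, |M.second m Y η l| ≤ Cs * v ^ 2 := by
    intro l
    have b1 := abs_le.1 (abs_sum_mul_le (l2 l) l1)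
    have b2 := abs_le.1 (abs_sum_sum_mul_le (l3 l) l1 l1)
    have q1 : 0 ≤ N * (N * (Cl * (Cl * v) * (Cl * v))) := by positivity
    have e : Cs * v ^ 2 = N * (Cl * v * (Cl * v)) + N * (N * (Cl * (Cl * v) * (Cl * v))) := by
      rw [hCs]; ring
    rw [second, abs_le, e]
    constructor <;> linarith
  have hvv : v ≤ 1 + v ^ 2 := by nlinarith
  have hls : ∀ l, |M.lead m Y η l + M.second m Y η l| ≤ (Cl + Cs) * (1 + v ^ 2) := by
    intro l
    refine (abs_add_le _ _).trans ?_
    have := l1 l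
    have := hsec l
    have : Cl * v ≤ Cl * (1 + v ^ 2) := by gcongr
    nlinarith
  have s1 := abs_le.1 (abs_sum_mul_le (fun k => hr k i (Y i) hYB) hls)
  have s2 := abs_le.1 (abs_sum_sum_mul_le (fun k l => hR (k, l) i (Y i) hYB) l1 l1)
  have s3 := abs_le.1 (abs_sum_sum_mul_le (fun k l => hP (k, l) i (Y i) hYB) l1 l1)
  have s4 := abs_le.1 (hcorr t ht)
  have s5 := abs_le.1 (hcorr η hη)
  have s6 := abs_le.1 ((h1 i (Y i) hYB t ht).trans (le_abs_self _))
  have s7 := abs_le.1 ((h1 i (Y i) hYB η hη).trans (le_abs_self _))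
  have s8 : (M.xiHat i (Y i) t - M.xiHat i (Y i) η) ^ 2 ≤ 4 * C2 ^ 2 := by
    have a1 := h2 i (Y i) hYB t ht
    have a2 := h2 i (Y i) hYB η hη
    have a3 : |M.xiHat i (Y i) t - M.xiHat i (Y i) η| ≤ 2 * C2 :=
      (abs_sub _ _).trans (by linarith)
    rw [← sq_abs]
    calc _ ≤ (2 * C2) ^ 2 := by gcongr
      _ = _ := by ring
  have s9 := sq_nonneg (M.xiHat i (Y i) t - M.xiHat i (Y i) η)
  have eA : (2 * |C1| + 4 * C2 ^ 2 + 2 * D + A) * (1 + v ^ 2)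
      = (2 * |C1| + 4 * C2 ^ 2 + 2 * D) + (2 * |C1| + 4 * C2 ^ 2 + 2 * D) * v ^ 2
        + N * (Cr * ((Cl + Cs) * (1 + v ^ 2)))
        + N * (N * (CR * (Cl * v) * (Cl * v))) + N * (N * (CP * (Cl * v) * (Cl * v)))
        + (N * (N * (CR * Cl ^ 2)) + N * (N * (CP * Cl ^ 2))) := by
    rw [hA]; ring
  have q1 : 0 ≤ (2 * |C1| + 4 * C2 ^ 2 + 2 * D) * v ^ 2 := by positivity
  have q2 : 0 ≤ N * (N * (CR * Cl ^ 2)) + N * (N * (CP * Cl ^ 2)) := by positivity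
  have q3 : 0 ≤ N * (N * (CR * (Cl * v) * (Cl * v))) := by positivity
  rw [excess, mainTerm, abs_le, eA]
  constructor <;> linarith [s1.1, s1.2, s2.1, s2.2, s3.1, s3.2, s4.1, s4.2, s5.1, s5.2]

end bounds

end Model
end NEFQVF

/-! ### Conditional means of the expansion terms and their cancellation -/

namespace NEFQVF

section

variable {Ω : Type*} [mΩ : MeasurableSpace Ω] {P : Measure Ω} [IsFiniteMeasure P]

lemma Negl.mul_comp {y : ℕ → Ω → ℝ} {i : ℕ} (hy : Measurable (y i)) {V : ℕ → Ω → ℝ}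
    (h : Negl P (sigmaOf y i) V) {F : ℝ → ℝ} (hF : Measurable F) {C : ℝ} (hC : ∀ t, |F t| ≤ C) :
    Negl P (sigmaOf y i) fun m ω => F (y i ω) * V m ω :=
  h.mul hy.comap_le (c := fun _ ω => F (y i ω))
    (fun _ => (hF.comp (comap_measurable (y i))).stronglyMeasurable)
    (Eventually.of_forall fun _ _ => hC _)

end

namespace Model

variable {p : ℕ} {M : Model p} {K : Set (Par p)} (hK : M.Regular K) {η : Par p} (hη : η ∈ K)
  {Ω : Type*} [MeasurableSpace Ω] {P : Measure Ω} [IsProbabilityMeasure P]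
  {θ y : ℕ → Ω → ℝ} (h : M.Generates P η θ y)

include hK hη h

lemma Generates.negl_avg_mul_avg (α β : Fin 2 → ℕ → Par p → ℝ) (i : ℕ) :
    Negl P (sigmaOf y i) fun m ω =>
      M.avg α m (fun j => y j ω) η * M.avg β m (fun j => y j ω) η
        - ((m : ℝ)⁻¹) ^ 2 *
          ∑ j ∈ Finset.range m, ∑ a, ∑ c, α a j η * M.Sig j η a c * β c j η := by
  refine (negl_sum_mul_sum (f := fun j t => M.ctr α j t η) (f' := fun j t => M.ctr β j t η)
    h.measurable_y h.indep_y (fun j => measurable_ctr α j η) (fun j => measurable_ctr β j η)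
    (h.memLp_ctr hK hη α) (h.memLp_ctr hK hη β) (h.integral_ctr hK hη α)
    (h.integral_ctr hK hη β) i).congr (Eventually.of_forall fun m => ae_of_all _ fun ω => ?_)
  simp only [h.integral_ctr_mul_ctr hK hη α β, avg]
  ring

/-- Conditioning on y_i kills every summand of the score but the i-th. That one is of order 1/m
after normalization and must be kept, which is the origin of the term W_i g_i in `b`. -/
lemma Generates.negl_lead (i : ℕ) (l : Idx p) : Negl P (sigmaOf y i) fun m ω =>
    M.lead m (fun j => y j ω) η l - ∑ k, (M.U m η)⁻¹ l k * M.areaScore k i (y i ω) η := by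
  obtain ⟨C, -, hu⟩ := hK.exists_ut_bound
  have h1 : ∀ k, Negl P (sigmaOf y i) fun m ω => M.ut m η l k * ((m : ℝ)⁻¹ *
      ((∑ j ∈ Finset.range m, M.ctr (M.scoreCoef k) j (y j ω) η)
        - M.ctr (M.scoreCoef k) i (y i ω) η)) := fun k =>
    (negl_sum (f := fun j t => M.ctr (M.scoreCoef k) j t η) h.measurable_y h.indep_y
      (fun j => measurable_ctr _ j η) (h.memLp_ctr hK hη _) (h.integral_ctr hK hη _) i).const_mul
      (h.measurable_y i).comap_le (hu.mono fun m hm => (hm η hη).2 l k)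
  refine (Negl.sum Finset.univ fun k _ => h1 k).congr ?_
  filter_upwards [eventually_gt_atTop 0] with m hm
  have hm0 : (m : ℝ) ≠ 0 := by exact_mod_cast hm.ne'
  refine ae_of_all _ fun ω => ?_
  beta_reduce
  rw [lead, agg_apply, ← Finset.sum_sub_distrib]
  refine Finset.sum_congr rfl fun k _ => ?_
  rw [areaScore_eq, ut]
  field_simp

/-- The covariance of the score is U, and U⁻¹UU⁻¹ = U⁻¹. Conditioning changes it only by O(m⁻²). -/
lemma Generates.negl_lead_mul_lead (i : ℕ) (k l : Idx p) : Negl P (sigmaOf y i) fun m ω =>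
    M.lead m (fun j => y j ω) η k * M.lead m (fun j => y j ω) η l - (M.U m η)⁻¹ k l := by
  obtain ⟨C, hC, hu⟩ := hK.exists_ut_bound
  have h1 : ∀ a b, Negl P (sigmaOf y i) fun m ω => (M.ut m η k a * M.ut m η l b) *
      (M.avg (M.scoreCoef a) m (fun j => y j ω) η * M.avg (M.scoreCoef b) m (fun j => y j ω) η
        - ((m : ℝ)⁻¹) ^ 2 * ∑ j ∈ Finset.range m, ∑ c, ∑ d,
          M.scoreCoef a c j η * M.Sig j η c d * M.scoreCoef b d j η) := fun a b =>
    (h.negl_avg_mul_avg hK hη (M.scoreCoef a) (M.scoreCoef b) i).const_mul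
      (h.measurable_y i).comap_le (C := C * C) (hu.mono fun m hm => by
        rw [abs_mul]
        exact mul_le_mul ((hm η hη).2 k a) ((hm η hη).2 l b) (abs_nonneg _) hC)
  refine (Negl.sum Finset.univ fun a _ => Negl.sum Finset.univ fun b _ => h1 a b).congr ?_
  filter_upwards [eventually_gt_atTop 0, hu] with m hm hum
  have hm0 : (m : ℝ) ≠ 0 := by exact_mod_cast hm.ne'
  have hU := (hum η hη).1.isUnit
  have e : (M.U m η)⁻¹ k l = ∑ a, ∑ b, M.ut m η k a * M.ut m η l b * (((m : ℝ)⁻¹) ^ 2 * M.U m η a b) := by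
    have e1 : (M.U m η)⁻¹ k l = ((M.U m η)⁻¹ * (M.U m η * (M.U m η)⁻¹)) k l := by
      rw [Matrix.mul_nonsing_inv _ hU, Matrix.mul_one]
    rw [e1, Matrix.mul_apply]
    refine Finset.sum_congr rfl fun a _ => ?_
    rw [Matrix.mul_apply, Finset.mul_sum]
    refine Finset.sum_congr rfl fun b _ => ?_
    rw [ut, ut, U_inv_symm m η b l]
    field_simp
  refine ae_of_all _ fun ω => ?_
  beta_reduce
  rw [e, lead, lead, agg_apply, agg_apply, Finset.sum_mul_sum, ← Finset.sum_sub_distrib]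
  refine Finset.sum_congr rfl fun a _ => ?_
  rw [← Finset.sum_sub_distrib]
  refine Finset.sum_congr rfl fun b _ => ?_
  rw [sum_scoreCoef_Sig hK hη, avg, avg]
  ring

/-- The covariance of the Jacobian fluctuation with `lead` produces U⁻¹a₁. The mean second
derivative contracted with the covariance U⁻¹ of `lead` produces U⁻¹a₂. -/
lemma Generates.negl_second (i : ℕ) (l : Idx p) : Negl P (sigmaOf y i) fun m ω =>
    M.second m (fun j => y j ω) η l
      - ∑ a, (M.U m η)⁻¹ l a * (M.a1 m η a + 1 / 2 * M.a2 m η a) := by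
  obtain ⟨C, hC, hu⟩ := hK.exists_ut_bound
  obtain ⟨Cl, hCl, hl⟩ := exists_abs_lead_le hK hη
  have h1 : ∀ k a b, Negl P (sigmaOf y i) fun m ω => (M.ut m η l a * M.ut m η k b) *
      (M.avg (M.jacCoef a k) m (fun j => y j ω) η * M.avg (M.scoreCoef b) m (fun j => y j ω) η
        - ((m : ℝ)⁻¹) ^ 2 * ∑ j ∈ Finset.range m, ∑ c, ∑ d,
          M.jacCoef a k c j η * M.Sig j η c d * M.scoreCoef b d j η) := fun k a b =>
    (h.negl_avg_mul_avg hK hη (M.jacCoef a k) (M.scoreCoef b) i).const_mul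
      (h.measurable_y i).comap_le (C := C * C) (hu.mono fun m hm => by
        rw [abs_mul]
        exact mul_le_mul ((hm η hη).2 l a) ((hm η hη).2 k b) (abs_nonneg _) hC)
  have h2 : ∀ k k', Negl P (sigmaOf y i) fun m ω => (1 / 2 * M.hessMean m η l k k') *
      (M.lead m (fun j => y j ω) η k * M.lead m (fun j => y j ω) η k' - (M.U m η)⁻¹ k k') :=
    fun k k' => (h.negl_lead_mul_lead hK hη i k k').const_mul (h.measurable_y i).comap_le
      (C := 1 / 2 * Cl) (hl.mono fun m hm => by
        rw [abs_mul, abs_of_pos (by norm_num : (0 : ℝ) < 1 / 2)]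
        gcongr
        exact (hm 0).2.2.1 l k k')
  refine ((Negl.sum Finset.univ fun k _ => Negl.sum Finset.univ fun a _ =>
    Negl.sum Finset.univ fun b _ => h1 k a b).add
    (Negl.sum Finset.univ fun k _ => Negl.sum Finset.univ fun k' _ => h2 k k')).congr ?_
  filter_upwards [eventually_gt_atTop 0] with m hm
  have hm0 : (m : ℝ) ≠ 0 := by exact_mod_cast hm.ne'
  refine ae_of_all _ fun ω => ?_
  have e1 : ∑ a, (M.U m η)⁻¹ l a * M.a1 m η a
      = ∑ k, ∑ a, ∑ b, (M.ut m η l a * M.ut m η k b) *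
        (((m : ℝ)⁻¹) ^ 2 * ∑ j ∈ Finset.range m, ∑ c, ∑ d,
          M.jacCoef a k c j η * M.Sig j η c d * M.scoreCoef b d j η) := by
    rw [Finset.sum_comm]
    refine Finset.sum_congr rfl fun a _ => ?_
    rw [a1_eq_sum hK hη, Finset.mul_sum]
    refine Finset.sum_congr rfl fun k _ => ?_
    rw [Finset.mul_sum]
    refine Finset.sum_congr rfl fun b _ => ?_
    simp only [sum_coef_Sig_scoreCoef hK hη (M.jacCoef a k)]
    rw [ut, ut]
    field_simp
  have e2 : ∑ a, (M.U m η)⁻¹ l a * (1 / 2 * M.a2 m η a)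
      = ∑ k, ∑ k', 1 / 2 * M.hessMean m η l k k' * (M.U m η)⁻¹ k k' := by
    have e3 : ∀ k k', 1 / 2 * M.hessMean m η l k k' * (M.U m η)⁻¹ k k'
        = ∑ a, (M.U m η)⁻¹ l a * (1 / 2 * ((∑ j ∈ Finset.range m, M.hessConst a k k' j η)
          * (M.U m η)⁻¹ k k')) := by
      intro k k'
      rw [hessMean, agg_apply, Finset.mul_sum, Finset.sum_mul]
      refine Finset.sum_congr rfl fun a _ => ?_
      rw [ut]
      field_simp
    simp only [e3]
    rw [Finset.sum_congr rfl fun k _ => Finset.sum_comm, Finset.sum_comm]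
    refine Finset.sum_congr rfl fun a _ => ?_
    rw [a2_eq_sum hK hη, Finset.mul_sum, Finset.mul_sum]
    refine Finset.sum_congr rfl fun k _ => ?_
    rw [Finset.mul_sum, Finset.mul_sum]
  have e4 : ∑ k, M.jacNoise m (fun j => y j ω) η l k * M.lead m (fun j => y j ω) η k
      = ∑ k, ∑ a, ∑ b, (M.ut m η l a * M.ut m η k b) *
        (M.avg (M.jacCoef a k) m (fun j => y j ω) η
          * M.avg (M.scoreCoef b) m (fun j => y j ω) η) := by
    refine Finset.sum_congr rfl fun k _ => ?_
    rw [jacNoise, lead, agg_apply, agg_apply, Finset.sum_mul_sum]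
    refine Finset.sum_congr rfl fun a _ => Finset.sum_congr rfl fun b _ => ?_
    rw [avg, avg]; ring
  have e5 : 1 / 2 * ∑ k, ∑ k', M.hessMean m η l k k' * M.lead m (fun j => y j ω) η k
        * M.lead m (fun j => y j ω) η k'
      = ∑ k, ∑ k', 1 / 2 * M.hessMean m η l k k' *
        (M.lead m (fun j => y j ω) η k * M.lead m (fun j => y j ω) η k') := by
    simp only [Finset.mul_sum, mul_assoc]
  simp only [mul_add, Finset.sum_add_distrib, mul_sub, Finset.sum_sub_distrib]
  rw [e1, e2, second, e4, e5]
  ring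

omit hη h in
lemma IsQuad.measurable (hη : η ∈ K) {f : ℕ → ℝ → Par p → ℝ} (hq : M.IsQuad f) (i : ℕ) :
    Measurable fun t => f i t η := by
  have e : (fun t => f i t η) = fun t => f i 0 η * (1 - t ^ 2) + f i 1 η * ((t ^ 2 + t) / 2)
    + f i (-1) η * ((t ^ 2 - t) / 2) := funext fun t => hq i t η (hK.arg_mem hη i 0)
  rw [e]; fun_prop

/-- The main term of the error has a negligible conditional expectation. -/
theorem Generates.negl_mainTerm (i : ℕ) (B : ℝ) : Negl P (sigmaOf y i) fun m ω =>
    (Set.Icc (-B) B).indicator 1 (y i ω) * M.mainTerm m i (fun j => y j ω) η := by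
  set cut : ℝ → ℝ := (Set.Icc (-B) B).indicator 1 with hcut
  have hcm : Measurable cut := measurable_one.indicator measurableSet_Icc
  -- On the event |y_i| ≤ B the coefficients are bounded functions of y_i, so they may multiply
  -- negligible sequences.
  have key : ∀ {f : ℕ → ℝ → Par p → ℝ}, M.IsQuad f → M.SmoothFam f → ∀ {V : ℕ → Ω → ℝ},
      Negl P (sigmaOf y i) V →
        Negl P (sigmaOf y i) fun m ω => cut (y i ω) * f i (y i ω) η * V m ω := by
    intro f hq hf V hV
    obtain ⟨C, hC⟩ := hf.exists_bound hK B
    refine Negl.mul_comp (h.measurable_y i) hV (F := fun t => cut t * f i t η)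
      (hcm.mul (hq.measurable hK hη i)) (C := |C|) fun t => ?_
    by_cases ht : t ∈ Set.Icc (-B) B
    · simp only [hcut, Set.indicator_of_mem ht, Pi.one_apply, one_mul]
      exact (hC i t (abs_le.2 ht) η hη).trans (le_abs_self C)
    · simp [hcut, Set.indicator_of_notMem ht]
  have h1 := Negl.sum Finset.univ fun l _ => key (isQuad_r l) (SmoothFam.r l)
    ((h.negl_lead hK hη i l).add (h.negl_second hK hη i l))
  have h2 := Negl.sum Finset.univ fun k _ => Negl.sum Finset.univ fun l _ =>
    key (isQuad_R k l) (SmoothFam.R k l) (h.negl_lead_mul_lead hK hη i k l)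
  have h3 := Negl.sum Finset.univ fun k _ => Negl.sum Finset.univ fun l _ =>
    key (isQuad_Pmat k l) (SmoothFam.Pmat k l) (h.negl_lead_mul_lead hK hη i k l)
  have hle := (h.measurable_y i).comap_le
  refine ((h1.add (h2.const_mul hle (c := fun _ => 1 / 2)
    (Eventually.of_forall fun _ => le_rfl))).add (h3.const_mul hle (c := fun _ => -1)
    (Eventually.of_forall fun _ => le_rfl))).congr ?_
  filter_upwards [eventually_gt_atTop 0] with m hm
  have hm0 : (m : ℝ) ≠ 0 := by exact_mod_cast hm.ne'
  refine ae_of_all _ fun ω => ?_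
  -- Written out, `corr` is minus the combination of `r`, R/2 and −P with the conditional means
  -- found above, so adding it cancels them exactly.
  have ec : M.corr m i (y i ω) η
      = (∑ k, ∑ l, M.Pmat i (y i ω) η k l * (M.U m η)⁻¹ k l)
      - (∑ l, M.r i (y i ω) η l * (∑ k, (M.U m η)⁻¹ l k * M.areaScore k i (y i ω) η
        + ∑ k, (M.U m η)⁻¹ l k * (M.a1 m η k + 1 / 2 * M.a2 m η k)))
      - 1 / 2 * ∑ k, ∑ l, M.R i (y i ω) η k l * (M.U m η)⁻¹ k l := by
    have e0 := mul_corr (M := M) m i (y i ω) η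
    refine mul_left_cancel₀ hm0 (e0.trans ?_)
    have e1 : ∀ A : Matrix (Idx p) (Idx p) ℝ, (m : ℝ) * ∑ k, ∑ l, A k l * (M.U m η)⁻¹ k l
        = ∑ k, ∑ l, A k l * M.ut m η l k := by
      intro A
      simp only [Finset.mul_sum]
      refine Finset.sum_congr rfl fun k _ => Finset.sum_congr rfl fun l _ => ?_
      rw [ut, U_inv_symm m η k l]; ring
    have e2 : (m : ℝ) * ∑ l, M.r i (y i ω) η l * (∑ k, (M.U m η)⁻¹ l k * M.areaScore k i (y i ω) η
        + ∑ k, (M.U m η)⁻¹ l k * (M.a1 m η k + 1 / 2 * M.a2 m η k))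
        = ∑ l, M.r i (y i ω) η l * ∑ k, M.ut m η l k *
        (M.areaScore k i (y i ω) η + M.a1 m η k + 1 / 2 * M.a2 m η k) := by
      rw [Finset.mul_sum]
      refine Finset.sum_congr rfl fun l _ => ?_
      rw [← Finset.sum_add_distrib, mul_left_comm, Finset.mul_sum (a := (m : ℝ))]
      congr 1
      refine Finset.sum_congr rfl fun k _ => ?_
      rw [ut]; ring
    rw [← e1, ← e1, ← e2]
    ring
  beta_reduce
  rw [mainTerm, ec]
  simp only [mul_assoc (cut (y i ω)), ← Finset.mul_sum]
  simp only [mul_add, mul_sub, Finset.sum_add_distrib, Finset.sum_sub_distrib, mul_assoc]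
  ring

end Model
end NEFQVF

namespace NEFQVF

/-! ### Convergence in probability of conditional expectations -/

/-- The truncation is a function of y_i and leaves the conditional expectation unchanged where |y_i|
≤ B. Markov's inequality treats that event, and its complement has small probability for large B.
Truncation is what reduces the claim to L¹ bounds. -/
lemma tendstoInMeasure_of_negl {Ω : Type*} [mΩ : MeasurableSpace Ω] {P : Measure Ω}
    [IsProbabilityMeasure P] {y : ℕ → Ω → ℝ} {i : ℕ} (hy : Measurable (y i)) {V : ℕ → Ω → ℝ}
    (hV : ∀ᶠ m in atTop, Integrable (V m) P)
    (h : ∀ B, Negl P (sigmaOf y i) fun m ω => (Set.Icc (-B) B).indicator 1 (y i ω) * V m ω) :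
    TendstoInMeasure P (fun (m : ℕ) ω => (m : ℝ) * (P[V m | sigmaOf y i]) ω) atTop (fun _ => 0) := by
  rw [tendstoInMeasure_iff_measureReal_norm]
  intro ε hε
  have htail : Tendsto (fun N : ℕ => P.real {ω | (N : ℝ) < |y i ω|}) atTop (𝓝 0) := by
    have hanti : Antitone fun N : ℕ => {ω | (N : ℝ) < |y i ω|} := fun a b hab ω hω =>
      (Nat.cast_le.2 hab : (a : ℝ) ≤ b).trans_lt hω
    have hmeas : ∀ N : ℕ, NullMeasurableSet {ω | (N : ℝ) < |y i ω|} P := fun N =>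
      (measurableSet_lt measurable_const hy.abs).nullMeasurableSet
    have h1 := tendsto_measure_iInter_atTop hmeas hanti ⟨0, measure_ne_top _ _⟩
    have h2 : ⋂ N : ℕ, {ω | (N : ℝ) < |y i ω|} = ∅ := by
      ext ω
      simp only [Set.mem_iInter, Set.mem_ofPred_eq, Set.mem_empty_iff_false, iff_false, not_forall,
        not_lt]
      exact exists_nat_ge _
    rw [h2, measure_empty] at h1
    exact (ENNReal.tendsto_toReal ENNReal.zero_ne_top).comp h1
  rw [Metric.tendsto_atTop]
  intro δ hδ
  obtain ⟨N, hN⟩ := (htail.eventually (gt_mem_nhds (half_pos hδ))).exists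
  have hB := h N
  set cut : ℝ → ℝ := (Set.Icc (-(N : ℝ)) N).indicator 1 with hcut
  have h3 := hB.2.eventually (gt_mem_nhds (mul_pos hε (half_pos hδ)))
  have hev : ∀ᶠ m : ℕ in atTop, dist (P.real {ω | ε ≤ ‖(m : ℝ) * (P[V m | sigmaOf y i]) ω - 0‖}) 0
      < δ := by
    filter_upwards [hV, h3] with m hm h3m
    have hcm : StronglyMeasurable[sigmaOf y i] fun ω => cut (y i ω) :=
      ((measurable_one.indicator measurableSet_Icc).comp (comap_measurable (y i))).stronglyMeasurable
    have hce : P[fun ω => cut (y i ω) * V m ω | sigmaOf y i]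
        =ᵐ[P] (fun ω => cut (y i ω)) * P[V m | sigmaOf y i] :=
      condExp_stronglyMeasurable_mul_of_bound hy.comap_le hcm hm 1 (ae_of_all _ fun ω => by
        by_cases hω : y i ω ∈ Set.Icc (-(N : ℝ)) N
        · simp [hcut, Set.indicator_of_mem hω]
        · simp [hcut, Set.indicator_of_notMem hω])
    set E := P[fun ω => cut (y i ω) * V m ω | sigmaOf y i] with hE
    have h4 := mul_meas_ge_le_integral_of_nonneg (μ := P) (f := fun ω => (m : ℝ) * |E ω|)
      (ae_of_all _ fun ω => by positivity) (integrable_condExp.abs.const_mul _) ε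
    rw [integral_const_mul] at h4
    have h5 : P.real {ω | ε ≤ ‖(m : ℝ) * (P[V m | sigmaOf y i]) ω - 0‖}
        ≤ P.real ({ω | (N : ℝ) < |y i ω|} ∪ {ω | ε ≤ (m : ℝ) * |E ω|}) := by
      refine ENNReal.toReal_mono (measure_ne_top _ _) (measure_mono_ae ?_)
      filter_upwards [hce] with ω hω hmem
      rcases lt_or_ge (N : ℝ) |y i ω| with hlt | hge
      · exact Or.inl hlt
      · refine Or.inr ?_
        have hc : cut (y i ω) = 1 := by
          simp [hcut, Set.indicator_of_mem (show y i ω ∈ Set.Icc (-(N : ℝ)) N from abs_le.1 hge)]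
        have hmem' : ε ≤ ‖(m : ℝ) * (P[V m | sigmaOf y i]) ω - 0‖ := hmem
        rw [sub_zero, norm_mul, Real.norm_eq_abs, Real.norm_eq_abs,
          abs_of_nonneg (Nat.cast_nonneg m)] at hmem'
        rw [Set.mem_ofPred_eq, hω, Pi.mul_apply, hc, one_mul]
        exact hmem'
    have h6 := measureReal_union_le (μ := P) {ω | (N : ℝ) < |y i ω|} {ω | ε ≤ (m : ℝ) * |E ω|}
    have h7 : P.real {ω | ε ≤ (m : ℝ) * |E ω|} < δ / 2 :=
      lt_of_mul_lt_mul_left (h4.trans_lt h3m) hε.le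
    rw [Real.dist_eq, sub_zero, abs_of_nonneg measureReal_nonneg]
    linarith
  exact eventually_atTop.1 hev

namespace Model

variable {p : ℕ} {M : Model p}

/-! ### Measurability in the estimator of the parameters -/

section measurability

variable {K : Set (Par p)} (hK : M.Regular K) {α : Type*} [MeasurableSpace α]
  {T : α → Par p} (hT : Measurable T) (hmem : ∀ a, T a ∈ K)

include hK hT hmem

/-- The function F is continuous on the domain only, so the argument is viewed as a measurable map
into that subtype. -/
lemma SmoothFam.measurable_comp {f : ℕ → ℝ → Par p → ℝ} (hf : M.SmoothFam f) (i : ℕ)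
    {Y : α → ℝ} (hY : Measurable Y) : Measurable fun a => f i (Y a) (T a) := by
  obtain ⟨F, hF, hF'⟩ := hf
  have harg : Measurable fun a => M.arg i (Y a) (T a) :=
    hY.prodMk (measurable_const.prodMk (measurable_const.prodMk hT))
  have h1 := (continuousOn_iff_continuous_domRestrict.1 hF.continuousOn).measurable.comp
    (harg.subtype_mk (h := fun a => hK.arg_mem (hmem a) i (Y a)))
  refine (funext fun a => ?_ : (fun a => f i (Y a) (T a)) = _) ▸ h1
  exact hF' i _ _ (hK.arg_mem (hmem a) i (Y a))

/-- Cramer's rule writes the entries through determinant and adjugate, which are continuous in the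
matrix. No invertibility is needed, by the convention 0⁻¹ = 0. -/
lemma measurable_ut (m : ℕ) (k l : Idx p) : Measurable fun a => M.ut m (T a) k l := by
  have hUm : Measurable fun a => (fun b c => M.U m (T a) b c : Idx p → Idx p → ℝ) := by
    refine measurable_pi_iff.2 fun b => measurable_pi_iff.2 fun c => ?_
    simp only [U, Matrix.sum_apply, Matrix.mul_apply]
    refine Finset.measurable_sum _ fun j _ => Finset.measurable_sum _ fun e _ => ?_
    exact (SmoothFam.measurable_comp hK hT hmem (SmoothFam.W b e) j measurable_const (Y := fun _ => 0)).mul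
      (SmoothFam.measurable_comp hK hT hmem (SmoothFam.D e c) j measurable_const (Y := fun _ => 0))
  have hdet : Continuous fun A : Idx p → Idx p → ℝ => (Matrix.of A).det :=
    Continuous.matrix_det continuous_id
  have hadj : Continuous fun A : Idx p → Idx p → ℝ => (Matrix.of A).adjugate k l :=
    (Continuous.matrix_adjugate continuous_id).matrix_elem k l
  have e : ∀ a, M.ut m (T a) k l = (m : ℝ) * ((Matrix.of fun b c => M.U m (T a) b c).det⁻¹
      * (Matrix.of fun b c => M.U m (T a) b c).adjugate k l) := fun a => by
    rw [ut, Matrix.inv_def, Ring.inverse_eq_inv', Matrix.smul_apply, smul_eq_mul]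
    rfl
  simp only [e]
  exact ((hdet.measurable.comp hUm).inv.mul (hadj.measurable.comp hUm)).const_mul _

lemma measurable_mul_corr (m i : ℕ) {Y : α → ℝ} (hY : Measurable Y) :
    Measurable fun a => (m : ℝ) * M.corr m i (Y a) (T a) := by
  simp only [mul_corr]
  have hu := fun k l => measurable_ut hK hT hmem m k l
  have hUi : ∀ k l, Measurable fun a => (M.U m (T a))⁻¹ k l := by
    intro k l
    rcases Nat.eq_zero_or_pos m with rfl | hm
    · simp [U]
    · have hm0 : (m : ℝ) ≠ 0 := by exact_mod_cast hm.ne'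
      have e : (fun a => (M.U m (T a))⁻¹ k l) = fun a => (m : ℝ)⁻¹ * M.ut m (T a) k l := by
        funext a; rw [ut, inv_mul_cancel_left₀ hm0]
      rw [e]; exact (hu k l).const_mul _
  have hf : ∀ {f : ℕ → ℝ → Par p → ℝ}, M.SmoothFam f → ∀ j,
      Measurable fun a => f j (Y a) (T a) := fun hf j =>
    SmoothFam.measurable_comp hK hT hmem hf j hY
  have ha1 : ∀ l, Measurable fun a => M.a1 m (T a) l := by
    intro l
    simp only [fun a => a1_eq_sum hK (hmem a) m l]
    exact Finset.measurable_sum _ fun k _ => Finset.measurable_sum _ fun k' _ => (hUi k k').mul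
      (Finset.measurable_sum _ fun j _ => Finset.measurable_sum _ fun c _ =>
        (hf (SmoothFam.jacCoef l k c) j).mul (hf (SmoothFam.D c k') j))
  have ha2 : ∀ l, Measurable fun a => M.a2 m (T a) l := by
    intro l
    simp only [fun a => a2_eq_sum hK (hmem a) m l]
    exact Finset.measurable_sum _ fun k _ => Finset.measurable_sum _ fun k' _ =>
      (Finset.measurable_sum _ fun j _ => hf (SmoothFam.hessConst l k k') j).mul (hUi k k')
  refine Measurable.add (Measurable.add ?_ (Measurable.const_mul ?_ _)) (Measurable.const_mul ?_ _)
  · exact Finset.measurable_sum _ fun k _ => Finset.measurable_sum _ fun l _ =>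
      (hf (SmoothFam.Pmat k l) i).mul (hu l k)
  · exact Finset.measurable_sum _ fun l _ => (hf (SmoothFam.r l) i).mul
      (Finset.measurable_sum _ fun k _ => (hu l k).mul
        (((hf (SmoothFam.areaScore k) i).add (ha1 k)).add ((ha2 k).const_mul _)))
  · exact Finset.measurable_sum _ fun k _ => Finset.measurable_sum _ fun l _ =>
      (hf (SmoothFam.R k l) i).mul (hu l k)

lemma measurable_corr {m : ℕ} (hm : 0 < m) (i : ℕ) {Y : α → ℝ} (hY : Measurable Y) :
    Measurable fun a => M.corr m i (Y a) (T a) := by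
  have hm0 : (m : ℝ) ≠ 0 := by exact_mod_cast hm.ne'
  have e : (fun a => M.corr m i (Y a) (T a))
      = fun a => (m : ℝ)⁻¹ * ((m : ℝ) * M.corr m i (Y a) (T a)) := by
    funext a; rw [inv_mul_cancel_left₀ hm0]
  rw [e]
  exact (measurable_mul_corr hK hT hmem m i hY).const_mul _

end measurability

/-! ### The estimator -/

section estimator

variable {K : Set (Par p)} (hK : M.Regular K) {η : Par p} {ρ : ℝ} (hρ0 : 0 < ρ) (hρ1 : ρ ≤ 1)
  (hρ : Metric.closedBall η ρ ⊆ K) {ηhat : (m : ℕ) → (Fin m → ℝ) → Par p} (hGT : M.IsGT K ηhat)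

include hK hρ0 hρ1 hρ hGT

open Classical in
/-- `mainTerm` approximates `excess` at the estimator of the parameters. -/
lemma exists_excess_approx (i : ℕ) (B : ℝ) {q : ℝ} (hq : 2 < q) (hq3 : q ≤ 3) :
    ∃ C, 0 ≤ C ∧ ∀ᶠ m : ℕ in atTop, ∀ Y : ℕ → ℝ, |Y i| ≤ B →
      |M.excess m i (Y i) η (ηhat m fun j => Y j) - M.mainTerm m i Y η|
        ≤ C * (M.noise m Y η ^ q + M.noise m Y η / m
          + if (fun j : Fin m => Y j) ∈ M.multipleRoots K m then 1 else 0) := by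
  obtain ⟨ε, hε, hε1, C₀, hC₀, hroot⟩ := exists_root hK hρ0 hρ
  obtain ⟨C₁, hC₁, h1⟩ := exists_excess_sub_mainTerm_le hK hρ hρ0 i B hC₀
  obtain ⟨C₂, hC₂, h2⟩ := exists_abs_excess_sub_mainTerm_le hK hρ hρ0 i B
  refine ⟨C₁ + 2 * C₂ + C₂ * (2 * ε ^ (-q) + 1), by positivity, ?_⟩
  filter_upwards [hroot, h1, h2, eventually_gt_atTop 0] with m hrm h1m h2m hm Y hYB
  have hm0 : (0 : ℝ) < m := by exact_mod_cast hm
  have hmemK := hGT.mem m fun j => Y j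
  have hbad := h2m Y hYB _ hmemK
  set v := M.noise m Y η with hv
  have hv0 : 0 ≤ v := noise_nonneg _ _ _
  have hvq : 0 ≤ v ^ q := Real.rpow_nonneg hv0 q
  have hvm : 0 ≤ v / m := by positivity
  have hεq : 0 ≤ ε ^ (-q) := by positivity
  -- Large fluctuations are paid for by 1 ≤ ε^(−q) v^q, multiple roots by the indicator. Otherwise
  -- the expansion applies with error v³ + v/m, and v³ ≤ v^q as v ≤ 1 and q ≤ 3.
  rcases lt_or_ge ε v with hlt | hle
  · have h3 : 1 ≤ ε ^ (-q) * v ^ q := by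
      rw [Real.rpow_neg hε.le, ← div_eq_inv_mul, one_le_div (by positivity)]
      exact Real.rpow_le_rpow hε.le hlt.le (by linarith)
    have h4 := sq_le_one_add_rpow hq.le v
    rw [abs_of_nonneg hv0] at h4
    have h5 : 1 + v ^ 2 ≤ (2 * ε ^ (-q) + 1) * v ^ q := by linarith
    have hi : 0 ≤ if (fun j : Fin m => Y j) ∈ M.multipleRoots K m then (1 : ℝ) else 0 := by
      split_ifs <;> norm_num
    calc _ ≤ C₂ * ((2 * ε ^ (-q) + 1) * v ^ q) := hbad.trans (by gcongr)
      _ = (C₂ * (2 * ε ^ (-q) + 1)) * v ^ q := by ring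
      _ ≤ (C₁ + 2 * C₂ + C₂ * (2 * ε ^ (-q) + 1)) * v ^ q := by
          have : 0 ≤ C₁ + 2 * C₂ := by positivity
          gcongr; linarith
      _ ≤ _ := by gcongr; linarith
  have hv1 : v ≤ 1 := hle.trans hε1
  split_ifs with hmr
  · have h3 : 1 + v ^ 2 ≤ 2 := by nlinarith
    have h4 : 0 ≤ C₁ + C₂ * (2 * ε ^ (-q) + 1) := by positivity
    calc _ ≤ C₂ * 2 := hbad.trans (by gcongr)
      _ ≤ (C₁ + 2 * C₂ + C₂ * (2 * ε ^ (-q) + 1)) * 1 := by linarith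
      _ ≤ _ := by gcongr; linarith
  · obtain ⟨t, ht, hts, htC⟩ := hrm Y hle
    have hsol := hGT.solves m (fun j => Y j) ⟨t, hρ ht, hts⟩
    -- A root in K exists, hence the estimator is one too. As roots in K are unique here, it is the
    -- root near η.
    have heq : ηhat m (fun j => Y j) = t := by
      by_contra hne
      exact hmr ⟨_, hmemK, t, hρ ht, hne, hsol, hts⟩
    rw [heq]
    have ht1 : ‖t - η‖ ≤ 1 := by
      rw [← dist_eq_norm]; exact (Metric.mem_closedBall.1 ht).trans hρ1
    refine (h1m Y hYB hv1 t ht hts htC ht1).trans ?_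
    have h3 : v ^ 3 ≤ v ^ q := by
      rcases hv0.eq_or_lt with h0 | h0
      · rw [← h0]; simp [Real.zero_rpow (by linarith : q ≠ 0)]
      · rw [← Real.rpow_natCast]
        exact Real.rpow_le_rpow_of_exponent_ge h0 hv1 (by exact_mod_cast hq3)
    have h4 : 0 ≤ 2 * C₂ + C₂ * (2 * ε ^ (-q) + 1) := by positivity
    rw [add_zero]
    gcongr
    linarith

variable {Ω : Type*} [MeasurableSpace Ω] {P : Measure Ω} [IsProbabilityMeasure P]
  {θ y : ℕ → Ω → ℝ} (h : M.Generates P η θ y)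

include h

omit hρ0 hρ1 hρ [IsProbabilityMeasure P] hK in
lemma Generates.measurable_ηhat (m : ℕ) : Measurable fun ω => ηhat m (sample y m ω) :=
  (hGT.measurable m).comp (measurable_pi_iff.2 fun j => h.measurable_y j)

omit hρ0 hρ1 hρ [IsProbabilityMeasure P] in
lemma Generates.measurable_excess {m : ℕ} (hm : 0 < m) (i : ℕ) :
    Measurable fun ω => M.excess m i (y i ω) η (ηhat m (sample y m ω)) := by
  have hT := h.measurable_ηhat hGT m
  have hmem : ∀ ω, ηhat m (sample y m ω) ∈ K := fun ω => hGT.mem m _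
  have hy := h.measurable_y i
  exact (((SmoothFam.measurable_comp hK hT hmem SmoothFam.T1 i hy).sub
    ((measurable_T1 i η).comp hy)).sub
    (((SmoothFam.measurable_comp hK hT hmem SmoothFam.xiHat i hy).sub
      ((measurable_xiHat i η).comp hy)).pow_const 2)).add (measurable_corr hK hT hmem hm i hy)

/-- Replacing `excess` by `mainTerm` has a negligible effect. -/
lemma Generates.negl_excess_sub_mainTerm
    (hroot : Tendsto (fun m : ℕ => (m : ℝ) * P.real {ω | sample y m ω ∈ M.multipleRoots K m})
      atTop (𝓝 0)) (i : ℕ) (B : ℝ) :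
    Negl P (sigmaOf y i) fun m ω => (Set.Icc (-B) B).indicator 1 (y i ω) *
      (M.excess m i (y i ω) η (ηhat m (sample y m ω)) - M.mainTerm m i (fun j => y j ω) η) := by
  classical
  have hη : η ∈ K := hρ (Metric.mem_closedBall_self hρ0.le)
  obtain ⟨q, hq, hq3, hIq, hTq, hI1, hT1⟩ := h.tendsto_noise hK hη
  obtain ⟨C, hC, happ⟩ := exists_excess_approx hK hρ0 hρ1 hρ hGT i B hq hq3
  -- Measurability of the event of multiple roots is not established. It is replaced by a measurable
  -- superset of the same measure.
  set S : ℕ → Set Ω := fun m => toMeasurable P {ω | sample y m ω ∈ M.multipleRoots K m} with hS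
  have hSm : ∀ m, MeasurableSet (S m) := fun m => measurableSet_toMeasurable _ _
  have hmain := (h.negl_mainTerm hK hη i B).1
  set bd : ℕ → Ω → ℝ := fun m ω => C * (M.noise m (fun j => y j ω) η ^ q
    + M.noise m (fun j => y j ω) η / m + (S m).indicator 1 ω) with hbd
  have hIbd : ∀ m : ℕ, 0 < m → Integrable (bd m) P := fun m hm =>
    (((hIq m hm).add ((hI1 m hm).div_const _)).add
      ((integrable_const (1 : ℝ)).indicator (hSm m))).const_mul C
  have hle : ∀ᶠ m : ℕ in atTop, ∀ ω, |(Set.Icc (-B) B).indicator 1 (y i ω) *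
      (M.excess m i (y i ω) η (ηhat m (sample y m ω)) - M.mainTerm m i (fun j => y j ω) η)|
        ≤ bd m ω := by
    filter_upwards [happ, eventually_gt_atTop 0] with m hm hm0 ω
    have hnn : 0 ≤ M.noise m (fun j => y j ω) η := noise_nonneg _ _ _
    have hind0 : 0 ≤ (S m).indicator (1 : Ω → ℝ) ω := Set.indicator_nonneg (fun _ _ => zero_le_one) _
    by_cases hω : y i ω ∈ Set.Icc (-B) B
    · rw [Set.indicator_of_mem hω, Pi.one_apply, one_mul]
      refine (hm (fun j => y j ω) (abs_le.2 hω)).trans ?_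
      simp only [hbd]
      gcongr
      split_ifs with hmr
      · rw [Set.indicator_of_mem (subset_toMeasurable P _ hmr)]; rfl
      · exact hind0
    · rw [Set.indicator_of_notMem hω, zero_mul, abs_zero]
      have := Real.rpow_nonneg hnn q
      simp only [hbd]
      positivity
  have hint : ∀ᶠ m : ℕ in atTop, Integrable (fun ω => (Set.Icc (-B) B).indicator 1 (y i ω) *
      (M.excess m i (y i ω) η (ηhat m (sample y m ω)) - M.mainTerm m i (fun j => y j ω) η)) P := by
    filter_upwards [hle, hmain, eventually_gt_atTop 0] with m hlem hmm hm
    refine (hIbd m hm).mono' ?_ (ae_of_all _ hlem)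
    have hcut : Measurable fun ω => (Set.Icc (-B) B).indicator (1 : ℝ → ℝ) (y i ω) :=
      (measurable_one.indicator measurableSet_Icc).comp (h.measurable_y i)
    refine ((hcut.mul (h.measurable_excess hK hGT hm i)).aestronglyMeasurable.sub
      hmm.aestronglyMeasurable).congr (ae_of_all _ fun ω => ?_)
    simp only [Pi.sub_apply, Pi.mul_apply]
    ring
  refine Negl.of_integral_abs hint ?_
  have hlim : Tendsto (fun m : ℕ => C * ((m : ℝ) * ∫ ω, M.noise m (fun j => y j ω) η ^ q ∂P
      + ∫ ω, M.noise m (fun j => y j ω) η ∂P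
      + (m : ℝ) * P.real {ω | sample y m ω ∈ M.multipleRoots K m})) atTop (𝓝 0) := by
    simpa using ((hTq.add hT1).add hroot).const_mul C
  refine squeeze_zero' (Eventually.of_forall fun m => mul_nonneg (Nat.cast_nonneg m)
    (integral_nonneg fun _ => abs_nonneg _)) ?_ hlim
  filter_upwards [hle, hint, eventually_gt_atTop 0] with m hlem him hm
  have hm0 : (m : ℝ) ≠ 0 := by exact_mod_cast hm.ne'
  have h1 := integral_mono him.abs (hIbd m hm) hlem
  have hSr : P.real (S m) = P.real {ω | sample y m ω ∈ M.multipleRoots K m} := by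
    rw [Measure.real, hS, measure_toMeasurable, Measure.real]
  have h2 : ∫ ω, bd m ω ∂P = C * (∫ ω, M.noise m (fun j => y j ω) η ^ q ∂P
      + (∫ ω, M.noise m (fun j => y j ω) η ∂P) / m
      + P.real {ω | sample y m ω ∈ M.multipleRoots K m}) := by
    have i1 : Integrable (fun ω => M.noise m (fun j => y j ω) η ^ q
      + M.noise m (fun j => y j ω) η / m) P := (hIq m hm).add ((hI1 m hm).div_const _)
    have i2 : Integrable (fun ω => (S m).indicator (1 : Ω → ℝ) ω) P :=
      (integrable_const (1 : ℝ)).indicator (hSm m)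
    have i3 : ∫ ω, (S m).indicator (1 : Ω → ℝ) ω ∂P = P.real (S m) := integral_indicator_one (hSm m)
    simp only [hbd]
    rw [integral_const_mul, integral_add i1 i2, integral_add (hIq m hm) ((hI1 m hm).div_const _),
      integral_div, i3, hSr]
  calc _ ≤ (m : ℝ) * ∫ ω, bd m ω ∂P := mul_le_mul_of_nonneg_left h1 (Nat.cast_nonneg m)
    _ = _ := by rw [h2]; field_simp

end estimator

end Model
end NEFQVF

/-! ### Integrability of the estimator and decomposition of its bias -/

namespace NEFQVF
namespace Model

variable {p : ℕ} {M : Model p}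

section

variable {K : Set (Par p)} (hK : M.Regular K) {η : Par p} {ρ : ℝ}
  (hρ : Metric.closedBall η ρ ⊆ K) {ηhat : (m : ℕ) → (Fin m → ℝ) → Par p} (hGT : M.IsGT K ηhat)
  {Ω : Type*} [MeasurableSpace Ω] {P : Measure Ω} [IsProbabilityMeasure P]
  {θ y : ℕ → Ω → ℝ} (h : M.Generates P η θ y)

include hK hρ hGT h

/-! ### Integrability -/

omit hK hρ hGT h [IsProbabilityMeasure P] in
lemma one_add_sq_le (t : ℝ) : 1 + t ^ 2 ≤ (1 + |t|) ^ 4 := by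
  have h1 : 1 + t ^ 2 ≤ (1 + |t|) ^ 2 := by rw [← sq_abs]; nlinarith [abs_nonneg t]
  have h2 : (1 : ℝ) ≤ (1 + |t|) ^ 2 := by nlinarith [abs_nonneg t]
  nlinarith

omit hρ hGT in
lemma Generates.integrable_one_add_abs_pow (hη : η ∈ K) (i : ℕ) :
    Integrable (fun ω => (1 + |y i ω|) ^ 4) P := by
  have h1 : MemLp (fun ω => 1 + |y i ω|) ((4 : ℕ) : ENNReal) P := by
    exact_mod_cast (memLp_const (1 : ℝ)).add (h.memLp_four hK hη i).abs
  refine (h1.integrable_norm_pow (by norm_num)).congr (ae_of_all _ fun ω => ?_)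
  simp only [Real.norm_eq_abs]
  rw [abs_of_nonneg (by positivity)]

omit hρ in
lemma Generates.integrable_T1_hat (hη : η ∈ K) (m i : ℕ) :
    Integrable (fun ω => M.T1 i (y i ω) (ηhat m (sample y m ω))) P := by
  obtain ⟨C, hC, hb⟩ := (isQuad_T1 (M := M)).exists_bound SmoothFam.T1 hK
  refine ((h.integrable_one_add_abs_pow hK hη i).const_mul C).mono'
    (SmoothFam.measurable_comp hK (h.measurable_ηhat hGT m) (fun ω => hGT.mem m _) SmoothFam.T1 i
      (h.measurable_y i)).aestronglyMeasurable (ae_of_all _ fun ω => ?_)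
  exact (hb i (y i ω) _ (hGT.mem m _)).trans (mul_le_mul_of_nonneg_left (one_add_sq_le _) hC)

omit hρ in
lemma Generates.memLp_xiHat_hat (hη : η ∈ K) (m i : ℕ) :
    MemLp (fun ω => M.xiHat i (y i ω) (ηhat m (sample y m ω))) 2 P := by
  obtain ⟨C, hC, hb⟩ := (isQuad_xiHat (M := M)).exists_bound SmoothFam.xiHat hK
  have hm := SmoothFam.measurable_comp hK (h.measurable_ηhat hGT m) (fun ω => hGT.mem m _)
    (SmoothFam.xiHat (M := M)) i (h.measurable_y i)
  refine (memLp_two_iff_integrable_sq hm.aestronglyMeasurable).2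
    (((h.integrable_one_add_abs_pow hK hη i).const_mul (C ^ 2)).mono'
      (hm.pow_const 2).aestronglyMeasurable (ae_of_all _ fun ω => ?_))
  rw [Real.norm_eq_abs, abs_pow]
  have h1 := hb i (y i ω) _ (hGT.mem m (sample y m ω))
  have h2 : 1 + (y i ω) ^ 2 ≤ (1 + |y i ω|) ^ 2 := by
    rw [← sq_abs]; nlinarith [abs_nonneg (y i ω)]
  calc _ ≤ (C * (1 + |y i ω|) ^ 2) ^ 2 := by
        gcongr
        exact h1.trans (mul_le_mul_of_nonneg_left h2 hC)
    _ = _ := by ring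

lemma Generates.eventually_integrable_corr (hη : η ∈ K) (i : ℕ) :
    ∀ᶠ m : ℕ in atTop,
      Integrable (fun ω => M.corr m i (y i ω) (ηhat m (sample y m ω))) P := by
  obtain ⟨C, hC, hb⟩ := nice_corr hK hρ i
  filter_upwards [hb, eventually_gt_atTop 0] with m hm hm0
  have hm1 : (1 : ℝ) ≤ m := by exact_mod_cast hm0
  refine ((h.integrable_one_add_abs_pow hK hη i).const_mul C).mono'
    (measurable_corr hK (h.measurable_ηhat hGT m) (fun ω => hGT.mem m _) hm0 i
      (h.measurable_y i)).aestronglyMeasurable (ae_of_all _ fun ω => ?_)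
  have h1 := (hm (y i ω)).1 _ (hGT.mem m (sample y m ω))
  rw [abs_mul, abs_of_nonneg (by linarith : (0 : ℝ) ≤ m)] at h1
  rw [Real.norm_eq_abs]
  exact (le_mul_of_one_le_left (abs_nonneg _) hm1).trans h1

lemma Generates.eventually_integrable_cmseHat (hη : η ∈ K) (i : ℕ) :
    ∀ᶠ m : ℕ in atTop,
      Integrable (fun ω => M.cmseHat m i (y i ω) (ηhat m (sample y m ω))) P := by
  filter_upwards [h.eventually_integrable_corr hK hρ hGT hη i] with m hm
  simp only [cmseHat_eq]
  exact (h.integrable_T1_hat hK hGT hη m i).add hm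

omit hρ in
lemma Generates.integrable_sq_error (hη : η ∈ K) (m i : ℕ) : Integrable
    (fun ω => (M.xiHat i (y i ω) (ηhat m (sample y m ω)) - deriv M.ψ (θ i ω)) ^ 2) P :=
  ((h.memLp_xiHat_hat hK hGT hη m i).sub (h.memLp_ξ hK hη i)).integrable_sq

/-- The bias of the estimator of the conditional mean squared error is negligible on the event that
the direct estimate is bounded. -/
theorem Generates.negl_bias (hρ0 : 0 < ρ) (hρ1 : ρ ≤ 1)
    (hroot : Tendsto (fun m : ℕ => (m : ℝ) * P.real {ω | sample y m ω ∈ M.multipleRoots K m})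
      atTop (𝓝 0)) (i : ℕ) (B : ℝ) :
    Negl P (sigmaOf y i) fun m ω => (Set.Icc (-B) B).indicator 1 (y i ω) *
      (M.cmseHat m i (y i ω) (ηhat m (sample y m ω))
        - (M.xiHat i (y i ω) (ηhat m (sample y m ω)) - deriv M.ψ (θ i ω)) ^ 2) := by
  have hη : η ∈ K := hρ (Metric.mem_closedBall_self hρ0.le)
  set cut : ℝ → ℝ := (Set.Icc (-B) B).indicator 1 with hcut
  have hcm : Measurable cut := measurable_one.indicator measurableSet_Icc
  have hc1 : ∀ t, |cut t| ≤ 1 := fun t => by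
    by_cases ht : t ∈ Set.Icc (-B) B
    · simp [hcut, Set.indicator_of_mem ht]
    · simp [hcut, Set.indicator_of_notMem ht]
  have hy := h.measurable_y i
  have h1 := h.negl_excess_sub_mainTerm hK hρ0 hρ1 hρ hGT hroot i B
  have h2 := h.negl_mainTerm hK hη i B
  have h3 : Negl P (sigmaOf y i) fun _ ω => -cut (y i ω) *
      ((deriv M.ψ (θ i ω) - M.xiHat i (y i ω) η) ^ 2 - M.T1 i (y i ω) η) :=
    Negl.mul_comp hy (Negl.of_condExp (Eventually.of_forall fun _ =>
      (h.memLp_residual hK hη i).integrable_sq.sub (h.integrable_T1 hK hη i))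
      (Eventually.of_forall fun _ => h.condExp_residual_sq hK hη i)) (F := fun t => -cut t) hcm.neg
      fun t => by rw [abs_neg]; exact hc1 t
  have hGm : ∀ m : ℕ, Measurable fun ω => 2 * cut (y i ω) *
      (M.xiHat i (y i ω) (ηhat m (sample y m ω)) - M.xiHat i (y i ω) η) := fun m =>
    ((hcm.comp hy).const_mul 2).mul ((SmoothFam.measurable_comp hK (h.measurable_ηhat hGT m)
      (fun ω => hGT.mem m _) (SmoothFam.xiHat (M := M)) i hy).sub ((measurable_xiHat i η).comp hy))
  have hI : ∀ m : ℕ, Integrable (fun ω => 2 * cut (y i ω) *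
      (M.xiHat i (y i ω) (ηhat m (sample y m ω)) - M.xiHat i (y i ω) η) *
        (deriv M.ψ (θ i ω) - M.xiHat i (y i ω) η)) P := by
    intro m
    have i1 := ((h.memLp_xiHat_hat hK hGT hη m i).sub (h.memLp_xiHat hK hη i)).integrable_mul
      (h.memLp_residual hK hη i)
    have i2 := i1.bdd_mul (c := 2) ((hcm.comp hy).const_mul 2).aestronglyMeasurable
      (ae_of_all _ fun ω => by
        rw [Real.norm_eq_abs, abs_mul, abs_two]
        exact mul_le_of_le_one_right zero_le_two (hc1 _))
    refine i2.congr (ae_of_all _ fun ω => ?_)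
    simp only [Function.comp_apply, Pi.mul_apply, Pi.sub_apply]
    ring
  have h4 : Negl P (sigmaOf y i) fun m ω => 2 * cut (y i ω) *
      (M.xiHat i (y i ω) (ηhat m (sample y m ω)) - M.xiHat i (y i ω) η) *
        (deriv M.ψ (θ i ω) - M.xiHat i (y i ω) η) := by
    refine Negl.of_condExp (Eventually.of_forall hI) ?_
    -- Once i < m the value y_i is a coordinate of the sample, so the factor of the residual,
    -- truncation included, is a function of the sample.
    filter_upwards [eventually_gt_atTop i] with m hm
    have hproj : Measurable fun s : Fin m → ℝ => s ⟨i, hm⟩ := measurable_pi_apply _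
    exact h.condExp_mul_residual hK hη (m := m) (i := i)
      (G := fun s => 2 * cut (s ⟨i, hm⟩) *
        (M.xiHat i (s ⟨i, hm⟩) (ηhat m s) - M.xiHat i (s ⟨i, hm⟩) η))
      (((hcm.comp hproj).const_mul 2).mul ((SmoothFam.measurable_comp hK (hGT.measurable m)
        (fun s => hGT.mem m s) (SmoothFam.xiHat (M := M)) i hproj).sub
          ((measurable_xiHat i η).comp hproj))) (hI m)
  -- Expand the squared error about the Bayes estimator at the true parameter: `excess`, the centred
  -- squared residual, and the cross term with the residual.
  refine (((h1.add h2).add h3).add h4).congr (Eventually.of_forall fun m => ae_of_all _ fun ω => ?_)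
  simp only [cmseHat_eq, excess, hcut]
  ring

end

end Model
end NEFQVF

/-- Second-order unbiasedness, given `y_i`, of the closed-form estimator `cmseHat` of the
conditional mean squared error of the empirical Bayes predictor, together with the identification
of the closed forms from which it is built. -/
theorem theorem5 {p : ℕ} (M : NEFQVF.Model p) (K : Set (NEFQVF.Par p)) (hK : M.Regular K)
    (η : NEFQVF.Par p) (hη : η ∈ interior K)
    {Ω : Type*} [MeasurableSpace Ω] (P : Measure Ω) [IsProbabilityMeasure P]
    (θ y : ℕ → Ω → ℝ) (hmodel : M.Generates P η θ y)
    (ηhat : (m : ℕ) → (Fin m → ℝ) → NEFQVF.Par p) (hGT : M.IsGT K ηhat)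
    (hroot : Tendsto
      (fun m : ℕ => (m : ℝ) * P.real {ω | NEFQVF.sample y m ω ∈ M.multipleRoots K m})
      atTop (𝓝 0))
    (i : ℕ) :
    -- second-order unbiasedness; both conditional expectations are those of integrable variables
    (∀ᶠ m : ℕ in atTop,
      Integrable (fun ω => M.cmseHat m i (y i ω) (ηhat m (NEFQVF.sample y m ω))) P ∧
      Integrable
        (fun ω => (M.xiHat i (y i ω) (ηhat m (NEFQVF.sample y m ω)) - deriv M.ψ (θ i ω)) ^ 2) P) ∧
    TendstoInMeasure P
      (fun (m : ℕ) ω => (m : ℝ) *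
        ((P[fun ω' => M.cmseHat m i (y i ω') (ηhat m (NEFQVF.sample y m ω'))
            | NEFQVF.sigmaOf y i]) ω
          - (P[fun ω' =>
              (M.xiHat i (y i ω') (ηhat m (NEFQVF.sample y m ω')) - deriv M.ψ (θ i ω')) ^ 2
            | NEFQVF.sigmaOf y i]) ω))
      atTop (fun _ => 0) ∧
    -- `xiHat` and `T1` are the posterior mean and the posterior variance of `ψ'(θ_i)`
    MemLp (fun ω => deriv M.ψ (θ i ω)) 2 P ∧
    P[fun ω => deriv M.ψ (θ i ω) | NEFQVF.sigmaOf y i] =ᵐ[P] (fun ω => M.xiHat i (y i ω) η) ∧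
    condVar (NEFQVF.sigmaOf y i) (fun ω => deriv M.ψ (θ i ω)) P
      =ᵐ[P] (fun ω => M.T1 i (y i ω) η) ∧
    -- `r` and `R` are the gradient and the Hessian matrix of `T1` with respect to the parameters
    (∀ (t : ℝ) (η' : NEFQVF.Par p), M.lin i η' ∈ M.Θ → 0 < NEFQVF.nu η' →
      M.v₂ < NEFQVF.nu η' →
      HasFDerivAt (M.T1 i t) (NEFQVF.form (M.r i t η')) η' ∧
      ∀ k, HasFDerivAt (fun η'' => M.r i t η'' k) (NEFQVF.form (M.R i t η' k)) η') ∧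
    -- the closed forms of the central moments of the direct estimates
    (∀ j, MemLp (y j) 4 P ∧ ∫ ω, y j ω ∂P = M.mean j η ∧
      ∫ ω, (y j ω - M.mean j η) ^ 2 ∂P = M.mu2 j η ∧
      ∫ ω, (y j ω - M.mean j η) ^ 3 ∂P = M.mu3 j η ∧
      ∫ ω, (y j ω - M.mean j η) ^ 4 ∂P = M.mu4 j η) ∧
    -- `U = Cov(s)`, `a₁ = E[(∂s/∂ηᵗ) U⁻¹ s]` and `a₂ = (tr (E[∂²s_l/∂η∂ηᵗ] U⁻¹))_l`
    (∀ m k l, ∫ ω, M.score m (NEFQVF.sample y m ω) η k * M.score m (NEFQVF.sample y m ω) η l ∂P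
      = M.U m η k l) ∧
    (∀ m l, M.a1 m η l = ∫ ω, ∑ k,
      NEFQVF.pd k (fun η' => M.score m (NEFQVF.sample y m ω) η' l) η *
        ((M.U m η)⁻¹.mulVec (M.score m (NEFQVF.sample y m ω) η)) k ∂P) ∧
    (∀ m l, M.a2 m η l = ((Matrix.of fun k k' => ∫ ω,
      NEFQVF.pd k (NEFQVF.pd k' (fun η' => M.score m (NEFQVF.sample y m ω) η' l)) η ∂P) *
        (M.U m η)⁻¹).trace) := by
  have hηK : η ∈ K := interior_subset hη
  obtain ⟨ρ', hρ'0, hρ'⟩ := Metric.isOpen_iff.1 isOpen_interior η hη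
  -- Halving puts the closed ball inside the open one. The cap 1 provides ‖t − η‖ ≤ 1, needed to
  -- compare powers in the expansion of the squared increment.
  set ρ := min (ρ' / 2) 1 with hρdef
  have hρ0 : 0 < ρ := by positivity
  have hρ1 : ρ ≤ 1 := min_le_right _ _
  have hρ : Metric.closedBall η ρ ⊆ K :=
    (Metric.closedBall_subset_ball ((min_le_left _ _).trans_lt (half_lt_self hρ'0))).trans
      (hρ'.trans interior_subset)
  have hcm := hmodel.eventually_integrable_cmseHat hK hρ hGT hηK i
  have hsq := fun m => hmodel.integrable_sq_error hK hGT hηK m i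
  refine ⟨hcm.mono fun m hm => ⟨hm, hsq m⟩, ?_, hmodel.memLp_ξ hK hηK i, hmodel.condExp_ξ hK hηK i,
    hmodel.condVar_ξ hK hηK i, fun t η' hl hν hv =>
      ⟨NEFQVF.Model.hasFDerivAt_T1 hl hν hv, fun k => NEFQVF.Model.hasFDerivAt_r hl hν hv k⟩,
    fun j => ⟨hmodel.memLp_four hK hηK j, hmodel.moments hK hηK j⟩,
    hmodel.integral_score_mul_score hK hηK, hmodel.a1_eq_integral hK hηK,
    hmodel.a2_eq_integral hK hηK⟩
  refine (NEFQVF.tendstoInMeasure_of_negl (hmodel.measurable_y i)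
    (hcm.mono fun m hm => hm.sub (hsq m))
    (hmodel.negl_bias hK hρ hGT hρ0 hρ1 hroot i)).congr' ?_ (ae_of_all _ fun _ => rfl)
  filter_upwards [hcm] with m hm
  filter_upwards [condExp_sub hm (hsq m) (NEFQVF.sigmaOf y i)] with ω hω
  exact congrArg _ hω

end
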